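/- Let $R$ be a commutative ring, $n\in\mathbb N$, and let $\mathcal P$ be the poset of Goresky–MacPherson $n$-perversities, i.e. maps $\bar p:\{0,\dots,n\}\to\mathbb N$ with $\bar p(0)=\bar p(1)=\bar p(2)=0$ and $\bar p(i)\le\bar p(i+1)\le\bar p(i)+1$ for $i\geq 1$; its greatest element is $\bar t$, with $\bar t(i)=\max(i-2,0)$. A perverse cochain complex is a functor from $\mathcal P$ to cochain complexes of $R$-modules, and a perverse differential graded algebra (pDGA) $A_\bullet$ is such a functor with an associative unital product, i.e. natural products $A^i_{\bar p}\otimes A^j_{\bar q}\to A^{i+j}_{\bar r}$ for $\bar p+\bar q\le\bar r$, with $1\in A^0_{\bar 0}$ and $d(ab)=(da)b+(-1)^{|a|}a\,db$. Its dual is the bimodule $(DA)^i_{\bar p}=\mathrm{Hom}_R(A^{-i}_{\bar t-\bar p},R)$ with $d\varphi=-(-1)^{|\varphi|}\varphi\circ d$, $(a\varphi)(x)=(-1)^{|a|(|\varphi|+|x|)}\varphi(xa)$, $(\varphi b)(x)=\varphi(bx)$. For a perverse differential graded $A$-bimodule $M_\bullet$, let $HH^*_\bullet(A,M)$ be the cohomology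 of the normalized Hochschild cochain complex $HC^*_\bullet(A,M)=\mathrm{Hom}_{A^e}(\mathbb B(A),M)\cong\mathrm{Hom}(T(s\bar A),M)$, the internal Hom being that of perverse complexes, $\mathbb B(A)$ the normalized two-sided bar construction and $A^e=A\boxtimes A^{op}$, and let $HH^*_\bullet(A)=HH^*_\bullet(A,A)$. With $\bar\varepsilon_l=\sum_{m\le l}(|a_m|-1)$, put \[(f\cdot g)[a_1|\cdots|a_k]=\sum_{0\le l\le k}(-1)^{|g|\bar\varepsilon_l}f[a_1|\cdots|a_l]\,g[a_{l+1}|\cdots|a_k]\] for $f\in HC(A)$ and $g\in HC(A,M)$ (this is the cup product $f\cup g$ if $M=A$), and $[f,g]=f\circ g-(-1)^{(|f|-1)(|g|-1)}g\circ f$ for $f,g\in HC(A)$, where \[(f\circ g)[a_1|\cdots|a_k]=\sum_{0\le l\le m\le k}(-1)^{(|g|-1)\bar\varepsilon_l}f[a_1|\cdots|a_l|g[a_{l+1}|\cdots|a_m]|a_{m+1}|\cdots|a_k].\] Identify $f\in HC^*(A,DA)$ with the linear form $f'(a_0[a_1|\cdots|a_k])=(-1)^{|a_0|\bar\varepsilon_k}f[a_1|\cdots|a_k](a_0)$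 on Hochschild chains, and let $B^\vee$ be the operator of degree $-1$ with $(B^\vee f)'=-(-1)^{|f|}f'\circ B$, where $B$ is Connes' boundary \[B(a_0[a_1|\cdots|a_k])=\sum_{i=0}^k(-1)^{\left(\sum_{m<i}(|a_m|-1)\right)\left(\sum_{m\ge i}(|a_m|-1)\right)}1[a_i|\cdots|a_k|a_0|\cdots|a_{i-1}].\] These operations descend to cohomology and make $HH^*_\bullet(A)$ a perverse Gerstenhaber algebra (an associative, unital, graded commutative product and a Lie bracket of degree $-1$ for which $[f,-]$ is a derivation, all of perverse degree $\bar 0$). **Theorem.** Let $A_\bullet$ be a perverse derived Poincaré duality algebra: for some $e\in\mathbb Z$ there is an isomorphism of degree $e$ from $A_\bullet$ to $DA_\bullet$ in the derived category of perverse differential graded $A_\bullet$-bimodules, represented by quasi-isomorphisms of bimodules $q:P_\bullet\to A_\bullet$ of degree $0$ and $c:P_\bullet\to DA_\bullet$ of degree $e$. An isomorphism $\phi:HH^*_\bullet(A)\to HH^{*+e}_\bullet(A,DA)$ with $\phi(x\cup y)=x\cdot\phi(y)$ is called associated to it if $\phi(1)=c_*(z)$ for some $z\in HH^0_{\bar 0}(A,P)$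 with $q_*(z)=1$. 1. If $\mathbb B(A)_\bullet$ is cofibrant as an $A_\bullet$-bimodule (projective model structure), there is exactly one associated $\phi$. 2. For every associated $\phi$, set $\Delta=\phi^{-1}\circ B^\vee\circ\phi:HH^*_\bullet(A)\to HH^{*-1}_\bullet(A)$. If $\Delta(1)=0$, then $HH^*_\bullet(A)$ with $\Delta$ is a perverse Batalin–Vilkovisky algebra: $\Delta$ has perverse degree $\bar 0$, $\Delta\circ\Delta=0$, and for all $a,b\in HH^*_\bullet(A)$ \[(-1)^{|a|}[a,b]=\Delta(a\cup b)-\Delta(a)\cup b-(-1)^{|a|}a\cup\Delta(b).\] -/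

import Mathlib

universe u

namespace PerverseHochschild

/-! ### Goresky–MacPherson perversities -/

/-- A Goresky–MacPherson `n`-perversity. -/
@[ext]
structure Perversity (n : ℕ) where
  toFun : Fin (n + 1) → ℕ
  zero_of_le_two : ∀ i : Fin (n + 1), (i : ℕ) ≤ 2 → toFun i = 0
  mono_step : ∀ i : Fin n, 1 ≤ (i : ℕ) → toFun i.castSucc ≤ toFun i.succ
  growth_step : ∀ i : Fin n, 1 ≤ (i : ℕ) → toFun i.succ ≤ toFun i.castSucc + 1

namespace Perversity

variable {n : ℕ}

/-- The pointwise order. -/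
instance : PartialOrder (Perversity n) :=
  PartialOrder.lift Perversity.toFun (fun _ _ h => Perversity.ext h)

/-- The zero perversity. -/
instance : Zero (Perversity n) :=
  ⟨{ toFun := fun _ => 0
     zero_of_le_two := fun _ _ => rfl
     mono_step := fun _ _ => le_rfl
     growth_step := fun _ _ => Nat.zero_le _ }⟩

/-- The top perversity `t(0) = t(1) = 0`, `t(i) = i - 2`. -/
def top (n : ℕ) : Perversity n where
  toFun := fun i => (i : ℕ) - 2
  zero_of_le_two := fun i hi => by omega
  mono_step := fun i _ => by simp only [Fin.val_castSucc, Fin.val_succ]; omega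
  growth_step := fun i _ => by simp only [Fin.val_castSucc, Fin.val_succ]; omega

/-- The complementary perversity `t - p`. -/
def compl (p : Perversity n) : Perversity n where
  toFun := fun i => ((i : ℕ) - 2) - p.toFun i
  zero_of_le_two := fun i hi => by omega
  mono_step := fun i hi => by
    have := p.growth_step i hi
    simp only [Fin.val_castSucc, Fin.val_succ]; omega
  growth_step := fun i hi => by
    have := p.mono_step i hi
    simp only [Fin.val_castSucc, Fin.val_succ]; omega

/-- `AddLE p q r` says that `p + q ≤ r` pointwise. -/
def AddLE (p q r : Perversity n) : Prop := p.toFun + q.toFun ≤ r.toFun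

open Classical in
/-- The smallest Goresky–MacPherson perversity above the function `w`, when there is one
(and the zero perversity otherwise).  In particular `p ⊕ q = ceil (p + q)`. -/
noncomputable def ceil (w : Fin (n + 1) → ℕ) : Perversity n :=
  if h : ∃ p : Perversity n, IsLeast {q : Perversity n | w ≤ q.toFun} p then h.choose else 0

theorem toFun_le_top (p : Perversity n) (i : Fin (n + 1)) : p.toFun i ≤ (i : ℕ) - 2 := by
  induction i using Fin.induction with
  | zero => rw [p.zero_of_le_two 0 (by simp)]; exact Nat.zero_le _
  | succ i ih =>
    by_cases hi : (i : ℕ) + 1 ≤ 2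
    · rw [p.zero_of_le_two i.succ (by simpa using hi)]; exact Nat.zero_le _
    · have := p.growth_step i (by omega)
      simp only [Fin.val_castSucc, Fin.val_succ] at *
      omega

theorem le_def {p q : Perversity n} : p ≤ q ↔ ∀ i, p.toFun i ≤ q.toFun i := Iff.rfl

theorem addLE_def {p q r : Perversity n} :
    AddLE p q r ↔ ∀ i, p.toFun i + q.toFun i ≤ r.toFun i := Iff.rfl

theorem compl_le_compl_iff {p q : Perversity n} : q.compl ≤ p.compl ↔ p ≤ q := by
  simp only [le_def]
  refine forall_congr' fun i => ?_
  have := p.toFun_le_top i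
  have := q.toFun_le_top i
  simp only [compl]; omega

theorem addLE_compl_left {p q r : Perversity n} :
    AddLE r.compl p q.compl ↔ AddLE p q r := by
  simp only [addLE_def]
  refine forall_congr' fun i => ?_
  have := p.toFun_le_top i
  have := q.toFun_le_top i
  have := r.toFun_le_top i
  simp only [compl]; omega

theorem addLE_compl_right {p q r : Perversity n} :
    AddLE q r.compl p.compl ↔ AddLE p q r := by
  simp only [addLE_def]
  refine forall_congr' fun i => ?_
  have := p.toFun_le_top i
  have := q.toFun_le_top i
  have := r.toFun_le_top i
  simp only [compl]; omega

end Perversity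

open Perversity

/-! ### Perverse cochain complexes, algebras and bimodules

Families of maps are indexed by all perversities and degrees, and vanish outside the range in
which the map makes sense (the `shape` fields), as for Mathlib's `HomologicalComplex`. -/

/-- A perverse cochain complex of `R`-modules of rank `n`: a functor from the poset of
perversities to cochain complexes. -/
structure PerverseComplex (R : Type u) [CommRing R] (n : ℕ) where
  X : Perversity n → ℤ → Type u
  [grp : ∀ p i, AddCommGroup (X p i)]
  [mod : ∀ p i, Module R (X p i)]
  /-- structure morphisms -/
  map : ∀ (p q : Perversity n) (i : ℤ), X p i →ₗ[R] X q i
  map_shape : ∀ {p q : Perversity n} (i : ℤ), ¬ p ≤ q → map p q i = 0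
  map_self : ∀ (p : Perversity n) (i : ℤ) (x : X p i), map p p i x = x
  map_map : ∀ {p q r : Perversity n}, p ≤ q → q ≤ r → ∀ (i : ℤ) (x : X p i),
    map q r i (map p q i x) = map p r i x
  /-- differential, of degree `+1` -/
  d : ∀ (p : Perversity n) (i j : ℤ), X p i →ₗ[R] X p j
  d_shape : ∀ (p : Perversity n) {i j : ℤ}, i + 1 ≠ j → d p i j = 0
  d_d : ∀ (p : Perversity n) (i j k : ℤ) (x : X p i), d p j k (d p i j x) = 0
  map_d : ∀ {p q : Perversity n}, p ≤ q → ∀ (i j : ℤ) (x : X p i),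
    map p q j (d p i j x) = d q i j (map p q i x)

attribute [instance] PerverseComplex.grp PerverseComplex.mod

/-- The transport `X p i → X p j` along an equality `i = j` (zero if `i ≠ j`). -/
def PerverseComplex.cast {R : Type u} [CommRing R] {n : ℕ} (M : PerverseComplex R n)
    (p : Perversity n) (i j : ℤ) : M.X p i →ₗ[R] M.X p j :=
  if h : i = j then h ▸ LinearMap.id else 0

/-- A perverse differential (upper) graded algebra.  The product is a family of products
`A_p ⊗ A_q → A_r` for `p + q ≤ r`, natural in `p`, `q`, `r`. -/
structure PDGA (R : Type u) [CommRing R] (n : ℕ) extends PerverseComplex R n where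
  one : X 0 0
  mul : ∀ (p q r : Perversity n) (i j k : ℤ), X p i →ₗ[R] X q j →ₗ[R] X r k
  mul_shape : ∀ {p q r : Perversity n} {i j k : ℤ},
    ¬ (AddLE p q r ∧ i + j = k) → mul p q r i j k = 0
  map_mul : ∀ {p q r r' : Perversity n}, AddLE p q r → r ≤ r' →
    ∀ (i j k : ℤ) (a : X p i) (b : X q j),
      map r r' k (mul p q r i j k a b) = mul p q r' i j k a b
  mul_map_map : ∀ {p p' q q' r : Perversity n}, p ≤ p' → q ≤ q' → AddLE p' q' r →
    ∀ (i j k : ℤ) (a : X p i) (b : X q j),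
      mul p' q' r i j k (map p p' i a) (map q q' j b) = mul p q r i j k a b
  mul_assoc : ∀ {p q r s v w : Perversity n} {i j k l m t : ℤ},
    AddLE p q v → AddLE v r s → AddLE q r w → AddLE p w s →
    i + j = l → l + k = t → j + k = m →
    ∀ (a : X p i) (b : X q j) (c : X r k),
      mul v r s l k t (mul p q v i j l a b) c = mul p w s i m t a (mul q r w j k m b c)
  one_mul : ∀ {p q : Perversity n}, p ≤ q → ∀ (i : ℤ) (a : X p i),
    mul 0 p q 0 i i one a = map p q i a
  mul_one : ∀ {p q : Perversity n}, p ≤ q → ∀ (i : ℤ) (a : X p i),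
    mul p 0 q i 0 i a one = map p q i a
  d_mul : ∀ {p q r : Perversity n} {i j k i' j' k' : ℤ}, AddLE p q r → i + j = k →
    i + 1 = i' → j + 1 = j' → k + 1 = k' → ∀ (a : X p i) (b : X q j),
      d r k k' (mul p q r i j k a b) =
        mul p q r i' j k' (d p i i' a) b + i.negOnePow • mul p q r i j' k' a (d q j j' b)

/-- A perverse differential graded `A`-bimodule. -/
structure Bimodule {R : Type u} [CommRing R] {n : ℕ} (A : PDGA R n)
    extends PerverseComplex R n where
  /-- left action -/
  lact : ∀ (p q r : Perversity n) (i j k : ℤ), A.X p i →ₗ[R] X q j →ₗ[R] X r k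
  lact_shape : ∀ {p q r : Perversity n} {i j k : ℤ},
    ¬ (AddLE p q r ∧ i + j = k) → lact p q r i j k = 0
  map_lact : ∀ {p q r r' : Perversity n}, AddLE p q r → r ≤ r' →
    ∀ (i j k : ℤ) (a : A.X p i) (m : X q j),
      map r r' k (lact p q r i j k a m) = lact p q r' i j k a m
  lact_map_map : ∀ {p p' q q' r : Perversity n}, p ≤ p' → q ≤ q' → AddLE p' q' r →
    ∀ (i j k : ℤ) (a : A.X p i) (m : X q j),
      lact p' q' r i j k (A.map p p' i a) (map q q' j m) = lact p q r i j k a m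
  /-- right action -/
  ract : ∀ (p q r : Perversity n) (i j k : ℤ), X p i →ₗ[R] A.X q j →ₗ[R] X r k
  ract_shape : ∀ {p q r : Perversity n} {i j k : ℤ},
    ¬ (AddLE p q r ∧ i + j = k) → ract p q r i j k = 0
  map_ract : ∀ {p q r r' : Perversity n}, AddLE p q r → r ≤ r' →
    ∀ (i j k : ℤ) (m : X p i) (b : A.X q j),
      map r r' k (ract p q r i j k m b) = ract p q r' i j k m b
  ract_map_map : ∀ {p p' q q' r : Perversity n}, p ≤ p' → q ≤ q' → AddLE p' q' r →
    ∀ (i j k : ℤ) (m : X p i) (b : A.X q j),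
      ract p' q' r i j k (map p p' i m) (A.map q q' j b) = ract p q r i j k m b
  mul_lact : ∀ {p q r s v w : Perversity n} {i j k l m t : ℤ},
    AddLE p q v → AddLE v r s → AddLE q r w → AddLE p w s →
    i + j = l → l + k = t → j + k = m →
    ∀ (a : A.X p i) (b : A.X q j) (x : X r k),
      lact v r s l k t (A.mul p q v i j l a b) x = lact p w s i m t a (lact q r w j k m b x)
  lact_ract : ∀ {p q r s v w : Perversity n} {i j k l m t : ℤ},
    AddLE p q v → AddLE v r s → AddLE q r w → AddLE p w s →
    i + j = l → l + k = t → j + k = m →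
    ∀ (a : A.X p i) (x : X q j) (b : A.X r k),
      ract v r s l k t (lact p q v i j l a x) b = lact p w s i m t a (ract q r w j k m x b)
  ract_mul : ∀ {p q r s v w : Perversity n} {i j k l m t : ℤ},
    AddLE p q v → AddLE v r s → AddLE q r w → AddLE p w s →
    i + j = l → l + k = t → j + k = m →
    ∀ (x : X p i) (a : A.X q j) (b : A.X r k),
      ract v r s l k t (ract p q v i j l x a) b = ract p w s i m t x (A.mul q r w j k m a b)
  one_lact : ∀ {p q : Perversity n}, p ≤ q → ∀ (i : ℤ) (x : X p i),
    lact 0 p q 0 i i A.one x = map p q i x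
  ract_one : ∀ {p q : Perversity n}, p ≤ q → ∀ (i : ℤ) (x : X p i),
    ract p 0 q i 0 i x A.one = map p q i x
  d_lact : ∀ {p q r : Perversity n} {i j k i' j' k' : ℤ}, AddLE p q r → i + j = k →
    i + 1 = i' → j + 1 = j' → k + 1 = k' → ∀ (a : A.X p i) (x : X q j),
      d r k k' (lact p q r i j k a x) =
        lact p q r i' j k' (A.d p i i' a) x + i.negOnePow • lact p q r i j' k' a (d q j j' x)
  d_ract : ∀ {p q r : Perversity n} {i j k i' j' k' : ℤ}, AddLE p q r → i + j = k →
    i + 1 = i' → j + 1 = j' → k + 1 = k' → ∀ (x : X p i) (b : A.X q j),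
      d r k k' (ract p q r i j k x b) =
        ract p q r i' j k' (d p i i' x) b + i.negOnePow • ract p q r i j' k' x (A.d q j j' b)

section Basic

variable {R : Type u} [CommRing R] {n : ℕ}

/-- `A` as a bimodule over itself. -/
def PDGA.regular (A : PDGA R n) : Bimodule A where
  toPerverseComplex := A.toPerverseComplex
  lact := A.mul
  lact_shape := A.mul_shape
  map_lact := A.map_mul
  lact_map_map := A.mul_map_map
  ract := A.mul
  ract_shape := A.mul_shape
  map_ract := A.map_mul
  ract_map_map := A.mul_map_map
  mul_lact := A.mul_assoc
  lact_ract := A.mul_assoc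
  ract_mul := A.mul_assoc
  one_lact := A.one_mul
  ract_one := A.mul_one
  d_lact := A.d_mul
  d_ract := A.d_mul

/-- The linear dual `DA`, with `(DA)_p^i = Hom_R (A_{t-p}^{-i}, R)`, differential
`dφ = -(-1)^{|φ|} φ ∘ d` and actions `(a φ)(x) = (-1)^{|a|(|φ| + |x|)} φ (x a)` (where
`|a| + |φ| + |x| = 0`, so that the sign is `(-1)^{|a|}`) and `(φ b)(x) = φ (b x)`. -/
def PDGA.dual (A : PDGA R n) : Bimodule A where
  X p i := Module.Dual R (A.X p.compl (-i))
  map p q i := (A.map q.compl p.compl (-i)).dualMap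
  map_shape i h := by
    rw [A.map_shape _ (fun h' => h (compl_le_compl_iff.1 h'))]; ext; simp
  map_self p i φ := by ext x; simp [A.map_self]
  map_map h1 h2 i φ := by
    ext x
    simp [A.map_map (compl_le_compl_iff.2 h2) (compl_le_compl_iff.2 h1)]
  d p i j := -(i.negOnePow • (A.d p.compl (-j) (-i)).dualMap)
  d_shape p i j h := by
    rw [A.d_shape _ (by omega)]; ext; simp
  d_d p i j k φ := by
    ext x; simp [A.d_d, Units.smul_def]
  map_d h i j φ := by
    ext x; simp [A.map_d (compl_le_compl_iff.2 h)]
  lact p q r i j k := LinearMap.mk₂ R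
    (fun a φ => i.negOnePow • (φ ∘ₗ (A.mul r.compl p q.compl (-k) i (-j)).flip a))
    (fun a b φ => by ext x; simp)
    (fun c a φ => by ext x; simp [Units.smul_def]; ring)
    (fun a φ ψ => by ext x; simp)
    (fun c a φ => by ext x; simp [Units.smul_def]; ring)
  lact_shape {p q r i j k} h := by
    ext a φ x
    simp [A.mul_shape (p := r.compl) (q := p) (r := q.compl) (i := -k) (j := i) (k := -j)
      (fun h' => h ⟨addLE_compl_left.1 h'.1, by omega⟩)]
  map_lact {p q r r'} h h' i j k a φ := by
    ext x
    have hle : AddLE p q r' := le_trans h h'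
    have := A.mul_map_map (compl_le_compl_iff.2 h') (le_refl p) (addLE_compl_left.2 h)
      (-k) i (-j) x a
    rw [A.map_self] at this
    simp [this]
  lact_map_map {p p' q q' r} h h' h'' i j k a φ := by
    ext x
    have h1 : AddLE p q' r := fun x => le_trans (Nat.add_le_add_right (h x) _) (h'' x)
    have e1 := A.mul_map_map (le_refl r.compl) h (addLE_compl_left.2 h'') (-k) i (-j) x a
    have e2 := A.map_mul (addLE_compl_left.2 h1) (compl_le_compl_iff.2 h') (-k) i (-j) x a
    rw [A.map_self] at e1
    simp [e1, e2]
  ract p q r i j k := LinearMap.mk₂ R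
    (fun φ b => φ ∘ₗ A.mul q r.compl p.compl j (-k) (-i) b)
    (fun φ ψ b => by ext x; simp)
    (fun c φ b => by ext x; simp)
    (fun φ a b => by ext x; simp)
    (fun c φ b => by ext x; simp)
  ract_shape {p q r i j k} h := by
    ext φ b x
    simp [A.mul_shape (p := q) (q := r.compl) (r := p.compl) (i := j) (j := -k) (k := -i)
      (fun h' => h ⟨addLE_compl_right.1 h'.1, by omega⟩)]
  map_ract {p q r r'} h h' i j k φ b := by
    ext x
    have := A.mul_map_map (le_refl q) (compl_le_compl_iff.2 h') (addLE_compl_right.2 h)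
      j (-k) (-i) b x
    rw [A.map_self] at this
    simp [this]
  ract_map_map {p p' q q' r} h h' h'' i j k φ b := by
    ext x
    have h1 : AddLE p' q r := fun x => le_trans (Nat.add_le_add_left (h' x) _) (h'' x)
    have e1 := A.mul_map_map h' (le_refl r.compl) (addLE_compl_right.2 h'') j (-k) (-i) b x
    have e2 := A.map_mul (addLE_compl_right.2 h1) (compl_le_compl_iff.2 h) j (-k) (-i) b x
    rw [A.map_self] at e1
    simp [e1, e2]
  mul_lact {p q r s v w i j k l m t} h1 h2 h3 h4 e1 e2 e3 a b φ := by
    ext x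
    have := A.mul_assoc (addLE_compl_left.2 h4) (addLE_compl_left.2 h3) h1
      (addLE_compl_left.2 h2) (i := -t) (j := i) (k := j) (l := -m) (m := l) (t := -k)
      (by omega) (by omega) e1 x a b
    simp only [LinearMap.mk₂_apply, LinearMap.smul_apply, LinearMap.comp_apply,
      LinearMap.flip_apply, this, ← e1, Int.negOnePow_add, mul_smul]
  lact_ract {p q r s v w i j k l m t} h1 h2 h3 h4 e1 e2 e3 a φ b := by
    ext x
    have := A.mul_assoc (addLE_compl_right.2 h2) (addLE_compl_left.2 h1)
      (addLE_compl_left.2 h4) (addLE_compl_right.2 h3) (i := k) (j := -t) (k := i) (l := -l)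
      (m := -m) (t := -j) (by omega) (by omega) (by omega) b x a
    simp [this]
  ract_mul {p q r s v w i j k l m t} h1 h2 h3 h4 e1 e2 e3 φ a b := by
    ext x
    have := A.mul_assoc h3 (addLE_compl_right.2 h4) (addLE_compl_right.2 h2)
      (addLE_compl_right.2 h1) (i := j) (j := k) (k := -t) (l := m)
      (m := -l) (t := -i) (by omega) (by omega) (by omega) a b x
    simp [this]
  one_lact h i φ := by
    ext x; simp [A.mul_one (compl_le_compl_iff.2 h)]
  ract_one h i φ := by
    ext x; simp [A.one_mul (compl_le_compl_iff.2 h)]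
  d_lact {p q r i j k i' j' k'} h e1 e2 e3 e4 a φ := by
    ext x
    subst e1 e2 e3 e4
    have := A.d_mul (addLE_compl_left.2 h) (i := -(i + j + 1)) (j := i) (k := -(j + 1))
      (i' := -(i + j)) (j' := i + 1) (k' := -j)
      (by omega) (by omega) (by omega) (by omega) x a
    simp [this, Int.negOnePow_add, mul_smul, Units.smul_def]
    rcases neg_one_pow_eq_or R i.natAbs with hi | hi <;>
      rcases neg_one_pow_eq_or R j.natAbs with hj | hj <;> rw [hi, hj] <;> ring
  d_ract {p q r i j k i' j' k'} h e1 e2 e3 e4 φ b := by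
    ext x
    subst e1 e2 e3 e4
    have := A.d_mul (addLE_compl_right.2 h) (i := j) (j := -(i + j + 1)) (k := -(i + 1))
      (i' := j + 1) (j' := -(i + j)) (k' := -i)
      (by omega) (by omega) (by omega) (by omega) b x
    simp [this, Int.negOnePow_add, mul_smul, Units.smul_def]

/-- A morphism of `A`-bimodules `M → N` of degree `e` and perverse degree `0` compatible with the
differentials (a cocycle of the internal Hom over `A ⊠ Aᵒᵖ`). -/
structure BimoduleHom {A : PDGA R n} (M N : Bimodule A) (e : ℤ) where
  toFun : ∀ (p : Perversity n) (i j : ℤ), M.X p i →ₗ[R] N.X p j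
  shape : ∀ (p : Perversity n) {i j : ℤ}, i + e ≠ j → toFun p i j = 0
  natural : ∀ {p q : Perversity n}, p ≤ q → ∀ (i j : ℤ) (x : M.X p i),
    N.map p q j (toFun p i j x) = toFun q i j (M.map p q i x)
  comm_d : ∀ (p : Perversity n) {i j i' j' : ℤ}, i + e = j → i + 1 = i' → j + 1 = j' →
    ∀ x : M.X p i, N.d p j j' (toFun p i j x) = e.negOnePow • toFun p i' j' (M.d p i i' x)
  map_lact : ∀ {p q r : Perversity n} {i j k j' k' : ℤ}, AddLE p q r → i + j = k →
    j + e = j' → k + e = k' → ∀ (a : A.X p i) (x : M.X q j),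
      toFun r k k' (M.lact p q r i j k a x) =
        (e * i).negOnePow • N.lact p q r i j' k' a (toFun q j j' x)
  map_ract : ∀ {p q r : Perversity n} {i j k i' k' : ℤ}, AddLE p q r → i + j = k →
    i + e = i' → k + e = k' → ∀ (x : M.X p i) (b : A.X q j),
      toFun r k k' (M.ract p q r i j k x b) = N.ract p q r i' j k' (toFun p i i' x) b

/-- A quasi-isomorphism: the induced maps `H^i(M_p) → H^{i+e}(N_p)` are all bijective. -/
def BimoduleHom.IsQuasiIso {A : PDGA R n} {M N : Bimodule A} {e : ℤ}
    (f : BimoduleHom M N e) : Prop :=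
  ∀ (p : Perversity n) (i j : ℤ), i + e = j →
    (∀ x : M.X p i, M.d p i (i + 1) x = 0 →
      (∃ y : N.X p (j - 1), N.d p (j - 1) j y = f.toFun p i j x) →
      ∃ z : M.X p (i - 1), M.d p (i - 1) i z = x) ∧
    (∀ y : N.X p j, N.d p j (j + 1) y = 0 →
      ∃ x : M.X p i, M.d p i (i + 1) x = 0 ∧
        ∃ z : N.X p (j - 1), N.d p (j - 1) j z = f.toFun p i j x - y)

/-- An isomorphism, of degree `e`, from `A` to its dual `DA` in the derived category of perverse
differential graded `A`-bimodules, presented as a fraction `A ← P → DA` of quasi-isomorphisms. -/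
structure DerivedDuality (A : PDGA R n) (e : ℤ) where
  P : Bimodule A
  q : BimoduleHom P A.regular 0
  c : BimoduleHom P A.dual e
  q_quasiIso : q.IsQuasiIso
  c_quasiIso : c.IsQuasiIso

/-! ### The Hochschild cochain complex -/

/-- A homogeneous element of `A`. -/
structure Elt (A : PDGA R n) where
  perv : Perversity n
  deg : ℤ
  val : A.X perv deg

/-- Sum of the perverse degrees of the entries of `[a₁|…|aₖ]`. -/
def pervSum {A : PDGA R n} (L : List (Elt A)) : Fin (n + 1) → ℕ :=
  (L.map fun a => a.perv.toFun).sum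

/-- The degree `∑ (|aᵢ| - 1)` of `[a₁|…|aₖ]` in `T(sĀ)`. -/
def sdeg {A : PDGA R n} (L : List (Elt A)) : ℤ :=
  (L.map fun a => a.deg - 1).sum

/-- The sum of `F (a₁ … aᵢ) (aᵢ₊₁ … aₖ)` over `0 ≤ i ≤ k`. -/
def splitSum {A : PDGA R n} {N : Type*} [AddCommMonoid N] (L : List (Elt A))
    (F : List (Elt A) → List (Elt A) → N) : N :=
  ∑ i ∈ Finset.range (L.length + 1), F (L.take i) (L.drop i)

/-- Arbitrary families of values `f [a₁|…|aₖ] ∈ M_s^t`. -/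
abbrev Raw (A : PDGA R n) (M : Bimodule A) : Type u :=
  List (Elt A) → ∀ (s : Perversity n) (t : ℤ), M.X s t

/-- The normalized Hochschild cochains of perverse degree `p` and degree `q`, i.e. the elements of
`Hom(T(sĀ), M)_p^q`: families of values `f [a₁|…|aₖ] ∈ M_s^t`, for `p₁ + ⋯ + pₖ + p ≤ s` and
`t = ∑ (|aᵢ| - 1) + q`, multilinear, natural in `p₁, …, pₖ` and `s`, and vanishing when some `aᵢ`
comes from the unit.  (The value is set to `0` for all other `s`, `t`.) -/
def HC (A : PDGA R n) (M : Bimodule A) (p : Perversity n) (q : ℤ) : Submodule R (Raw A M) where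
  carrier := {f |
    (∀ L s t, ¬ (pervSum L + p.toFun ≤ s.toFun ∧ sdeg L + q = t) → f L s t = 0) ∧
    (∀ (L L' : List (Elt A)) (p' : Perversity n) (i : ℤ) (a b : A.X p' i) s t,
      f (L ++ ⟨p', i, a + b⟩ :: L') s t =
        f (L ++ ⟨p', i, a⟩ :: L') s t + f (L ++ ⟨p', i, b⟩ :: L') s t) ∧
    (∀ (L L' : List (Elt A)) (p' : Perversity n) (i : ℤ) (c : R) (a : A.X p' i) s t,
      f (L ++ ⟨p', i, c • a⟩ :: L') s t = c • f (L ++ ⟨p', i, a⟩ :: L') s t) ∧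
    (∀ (L L' : List (Elt A)) (p₁ p₂ : Perversity n) (i : ℤ) (a : A.X p₁ i) (s : Perversity n) t,
      p₁ ≤ p₂ →
      pervSum (L ++ ⟨p₂, i, A.map p₁ p₂ i a⟩ :: L') + p.toFun ≤ s.toFun →
      f (L ++ ⟨p₂, i, A.map p₁ p₂ i a⟩ :: L') s t = f (L ++ ⟨p₁, i, a⟩ :: L') s t) ∧
    (∀ (L : List (Elt A)) (s s' : Perversity n) (t : ℤ),
      pervSum L + p.toFun ≤ s.toFun → s ≤ s' → M.map s s' t (f L s t) = f L s' t) ∧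
    (∀ (L L' : List (Elt A)) (p' : Perversity n) s t,
      f (L ++ ⟨p', 0, A.map 0 p' 0 A.one⟩ :: L') s t = 0)}
  zero_mem' := by simp
  add_mem' := by
    rintro f g ⟨f1, f2, f3, f4, f5, f6⟩ ⟨g1, g2, g3, g4, g5, g6⟩
    refine ⟨fun L s t h => ?_, fun L L' p' i a b s t => ?_, fun L L' p' i c a s t => ?_,
      fun L L' p₁ p₂ i a s t h h' => ?_, fun L s s' t h h' => ?_, fun L L' p' s t => ?_⟩
    · simp [f1 L s t h, g1 L s t h]
    · simp only [Pi.add_apply, f2, g2]; abel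
    · simp only [Pi.add_apply, f3, g3, smul_add]
    · simp only [Pi.add_apply, f4 L L' p₁ p₂ i a s t h h', g4 L L' p₁ p₂ i a s t h h']
    · simp only [Pi.add_apply, map_add, f5 L s s' t h h', g5 L s s' t h h']
    · simp [f6, g6]
  smul_mem' := by
    rintro c f ⟨f1, f2, f3, f4, f5, f6⟩
    refine ⟨fun L s t h => ?_, fun L L' p' i a b s t => ?_, fun L L' p' i c a s t => ?_,
      fun L L' p₁ p₂ i a s t h h' => ?_, fun L s s' t h h' => ?_, fun L L' p' s t => ?_⟩
    · simp [f1 L s t h]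
    · simp only [Pi.smul_apply, f2, smul_add]
    · simp only [Pi.smul_apply, f3]; rw [smul_comm]
    · simp only [Pi.smul_apply, f4 L L' p₁ p₂ i a s t h h']
    · simp only [Pi.smul_apply, map_smul, f5 L s s' t h h']
    · simp [f6]

/-- The entry `a b`. -/
noncomputable def Elt.mul {A : PDGA R n} (a b : Elt A) : Elt A :=
  ⟨ceil (a.perv.toFun + b.perv.toFun), a.deg + b.deg, A.mul _ _ _ _ _ _ a.val b.val⟩

/-- The entry `d a`. -/
def Elt.d {A : PDGA R n} (a : Elt A) : Elt A :=
  ⟨a.perv, a.deg + 1, A.d _ _ _ a.val⟩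

/-- The entry `f [a₁|…|aₖ]`, for `f` a cochain of perverse degree `p` and degree `q`. -/
noncomputable def Raw.entry {A : PDGA R n} (p : Perversity n) (q : ℤ) (f : Raw A A.regular)
    (L : List (Elt A)) : Elt A :=
  ⟨ceil (pervSum L + p.toFun), sdeg L + q, f L _ _⟩

section Differential

variable {A : PDGA R n} {M : Bimodule A} (p : Perversity n) (q : ℤ) (f : Raw A M)
  (s : Perversity n) (t : ℤ)

/-- `± f [a₁|…|d aᵢ|…|aₖ]` with `(a₁ … aᵢ₋₁)` and `(aᵢ … aₖ)` as arguments. -/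
def dTerm (L : List (Elt A)) : List (Elt A) → M.X s t
  | [] => 0
  | a :: L' => (sdeg L + q).negOnePow • f (L ++ a.d :: L') s t

/-- `± f [a₁|…|aᵢ₋₁ aᵢ|…|aₖ]` with `(a₁ … aᵢ₋₂)` and `(aᵢ₋₁ … aₖ)` as arguments. -/
noncomputable def mulTerm (L : List (Elt A)) : List (Elt A) → M.X s t
  | a :: b :: L' => -((sdeg L + (a.deg - 1) + q).negOnePow • f (L ++ a.mul b :: L') s t)
  | _ => 0

/-- `± f [a₁|…|aₖ₋₁] aₖ` with `(a₁ … aₖ₋₁)` and `(aₖ)` as arguments. -/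
noncomputable def rightTerm (L : List (Elt A)) : List (Elt A) → M.X s t
  | [b] => (sdeg L + q).negOnePow •
      M.ract (ceil (pervSum L + p.toFun)) b.perv s (sdeg L + q) b.deg t (f L _ _) b.val
  | _ => 0

/-- `± a₁ f [a₂|…|aₖ]`. -/
noncomputable def leftTerm : List (Elt A) → M.X s t
  | [] => 0
  | a :: L => -(((a.deg + 1) * q).negOnePow •
      M.lact a.perv (ceil (pervSum L + p.toFun)) s a.deg (sdeg L + q) t a.val (f L _ _))

end Differential

/-- The Hochschild differential on cochains of perverse degree `p` and degree `q`. -/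
noncomputable def hochD {A : PDGA R n} {M : Bimodule A} (p : Perversity n) (q : ℤ) :
    Raw A M →ₗ[R] Raw A M where
  toFun f L s t :=
    M.d s (t - 1) t (f L s (t - 1)) + splitSum L (dTerm q f s t)
      + leftTerm p q f s t L + splitSum L (rightTerm p q f s t) + splitSum L (mulTerm q f s t)
  map_add' f g := by
    have h1 : ∀ s t L L', dTerm q (f + g) s t L L' = dTerm q f s t L L' + dTerm q g s t L L' := by
      rintro s t L (_ | ⟨a, L'⟩) <;> simp [dTerm]
    have h2 : ∀ s t L L',
        mulTerm q (f + g) s t L L' = mulTerm q f s t L L' + mulTerm q g s t L L' := by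
      rintro s t L (_ | ⟨a, _ | ⟨b, L'⟩⟩) <;> simp [mulTerm, add_comm]
    have h3 : ∀ s t L L',
        rightTerm p q (f + g) s t L L' = rightTerm p q f s t L L' + rightTerm p q g s t L L' := by
      rintro s t L (_ | ⟨a, _ | ⟨b, L'⟩⟩) <;> simp [rightTerm]
    have h4 : ∀ s t L,
        leftTerm p q (f + g) s t L = leftTerm p q f s t L + leftTerm p q g s t L := by
      rintro s t (_ | ⟨a, L'⟩) <;> simp [leftTerm, add_comm]
    funext L s t
    simp only [splitSum, h1, h2, h3, h4, Finset.sum_add_distrib, Pi.add_apply, map_add]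
    abel
  map_smul' c f := by
    have h1 : ∀ s t L L', dTerm q (c • f) s t L L' = c • dTerm q f s t L L' := by
      rintro s t L (_ | ⟨a, L'⟩) <;> simp [dTerm, smul_comm c]
    have h2 : ∀ s t L L', mulTerm q (c • f) s t L L' = c • mulTerm q f s t L L' := by
      rintro s t L (_ | ⟨a, _ | ⟨b, L'⟩⟩) <;> simp [mulTerm, smul_comm c]
    have h3 : ∀ s t L L', rightTerm p q (c • f) s t L L' = c • rightTerm p q f s t L L' := by
      rintro s t L (_ | ⟨a, _ | ⟨b, L'⟩⟩) <;> simp [rightTerm, smul_comm c]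
    have h4 : ∀ s t L, leftTerm p q (c • f) s t L = c • leftTerm p q f s t L := by
      rintro s t (_ | ⟨a, L'⟩) <;> simp [leftTerm, smul_comm c]
    funext L s t
    simp only [splitSum, h1, h2, h3, h4, ← Finset.smul_sum, Pi.smul_apply, map_smul, smul_add,
      RingHom.id_apply]

/-- Hochschild cocycles. -/
noncomputable def cocycles (A : PDGA R n) (M : Bimodule A) (p : Perversity n) (q : ℤ) :
    Submodule R (Raw A M) :=
  HC A M p q ⊓ LinearMap.ker (hochD p q)

/-- Hochschild coboundaries. -/
noncomputable def coboundaries (A : PDGA R n) (M : Bimodule A) (p : Perversity n) (q : ℤ) :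
    Submodule R (Raw A M) :=
  (HC A M p (q - 1)).map (hochD p (q - 1))

/-- Hochschild cohomology `HH^q_p(A, M)`: cocycles modulo coboundaries. -/
abbrev HH (A : PDGA R n) (M : Bimodule A) (p : Perversity n) (q : ℤ) : Type u :=
  cocycles A M p q ⧸ (coboundaries A M p q).submoduleOf (cocycles A M p q)

/-- The class of a cocycle. -/
noncomputable abbrev HH.mk {A : PDGA R n} {M : Bimodule A} {p : Perversity n} {q : ℤ}
    (f : Raw A M) (hf : f ∈ cocycles A M p q) : HH A M p q :=
  Submodule.Quotient.mk ⟨f, hf⟩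

/-- The bar construction `𝔹(A)` is cofibrant as an `A`-bimodule: it has the left lifting property
with respect to the maps of bimodules which are surjective quasi-isomorphisms.  Here morphisms of
bimodules `𝔹(A) → M` are the cocycles of degree `0` and perverse degree `0` in
`Hom_{A ⊠ Aᵒᵖ}(𝔹(A), M) = HC(A, M)`. -/
def BarCofibrant (A : PDGA R n) : Prop :=
  ∀ (E B : Bimodule A) (π : BimoduleHom E B 0), π.IsQuasiIso →
    (∀ p i, Function.Surjective (π.toFun p i i)) →
    ∀ f ∈ cocycles A B 0 0, ∃ g ∈ cocycles A E 0 0, ∀ L s t, π.toFun s t t (g L s t) = f L s t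

/-! ### Operations on Hochschild cochains -/

section Operations

variable {A : PDGA R n}

/-- Postcomposition with a morphism of bimodules of degree `e`. -/
def push {M N : Bimodule A} {e : ℤ} (g : BimoduleHom M N e) (f : Raw A M) : Raw A N :=
  fun L s t => g.toFun s (t - e) t (f L s (t - e))

open Classical in
/-- The structure morphism from perverse degree `≤ r` to perverse degree `r`: the values
`f [a₁|…|aₖ] ∈ M_s` are only kept for `p₁ + ⋯ + pₖ + r ≤ s`. -/
noncomputable def restr {M : Bimodule A} (r : Perversity n) (f : Raw A M) : Raw A M :=
  fun L s t => if pervSum L + r.toFun ≤ s.toFun then f L s t else 0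

/-- The unit cochain, `[] ↦ 1`. -/
noncomputable def oneRaw (A : PDGA R n) : Raw A A.regular
  | [], s, t => A.cast s 0 t (A.map 0 s 0 A.one)
  | _ :: _, _, _ => 0

/-- The product `f · g` of `f ∈ HC_p^i(A)` and `g ∈ HC_q^j(A, M)`:
`(f·g)[a₁|…|aₖ] = ∑ (-1)^{|g| |[a₁|…|aₗ]|} f[a₁|…|aₗ] g[aₗ₊₁|…|aₖ]`.
For `M = A` this is the cup product. -/
noncomputable def actRaw {M : Bimodule A} (p q : Perversity n) (i j : ℤ)
    (f : Raw A A.regular) (g : Raw A M) : Raw A M :=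
  fun L s t => splitSum L fun L₁ L₂ => (j * sdeg L₁).negOnePow •
    M.lact (ceil (pervSum L₁ + p.toFun)) (ceil (pervSum L₂ + q.toFun)) s
      (sdeg L₁ + i) (sdeg L₂ + j) t (f L₁ _ _) (g L₂ _ _)

/-- `(f ∘ g)[a₁|…|aₖ] = ∑ (-1)^{(|g|-1) |[a₁|…|aₗ]|} f[a₁|…|aₗ|g[aₗ₊₁|…|aₘ]|aₘ₊₁|…|aₖ]`,
where `g` has perverse degree `q` and degree `j`. -/
noncomputable def circRaw (q : Perversity n) (j : ℤ) (f g : Raw A A.regular) : Raw A A.regular :=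
  fun L s t => splitSum L fun L₁ L' => splitSum L' fun L₂ L₃ =>
    ((j - 1) * sdeg L₁).negOnePow • f (L₁ ++ Raw.entry q j g L₂ :: L₃) s t

/-- The Gerstenhaber bracket of `f ∈ HC_p^i(A)` and `g ∈ HC_q^j(A)`. -/
noncomputable def bracketRaw (p q : Perversity n) (i j : ℤ) (f g : Raw A A.regular) :
    Raw A A.regular :=
  circRaw q j f g - ((i - 1) * (j - 1)).negOnePow • circRaw p i g f

/-- `h = B^∨ f`, for `f ∈ HC^q(A, DA)`.  A cochain `f` is identified with the linear form
`f'(a₀[a₁|…|aₖ]) = (-1)^{|a₀| |[a₁|…|aₖ]|} f[a₁|…|aₖ](a₀)` on Hochschild chains, and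
`(B^∨ f)' = -(-1)^{|f|} f' ∘ B`, where
`B(a₀[a₁|…|aₖ]) = ∑ (-1)^{|[a₀|…|aₗ]| |[aₗ₊₁|…|aₖ]|} 1[aₗ₊₁|…|aₖ|a₀|…|aₗ]`. -/
def IsConnesDual (q : ℤ) (f h : Raw A A.dual) : Prop :=
  ∀ (L : List (Elt A)) (s : Perversity n) (t : ℤ) (x : A.X s.compl (-t)),
    let a₀ : Elt A := ⟨s.compl, -t, x⟩
    (-t * sdeg L).negOnePow • (show Module.Dual R (A.X s.compl (-t)) from h L s t) x =
      -(q.negOnePow • splitSum L fun L₁ L₂ => (sdeg (a₀ :: L₁) * sdeg L₂).negOnePow •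
        (show Module.Dual R (A.X (top n).compl (-0)) from f (L₂ ++ a₀ :: L₁) (top n) 0)
          (A.cast _ 0 (-0) (A.map 0 _ 0 A.one)))

end Operations

/-- The operations on Hochschild cohomology which the operations on cochains induce. -/
structure InducedOperations (A : PDGA R n) where
  /-- structure morphisms -/
  res : ∀ {p p' : Perversity n}, p ≤ p' → ∀ i : ℤ,
    HH A A.regular p i →ₗ[R] HH A A.regular p' i
  res_mk : ∀ {p p' : Perversity n} (h : p ≤ p') (i : ℤ) (f : Raw A A.regular)
    (hf : f ∈ cocycles A A.regular p i),
    ∃ h' : restr p' f ∈ cocycles A A.regular p' i, res h i (HH.mk f hf) = HH.mk _ h'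
  /-- unit class -/
  one : HH A A.regular 0 0
  one_eq : ∃ h : oneRaw A ∈ cocycles A A.regular 0 0, one = HH.mk _ h
  /-- cup product -/
  cup : ∀ {p q r : Perversity n} {i j k : ℤ}, AddLE p q r → i + j = k →
    HH A A.regular p i →ₗ[R] HH A A.regular q j →ₗ[R] HH A A.regular r k
  cup_mk : ∀ {p q r : Perversity n} {i j k : ℤ} (h : AddLE p q r) (e : i + j = k)
    (f g : Raw A A.regular) (hf : f ∈ cocycles A A.regular p i)
    (hg : g ∈ cocycles A A.regular q j),
    ∃ h' : restr r (actRaw p q i j f g) ∈ cocycles A A.regular r k,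
      cup h e (HH.mk f hf) (HH.mk g hg) = HH.mk _ h'
  /-- Gerstenhaber bracket -/
  bracket : ∀ {p q r : Perversity n} {i j k : ℤ}, AddLE p q r → i + j = k + 1 →
    HH A A.regular p i →ₗ[R] HH A A.regular q j →ₗ[R] HH A A.regular r k
  bracket_mk : ∀ {p q r : Perversity n} {i j k : ℤ} (h : AddLE p q r) (e : i + j = k + 1)
    (f g : Raw A A.regular) (hf : f ∈ cocycles A A.regular p i)
    (hg : g ∈ cocycles A A.regular q j),
    ∃ h' : restr r (bracketRaw p q i j f g) ∈ cocycles A A.regular r k,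
      bracket h e (HH.mk f hf) (HH.mk g hg) = HH.mk _ h'
  /-- action of `HH(A)` on `HH(A, DA)` -/
  act : ∀ {p q r : Perversity n} {i j k : ℤ}, AddLE p q r → i + j = k →
    HH A A.regular p i →ₗ[R] HH A A.dual q j →ₗ[R] HH A A.dual r k
  act_mk : ∀ {p q r : Perversity n} {i j k : ℤ} (h : AddLE p q r) (e : i + j = k)
    (f : Raw A A.regular) (g : Raw A A.dual) (hf : f ∈ cocycles A A.regular p i)
    (hg : g ∈ cocycles A A.dual q j),
    ∃ h' : restr r (actRaw p q i j f g) ∈ cocycles A A.dual r k,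
      act h e (HH.mk f hf) (HH.mk g hg) = HH.mk _ h'
  /-- dual of Connes' boundary -/
  connes : ∀ (p : Perversity n) {i j : ℤ}, j + 1 = i → HH A A.dual p i →ₗ[R] HH A A.dual p j
  connes_mk : ∀ (p : Perversity n) {i j : ℤ} (e : j + 1 = i) (f : Raw A A.dual)
    (hf : f ∈ cocycles A A.dual p i),
    ∃ (h : Raw A A.dual) (hh : h ∈ cocycles A A.dual p j), IsConnesDual i f h ∧
      connes p e (HH.mk f hf) = HH.mk h hh

end Basic

/-! ### Perverse Gerstenhaber and Batalin–Vilkovisky algebras -/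

section BV

variable {R : Type u} [CommRing R] {n : ℕ} {V : Perversity n → ℤ → Type u}
  [∀ p i, AddCommGroup (V p i)] [∀ p i, Module R (V p i)]

/-- The perverse graded module `V`, with structure morphisms `res`, is a perverse Gerstenhaber
algebra for the given unit, product and bracket (which have perverse degree `0`). -/
structure IsPerverseGerstenhaber
    (res : ∀ {p p' : Perversity n}, p ≤ p' → ∀ i : ℤ, V p i →ₗ[R] V p' i)
    (one : V 0 0)
    (cup : ∀ {p q r : Perversity n} {i j k : ℤ}, AddLE p q r → i + j = k →
      V p i →ₗ[R] V q j →ₗ[R] V r k)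
    (bracket : ∀ {p q r : Perversity n} {i j k : ℤ}, AddLE p q r → i + j = k + 1 →
      V p i →ₗ[R] V q j →ₗ[R] V r k) : Prop where
  res_self : ∀ (p : Perversity n) (i : ℤ) (x : V p i), res (le_refl p) i x = x
  res_res : ∀ {p q r : Perversity n} (h : p ≤ q) (h' : q ≤ r) (i : ℤ) (x : V p i),
    res h' i (res h i x) = res (h.trans h') i x
  res_cup : ∀ {p q r r' : Perversity n} {i j k : ℤ} (h : AddLE p q r) (h' : AddLE p q r')
    (hr : r ≤ r') (e : i + j = k) (x : V p i) (y : V q j),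
    res hr k (cup h e x y) = cup h' e x y
  cup_res : ∀ {p p' q q' r : Perversity n} {i j k : ℤ} (hp : p ≤ p') (hq : q ≤ q')
    (h : AddLE p q r) (h' : AddLE p' q' r) (e : i + j = k) (x : V p i) (y : V q j),
    cup h' e (res hp i x) (res hq j y) = cup h e x y
  res_bracket : ∀ {p q r r' : Perversity n} {i j k : ℤ} (h : AddLE p q r) (h' : AddLE p q r')
    (hr : r ≤ r') (e : i + j = k + 1) (x : V p i) (y : V q j),
    res hr k (bracket h e x y) = bracket h' e x y
  bracket_res : ∀ {p p' q q' r : Perversity n} {i j k : ℤ} (hp : p ≤ p') (hq : q ≤ q')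
    (h : AddLE p q r) (h' : AddLE p' q' r) (e : i + j = k + 1) (x : V p i) (y : V q j),
    bracket h' e (res hp i x) (res hq j y) = bracket h e x y
  one_cup : ∀ {p q : Perversity n} {i : ℤ} (h : AddLE 0 p q) (h' : p ≤ q) (x : V p i),
    cup h (zero_add i) one x = res h' i x
  cup_one : ∀ {p q : Perversity n} {i : ℤ} (h : AddLE p 0 q) (h' : p ≤ q) (x : V p i),
    cup h (add_zero i) x one = res h' i x
  cup_assoc : ∀ {p q r s v w : Perversity n} {i j k l m t : ℤ}
    (h₁ : AddLE p q v) (h₂ : AddLE v r s) (h₃ : AddLE q r w) (h₄ : AddLE p w s)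
    (e₁ : i + j = l) (e₂ : l + k = t) (e₃ : j + k = m) (e₄ : i + m = t)
    (x : V p i) (y : V q j) (z : V r k),
    cup h₂ e₂ (cup h₁ e₁ x y) z = cup h₄ e₄ x (cup h₃ e₃ y z)
  cup_comm : ∀ {p q r : Perversity n} {i j k : ℤ} (h : AddLE p q r) (h' : AddLE q p r)
    (e : i + j = k) (e' : j + i = k) (x : V p i) (y : V q j),
    cup h e x y = (i * j).negOnePow • cup h' e' y x
  bracket_skew : ∀ {p q r : Perversity n} {i j k : ℤ} (h : AddLE p q r) (h' : AddLE q p r)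
    (e : i + j = k + 1) (e' : j + i = k + 1) (x : V p i) (y : V q j),
    bracket h e x y = -(((i - 1) * (j - 1)).negOnePow • bracket h' e' y x)
  jacobi : ∀ {p q r s v w u : Perversity n} {i j k l m m' t : ℤ}
    (h₁ : AddLE p q v) (h₂ : AddLE v r s) (h₃ : AddLE q r w) (h₄ : AddLE p w s)
    (h₅ : AddLE p r u) (h₆ : AddLE q u s)
    (e₁ : i + j = l + 1) (e₂ : l + k = t + 1) (e₃ : j + k = m + 1) (e₄ : i + m = t + 1)
    (e₅ : i + k = m' + 1) (e₆ : j + m' = t + 1)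
    (x : V p i) (y : V q j) (z : V r k),
    bracket h₂ e₂ (bracket h₁ e₁ x y) z = bracket h₄ e₄ x (bracket h₃ e₃ y z)
      - ((i - 1) * (j - 1)).negOnePow • bracket h₆ e₆ y (bracket h₅ e₅ x z)
  leibniz : ∀ {p q r s v w u : Perversity n} {i j k l m m' t : ℤ}
    (h₁ : AddLE p q v) (h₂ : AddLE v r s) (h₃ : AddLE q r w) (h₄ : AddLE p w s)
    (h₅ : AddLE p r u) (h₆ : AddLE q u s)
    (e₁ : i + j = l + 1) (e₂ : l + k = t) (e₃ : j + k = m) (e₄ : i + m = t + 1)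
    (e₅ : i + k = m' + 1) (e₆ : j + m' = t)
    (x : V p i) (y : V q j) (z : V r k),
    bracket h₄ e₄ x (cup h₃ e₃ y z) = cup h₂ e₂ (bracket h₁ e₁ x y) z
      + ((i - 1) * j).negOnePow • cup h₆ e₆ y (bracket h₅ e₅ x z)

/-- The perverse Gerstenhaber algebra `V` with the operator `Δ` of degree `-1` and perverse degree
`0` is a perverse Batalin–Vilkovisky algebra. -/
structure IsPerverseBV
    (res : ∀ {p p' : Perversity n}, p ≤ p' → ∀ i : ℤ, V p i →ₗ[R] V p' i)
    (one : V 0 0)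
    (cup : ∀ {p q r : Perversity n} {i j k : ℤ}, AddLE p q r → i + j = k →
      V p i →ₗ[R] V q j →ₗ[R] V r k)
    (bracket : ∀ {p q r : Perversity n} {i j k : ℤ}, AddLE p q r → i + j = k + 1 →
      V p i →ₗ[R] V q j →ₗ[R] V r k)
    (Δ : ∀ (p : Perversity n) (i : ℤ), V p i →ₗ[R] V p (i - 1)) : Prop
    extends IsPerverseGerstenhaber res one cup bracket where
  res_delta : ∀ {p p' : Perversity n} (h : p ≤ p') (i : ℤ) (x : V p i),
    res h (i - 1) (Δ p i x) = Δ p' i (res h i x)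
  delta_delta : ∀ (p : Perversity n) (i : ℤ) (x : V p i), Δ p (i - 1) (Δ p i x) = 0
  bracket_eq : ∀ {p q r : Perversity n} {i j k : ℤ} (h : AddLE p q r) (e : i + j = k)
    (e₀ : i + j = k - 1 + 1) (e₁ : i - 1 + j = k - 1) (e₂ : i + (j - 1) = k - 1)
    (x : V p i) (y : V q j),
    i.negOnePow • bracket h e₀ x y =
      Δ r k (cup h e x y) - cup h e₁ (Δ p i x) y - i.negOnePow • cup h e₂ x (Δ q j y)

end BV

section Duality

variable {R : Type u} [CommRing R] {n : ℕ} {A : PDGA R n} {e : ℤ}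

/-- `φ` is an isomorphism of `HH(A)`-modules `HH(A) ≅ HH(A, DA)` of degree `e` which is associated
to the derived isomorphism `A ← P → DA`: it sends the unit to the class `c_* q_*⁻¹ 1`, where
`q_* : HH(A, P) → HH(A)` and `c_* : HH(A, P) → HH(A, DA)` are the induced maps; so `φ x = x · φ 1`
is the action on this class. -/
def IsAssociated (H : InducedOperations A) (𝔇 : DerivedDuality A e)
    (φ : ∀ (p : Perversity n) (i : ℤ), HH A A.regular p i ≃ₗ[R] HH A A.dual p (i + e)) : Prop :=
  (∀ {p q r : Perversity n} {i j k : ℤ} (h : AddLE p q r) (h₁ : i + j = k)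
    (h₂ : i + (j + e) = k + e) (x : HH A A.regular p i) (y : HH A A.regular q j),
    φ r k (H.cup h h₁ x y) = H.act h h₂ x (φ q j y)) ∧
  ∃ f ∈ cocycles A 𝔇.P 0 0, ∃ (hq : push 𝔇.q f ∈ cocycles A A.regular 0 0)
    (hc : push 𝔇.c f ∈ cocycles A A.dual 0 (0 + e)),
    HH.mk _ hq = H.one ∧ HH.mk _ hc = φ 0 0 H.one

/-- `Δ = φ⁻¹ ∘ B^∨ ∘ φ`. -/
noncomputable def delta (H : InducedOperations A)
    (φ : ∀ (p : Perversity n) (i : ℤ), HH A A.regular p i ≃ₗ[R] HH A A.dual p (i + e))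
    (p : Perversity n) (i : ℤ) : HH A A.regular p i →ₗ[R] HH A A.regular p (i - 1) :=
  (φ p (i - 1)).symm.toLinearMap ∘ₗ H.connes p (by omega) ∘ₗ (φ p i).toLinearMap

end Duality

end PerverseHochschild

open PerverseHochschild

set_option linter.unusedSectionVars false

namespace PerverseHochschild

open Perversity

section

theorem sgn_eq {x y : ℤ} (h : (x : ZMod 2) = y) : x.negOnePow = y.negOnePow := by
  rw [Int.negOnePow_eq_iff, even_iff_two_dvd]
  exact (ZMod.intCast_eq_intCast_iff_dvd_sub y x 2).1 h.symm

namespace Perversity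

variable {n : ℕ}

theorem toFun_mono (p : Perversity n) : Monotone p.toFun := by
  refine Fin.monotone_iff_le_succ.2 fun i => ?_
  by_cases hi : 1 ≤ (i : ℕ)
  · exact p.mono_step i hi
  · rw [p.zero_of_le_two i.castSucc (by simp; omega)]; exact Nat.zero_le _

theorem exists_isLeast {S : Set (Perversity n)} (hS : S.Nonempty)
    (h : ∀ p : Perversity n, (∀ i, ∃ q ∈ S, p.toFun i = q.toFun i) → p ∈ S) :
    ∃ p, IsLeast S p := by
  have hne (i) : ((fun p : Perversity n => p.toFun i) '' S).Nonempty := hS.image _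
  have hle (i) {q : Perversity n} (hq : q ∈ S) :
      sInf ((fun p : Perversity n => p.toFun i) '' S) ≤ q.toFun i :=
    Nat.sInf_le (Set.mem_image_of_mem (fun p : Perversity n => p.toFun i) hq)
  refine ⟨{ toFun := fun i => sInf ((fun p : Perversity n => p.toFun i) '' S)
            zero_of_le_two := ?_, mono_step := ?_, growth_step := ?_ }, h _ fun i => ?_,
    fun q hq i => hle i hq⟩
  · intro i hi
    obtain ⟨p, hp⟩ := hS
    exact Nat.le_zero.1 ((hle i hp).trans (p.zero_of_le_two i hi).le)
  · intro i hi
    obtain ⟨p, hp, h⟩ := Nat.sInf_mem (hne i.succ)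
    rw [← h]
    exact (hle _ hp).trans (p.mono_step i hi)
  · intro i hi
    obtain ⟨p, hp, h⟩ := Nat.sInf_mem (hne i.castSucc)
    rw [← h]
    exact (hle _ hp).trans (p.growth_step i hi)
  · obtain ⟨p, hp, h⟩ := Nat.sInf_mem (hne i)
    exact ⟨p, hp, h.symm⟩

theorem ceil_isLeast {w : Fin (n + 1) → ℕ} {s : Perversity n} (h : w ≤ s.toFun) :
    IsLeast {q : Perversity n | w ≤ q.toFun} (ceil w) := by
  have : ∃ p : Perversity n, IsLeast {q : Perversity n | w ≤ q.toFun} p := by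
    refine exists_isLeast ⟨s, h⟩ fun p hp i => ?_
    obtain ⟨q, hq, h⟩ := hp i
    rw [h]; exact hq i
  rw [ceil, dif_pos this]
  exact this.choose_spec

theorem le_ceil {w : Fin (n + 1) → ℕ} {s : Perversity n} (h : w ≤ s.toFun) :
    w ≤ (ceil w).toFun := (ceil_isLeast h).1

theorem ceil_le {w : Fin (n + 1) → ℕ} {s : Perversity n} (h : w ≤ s.toFun) : ceil w ≤ s :=
  (ceil_isLeast h).2 h

theorem ceil_add_le {w v : Fin (n + 1) → ℕ} {s : Perversity n} (hw : Monotone w)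
    (hv : Monotone v) (h : w + v ≤ s.toFun) : (ceil w).toFun + v ≤ s.toFun := by
  let f : Fin (n + 1) → ℕ := fun i => sInf ((fun j => s.toFun j - v j) '' Set.Ici i)
  have hne (i) : ((fun j => s.toFun j - v j) '' Set.Ici i).Nonempty := Set.nonempty_Ici.image _
  have hle (i j) (hj : i ≤ j) : f i ≤ s.toFun j - v j :=
    Nat.sInf_le (Set.mem_image_of_mem (fun j => s.toFun j - v j) (Set.mem_Ici.2 hj))
  let u : Perversity n :=
    { toFun := f
      zero_of_le_two := fun i hi => by
        have := hle i i le_rfl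
        rw [s.zero_of_le_two i hi] at this
        omega
      mono_step := fun i hi => by
        obtain ⟨j, hj, h'⟩ := Nat.sInf_mem (hne i.succ)
        change _ ≤ sInf _
        rw [← h']
        exact hle _ _ ((Fin.castSucc_le_succ i).trans hj)
      growth_step := fun i hi => by
        obtain ⟨j, hj, h'⟩ := Nat.sInf_mem (hne i.castSucc)
        change _ ≤ sInf _ + 1
        rw [← h']
        rcases eq_or_lt_of_le (Set.mem_Ici.1 hj) with rfl | hj'
        · refine (hle _ _ le_rfl).trans ?_
          have h1 := s.growth_step i hi
          have h2 := hv (Fin.castSucc_le_succ i)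
          have h3 := h i.castSucc
          simp only [Pi.add_apply] at h3 ⊢
          omega
        · exact (hle _ _ (Fin.castSucc_lt_iff_succ_le.1 hj')).trans (Nat.le_succ _) }
  have hu : ceil w ≤ u := ceil_le fun i => by
    obtain ⟨j, hj, h'⟩ := Nat.sInf_mem (hne i)
    change _ ≤ sInf _
    rw [← h']
    have := h j
    have := hw (Set.mem_Ici.1 hj)
    simp only [Pi.add_apply] at *
    omega
  intro i
  have h1 := hu i
  have h2 := hle i i le_rfl
  have h3 := h i
  change (ceil w).toFun i ≤ f i at h1
  simp only [Pi.add_apply] at *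
  omega

theorem compl_compl (p : Perversity n) : p.compl.compl = p := by
  ext i
  have := p.toFun_le_top i
  simp only [compl]; omega

theorem le_compl_iff {p : Perversity n} {w : Fin (n + 1) → ℕ} :
    w ≤ p.compl.toFun ↔ p.toFun + w ≤ (top n).toFun := by
  refine forall_congr' fun i => ?_
  have := p.toFun_le_top i
  simp only [compl, top, Pi.add_apply]; omega

end Perversity

end

section

section SplitSum

variable {R : Type u} [CommRing R] {n : ℕ} {A : PDGA R n} {N : Type*} [AddCommGroup N]

theorem splitSum_nil (F : List (Elt A) → List (Elt A) → N) : splitSum [] F = F [] [] := by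
  simp [splitSum]

theorem splitSum_cons (a : Elt A) (L : List (Elt A)) (F : List (Elt A) → List (Elt A) → N) :
    splitSum (a :: L) F = F [] (a :: L) + splitSum L fun L₁ L₂ => F (a :: L₁) L₂ := by
  simp only [splitSum, List.length_cons]
  rw [Finset.sum_range_succ']
  simp [add_comm]

theorem splitSum_congr {L : List (Elt A)} {F G : List (Elt A) → List (Elt A) → N}
    (h : ∀ L₁ L₂, L₁ ++ L₂ = L → F L₁ L₂ = G L₁ L₂) : splitSum L F = splitSum L G :=
  Finset.sum_congr rfl fun _ _ => h _ _ (List.take_append_drop _ _)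

theorem splitSum_zero (L : List (Elt A)) :
    splitSum L (fun _ _ => (0 : N)) = 0 := by simp [splitSum]

theorem splitSum_eq_zero {L : List (Elt A)} {F : List (Elt A) → List (Elt A) → N}
    (h : ∀ L₁ L₂, L₁ ++ L₂ = L → F L₁ L₂ = 0) : splitSum L F = 0 :=
  (splitSum_congr h).trans (splitSum_zero L)

theorem splitSum_add (L : List (Elt A)) (F G : List (Elt A) → List (Elt A) → N) :
    splitSum L (fun L₁ L₂ => F L₁ L₂ + G L₁ L₂) = splitSum L F + splitSum L G :=
  Finset.sum_add_distrib

theorem splitSum_neg (L : List (Elt A)) (F : List (Elt A) → List (Elt A) → N) :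
    splitSum L (fun L₁ L₂ => -F L₁ L₂) = -splitSum L F := Finset.sum_neg_distrib _

theorem splitSum_sub (L : List (Elt A)) (F G : List (Elt A) → List (Elt A) → N) :
    splitSum L (fun L₁ L₂ => F L₁ L₂ - G L₁ L₂) = splitSum L F - splitSum L G :=
  Finset.sum_sub_distrib _ _

theorem splitSum_smul {S : Type*} [Monoid S] [DistribMulAction S N] (c : S) (L : List (Elt A))
    (F : List (Elt A) → List (Elt A) → N) :
    splitSum L (fun L₁ L₂ => c • F L₁ L₂) = c • splitSum L F := (Finset.smul_sum).symm

theorem map_splitSum {N' : Type*} [AddCommGroup N'] {Φ : Type*} [FunLike Φ N N']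
    [AddMonoidHomClass Φ N N'] (φ : Φ) (L : List (Elt A))
    (F : List (Elt A) → List (Elt A) → N) :
    φ (splitSum L F) = splitSum L fun L₁ L₂ => φ (F L₁ L₂) := map_sum _ _ _

theorem splitSum_comm (L K : List (Elt A))
    (F : List (Elt A) → List (Elt A) → List (Elt A) → List (Elt A) → N) :
    (splitSum L fun L₁ L₂ => splitSum K fun K₁ K₂ => F L₁ L₂ K₁ K₂) =
      splitSum K fun K₁ K₂ => splitSum L fun L₁ L₂ => F L₁ L₂ K₁ K₂ := Finset.sum_comm

theorem splitSum_append_cons (K : List (Elt A)) (x : Elt A) (L : List (Elt A))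
    (F : List (Elt A) → List (Elt A) → N) :
    splitSum (K ++ x :: L) F = splitSum K (fun K₁ K₂ => F K₁ (K₂ ++ x :: L)) +
      splitSum L fun L₁ L₂ => F (K ++ x :: L₁) L₂ := by
  induction K generalizing F with
  | nil => simp [splitSum_cons, splitSum_nil]
  | cons a K ih =>
    rw [List.cons_append, splitSum_cons, ih, splitSum_cons, add_assoc]
    rfl

theorem splitSum_splitSum (L : List (Elt A))
    (F : List (Elt A) → List (Elt A) → List (Elt A) → N) :
    (splitSum L fun L' L₃ => splitSum L' fun L₁ L₂ => F L₁ L₂ L₃) =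
      splitSum L fun L₁ L' => splitSum L' fun L₂ L₃ => F L₁ L₂ L₃ := by
  induction L generalizing F with
  | nil => simp [splitSum_nil]
  | cons a L ih =>
    simp only [splitSum_cons, splitSum_nil, splitSum_add]
    rw [ih]
    abel

theorem splitSum_eq_nil {L : List (Elt A)} {F : List (Elt A) → List (Elt A) → N}
    (h : ∀ L₁ L₂, L₁ ≠ [] → F L₁ L₂ = 0) : splitSum L F = F [] L := by
  cases L with
  | nil => exact splitSum_nil F
  | cons a L =>
    rw [splitSum_cons, splitSum_eq_zero fun _ _ _ => h _ _ (List.cons_ne_nil _ _), add_zero]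

theorem splitSum_eq_self {L : List (Elt A)} {F : List (Elt A) → List (Elt A) → N}
    (h : ∀ L₁ L₂, L₂ ≠ [] → F L₁ L₂ = 0) : splitSum L F = F L [] := by
  induction L generalizing F with
  | nil => exact splitSum_nil F
  | cons a L ih =>
    rw [splitSum_cons, ih fun _ _ => h _ _, h _ _ (List.cons_ne_nil _ _), zero_add]

theorem pervSum_nil : pervSum ([] : List (Elt A)) = 0 := rfl

theorem pervSum_cons (a : Elt A) (L : List (Elt A)) :
    pervSum (a :: L) = a.perv.toFun + pervSum L := by simp [pervSum]

theorem pervSum_append (K L : List (Elt A)) : pervSum (K ++ L) = pervSum K + pervSum L := by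
  simp [pervSum]

theorem sdeg_nil : sdeg ([] : List (Elt A)) = 0 := rfl

theorem sdeg_cons (a : Elt A) (L : List (Elt A)) : sdeg (a :: L) = (a.deg - 1) + sdeg L := by
  simp [sdeg]

theorem sdeg_append (K L : List (Elt A)) : sdeg (K ++ L) = sdeg K + sdeg L := by
  simp [sdeg]

theorem pervSum_mono (L : List (Elt A)) : Monotone (pervSum L) := by
  induction L with
  | nil => exact fun _ _ _ => le_rfl
  | cons a L ih => rw [pervSum_cons]; exact a.perv.toFun_mono.add ih

end SplitSum

section Multilinear

variable {R : Type u} [CommRing R] {n : ℕ} {A : PDGA R n} {N : Type*} [AddCommGroup N]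
  [Module R N]

theorem PerverseComplex.cast_self (M : PerverseComplex R n) (p : Perversity n) (i : ℤ)
    (x : M.X p i) : M.cast p i i x = x := by simp [PerverseComplex.cast]

theorem PerverseComplex.cast_of_ne (M : PerverseComplex R n) (p : Perversity n) {i j : ℤ}
    (h : i ≠ j) : M.cast p i j = 0 := by simp [PerverseComplex.cast, h]

theorem PerverseComplex.map_cast (M : PerverseComplex R n) (p q : Perversity n) (i j : ℤ)
    (x : M.X p i) : M.map p q j (M.cast p i j x) = M.cast q i j (M.map p q i x) := by
  by_cases h : i = j
  · subst h; simp only [cast_self]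
  · simp [cast_of_ne _ _ h]

/-- The image of the entry `x` in `A_s^t` (zero if this does not make sense). -/
def Elt.ev (x : Elt A) (s : Perversity n) (t : ℤ) : A.X s t :=
  A.cast s x.deg t (A.map x.perv s x.deg x.val)

/-- The function `H` of one entry is linear, natural, and vanishes unless the perversity of the
entry is at most `s - v`. -/
structure Slot (v : Fin (n + 1) → ℕ) (s : Perversity n) (H : Elt A → N) : Prop where
  out : ∀ x : Elt A, ¬ (x.perv.toFun + v ≤ s.toFun) → H x = 0
  add : ∀ (p : Perversity n) (i : ℤ) (a b : A.X p i), H ⟨p, i, a + b⟩ = H ⟨p, i, a⟩ + H ⟨p, i, b⟩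
  smul : ∀ (p : Perversity n) (i : ℤ) (c : R) (a : A.X p i), H ⟨p, i, c • a⟩ = c • H ⟨p, i, a⟩
  nat : ∀ (p₁ p₂ : Perversity n) (i : ℤ) (a : A.X p₁ i), p₁ ≤ p₂ → p₂.toFun + v ≤ s.toFun →
    H ⟨p₂, i, A.map p₁ p₂ i a⟩ = H ⟨p₁, i, a⟩

/-- The function `G` of lists is multilinear, natural, and vanishes unless the sum of the
perversities of the entries is at most `s - w`. -/
structure IsMul (w : Fin (n + 1) → ℕ) (s : Perversity n) (G : List (Elt A) → N) : Prop where
  out : ∀ L, ¬ (pervSum L + w ≤ s.toFun) → G L = 0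
  slot : ∀ L L', Slot (pervSum L + pervSum L' + w) s fun x => G (L ++ x :: L')

namespace Slot

variable {v : Fin (n + 1) → ℕ} {s : Perversity n} {H H' : Elt A → N}

/-- The restriction of `H` to the entries of given perversity and degree. -/
def lin (h : Slot v s H) (p : Perversity n) (i : ℤ) : A.X p i →ₗ[R] N where
  toFun a := H ⟨p, i, a⟩
  map_add' := h.add p i
  map_smul' := h.smul p i

theorem map_zero (h : Slot v s H) (p : Perversity n) (i : ℤ) : H ⟨p, i, 0⟩ = 0 :=
  (h.lin p i).map_zero

theorem map_units_smul (h : Slot v s H) (p : Perversity n) (i : ℤ) (c : ℤˣ) (a : A.X p i) :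
    H ⟨p, i, c • a⟩ = c • H ⟨p, i, a⟩ :=
  _root_.map_zsmul (h.lin p i) (c : ℤ) a

theorem map_splitSum (h : Slot v s H) (p : Perversity n) (i : ℤ) (L : List (Elt A))
    (F : List (Elt A) → List (Elt A) → A.X p i) :
    H ⟨p, i, splitSum L F⟩ = splitSum L fun L₁ L₂ => H ⟨p, i, F L₁ L₂⟩ :=
  PerverseHochschild.map_splitSum (h.lin p i) L F

theorem zero : Slot v s (fun _ : Elt A => (0 : N)) :=
  ⟨fun _ _ => rfl, by simp, by simp, by simp⟩

theorem fun_add (h : Slot v s H) (h' : Slot v s H') : Slot v s fun x => H x + H' x where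
  out x hx := by rw [h.out x hx, h'.out x hx, add_zero]
  add p i a b := by rw [h.add, h'.add]; abel
  smul p i c a := by rw [h.smul, h'.smul, smul_add]
  nat p₁ p₂ i a h₁ h₂ := by rw [h.nat _ _ _ _ h₁ h₂, h'.nat _ _ _ _ h₁ h₂]

theorem fun_sign (h : Slot v s H) (φ : ℤ → ℤ) : Slot v s fun x => (φ x.deg).negOnePow • H x where
  out x hx := by rw [h.out x hx, smul_zero]
  add p i a b := by rw [h.add, smul_add]
  smul p i c a := by rw [h.smul, smul_comm]
  nat p₁ p₂ i a h₁ h₂ := by rw [h.nat _ _ _ _ h₁ h₂]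

theorem fun_sum {ι : Type*} (S : Finset ι) {H : ι → Elt A → N} (h : ∀ i ∈ S, Slot v s (H i)) :
    Slot v s fun x => ∑ i ∈ S, H i x := by
  classical
  induction S using Finset.induction_on with
  | empty => simpa using zero
  | insert a S ha ih =>
    simp only [Finset.sum_insert ha]
    exact (h a (Finset.mem_insert_self a S)).fun_add
      (ih fun i hi => h i (Finset.mem_insert_of_mem hi))

theorem fun_splitSum (L : List (Elt A)) {H : List (Elt A) → List (Elt A) → Elt A → N}
    (h : ∀ L₁ L₂, L₁ ++ L₂ = L → Slot v s (H L₁ L₂)) :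
    Slot v s fun x => splitSum L fun L₁ L₂ => H L₁ L₂ x :=
  fun_sum _ fun _ _ => h _ _ (List.take_append_drop _ _)

theorem congr (h : Slot v s H) {v' : Fin (n + 1) → ℕ} (e : v = v') (e' : ∀ x, H' x = H x) :
    Slot v' s H' := by
  obtain rfl : H' = H := funext e'
  exact e ▸ h

theorem comp_lin {N' : Type*} [AddCommGroup N'] [Module R N'] (h : Slot v s H)
    (φ : N →ₗ[R] N') : Slot v s fun x => φ (H x) where
  out x hx := by rw [h.out x hx, _root_.map_zero]
  add p i a b := by rw [h.add, _root_.map_add]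
  smul p i c a := by rw [h.smul, _root_.map_smul]
  nat p₁ p₂ i a h₁ h₂ := by rw [h.nat _ _ _ _ h₁ h₂]

end Slot

theorem Elt.ev_mk (p s : Perversity n) (t : ℤ) (a : A.X p t) :
    (⟨p, t, a⟩ : Elt A).ev s t = A.map p s t a := A.cast_self _ _ _

theorem Elt.ev_of_ne (x : Elt A) (s : Perversity n) {t : ℤ} (h : x.deg ≠ t) : x.ev s t = 0 := by
  rw [Elt.ev, A.cast_of_ne _ h, LinearMap.zero_apply]

theorem Elt.ev_self (x : Elt A) : x.ev x.perv x.deg = x.val := by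
  rw [Elt.ev, A.cast_self, A.map_self]

theorem Elt.ev_of_not_le (x : Elt A) (s : Perversity n) (t : ℤ) (h : ¬ x.perv ≤ s) :
    x.ev s t = 0 := by
  rw [Elt.ev, A.map_shape _ h]; simp

theorem Elt.map_ev (x : Elt A) {s s' : Perversity n} (t : ℤ) (h : x.perv ≤ s) (h' : s ≤ s') :
    A.map s s' t (x.ev s t) = x.ev s' t := by
  rw [Elt.ev, A.map_cast, A.map_map h h']; rfl

theorem slot_ev (s : Perversity n) (t : ℤ) : Slot 0 s fun x : Elt A => x.ev s t where
  out x hx := x.ev_of_not_le s t fun h => hx (by rw [add_zero]; exact h)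
  add p i a b := by simp [Elt.ev]
  smul p i c a := by simp [Elt.ev]
  nat p₁ p₂ i a h₁ h₂ := by
    simp only [Elt.ev]; rw [add_zero] at h₂; rw [A.map_map h₁ h₂]

/-- Multilinear natural families of values `f [a₁|…|aₖ] ∈ C_s^t`, for `p₁ + ⋯ + pₖ + w ≤ s` and
`t = ∑ (|aᵢ| - 1) + q`, and zero otherwise. -/
structure Fam (C : PerverseComplex R n) (w : Fin (n + 1) → ℕ) (q : ℤ)
    (f : List (Elt A) → ∀ s t, C.X s t) : Prop where
  shape : ∀ L s t, sdeg L + q ≠ t → f L s t = 0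
  mul : ∀ s t, IsMul w s fun L => f L s t
  nat : ∀ L s s' t, pervSum L + w ≤ s.toFun → s ≤ s' → C.map s s' t (f L s t) = f L s' t

/-- The family of values `f` vanishes when some entry comes from the unit. -/
def Normalized (G : List (Elt A) → N) : Prop :=
  ∀ (L L' : List (Elt A)) (p : Perversity n), G (L ++ ⟨p, 0, A.map 0 p 0 A.one⟩ :: L') = 0

theorem mem_HC {M : Bimodule A} {p : Perversity n} {q : ℤ} {f : Raw A M} :
    f ∈ HC A M p q ↔ Fam M.toPerverseComplex p.toFun q f ∧ ∀ s t, Normalized fun L => f L s t := by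
  constructor
  · rintro ⟨h1, h2, h3, h4, h5, h6⟩
    refine ⟨⟨fun L s t h => h1 L s t fun h' => h h'.2, fun s t => ⟨fun L h => h1 L s t fun h' =>
      h h'.1, fun L L' => ⟨fun x h => h1 _ s t fun h' => h ?_, fun p' i a b => h2 L L' p' i a b s t,
      fun p' i c a => h3 L L' p' i c a s t, fun p₁ p₂ i a h h' => h4 L L' p₁ p₂ i a s t h ?_⟩⟩,
      fun L s s' t h h' => h5 L s s' t h h'⟩, fun s t L L' p' => h6 L L' p' s t⟩
    · refine le_of_eq_of_le ?_ h'.1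
      rw [pervSum_append, pervSum_cons]; abel
    · refine le_of_eq_of_le ?_ h'
      rw [pervSum_append, pervSum_cons]; abel
  · rintro ⟨⟨h1, h2, h3⟩, h4⟩
    refine ⟨fun L s t h => ?_, fun L L' p' i a b s t => ((h2 s t).slot L L').add p' i a b,
      fun L L' p' i c a s t => ((h2 s t).slot L L').smul p' i c a,
      fun L L' p₁ p₂ i a s t h h' => ((h2 s t).slot L L').nat p₁ p₂ i a h ?_,
      fun L s s' t h h' => h3 L s s' t h h', fun L L' p' s t => h4 s t L L' p'⟩
    · by_cases h' : sdeg L + q = t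
      · exact (h2 s t).out L fun h'' => h ⟨h'', h'⟩
      · exact h1 L s t h'
    · refine le_of_eq_of_le ?_ h'
      rw [pervSum_append, pervSum_cons]; abel

end Multilinear

end

section

variable {R : Type u} [CommRing R] {n : ℕ} {A : PDGA R n} {N : Type*} [AddCommGroup N]
  [Module R N]

/-- The entry `f [a₁|…|aₖ]`, for a family of values graded by `w` and `q`. -/
noncomputable def ent (w : Fin (n + 1) → ℕ) (q : ℤ) (f : List (Elt A) → ∀ s t, A.X s t)
    (L : List (Elt A)) : Elt A :=
  ⟨ceil (pervSum L + w), sdeg L + q, f L _ _⟩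

/-- A multilinear natural family of values in `A`, with its bidegree. -/
structure Cochain (A : PDGA R n) where
  w : Fin (n + 1) → ℕ
  mono : Monotone w
  deg : ℤ
  val : List (Elt A) → ∀ s t, A.X s t
  fam : Fam A.toPerverseComplex w deg val

/-- The entry `f [a₁|…|aₖ]`. -/
noncomputable def Cochain.ent (f : Cochain A) (L : List (Elt A)) : Elt A :=
  PerverseHochschild.ent f.w f.deg f.val L

theorem ent_deg (w : Fin (n + 1) → ℕ) (q : ℤ) (f : List (Elt A) → ∀ s t, A.X s t)
    (L : List (Elt A)) : (ent w q f L).deg = sdeg L + q := rfl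

theorem Cochain.ent_deg (f : Cochain A) (L : List (Elt A)) :
    (f.ent L).deg = sdeg L + f.deg := rfl

theorem Cochain.ent_perv (f : Cochain A) (L : List (Elt A)) :
    (f.ent L).perv = ceil (pervSum L + f.w) := rfl

/-- The function `H` of elements of `C` is linear, natural, and vanishes unless the perversity is
at most `s - v`. -/
structure PSlot (C : PerverseComplex R n) (v : Fin (n + 1) → ℕ) (s : Perversity n)
    (H : ∀ p i, C.X p i → N) : Prop where
  out : ∀ p i x, ¬ (p.toFun + v ≤ s.toFun) → H p i x = 0
  add : ∀ (p : Perversity n) (i : ℤ) (a b : C.X p i), H p i (a + b) = H p i a + H p i b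
  smul : ∀ (p : Perversity n) (i : ℤ) (c : R) (a : C.X p i), H p i (c • a) = c • H p i a
  nat : ∀ (p₁ p₂ : Perversity n) (i : ℤ) (a : C.X p₁ i), p₁ ≤ p₂ → p₂.toFun + v ≤ s.toFun →
    H p₂ i (C.map p₁ p₂ i a) = H p₁ i a

/-- The value of `H` at `f [a₁|…|aₖ]`. -/
noncomputable def pval {C : PerverseComplex R n} (w : Fin (n + 1) → ℕ) (q : ℤ)
    (f : List (Elt A) → ∀ s t, C.X s t) (H : ∀ p i, C.X p i → N) (L : List (Elt A)) : N :=
  H (ceil (pervSum L + w)) (sdeg L + q) (f L _ _)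

theorem pervSum_mid (L L' : List (Elt A)) (x : Elt A) :
    pervSum (L ++ x :: L') = pervSum L + pervSum L' + x.perv.toFun := by
  rw [pervSum_append, pervSum_cons]; abel

theorem sdeg_mid (L L' : List (Elt A)) (x : Elt A) :
    sdeg (L ++ x :: L') = sdeg L + sdeg L' + (x.deg - 1) := by
  rw [sdeg_append, sdeg_cons]; abel

section

variable {C : PerverseComplex R n} {v w : Fin (n + 1) → ℕ} {s : Perversity n}
  {H : ∀ p i, C.X p i → N} {q : ℤ} {f : List (Elt A) → ∀ s t, C.X s t}

/-- The restriction of `H` to given perversity and degree. -/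
def PSlot.lin (h : PSlot C v s H) (p : Perversity n) (i : ℤ) : C.X p i →ₗ[R] N where
  toFun := H p i
  map_add' := h.add p i
  map_smul' := h.smul p i

theorem PSlot.map_zero (h : PSlot C v s H) (p : Perversity n) (i : ℤ) : H p i 0 = 0 :=
  (h.lin p i).map_zero

theorem PSlot.ent_eq (h : PSlot C v s H) (hf : Fam C w q f) {L : List (Elt A)}
    {c : Perversity n} {t : ℤ} (h₁ : pervSum L + w ≤ c.toFun) (h₂ : c.toFun + v ≤ s.toFun)
    (ht : sdeg L + q = t) : pval w q f H L = H c t (f L c t) := by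
  subst ht
  rw [← hf.nat L (ceil (pervSum L + w)) c _ (le_ceil h₁) (ceil_le h₁),
    h.nat _ _ _ _ (ceil_le h₁) h₂]
  rfl

theorem PSlot.ent_eq_zero (h : PSlot C v s H) (hf : Fam C w q f)
    {L : List (Elt A)} (hL : ¬ (pervSum L + w + v ≤ s.toFun)) : pval w q f H L = 0 := by
  by_cases h₁ : pervSum L + w ≤ (ceil (pervSum L + w)).toFun
  · exact h.out _ _ _ fun h₂ => hL (le_trans (add_le_add_left h₁ _) h₂)
  · rw [pval, (hf.mul _ _).out _ h₁, h.map_zero]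

/-- A function filled with the values of a family is multilinear. -/
theorem PSlot.isMul_ent (h : PSlot C v s H) (hf : Fam C w q f)
    (hv : Monotone v) (hw : Monotone w) : IsMul (w + v) s (pval w q f H) where
  out L hL := h.ent_eq_zero hf (by rwa [add_assoc])
  slot L L' := by
    have key (p : Perversity n) (i : ℤ)
        (hp : p.toFun + (pervSum L + pervSum L' + (w + v)) ≤ s.toFun) :
        ∃ (c : Perversity n) (t : ℤ), c.toFun + v ≤ s.toFun ∧
          pervSum L + pervSum L' + w + p.toFun ≤ c.toFun ∧
          ∀ p' ≤ p, ∀ a : A.X p' i, pval w q f H (L ++ ⟨p', i, a⟩ :: L') =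
            H c t (f (L ++ ⟨p', i, a⟩ :: L') c t) := by
      have e : pervSum L + pervSum L' + w + p.toFun + v ≤ s.toFun :=
        le_of_eq_of_le (by abel) hp
      have e' : pervSum L + pervSum L' + w + p.toFun ≤ s.toFun :=
        le_trans (le_add_of_nonneg_right fun _ => Nat.zero_le _) e
      refine ⟨ceil (pervSum L + pervSum L' + w + p.toFun), sdeg L + sdeg L' + (i - 1) + q,
        ceil_add_le ?_ hv e, le_ceil e', fun p' hp' a => ?_⟩
      · exact (((pervSum_mono L).add (pervSum_mono L')).add hw).add p.toFun_mono
      · refine h.ent_eq hf ?_ (ceil_add_le ?_ hv e) (by rw [sdeg_mid])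
        · refine le_trans ?_ (le_ceil e')
          rw [pervSum_mid]
          intro j
          have := hp' j
          simp only [Pi.add_apply]; change p'.toFun j ≤ _ at this; omega
        · exact (((pervSum_mono L).add (pervSum_mono L')).add hw).add p.toFun_mono
    have out : ∀ x : Elt A, ¬ (x.perv.toFun + (pervSum L + pervSum L' + (w + v)) ≤ s.toFun) →
        pval w q f H (L ++ x :: L') = 0 := fun x hx => h.ent_eq_zero hf fun h' =>
      hx (le_of_eq_of_le (by rw [pervSum_mid]; abel) h')
    refine ⟨out, fun p i a b => ?_, fun p i c a => ?_, fun p₁ p₂ i a h₁ h₂ => ?_⟩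
    · by_cases hp : p.toFun + (pervSum L + pervSum L' + (w + v)) ≤ s.toFun
      · obtain ⟨c, t, hc, hc', e⟩ := key p i hp
        rw [e p le_rfl, e p le_rfl, e p le_rfl, ((hf.mul c t).slot L L').add, h.add]
      · rw [out ⟨p, i, a + b⟩ hp, out ⟨p, i, a⟩ hp, out ⟨p, i, b⟩ hp, add_zero]
    · by_cases hp : p.toFun + (pervSum L + pervSum L' + (w + v)) ≤ s.toFun
      · obtain ⟨c', t, hc, hc', e⟩ := key p i hp
        rw [e p le_rfl, e p le_rfl, ((hf.mul c' t).slot L L').smul, h.smul]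
      · rw [out ⟨p, i, c • a⟩ hp, out ⟨p, i, a⟩ hp, smul_zero]
    · obtain ⟨c, t, hc, hc', e⟩ := key p₂ i h₂
      rw [e p₂ le_rfl, e p₁ h₁, ((hf.mul c t).slot L L').nat _ _ _ _ h₁]
      exact le_of_eq_of_le (by abel) hc'

end

section

variable {v w : Fin (n + 1) → ℕ} {s : Perversity n} {H : Elt A → N} {q : ℤ}
  {f : List (Elt A) → ∀ s t, A.X s t}

theorem Slot.pslot (h : Slot v s H) : PSlot A.toPerverseComplex v s fun p i x => H ⟨p, i, x⟩ :=
  ⟨fun p i x => h.out ⟨p, i, x⟩, h.add, h.smul, h.nat⟩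

theorem Slot.ent_eq (h : Slot v s H) (hf : Fam A.toPerverseComplex w q f) {L : List (Elt A)}
    {c : Perversity n} {t : ℤ} (h₁ : pervSum L + w ≤ c.toFun) (h₂ : c.toFun + v ≤ s.toFun)
    (ht : sdeg L + q = t) : H (ent w q f L) = H ⟨c, t, f L c t⟩ := h.pslot.ent_eq hf h₁ h₂ ht

theorem Slot.ent_eq_zero (h : Slot v s H) (hf : Fam A.toPerverseComplex w q f)
    {L : List (Elt A)} (hL : ¬ (pervSum L + w + v ≤ s.toFun)) : H (ent w q f L) = 0 :=
  h.pslot.ent_eq_zero hf hL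

/-- A slot filled with the values of a family is multilinear. -/
theorem Slot.isMul_ent (h : Slot v s H) (hf : Fam A.toPerverseComplex w q f)
    (hv : Monotone v) (hw : Monotone w) : IsMul (w + v) s fun L => H (ent w q f L) :=
  h.pslot.isMul_ent hf hv hw

end

/-! ### Insertion -/

/-- The sum of `± G [a₁|…|f[…]|…|aₖ]`. -/
noncomputable def ins (f : Cochain A) (G : List (Elt A) → N) (L : List (Elt A)) : N :=
  splitSum L fun L₁ L' => splitSum L' fun L₂ L₃ =>
    ((f.deg - 1) * sdeg L₁).negOnePow • G (L₁ ++ f.ent L₂ :: L₃)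

/-- Functions of a list with a marked entry. -/
abbrev Marked (A : PDGA R n) (N : Type*) := List (Elt A) → Elt A → List (Elt A) → N

def mark (G : List (Elt A) → N) : Marked A N := fun K a K' => G (K ++ a :: K')

/-- Insertion to the right of the mark. -/
noncomputable def insR (f : Cochain A) (Γ : Marked A N) : Marked A N := fun K a K' =>
  splitSum K' fun K₁ K'' => splitSum K'' fun K₂ K₃ =>
    ((f.deg - 1) * (sdeg K + (a.deg - 1) + sdeg K₁)).negOnePow • Γ K a (K₁ ++ f.ent K₂ :: K₃)

/-- Insertion to the left of the mark. -/
noncomputable def insL (f : Cochain A) (Γ : Marked A N) : Marked A N := fun K a K' =>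
  ins f (fun X => Γ X a K') K

/-- Insertion at the mark. -/
noncomputable def sub (f : Cochain A) (Γ : Marked A N) : Marked A N := fun K a K' =>
  splitSum K fun K₁ K₂ => splitSum K' fun K₃ K₄ =>
    ((f.deg - 1) * sdeg K₁).negOnePow • Γ K₁ (f.ent (K₂ ++ a :: K₃)) K₄

/-- Insertion, at the mark, of `f` with `g` inserted into it to the right of the mark. -/
noncomputable def subR (f g : Cochain A) (Γ : Marked A N) : Marked A N := fun K a K' =>
  splitSum K fun K₁ K₂ => splitSum K' fun K₃ K₄ =>
    ((f.deg - 1) * sdeg K₁).negOnePow • ((g.deg - 1) * sdeg K₁).negOnePow •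
      insR g (mark fun X => Γ K₁ (f.ent X) K₄) K₂ a K₃

theorem mark_ins (f : Cochain A) (G : List (Elt A) → N) (K : List (Elt A)) (a : Elt A)
    (K' : List (Elt A)) : mark (ins f G) K a K' =
      sub f (mark G) K a K' + insR f (mark G) K a K' + insL f (mark G) K a K' := by
  simp only [mark, ins, sub, insR, insL, splitSum_append_cons, splitSum_add]
  rw [add_assoc, add_comm]
  congr 1
  · congr 1
    refine splitSum_congr fun K₁ K₂ _ => splitSum_congr fun K₃ K₄ _ => ?_
    rw [sdeg_append, sdeg_cons, List.append_assoc, List.cons_append, add_assoc]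
  · refine splitSum_congr fun K₁ K₂ _ => splitSum_congr fun K₃ K₄ _ => ?_
    rw [List.append_assoc, List.cons_append]

end

section

variable {R : Type u} [CommRing R] {n : ℕ} {A : PDGA R n} {N : Type*} [AddCommGroup N]

theorem negOnePow_smul_smul (k : ℤ) (x : N) : k.negOnePow • k.negOnePow • x = x := by
  rw [smul_smul, ← Int.negOnePow_add, Int.negOnePow_even _ ⟨_, rfl⟩, one_smul]

theorem sgn_smul_congr {x y : ℤ} {a b : N} (h : (x : ZMod 2) = y) (h' : a = b) :
    x.negOnePow • a = y.negOnePow • b := by rw [sgn_eq h, h']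

theorem splitSum_nest (L : List (Elt A))
    (F : List (Elt A) → List (Elt A) → List (Elt A) → List (Elt A) → N) :
    (splitSum L fun L' L₃ => splitSum L' fun L₁ L₂ => F L' L₁ L₂ L₃) =
      splitSum L fun L₁ L' => splitSum L' fun L₂ L₃ => F (L₁ ++ L₂) L₁ L₂ L₃ := by
  rw [← splitSum_splitSum]
  exact splitSum_congr fun _ _ _ => splitSum_congr fun _ _ h => by rw [h]

theorem splitSum_first (K : List (Elt A))
    (F : List (Elt A) → List (Elt A) → List (Elt A) → List (Elt A) → List (Elt A) → N) :
    (splitSum K fun K₁ K₂ => splitSum K₂ fun L₁ L₂ => splitSum K₁ fun B₁ B₂ =>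
        F K₁ B₁ B₂ L₁ L₂) =
      splitSum K fun B₁ K₁ => splitSum K₁ fun B₂ K₂ => splitSum K₂ fun L₁ L₂ =>
        F (B₁ ++ B₂) B₁ B₂ L₁ L₂ := by
  refine Eq.trans ?_ (splitSum_nest K fun K₁ B₁ B₂ K₂ => splitSum K₂ fun L₁ L₂ =>
    F K₁ B₁ B₂ L₁ L₂)
  exact splitSum_congr fun K₁ K₂ _ => splitSum_comm _ _ _

theorem splitSum_comm_left (K L : List (Elt A))
    (F : List (Elt A) → List (Elt A) → List (Elt A) → List (Elt A) → List (Elt A) →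
      List (Elt A) → List (Elt A) → List (Elt A) → N) :
    (splitSum K fun K₁ K' => splitSum K' fun K₂ K₃ =>
      splitSum L fun L₁ L' => splitSum L' fun L₂ L₃ => F K₁ K' K₂ K₃ L₁ L' L₂ L₃) =
    splitSum L fun L₁ L' => splitSum L' fun L₂ L₃ =>
      splitSum K fun K₁ K' => splitSum K' fun K₂ K₃ => F K₁ K' K₂ K₃ L₁ L' L₂ L₃ := by
  refine (splitSum_congr fun K₁ K' _ => splitSum_comm K' L _).trans
    ((splitSum_comm K L _).trans (splitSum_congr fun L₁ L' _ => ?_))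
  exact (splitSum_congr fun K₁ K' _ => splitSum_comm K' L' _).trans (splitSum_comm K L' _)

theorem splitSum_units_smul (c : ℤˣ) (L : List (Elt A))
    (F : List (Elt A) → List (Elt A) → N) :
    c • splitSum L F = splitSum L (fun L₁ L₂ => c • F L₁ L₂) := Finset.smul_sum

theorem insR_sub (f g : Cochain A) (Γ : Marked A N) (K : List (Elt A)) (a : Elt A)
    (K' : List (Elt A)) : insR g (sub f Γ) K a K' = subR f g Γ K a K' +
      ((f.deg - 1) * (g.deg - 1)).negOnePow • sub f (insR g Γ) K a K' := by
  simp only [insR, sub, subR, mark, splitSum_append_cons, splitSum_add, smul_add,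
    splitSum_units_smul]
  rw [add_comm]
  simp only [splitSum_comm _ K]
  simp only [splitSum_first, splitSum_nest, smul_smul, ← Int.negOnePow_add]
  congr 1
  · refine splitSum_congr fun K₁ K₂ hK => splitSum_congr fun B₁ _ _ => splitSum_congr fun B₂ _ _ =>
      splitSum_congr fun _ _ _ => sgn_smul_congr ?_ ?_
    · rw [← hK]; simp only [sdeg_append]; push_cast; grind
    · rfl
  · refine splitSum_congr fun K₁ K₂ hK => splitSum_congr fun B₁ _ _ => splitSum_congr fun B₂ _ _ =>
      splitSum_congr fun _ _ _ => sgn_smul_congr ?_ ?_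
    · rw [← hK]; simp only [sdeg_append, sdeg_cons, Cochain.ent_deg]; push_cast; grind
    · rfl

/-- Insertion to the right of the mark of `f` with `g` inserted into it. -/
noncomputable def insRR (f g : Cochain A) (Γ : Marked A N) : Marked A N := fun K a K' =>
  splitSum K' fun K₁ K'' => splitSum K'' fun K₂ K₃ =>
    ((f.deg + g.deg) * (sdeg K + (a.deg - 1) + sdeg K₁)).negOnePow •
      ins g (fun X => Γ K a (K₁ ++ f.ent X :: K₃)) K₂

/-- Insertions of `f` and, further right, of `g`, to the right of the mark. -/
noncomputable def insRinsR (f g : Cochain A) (Γ : Marked A N) : Marked A N := fun K a K' =>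
  splitSum K' fun K₁ L => splitSum L fun K₂ K₃ =>
    ((f.deg + g.deg) * (sdeg K + (a.deg - 1) + sdeg K₁) + (g.deg - 1) * sdeg K₂).negOnePow •
      ins g (fun X => Γ K a (K₁ ++ f.ent K₂ :: X)) K₃

theorem insR_insR (f g : Cochain A) (Γ : Marked A N) (K : List (Elt A)) (a : Elt A)
    (K' : List (Elt A)) : insR g (insR f Γ) K a K' = insRR f g Γ K a K' +
      insRinsR f g Γ K a K' +
      ((f.deg - 1) * (g.deg - 1)).negOnePow • insRinsR g f Γ K a K' := by
  simp only [insR, insRR, insRinsR, ins, splitSum_append_cons, splitSum_add, smul_add,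
    splitSum_units_smul]
  simp only [splitSum_first, splitSum_nest, smul_smul, ← Int.negOnePow_add, List.append_assoc,
    List.cons_append]
  rw [add_comm (splitSum K' _) (splitSum K' _)]
  congr 1
  · congr 1
    · refine splitSum_congr fun _ _ hK => splitSum_congr fun _ _ _ => splitSum_congr fun _ _ _ =>
        splitSum_congr fun _ _ _ => sgn_smul_congr ?_ ?_
      · simp only [sdeg_append]; push_cast; grind
      · rfl
    · refine splitSum_congr fun _ _ hK => splitSum_congr fun _ _ _ => splitSum_congr fun _ _ _ =>
        splitSum_congr fun _ _ _ => sgn_smul_congr ?_ ?_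
      · simp only [sdeg_append]; push_cast; grind
      · rfl
  · refine splitSum_congr fun _ _ hK => splitSum_congr fun _ _ _ => splitSum_congr fun _ _ _ =>
      splitSum_congr fun _ _ _ => sgn_smul_congr ?_ ?_
    · simp only [sdeg_append, sdeg_cons, Cochain.ent_deg]; push_cast; grind
    · rfl

theorem insL_insR (f g : Cochain A) (Γ : Marked A N) (K : List (Elt A)) (a : Elt A)
    (K' : List (Elt A)) : insL f (insR g Γ) K a K' =
      ((f.deg - 1) * (g.deg - 1)).negOnePow • insR g (insL f Γ) K a K' := by
  simp only [insR, insL, ins, splitSum_units_smul]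
  rw [splitSum_comm_left]
  refine splitSum_congr fun _ _ _ => splitSum_congr fun _ _ _ => splitSum_congr fun _ _ hK =>
    splitSum_congr fun _ _ hK' => ?_
  simp only [smul_smul, ← Int.negOnePow_add]
  refine sgn_smul_congr ?_ ?_
  · rw [← hK, ← hK']; simp only [sdeg_append, sdeg_cons, Cochain.ent_deg]; push_cast; grind
  · rfl

end

section

variable {R : Type u} [CommRing R] {n : ℕ} {A : PDGA R n} {N : Type*} [AddCommGroup N]
  [Module R N] {M : Bimodule A}

section

variable {v w u : Fin (n + 1) → ℕ} {s : Perversity n} {H : Elt A → N}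
  {G : List (Elt A) → N}

theorem Slot.weaken (h : Slot (v + (ceil u).toFun) s H) (hv : Monotone v) (hu : Monotone u)
    (h0 : ∀ x : Elt A, ¬ (x.perv.toFun + (v + u) ≤ s.toFun) → H x = 0) : Slot (v + u) s H where
  out := h0
  add := h.add
  smul := h.smul
  nat p₁ p₂ i a h₁ h₂ := h.nat p₁ p₂ i a h₁ <| le_of_eq_of_le
    (by abel : _ = (ceil u).toFun + (p₂.toFun + v))
    (ceil_add_le hu (p₂.toFun_mono.add hv) (le_of_eq_of_le (by abel) h₂))

theorem IsMul.weaken (h : IsMul (w + (ceil u).toFun) s G) (hw : Monotone w) (hu : Monotone u)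
    (h0 : ∀ L, ¬ (pervSum L + (w + u) ≤ s.toFun) → G L = 0) : IsMul (w + u) s G where
  out := h0
  slot L L' := by
    refine (Slot.weaken (v := pervSum L + pervSum L' + w) (u := u) ?_ ?_ hu ?_).congr
      (by abel) fun _ => rfl
    · exact (h.slot L L').congr (by abel) fun _ => rfl
    · exact ((pervSum_mono L).add (pervSum_mono L')).add hw
    · exact fun x hx => h0 _ fun h' => hx (le_of_eq_of_le (by rw [pervSum_mid]; abel) h')

theorem IsMul.congr (h : IsMul w s G) {w' : Fin (n + 1) → ℕ} (e : w = w')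
    {G' : List (Elt A) → N} (e' : ∀ L, G' L = G L) : IsMul w' s G' := by
  obtain rfl : G' = G := funext e'
  exact e ▸ h

theorem IsMul.zero : IsMul w s fun _ : List (Elt A) => (0 : N) :=
  ⟨fun _ _ => rfl, fun _ _ => Slot.zero⟩

theorem IsMul.fun_add {G' : List (Elt A) → N} (h : IsMul w s G) (h' : IsMul w s G') :
    IsMul w s fun L => G L + G' L where
  out L hL := by rw [h.out L hL, h'.out L hL, add_zero]
  slot L L' := (h.slot L L').fun_add (h'.slot L L')

theorem IsMul.fun_sign (h : IsMul w s G) (φ : ℤ → ℤ) :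
    IsMul w s fun L => (φ (sdeg L)).negOnePow • G L where
  out L hL := by rw [h.out L hL, smul_zero]
  slot L L' := ((h.slot L L').fun_sign fun d => φ (sdeg L + sdeg L' + (d - 1))).congr rfl
    fun x => by rw [sdeg_mid]

theorem IsMul.fun_sum {ι : Type*} (S : Finset ι) {G : ι → List (Elt A) → N}
    (h : ∀ i ∈ S, IsMul w s (G i)) : IsMul w s fun L => ∑ i ∈ S, G i L where
  out L hL := Finset.sum_eq_zero fun i hi => (h i hi).out L hL
  slot L L' := Slot.fun_sum S fun i hi => (h i hi).slot L L'

theorem IsMul.fun_splitSum (K : List (Elt A))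
    {G : List (Elt A) → List (Elt A) → List (Elt A) → N}
    (h : ∀ K₁ K₂, K₁ ++ K₂ = K → IsMul w s (G K₁ K₂)) :
    IsMul w s fun L => splitSum K fun K₁ K₂ => G K₁ K₂ L :=
  fun_sum _ fun _ _ => h _ _ (List.take_append_drop _ _)

theorem IsMul.splitSum {F : List (Elt A) → List (Elt A) → N}
    (h₁ : ∀ K, IsMul (pervSum K + w) s fun L => F L K)
    (h₂ : ∀ K, IsMul (pervSum K + w) s fun L => F K L) :
    IsMul w s fun L => PerverseHochschild.splitSum L F where
  out L hL := splitSum_eq_zero fun L₁ L₂ h => (h₁ L₂).out L₁ fun h' => hL <| by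
    rw [← h, pervSum_append]; exact le_of_eq_of_le (by abel) h'
  slot L L' := by
    simp only [splitSum_append_cons]
    refine Slot.fun_add (Slot.fun_splitSum _ fun L₁ L₂ h => ?_)
      (Slot.fun_splitSum _ fun L₁ L₂ h => ?_)
    · exact ((h₂ L₁).slot L₂ L').congr (by rw [← h, pervSum_append]; abel) fun _ => rfl
    · exact ((h₁ L₂).slot L L₁).congr (by rw [← h, pervSum_append]; abel) fun _ => rfl

/-- Multilinear natural functions of a list with a marked entry. -/
structure Marked.IsMul (w : Fin (n + 1) → ℕ) (s : Perversity n) (Γ : Marked A N) : Prop where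
  left : ∀ a K', PerverseHochschild.IsMul (a.perv.toFun + pervSum K' + w) s fun K => Γ K a K'
  mid : ∀ K K', Slot (pervSum K + pervSum K' + w) s fun a => Γ K a K'
  right : ∀ K a, PerverseHochschild.IsMul (pervSum K + a.perv.toFun + w) s fun K' => Γ K a K'

theorem IsMul.mark (h : IsMul w s G) : Marked.IsMul w s (mark G) where
  left a K' :=
    { out := fun K hK => h.out _ fun h' => hK (le_of_eq_of_le (by rw [pervSum_mid]; abel) h')
      slot := fun L L' => (h.slot L (L' ++ a :: K')).congr (by rw [pervSum_mid]; abel)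
        fun x => by rw [PerverseHochschild.mark, List.append_assoc, List.cons_append] }
  mid K K' := h.slot K K'
  right K a :=
    { out := fun K' hK => h.out _ fun h' => hK (le_of_eq_of_le (by rw [pervSum_mid]; abel) h')
      slot := fun L L' => (h.slot (K ++ a :: L) L').congr (by rw [pervSum_mid]; abel)
        fun x => by rw [PerverseHochschild.mark, List.append_assoc, List.cons_append] }

theorem Marked.IsMul.out {Γ : Marked A N} (h : Γ.IsMul w s) {K K' : List (Elt A)} {a : Elt A}
    (h' : ¬ (pervSum K + a.perv.toFun + pervSum K' + w ≤ s.toFun)) : Γ K a K' = 0 :=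
  (h.mid K K').out a fun h'' => h' (le_of_eq_of_le (by abel) h'')

/-- Insertion of `c` at the mark. -/
noncomputable def star (Γ : Marked A N) (c : Cochain A) (L : List (Elt A)) : N :=
  splitSum L fun L₁ L' => splitSum L' fun L₂ L₃ =>
    ((c.deg - 1) * sdeg L₁).negOnePow • Γ L₁ (c.ent L₂) L₃

theorem star_mark (G : List (Elt A) → N) (c : Cochain A) (L : List (Elt A)) :
    star (mark G) c L = ins c G L := rfl

theorem insR_eq_ins (f : Cochain A) (Γ : Marked A N) (K : List (Elt A)) (a : Elt A)
    (K' : List (Elt A)) : insR f Γ K a K' =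
      ((f.deg - 1) * (sdeg K + (a.deg - 1))).negOnePow • ins f (Γ K a) K' := by
  simp only [insR, ins, splitSum_units_smul, smul_smul, ← Int.negOnePow_add, mul_add]

theorem Marked.IsMul.slot_ent {Γ : Marked A N} (h : Γ.IsMul w s) (hw : Monotone w)
    (c : Cochain A) (K K' : List (Elt A)) :
    PerverseHochschild.IsMul (pervSum K + pervSum K' + (c.w + w)) s
      fun L => Γ K (c.ent L) K' :=
  ((h.mid K K').isMul_ent c.fam
    (((pervSum_mono K).add (pervSum_mono K')).add hw) c.mono).congr (by abel) fun _ => rfl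

theorem Marked.IsMul.star {Γ : Marked A N} (h : Γ.IsMul w s) (hw : Monotone w) (c : Cochain A) :
    PerverseHochschild.IsMul (c.w + w) s (star Γ c) := by
  have out {L₁ L₂ L₃ : List (Elt A)}
      (hL : ¬ (pervSum L₁ + pervSum L₂ + pervSum L₃ + (c.w + w) ≤ s.toFun)) :
      Γ L₁ (c.ent L₂) L₃ = 0 :=
    (h.slot_ent hw c L₁ L₃).out L₂ fun h' => hL (le_of_eq_of_le (by abel) h')
  refine IsMul.splitSum (fun K => ?_) fun K => ?_
  · refine IsMul.fun_splitSum K fun K₁ K₂ hK => IsMul.fun_sign (G := fun L => Γ L (c.ent K₁) K₂)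
      ?_ fun d => (c.deg - 1) * d
    refine (IsMul.weaken (w := pervSum K₂ + w) (u := pervSum K₁ + c.w) ?_
      ((pervSum_mono K₂).add hw) ((pervSum_mono K₁).add c.mono) ?_).congr ?_ fun _ => rfl
    · exact (h.left (c.ent K₁) K₂).congr (by rw [Cochain.ent_perv]; abel) fun _ => rfl
    · exact fun L hL => out fun h' => hL (le_of_eq_of_le (by abel) h')
    · rw [← hK, pervSum_append]; abel
  · refine IsMul.splitSum (fun K' => ?_) fun K' => ?_
    · exact ((h.slot_ent hw c K K').fun_sign fun _ => (c.deg - 1) * sdeg K).congr (by abel)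
        fun _ => rfl
    · refine ((IsMul.weaken (w := pervSum K + w) (u := pervSum K' + c.w)
        (G := fun L => Γ K (c.ent K') L) ?_
        ((pervSum_mono K).add hw) ((pervSum_mono K').add c.mono) ?_).fun_sign
          fun _ => (c.deg - 1) * sdeg K).congr (by abel) fun _ => rfl
      · exact (h.right K (c.ent K')).congr (by rw [Cochain.ent_perv]; abel) fun _ => rfl
      · exact fun L hL => out fun h' => hL (le_of_eq_of_le (by abel) h')

theorem IsMul.ins (h : IsMul w s G) (hw : Monotone w) (f : Cochain A) :
    IsMul (f.w + w) s (ins f G) := h.mark.star hw f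

theorem Marked.IsMul.insR {Γ : Marked A N} (h : Γ.IsMul w s) (hw : Monotone w) (f : Cochain A) :
    Marked.IsMul (f.w + w) s (insR f Γ) := by
  have out {K K' : List (Elt A)} {a : Elt A} {K₁ K₂ K₃ : List (Elt A)}
      (hK' : K₁ ++ (K₂ ++ K₃) = K')
      (hL : ¬ (pervSum K + a.perv.toFun + pervSum K' + (f.w + w) ≤ s.toFun)) :
      Γ K a (K₁ ++ f.ent K₂ :: K₃) = 0 := by
    refine ((h.right K a).slot K₁ K₃).ent_eq_zero f.fam fun h' => hL (le_of_eq_of_le ?_ h')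
    rw [← hK']; simp only [pervSum_append]; abel
  refine ⟨fun a K' => ?_, fun K K' => ?_, fun K a => ?_⟩
  · refine IsMul.fun_splitSum K' fun K₁ K'' h₁ => IsMul.fun_splitSum K'' fun K₂ K₃ h₂ =>
      IsMul.fun_sign (G := fun L => Γ L a (K₁ ++ f.ent K₂ :: K₃)) ?_
        fun d => (f.deg - 1) * (d + (a.deg - 1) + sdeg K₁)
    refine (IsMul.weaken (w := a.perv.toFun + pervSum K₁ + pervSum K₃ + w)
      (u := pervSum K₂ + f.w) ?_ ?_ ((pervSum_mono K₂).add f.mono) ?_).congr ?_ fun _ => rfl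
    · exact (h.left a _).congr (by rw [pervSum_mid, Cochain.ent_perv]; abel) fun _ => rfl
    · exact ((a.perv.toFun_mono.add (pervSum_mono _)).add (pervSum_mono _)).add hw
    · refine fun L hL => out (by rw [h₂, h₁]) fun h' => hL (le_of_eq_of_le ?_ h')
      rw [← h₁, ← h₂]; simp only [pervSum_append]; abel
    · rw [← h₁, ← h₂]; simp only [pervSum_append]; abel
  · refine Slot.fun_splitSum K' fun K₁ K'' h₁ => Slot.fun_splitSum K'' fun K₂ K₃ h₂ =>
      Slot.fun_sign (H := fun a => Γ K a (K₁ ++ f.ent K₂ :: K₃)) ?_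
        fun d => (f.deg - 1) * (sdeg K + (d - 1) + sdeg K₁)
    refine (Slot.weaken (v := pervSum K + pervSum K₁ + pervSum K₃ + w)
      (u := pervSum K₂ + f.w) ?_ ?_ ((pervSum_mono K₂).add f.mono) ?_).congr ?_ fun _ => rfl
    · exact (h.mid K _).congr (by rw [pervSum_mid, Cochain.ent_perv]; abel) fun _ => rfl
    · exact (((pervSum_mono _).add (pervSum_mono _)).add (pervSum_mono _)).add hw
    · refine fun x hx => out (by rw [h₂, h₁]) fun h' => hx (le_of_eq_of_le ?_ h')
      rw [← h₁, ← h₂]; simp only [pervSum_append]; abel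
    · rw [← h₁, ← h₂]; simp only [pervSum_append]; abel
  · exact (((h.right K a).ins (((pervSum_mono K).add a.perv.toFun_mono).add hw) f).fun_sign
      fun _ => (f.deg - 1) * (sdeg K + (a.deg - 1))).congr (by abel)
      fun L => insR_eq_ins f Γ K a L

end

/-! ### Composition -/

section Comp

variable {v w : Fin (n + 1) → ℕ} {s : Perversity n} {H : Elt A → N}

theorem pervSum_ent_le {f : Cochain A} (L₁ L₂ L₃ : List (Elt A)) (hw : Monotone w)
    (h : pervSum (L₁ ++ (L₂ ++ L₃)) + (f.w + w) ≤ s.toFun) :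
    pervSum (L₁ ++ f.ent L₂ :: L₃) + w ≤ s.toFun := by
  rw [pervSum_mid, Cochain.ent_perv]
  refine le_of_eq_of_le (by abel : _ = (ceil (pervSum L₂ + f.w)).toFun +
    (pervSum L₁ + pervSum L₃ + w)) (ceil_add_le ((pervSum_mono _).add f.mono)
      (((pervSum_mono _).add (pervSum_mono _)).add hw) (le_of_eq_of_le ?_ h))
  simp only [pervSum_append]; abel

theorem sdeg_ent (f : Cochain A) (L₁ L₂ L₃ : List (Elt A)) :
    sdeg (L₁ ++ f.ent L₂ :: L₃) = sdeg (L₁ ++ (L₂ ++ L₃)) + (f.deg - 1) := by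
  simp only [sdeg_append, sdeg_cons, Cochain.ent_deg]; abel

theorem Fam.ins {C : PerverseComplex R n} {q : ℤ} {f : List (Elt A) → ∀ s t, C.X s t}
    (hf : Fam C w q f) (hw : Monotone w) (g : Cochain A) :
    Fam C (g.w + w) (q + g.deg - 1) fun L s t => ins g (fun K => f K s t) L where
  shape L s t h := splitSum_eq_zero fun L₁ L' h₁ => splitSum_eq_zero fun L₂ L₃ h₂ => by
    refine (congrArg _ (hf.shape _ _ _ fun h' => h ?_)).trans (smul_zero _)
    rw [← h₁, ← h₂, ← h', sdeg_ent]; abel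
  mul s t := (hf.mul s t).ins hw g
  nat L s s' t h h' := by
    simp only [PerverseHochschild.ins, map_splitSum]
    refine splitSum_congr fun L₁ L' h₁ => splitSum_congr fun L₂ L₃ h₂ => ?_
    rw [Units.smul_def, map_zsmul, hf.nat _ _ _ _ (pervSum_ent_le L₁ L₂ L₃ hw ?_) h']; rfl
    rw [h₂, h₁]; exact h

/-- The composition `f ∘ g`. -/
noncomputable def Cochain.circ (f g : Cochain A) : Cochain A where
  w := g.w + f.w
  mono := g.mono.add f.mono
  deg := f.deg + g.deg - 1
  val L s t := ins g (fun K => f.val K s t) L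
  fam := f.fam.ins f.mono g

theorem Slot.isMul_cochain (h : Slot v s H) (hv : Monotone v) (f : Cochain A) :
    IsMul (f.w + v) s fun L => H (f.ent L) := h.isMul_ent f.fam hv f.mono

theorem map_ins {N' : Type*} [AddCommGroup N'] [Module R N'] (φ : N →ₗ[R] N') (g : Cochain A)
    (G : List (Elt A) → N) (L : List (Elt A)) :
    φ (ins g G L) = ins g (fun K => φ (G K)) L := by
  simp only [ins, map_splitSum, Units.smul_def, map_zsmul]

/-- In the range, insertion into `f` can be computed at any sufficiently large perversity. -/
theorem PSlot.ins_ent {C : PerverseComplex R n} {H : ∀ p i, C.X p i → N} (h : PSlot C v s H)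
    {q : ℤ} {f : List (Elt A) → ∀ s t, C.X s t} (hf : Fam C w q f) (hw : Monotone w)
    (g : Cochain A) {K : List (Elt A)}
    {c : Perversity n} {t : ℤ} (h₁ : pervSum K + (g.w + w) ≤ c.toFun)
    (h₂ : c.toFun + v ≤ s.toFun) (ht : sdeg K + (q + g.deg - 1) = t) :
    ins g (pval w q f H) K = H c t (ins g (fun L => f L c t) K) := by
  change _ = h.lin c t (ins g (fun L => f L c t) K)
  rw [map_ins]
  simp only [ins]
  refine splitSum_congr fun L₁ L' e₁ => splitSum_congr fun L₂ L₃ e₂ => ?_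
  refine congrArg _ (h.ent_eq hf (pervSum_ent_le L₁ L₂ L₃ hw ?_) h₂ ?_)
  · rw [e₂, e₁]; exact h₁
  · rw [sdeg_ent, e₂, e₁, ← ht]; abel

theorem Slot.ins_ent (h : Slot v s H) (f g : Cochain A) {K : List (Elt A)}
    {c : Perversity n} {t : ℤ} (h₁ : pervSum K + (g.w + f.w) ≤ c.toFun)
    (h₂ : c.toFun + v ≤ s.toFun) (ht : sdeg K + (f.deg + g.deg - 1) = t) :
    ins g (fun L => H (f.ent L)) K = H ⟨c, t, ins g (fun L => f.val L c t) K⟩ :=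
  h.pslot.ins_ent f.fam f.mono g h₁ h₂ ht

theorem Slot.circ_ent (h : Slot v s H) (hv : Monotone v) (f g : Cochain A) (K : List (Elt A)) :
    H ((f.circ g).ent K) = ins g (fun L => H (f.ent L)) K := by
  by_cases hK : pervSum K + (g.w + f.w) + v ≤ s.toFun
  · have h₁ : pervSum K + (g.w + f.w) ≤ s.toFun :=
      le_trans (le_add_of_nonneg_right fun _ => Nat.zero_le _) hK
    rw [h.ins_ent f g (c := ceil (pervSum K + (g.w + f.w))) (le_ceil h₁)
      (ceil_add_le ((pervSum_mono K).add (g.mono.add f.mono)) hv hK) rfl]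
    rfl
  · rw [((h.isMul_cochain hv f).ins (f.mono.add hv) g).out K fun h' => hK
      (le_of_eq_of_le (by abel) h')]
    exact h.ent_eq_zero (f.circ g).fam hK

/-- `h` vanishes on the entries of `f` if `f` is zero. -/
theorem Slot.ent_of_eq (h : Slot v s H) (hv : Monotone v) {f g f' g' : Cochain A} (ε : ℤˣ)
    (hw : g.w + f.w = g'.w + f'.w) (hd : f.deg + g.deg = f'.deg + g'.deg)
    (e : ∀ K s t, ins g (fun L => f.val L s t) K = ε • ins g' (fun L => f'.val L s t) K)
    (K : List (Elt A)) :
    ins g (fun L => H (f.ent L)) K = ε • ins g' (fun L => H (f'.ent L)) K := by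
  by_cases hK : pervSum K + (g.w + f.w) + v ≤ s.toFun
  · have h₁ : pervSum K + (g.w + f.w) ≤ s.toFun :=
      le_trans (le_add_of_nonneg_right fun _ => Nat.zero_le _) hK
    have h₂ := ceil_add_le ((pervSum_mono K).add (g.mono.add f.mono)) hv hK
    rw [h.ins_ent f g (le_ceil h₁) h₂ rfl,
      h.ins_ent f' g' (c := ceil (pervSum K + (g.w + f.w))) (t := sdeg K + (f.deg + g.deg - 1))
        (by rw [← hw]; exact le_ceil h₁) h₂ (by rw [hd]), e, h.map_units_smul]
  · rw [((h.isMul_cochain hv f).ins (f.mono.add hv) g).out K fun h' => hK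
        (le_of_eq_of_le (by abel) h'),
      ((h.isMul_cochain hv f').ins (f'.mono.add hv) g').out K fun h' => hK
        (le_of_eq_of_le (by rw [hw]; abel) h'), smul_zero]

end Comp

/-- The product of two entries in `A_s^t`. -/
def Elt.pmul (a b : Elt A) (s : Perversity n) (t : ℤ) : A.X s t :=
  A.mul a.perv b.perv s a.deg b.deg t a.val b.val

theorem slot_pmul_left (b : Elt A) (s : Perversity n) (t : ℤ) :
    Slot b.perv.toFun s fun a => a.pmul b s t where
  out x hx := by
    rw [Elt.pmul, A.mul_shape fun h => hx h.1]; rfl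
  add p i a b := by simp [Elt.pmul]
  smul p i c a := by simp [Elt.pmul]
  nat p₁ p₂ i a h₁ h₂ := by
    have := A.mul_map_map h₁ (le_refl b.perv) h₂ i b.deg t a b.val
    rwa [A.map_self] at this

theorem slot_pmul_right (a : Elt A) (s : Perversity n) (t : ℤ) :
    Slot a.perv.toFun s fun b => a.pmul b s t where
  out x hx := by
    rw [Elt.pmul, A.mul_shape fun h => hx (le_of_eq_of_le (add_comm _ _) h.1)]; rfl
  add p i a b := by simp [Elt.pmul]
  smul p i c a := by simp [Elt.pmul]
  nat p₁ p₂ i b h₁ h₂ := by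
    have := A.mul_map_map (le_refl a.perv) h₁ (le_of_eq_of_le (add_comm _ _) h₂) a.deg i t a.val b
    rwa [A.map_self] at this

theorem Elt.map_pmul (a b : Elt A) {s s' : Perversity n} (t : ℤ)
    (h : AddLE a.perv b.perv s) (h' : s ≤ s') : A.map s s' t (a.pmul b s t) = a.pmul b s' t :=
  A.map_mul h h' _ _ _ _ _

theorem Elt.d_ev (x : Elt A) (s : Perversity n) (t : ℤ) :
    x.d.ev s t = A.d s (t - 1) t (x.ev s (t - 1)) := by
  obtain ⟨t, rfl⟩ : ∃ t', t = t' + 1 := ⟨t - 1, by ring⟩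
  rw [add_sub_cancel_right]
  by_cases hd : x.deg = t
  · subst hd
    by_cases hp : x.perv ≤ s
    · simp only [Elt.ev, A.cast_self]
      exact (A.cast_self _ _ _).trans (A.map_d hp _ _ _)
    · rw [x.ev_of_not_le s _ hp, x.d.ev_of_not_le s _ hp, map_zero]
  · rw [x.ev_of_ne s hd, x.d.ev_of_ne s, map_zero]
    simp only [Elt.d]; omega

theorem slot_d_ev (s : Perversity n) (t : ℤ) : Slot 0 s fun x : Elt A => x.d.ev s t :=
  ((slot_ev s (t - 1)).comp_lin (A.d s (t - 1) t)).congr rfl fun x => x.d_ev s t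

/-- The differential and the product as a cochain of degree `2`. -/
def mVal : List (Elt A) → ∀ s t, A.X s t
  | [a], s, t => a.d.ev s t
  | [a, b], s, t => a.deg.negOnePow • a.pmul b s t
  | _, _, _ => 0

theorem mVal_eq_zero {L : List (Elt A)} (h : 3 ≤ L.length) (s : Perversity n) (t : ℤ) :
    mVal L s t = 0 := by
  match L, h with
  | _ :: _ :: _ :: _, _ => rfl

theorem mVal_isMul (s : Perversity n) (t : ℤ) : IsMul 0 s fun L : List (Elt A) => mVal L s t where
  out L hL := by
    match L with
    | [] => rfl
    | [a] => exact (slot_d_ev s t).out a fun h => hL <| by simpa [pervSum_cons, pervSum_nil] using h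
    | [a, b] =>
      have : a.pmul b s t = 0 := (slot_pmul_left b s t).out a fun h => hL <| by
        simpa [pervSum_cons, pervSum_nil] using h
      simp [mVal, this]
    | _ :: _ :: _ :: _ => rfl
  slot L L' := by
    match L, L' with
    | [], [] =>
      refine (slot_d_ev s t).congr ?_ fun _ => rfl
      simp [pervSum_nil]
    | [], [b] =>
      refine ((slot_pmul_left b s t).fun_sign id).congr ?_ fun _ => rfl
      simp [pervSum_nil, pervSum_cons]
    | [a], [] =>
      refine ((slot_pmul_right a s t).fun_sign fun _ => a.deg).congr ?_ fun _ => rfl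
      simp [pervSum_nil, pervSum_cons]
    | _ :: _ :: _, _ =>
      exact Slot.zero.congr rfl fun x => mVal_eq_zero (by simp; omega) s t
    | [_], _ :: _ => exact Slot.zero.congr rfl fun x => mVal_eq_zero (by simp) s t
    | [], _ :: _ :: _ => exact Slot.zero.congr rfl fun x => mVal_eq_zero (by simp) s t

/-- The differential and the product as a cochain of degree `2`. -/
def mC (A : PDGA R n) : Cochain A where
  w := 0
  mono := fun _ _ _ => le_rfl
  deg := 2
  val := mVal
  fam :=
    { shape := fun L s t h => by
        match L with
        | [] => rfl
        | [a] =>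
          refine Elt.ev_of_ne _ s fun h' => h ?_
          simp only [Elt.d] at h'
          simp only [sdeg_cons, sdeg_nil]; omega
        | [a, b] =>
          simp only [mVal, Elt.pmul]
          rw [A.mul_shape fun h' => h ?_]
          · simp
          · simp only [sdeg_cons, sdeg_nil]; omega
        | _ :: _ :: _ :: _ => rfl
      mul := mVal_isMul
      nat := fun L s s' t h h' => by
        match L with
        | [] => exact map_zero _
        | [a] => exact a.d.map_ev t (by
            simp only [pervSum_cons, pervSum_nil, add_zero] at h; exact h) h'
        | [a, b] =>
          simp only [mVal, Units.smul_def, map_zsmul]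
          rw [a.map_pmul b t (by
            simp only [pervSum_cons, pervSum_nil, add_zero] at h; exact h) h']
        | _ :: _ :: _ :: _ => exact map_zero _ }

section

variable {v : Fin (n + 1) → ℕ} {s : Perversity n} {H : Elt A → N}

theorem Slot.mC_one (h : Slot v s H) (a : Elt A) : H ((mC A).ent [a]) = H a.d := by
  by_cases ha : a.perv.toFun + v ≤ s.toFun
  · refine (h.ent_eq (mC A).fam (c := a.perv) (t := a.deg + 1) ?_ ha ?_).trans ?_
    · exact le_of_eq (by simp [pervSum_cons, pervSum_nil, mC])
    · simp only [sdeg_cons, sdeg_nil, mC]; omega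
    · change H ⟨a.d.perv, a.d.deg, a.d.ev a.d.perv a.d.deg⟩ = H a.d
      rw [Elt.ev_self]
  · rw [h.out a.d ha]
    exact h.ent_eq_zero (mC A).fam fun h' => ha (by simpa [pervSum_cons, pervSum_nil, mC] using h')

theorem Slot.mC_two (h : Slot v s H) (hv : Monotone v) (a b : Elt A) :
    H ((mC A).ent [a, b]) = a.deg.negOnePow • H (a.mul b) := by
  have e : pervSum [a, b] = a.perv.toFun + b.perv.toFun := by simp [pervSum_cons, pervSum_nil]
  by_cases ha : a.perv.toFun + b.perv.toFun + v ≤ s.toFun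
  · have hs : a.perv.toFun + b.perv.toFun ≤ s.toFun :=
      le_trans (le_add_of_nonneg_right fun _ => Nat.zero_le _) ha
    rw [← h.map_units_smul]
    refine (h.ent_eq (mC A).fam (c := (a.mul b).perv) (t := a.deg + b.deg) ?_ ?_ ?_).trans ?_
    · rw [e]; exact le_ceil hs
    · exact ceil_add_le (a.perv.toFun_mono.add b.perv.toFun_mono) hv ha
    · simp only [sdeg_cons, sdeg_nil, mC]; omega
    · rfl
  · have h0 : H (a.mul b) = 0 := by
      by_cases h₁ : a.perv.toFun + b.perv.toFun ≤ (a.mul b).perv.toFun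
      · exact h.out _ fun h₂ => ha (le_trans (add_le_add_left h₁ _) h₂)
      · have h₀ := A.mul_shape (i := a.deg) (j := b.deg) (k := a.deg + b.deg) fun h' => h₁ h'.1
        have : (a.mul b).val = 0 := LinearMap.congr_fun₂ h₀ a.val b.val
        have h₂ := h.map_zero (a.mul b).perv (a.mul b).deg
        rwa [← this] at h₂
    rw [h0, smul_zero]
    exact h.ent_eq_zero (mC A).fam fun h' => ha (le_of_eq_of_le (by rw [e]; simp [mC]) h')

theorem Slot.mC_three (h : Slot v s H) {L : List (Elt A)} (hL : 3 ≤ L.length) :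
    H ((mC A).ent L) = 0 := by
  have : (mC A).val L = 0 := by funext s t; exact mVal_eq_zero hL s t
  simp only [Cochain.ent, ent, this]
  exact h.map_zero _ _

theorem Slot.mC_nil (h : Slot v s H) : H ((mC A).ent []) = 0 := h.map_zero _ _

end

/-! ### Closed cochains -/

/-- `D f = 0`, where `D f = m ∘ f - (-1)^{|f| - 1} f ∘ m`. -/
def Closed (f : Cochain A) : Prop := ∀ K s t, ins f (fun L => mVal L s t) K =
  (f.deg - 1).negOnePow • ins (mC A) (fun L => f.val L s t) K

/-- The terms of `D` which act on the arguments. -/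
noncomputable def dMark (Γ : Marked A N) : Marked A N := fun K a K' =>
  sub (mC A) Γ K a K' + insR (mC A) Γ K a K' + insL (mC A) Γ K a K'

theorem dMark_mark (G : List (Elt A) → N) : dMark (mark G) = mark (ins (mC A) G) := by
  funext K a K'; exact (mark_ins _ _ _ _ _).symm

theorem insR_add (f : Cochain A) (Γ Γ' : Marked A N) (K : List (Elt A)) (a : Elt A)
    (K' : List (Elt A)) : insR f (fun K a K' => Γ K a K' + Γ' K a K') K a K' =
      insR f Γ K a K' + insR f Γ' K a K' := by
  simp only [insR, splitSum_add, smul_add]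

theorem insR_units_smul (f : Cochain A) (ε : ℤˣ) (Γ : Marked A N) (K : List (Elt A)) (a : Elt A)
    (K' : List (Elt A)) : insR f (fun K a K' => ε • Γ K a K') K a K' =
      ε • insR f Γ K a K' := by
  simp only [insR, splitSum_units_smul, smul_comm ε]

section

variable {v w : Fin (n + 1) → ℕ} {s : Perversity n} {H : Elt A → N}

theorem Closed.slot {f : Cochain A} (hf : Closed f) (h : Slot v s H) (hv : Monotone v)
    (K : List (Elt A)) : ins f (fun L => H ((mC A).ent L)) K =
      (f.deg - 1).negOnePow • ins (mC A) (fun L => H (f.ent L)) K :=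
  h.ent_of_eq (f := mC A) (g := f) (f' := f) (g' := mC A) hv _ (add_comm _ _) (add_comm _ _) hf K

theorem Closed.insRR_mC {g : Cochain A} (hg : Closed g) {Γ : Marked A N} (h : Γ.IsMul w s)
    (hw : Monotone w) (K : List (Elt A)) (a : Elt A) (K' : List (Elt A)) :
    insRR g (mC A) Γ K a K' = (g.deg - 1).negOnePow • insRR (mC A) g Γ K a K' := by
  simp only [insRR, splitSum_units_smul]
  refine splitSum_congr fun K₁ K'' _ => splitSum_congr fun K₂ K₃ _ => ?_
  rw [hg.slot ((h.right K a).slot K₁ K₃) (((pervSum_mono _).add (pervSum_mono _)).add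
    (((pervSum_mono _).add a.perv.toFun_mono).add hw)), smul_comm, add_comm g.deg]
  rw [smul_smul (g.deg - 1).negOnePow, ← Int.negOnePow_add, Int.negOnePow_even _ ⟨_, rfl⟩,
    one_smul]

theorem Closed.insR_mC {g : Cochain A} (hg : Closed g) {Γ : Marked A N} (h : Γ.IsMul w s)
    (hw : Monotone w) (K : List (Elt A)) (a : Elt A) (K' : List (Elt A)) :
    insR (mC A) (insR g Γ) K a K' = (g.deg - 1).negOnePow • insR g (insR (mC A) Γ) K a K' := by
  rw [insR_insR, insR_insR, hg.insRR_mC h hw, smul_add, smul_add, smul_smul, ← Int.negOnePow_add]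
  have e1 : ((g.deg - 1) * ((mC A).deg - 1)).negOnePow = (g.deg - 1).negOnePow := by
    simp [mC]
  have e2 : (g.deg - 1 + ((mC A).deg - 1) * (g.deg - 1)).negOnePow = 1 :=
    Int.negOnePow_even _ ⟨g.deg - 1, by simp only [mC]; ring⟩
  rw [e1, e2, one_smul]
  abel

/-- Compatibility of `D` with insertion of a cocycle. -/
theorem Closed.dMark_insR {g : Cochain A} (hg : Closed g) {Γ : Marked A N} (h : Γ.IsMul w s)
    (hw : Monotone w) (K : List (Elt A)) (a : Elt A) (K' : List (Elt A)) :
    dMark (insR g Γ) K a K' = (g.deg - 1).negOnePow •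
      (insR g (dMark Γ) K a K' - subR (mC A) g Γ K a K') := by
  unfold dMark
  rw [insR_add, insR_add, insR_sub, hg.insR_mC h hw, insL_insR]
  have e1 : (((mC A).deg - 1) * (g.deg - 1)).negOnePow = (g.deg - 1).negOnePow := by
    simp [mC]
  rw [e1]
  simp only [smul_add, smul_sub, smul_smul, ← Int.negOnePow_add,
    Int.negOnePow_even (g.deg - 1 + (g.deg - 1)) ⟨_, rfl⟩, one_smul]
  abel

/-- The differential of `f` with `g` inserted to the right of the mark, for cocycles `f`, `g`. -/
theorem Closed.dMark_insR_mark {f g : Cochain A} (hf : Closed f) (hg : Closed g) (h : Slot v s H)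
    (hv : Monotone v) (K : List (Elt A)) (a : Elt A) (K' : List (Elt A)) :
    dMark (insR g (mark fun L => H (f.ent L))) K a K' =
      (f.deg + g.deg).negOnePow • (subR f g (mark fun L => H ((mC A).ent L)) K a K' +
        insRR f g (mark fun L => H ((mC A).ent L)) K a K' +
        ((f.deg - 1) * (g.deg - 1)).negOnePow •
          sub f (insR g (mark fun L => H ((mC A).ent L))) K a K') -
      (g.deg - 1).negOnePow • subR (mC A) g (mark fun L => H (f.ent L)) K a K' := by
  have hm := (h.isMul_cochain hv f).mark
  rw [hg.dMark_insR hm (f.mono.add hv), dMark_mark, smul_sub]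
  congr 1
  have e1 : mark (ins (mC A) fun L => H (f.ent L)) = fun K a K' => (f.deg - 1).negOnePow •
      mark (ins f fun L => H ((mC A).ent L)) K a K' := by
    funext K a K'
    simp only [mark]
    rw [hf.slot h hv, negOnePow_smul_smul]
  have e2 : mark (ins f fun L => H ((mC A).ent L)) = fun K a K' =>
      sub f (mark fun L => H ((mC A).ent L)) K a K' + insR f (mark fun L => H ((mC A).ent L)) K a K'
        + insL f (mark fun L => H ((mC A).ent L)) K a K' := by
    funext K a K'; exact mark_ins _ _ _ _ _
  rw [e1, insR_units_smul, e2, insR_add, insR_add, insR_sub, insR_insR, smul_smul,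
    ← Int.negOnePow_add]
  have e3 : insR g (insL f (mark fun L => H ((mC A).ent L))) K a K' = 0 := by
    refine splitSum_eq_zero fun _ _ _ => splitSum_eq_zero fun _ _ _ => ?_
    rw [insL, ins, splitSum_eq_zero, smul_zero]
    refine fun _ _ _ => splitSum_eq_zero fun _ _ _ => ?_
    rw [mark, h.mC_three (by simp; omega), smul_zero]
  have e4 (f g : Cochain A) : insRinsR f g (mark fun L => H ((mC A).ent L)) K a K' = 0 := by
    refine splitSum_eq_zero fun _ _ _ => splitSum_eq_zero fun _ _ _ => ?_
    rw [ins, splitSum_eq_zero, smul_zero]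
    refine fun _ _ _ => splitSum_eq_zero fun _ _ _ => ?_
    rw [mark, h.mC_three (by simp; omega), smul_zero]
  rw [e3, e4, e4, smul_zero, add_zero, add_zero, add_zero]
  rw [sgn_eq (x := g.deg - 1 + (f.deg - 1)) (y := f.deg + g.deg) (by push_cast; grind)]
  congr 1
  abel

end

theorem star_add (Γ Γ' : Marked A N) (c : Cochain A) (L : List (Elt A)) :
    star (fun K a K' => Γ K a K' + Γ' K a K') c L = star Γ c L + star Γ' c L := by
  simp only [star, splitSum_add, smul_add]

theorem star_units_smul (ε : ℤˣ) (Γ : Marked A N) (c : Cochain A) (L : List (Elt A)) :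
    star (fun K a K' => ε • Γ K a K') c L = ε • star Γ c L := by
  simp only [star, splitSum_units_smul, smul_comm ε]

theorem star_sub_fun (Γ Γ' : Marked A N) (c : Cochain A) (L : List (Elt A)) :
    star (fun K a K' => Γ K a K' - Γ' K a K') c L = star Γ c L - star Γ' c L := by
  simp only [star, splitSum_sub, smul_sub]

theorem star_congr {Γ Γ' : Marked A N} (c : Cochain A) (L : List (Elt A))
    (h : ∀ K a K', Γ K a K' = Γ' K a K') : star Γ c L = star Γ' c L := by
  obtain rfl : Γ = Γ' := by funext K a K'; exact h K a K'
  rfl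

section

variable {v w : Fin (n + 1) → ℕ} {s : Perversity n} {H : Elt A → N}

/-- `Γ ⋆ (f ∘ c) = (Γ • f) ⋆ c`. -/
theorem star_sub {Γ : Marked A N} (h : Γ.IsMul w s) (hw : Monotone w) (f c : Cochain A)
    (L : List (Elt A)) : star (sub f Γ) c L = star Γ (f.circ c) L := by
  simp only [star, sub, splitSum_units_smul, smul_smul, ← Int.negOnePow_add]
  have : ∀ K K' X, Γ K ((f.circ c).ent X) K' = ins c (fun Y => Γ K (f.ent Y) K') X :=
    fun K K' X => (h.mid K K').circ_ent
      (((pervSum_mono _).add (pervSum_mono _)).add hw) f c X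
  simp only [this, ins, splitSum_units_smul, smul_smul, ← Int.negOnePow_add]
  simp only [splitSum_first, splitSum_nest]
  refine splitSum_congr fun _ _ _ => splitSum_congr fun _ _ _ => splitSum_congr fun _ _ _ =>
    splitSum_congr fun _ _ _ => sgn_smul_congr ?_ ?_
  · simp only [sdeg_append, Cochain.circ]; push_cast; grind
  · rfl

/-- Insertion of `f` into `Γ ⋆ c`. -/
theorem ins_star {Γ : Marked A N} (h : Γ.IsMul w s) (hw : Monotone w) (f c : Cochain A)
    (L : List (Elt A)) : ins f (star Γ c) L = star Γ (c.circ f) L +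
      ((c.deg - 1) * (f.deg - 1)).negOnePow • (star (insR f Γ) c L + star (insL f Γ) c L) := by
  have : ∀ K K' X, Γ K ((c.circ f).ent X) K' = ins f (fun Y => Γ K (c.ent Y) K') X :=
    fun K K' X => (h.mid K K').circ_ent
      (((pervSum_mono _).add (pervSum_mono _)).add hw) c f X
  have key {a b c a' b' c' : N} (h₁ : a = a') (h₂ : b = b') (h₃ : c = c') :
      a + b + c = b' + (a' + c') := by rw [h₁, h₂, h₃]; abel
  simp only [ins, star, this, insR, insL, splitSum_append_cons, splitSum_add, smul_add,
    splitSum_units_smul, smul_smul, ← Int.negOnePow_add]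
  simp only [splitSum_first, splitSum_nest]
  refine key ?_ ?_ ?_ <;>
  · refine splitSum_congr fun _ _ _ => splitSum_congr fun _ _ _ => splitSum_congr fun _ _ _ =>
      splitSum_congr fun _ _ _ => sgn_smul_congr ?_ ?_
    · simp only [sdeg_append, sdeg_cons, Cochain.ent_deg, Cochain.circ]; push_cast; grind
    · simp only

theorem star_insR_comm (f g : Cochain A) (G : List (Elt A) → N) (L : List (Elt A)) :
    star (insL f (mark G)) g L =
      ((f.deg - 1) * (g.deg - 1)).negOnePow • star (insR g (mark G)) f L := by
  simp only [star, mark, ins, insR, insL,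
    splitSum_units_smul, smul_smul, ← Int.negOnePow_add]
  simp only [splitSum_first]
  refine splitSum_congr fun _ _ _ => splitSum_congr fun _ _ _ => splitSum_congr fun _ _ _ =>
    splitSum_congr fun _ _ _ => sgn_smul_congr ?_ ?_
  · simp only [sdeg_append, Cochain.ent_deg]; push_cast; grind
  · simp only [List.append_assoc, List.cons_append]

end

/-! ### Signs -/

/-- The sign with exponent in `ℤ/2`. -/
def sgn (a : ZMod 2) : ℤˣ := if a = 0 then 1 else -1

theorem negOnePow_eq_sgn (x : ℤ) : x.negOnePow = sgn x := by
  rcases Int.even_or_odd x with h | h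
  · rw [Int.negOnePow_even _ h, sgn, if_pos]
    exact (ZMod.intCast_zmod_eq_zero_iff_dvd x 2).2 h.two_dvd
  · rw [Int.negOnePow_odd _ h, sgn, if_neg]
    intro h'
    have := (ZMod.intCast_zmod_eq_zero_iff_dvd x 2).1 h'
    exact (Int.not_even_iff_odd.2 h) (even_iff_two_dvd.2 this)

theorem zmod_two_cases (a : ZMod 2) : a = 0 ∨ a = 1 := by revert a; decide

/-! ### Linear combinations of cochains -/

theorem Fam.fun_add {C : PerverseComplex R n} {w : Fin (n + 1) → ℕ} {q : ℤ}
    {f g : List (Elt A) → ∀ s t, C.X s t} (hf : Fam C w q f) (hg : Fam C w q g) :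
    Fam C w q fun L s t => f L s t + g L s t where
  shape L s t h := by rw [hf.shape L s t h, hg.shape L s t h, add_zero]
  mul s t := (hf.mul s t).fun_add (hg.mul s t)
  nat L s s' t h h' := by rw [map_add, hf.nat L s s' t h h', hg.nat L s s' t h h']

theorem IsMul.fun_units_smul {w : Fin (n + 1) → ℕ} {s : Perversity n} {G : List (Elt A) → N}
    (h : IsMul w s G) (ε : ℤˣ) : IsMul w s fun L => ε • G L where
  out L hL := by rw [h.out L hL, smul_zero]
  slot L L' :=
    { out := fun x hx => by rw [(h.slot L L').out x hx, smul_zero]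
      add := fun p i a b => by rw [(h.slot L L').add, smul_add]
      smul := fun p i c a => by rw [(h.slot L L').smul, smul_comm]
      nat := fun p₁ p₂ i a h₁ h₂ => by rw [(h.slot L L').nat _ _ _ _ h₁ h₂] }

theorem Fam.fun_units_smul {C : PerverseComplex R n} {w : Fin (n + 1) → ℕ} {q : ℤ}
    {f : List (Elt A) → ∀ s t, C.X s t} (hf : Fam C w q f) (ε : ℤˣ) :
    Fam C w q fun L s t => ε • f L s t where
  shape L s t h := by rw [hf.shape L s t h, smul_zero]
  mul s t := (hf.mul s t).fun_units_smul ε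
  nat L s s' t h h' := by rw [Units.smul_def, map_zsmul, hf.nat L s s' t h h']; rfl

theorem Fam.congr {C : PerverseComplex R n} {w w' : Fin (n + 1) → ℕ} {q q' : ℤ}
    {f : List (Elt A) → ∀ s t, C.X s t} (hf : Fam C w q f) (hw : w = w') (hq : q = q') :
    Fam C w' q' f := hw ▸ hq ▸ hf

/-- The cochain `f + ε g`. -/
noncomputable def Cochain.comb (f g : Cochain A) (hw : g.w = f.w) (hd : g.deg = f.deg)
    (ε : ℤˣ) : Cochain A where
  w := f.w
  mono := f.mono
  deg := f.deg
  val L s t := f.val L s t + ε • g.val L s t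
  fam := f.fam.fun_add ((g.fam.congr hw hd).fun_units_smul ε)

section

variable {v w : Fin (n + 1) → ℕ} {s : Perversity n} {H : Elt A → N}

theorem ent_of_range (H : Elt A → N) (f : Cochain A) {w' : Fin (n + 1) → ℕ}
    {q' : ℤ} (hw : f.w = w') (hq : f.deg = q') (L : List (Elt A)) :
    H (f.ent L) = H ⟨ceil (pervSum L + w'), sdeg L + q', f.val L _ _⟩ := by
  subst hw hq; rfl

theorem Slot.comb_ent (h : Slot v s H) {f g : Cochain A} (hw : g.w = f.w) (hd : g.deg = f.deg)
    (ε : ℤˣ) (L : List (Elt A)) :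
    H ((f.comb g hw hd ε).ent L) = H (f.ent L) + ε • H (g.ent L) := by
  rw [ent_of_range H g hw hd, ← h.map_units_smul]
  exact h.add _ _ _ _

theorem Slot.ent_congr (_h : Slot v s H) {f g : Cochain A} (hw : f.w = g.w) (hd : f.deg = g.deg)
    (e : ∀ L s t, f.val L s t = g.val L s t) (L : List (Elt A)) : H (f.ent L) = H (g.ent L) := by
  rw [ent_of_range H f hw hd, e]; rfl

theorem Slot.ent_smul (h : Slot v s H) {f g : Cochain A} (hw : f.w = g.w) (hd : f.deg = g.deg)
    (ε : ℤˣ) (e : ∀ L s t, f.val L s t = ε • g.val L s t) (L : List (Elt A)) :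
    H (f.ent L) = ε • H (g.ent L) := by
  rw [ent_of_range H f hw hd, e, h.map_units_smul]; rfl

theorem star_comb {Γ : Marked A N} (hΓ : Γ.IsMul w s) {f g : Cochain A} (hw : g.w = f.w)
    (hd : g.deg = f.deg) (ε : ℤˣ) (L : List (Elt A)) :
    star Γ (f.comb g hw hd ε) L = star Γ f L + ε • star Γ g L := by
  simp only [star, splitSum_units_smul, ← splitSum_add]
  refine splitSum_congr fun _ _ _ => splitSum_congr fun _ _ _ => ?_
  rw [(hΓ.mid _ _).comb_ent hw hd ε, smul_add, smul_comm ε, hd]; rfl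

theorem star_ent_smul {Γ : Marked A N} (hΓ : Γ.IsMul w s) {f g : Cochain A} (hw : f.w = g.w)
    (hd : f.deg = g.deg) (ε : ℤˣ) (e : ∀ L s t, f.val L s t = ε • g.val L s t)
    (L : List (Elt A)) : star Γ f L = ε • star Γ g L := by
  simp only [star, splitSum_units_smul]
  refine splitSum_congr fun _ _ _ => splitSum_congr fun _ _ _ => ?_
  rw [(hΓ.mid _ _).ent_smul hw hd ε e, smul_comm ε, hd]

theorem Cochain.ev_ent (f : Cochain A) (L : List (Elt A)) (s : Perversity n) (t : ℤ) :
    (f.ent L).ev s t = f.val L s t := by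
  by_cases ht : sdeg L + f.deg = t
  · by_cases hL : pervSum L + f.w ≤ s.toFun
    · refine ((slot_ev s t).ent_eq f.fam hL (by rw [add_zero]) ht).trans ?_
      rw [Elt.ev_mk, A.map_self]
    · rw [(f.fam.mul s t).out L hL]
      exact (slot_ev s t).ent_eq_zero f.fam (by rwa [add_zero])
  · rw [f.fam.shape _ _ _ ht]
    exact Elt.ev_of_ne _ s ht

end

/-! ### The differential and the bracket -/

/-- The differential `D f = m ∘ f - (-1)^{|f| - 1} f ∘ m`. -/
noncomputable def Cochain.D (f : Cochain A) : Cochain A :=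
  ((mC A).circ f).comb (f.circ (mC A)) (add_comm _ _) (by simp only [Cochain.circ]; ring)
    f.deg.negOnePow

theorem Cochain.D_val (f : Cochain A) (L : List (Elt A)) (s : Perversity n) (t : ℤ) :
    f.D.val L s t = ins f (fun K => mVal K s t) L +
      f.deg.negOnePow • ins (mC A) (fun K => f.val K s t) L := rfl

theorem closed_iff {f : Cochain A} : Closed f ↔ ∀ L s t, f.D.val L s t = 0 := by
  refine forall_congr' fun L => forall_congr' fun s => forall_congr' fun t => ?_
  rw [f.D_val, ← sub_eq_zero, sgn_eq (x := f.deg) (y := f.deg - 1 + 1) (by push_cast; grind),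
    Int.negOnePow_succ, Units.neg_smul, ← sub_eq_add_neg]

/-- The Gerstenhaber bracket. -/
noncomputable def Cochain.brk (f g : Cochain A) : Cochain A :=
  (f.circ g).comb (g.circ f) (add_comm _ _) (by simp only [Cochain.circ]; ring)
    (1 + (f.deg - 1) * (g.deg - 1)).negOnePow

/-- The cochain `f{c, g}`. -/
noncomputable def Cochain.brace (f c g : Cochain A) : Cochain A where
  w := c.w + (g.w + f.w)
  mono := c.mono.add (g.mono.add f.mono)
  deg := f.deg + c.deg + g.deg - 2
  val L s t := star (insR g (mark fun K => f.val K s t)) c L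
  fam :=
    { shape := fun L s t h => splitSum_eq_zero fun L₁ L' h₁ => splitSum_eq_zero fun L₂ L₃ h₂ => by
        rw [insR, splitSum_eq_zero, smul_zero]
        refine fun K₁ K' h₃ => splitSum_eq_zero fun K₂ K₃ h₄ => ?_
        refine (congrArg _ (f.fam.shape _ _ _ fun h' => h ?_)).trans (smul_zero _)
        rw [← h₁, ← h₂, ← h₃, ← h₄, ← h']
        simp only [sdeg_append, sdeg_cons, Cochain.ent_deg]; abel
      mul := fun s t => ((f.fam.mul s t).mark.insR f.mono g).star (g.mono.add f.mono) c
      nat := fun L s s' t h h' => by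
        simp only [star, insR, map_splitSum, splitSum_units_smul]
        refine splitSum_congr fun L₁ L' h₁ => splitSum_congr fun L₂ L₃ h₂ =>
          splitSum_congr fun K₁ K' h₃ => splitSum_congr fun K₂ K₃ h₄ => ?_
        rw [Units.smul_def, map_zsmul, Units.smul_def, map_zsmul]
        refine congrArg _ (congrArg _ (f.fam.nat _ _ _ _ ?_ h'))
        have e := pervSum_ent_le (f := g) (L₁ ++ c.ent L₂ :: K₁) K₂ K₃ f.mono (s := s) ?_
        · rwa [List.append_assoc, List.cons_append] at e
        · refine le_of_eq_of_le ?_ (pervSum_ent_le (f := c) (w := g.w + f.w) L₁ L₂ L₃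
            (g.mono.add f.mono)
            (le_of_eq_of_le ?_ h))
          · rw [← h₃, ← h₄]; simp only [pervSum_append, pervSum_cons]; abel
          · rw [← h₁, ← h₂] }

section

variable {v w : Fin (n + 1) → ℕ} {s : Perversity n} {H : Elt A → N}

theorem Slot.brace_ent (h : Slot v s H) (hv : Monotone v) (f c g : Cochain A)
    (K : List (Elt A)) : H ((f.brace c g).ent K) =
      star (insR g (mark fun L => H (f.ent L))) c K := by
  by_cases hK : pervSum K + (c.w + (g.w + f.w)) + v ≤ s.toFun
  · have h₁ : pervSum K + (c.w + (g.w + f.w)) ≤ s.toFun :=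
      le_trans (le_add_of_nonneg_right fun _ => Nat.zero_le _) hK
    have h₂ := le_ceil h₁
    have h₃ : (ceil (pervSum K + (c.w + (g.w + f.w)))).toFun + v ≤ s.toFun :=
      ceil_add_le ((pervSum_mono K).add (f.brace c g).mono) hv hK
    change H ⟨ceil (pervSum K + (c.w + (g.w + f.w))), sdeg K + (f.deg + c.deg + g.deg - 2),
      star (insR g (mark fun L => f.val L _ _)) c K⟩ = _
    simp only [star, insR, h.map_splitSum, h.map_units_smul, splitSum_units_smul]
    refine splitSum_congr fun L₁ L' e₁ => splitSum_congr fun L₂ L₃ e₂ =>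
      splitSum_congr fun K₁ K' e₃ => splitSum_congr fun K₂ K₃ e₄ => ?_
    congr 2
    refine (h.ent_eq f.fam ?_ h₃ ?_).symm
    · have e := pervSum_ent_le (f := g) (L₁ ++ c.ent L₂ :: K₁) K₂ K₃ f.mono
        (s := ceil (pervSum K + (c.w + (g.w + f.w)))) ?_
      · rwa [List.append_assoc, List.cons_append] at e
      · refine le_of_eq_of_le ?_ (pervSum_ent_le (f := c) (w := g.w + f.w) L₁ L₂ L₃
            (g.mono.add f.mono)
          (le_of_eq_of_le ?_ h₂))
        · rw [← e₃, ← e₄]; simp only [pervSum_append, pervSum_cons]; abel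
        · rw [← e₁, ← e₂]
    · rw [← e₁, ← e₂, ← e₃, ← e₄]
      simp only [sdeg_append, sdeg_cons, Cochain.ent_deg]; ring
  · have h₁ := (((h.isMul_cochain hv f).mark.insR (f.mono.add hv) g).star
      (g.mono.add (f.mono.add hv)) c).out K fun h' => hK (le_of_eq_of_le (by abel) h')
    rw [h₁]
    exact h.ent_eq_zero (f.brace c g).fam hK

/-- `Γ ⋆ (f{c, g}) = (Γ • f{-, g}) ⋆ c`. -/
theorem star_subR {Γ : Marked A N} (h : Γ.IsMul w s) (hw : Monotone w) (f c g : Cochain A)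
    (L : List (Elt A)) : star (subR f g Γ) c L = star Γ (f.brace c g) L := by
  have : ∀ K K' X, Γ K ((f.brace c g).ent X) K' =
      star (insR g (mark fun Y => Γ K (f.ent Y) K')) c X :=
    fun K K' X => (h.mid K K').brace_ent (((pervSum_mono _).add (pervSum_mono _)).add hw) f c g X
  simp only [star, this, subR, splitSum_units_smul, smul_smul, ← Int.negOnePow_add]
  simp only [splitSum_first, splitSum_nest]
  refine splitSum_congr fun _ _ _ => splitSum_congr fun _ _ _ => splitSum_congr fun _ _ _ =>
    splitSum_congr fun _ _ _ => sgn_smul_congr ?_ ?_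
  · simp only [sdeg_append, Cochain.brace]; push_cast; grind
  · rfl

/-- The differential commutes with the insertion of a cocycle at the mark. -/
theorem Closed.ins_star {c : Cochain A} (hc : Closed c) {Γ : Marked A N} (h : Γ.IsMul w s)
    (hw : Monotone w) (L : List (Elt A)) :
    ins (mC A) (star Γ c) L = (c.deg - 1).negOnePow • star (dMark Γ) c L := by
  have e1 : star Γ (c.circ (mC A)) L = (c.deg - 1).negOnePow • star (sub (mC A) Γ) c L := by
    rw [star_sub h hw]
    refine star_ent_smul h (add_comm _ _) (by simp only [Cochain.circ]; ring) _ (fun K s t => ?_) L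
    change ins (mC A) (fun L => c.val L s t) K = _ • ins c (fun L => mVal L s t) K
    rw [hc, negOnePow_smul_smul]
  rw [PerverseHochschild.ins_star h hw, e1]
  unfold dMark
  rw [star_add, star_add, add_assoc, smul_add]
  simp [mC]

end

/-! ### Sums over the first and the last entry -/

/-- The value of `F` at the first entry and the rest of the list (zero for the empty list). -/
def headSum (L : List (Elt A)) (F : Elt A → List (Elt A) → N) : N :=
  match L with
  | [] => 0
  | a :: L' => F a L'

/-- The value of `F` at the entry of a list of length one (zero for other lists). -/
def oneSum (B : List (Elt A)) (F : Elt A → N) : N :=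
  match B with
  | [b] => F b
  | _ => 0

/-- The value of `F` at the last entry, with the list before it (zero for the empty list). -/
def lastSum (L : List (Elt A)) (F : List (Elt A) → Elt A → N) : N :=
  splitSum L fun L₁ B => oneSum B (F L₁)

theorem headSum_congr {L : List (Elt A)} {F G : Elt A → List (Elt A) → N}
    (h : ∀ a L', a :: L' = L → F a L' = G a L') : headSum L F = headSum L G := by
  cases L with
  | nil => rfl
  | cons a L' => exact h a L' rfl

theorem lastSum_congr {L : List (Elt A)} {F G : List (Elt A) → Elt A → N}
    (h : ∀ L₁ b, L₁ ++ [b] = L → F L₁ b = G L₁ b) : lastSum L F = lastSum L G :=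
  splitSum_congr fun L₁ B e => by
    match B with
    | [b] => exact h L₁ b e
    | [] => rfl
    | _ :: _ :: _ => rfl

theorem map_headSum {N' : Type*} [AddCommGroup N'] [Module R N'] (φ : N →ₗ[R] N')
    (L : List (Elt A)) (F : Elt A → List (Elt A) → N) :
    φ (headSum L F) = headSum L fun a L' => φ (F a L') := by
  cases L with
  | nil => exact φ.map_zero
  | cons a L' => rfl

theorem map_lastSum {N' : Type*} [AddCommGroup N'] [Module R N'] (φ : N →ₗ[R] N')
    (L : List (Elt A)) (F : List (Elt A) → Elt A → N) :
    φ (lastSum L F) = lastSum L fun L₁ b => φ (F L₁ b) := by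
  rw [lastSum, map_splitSum]
  refine splitSum_congr fun L₁ B _ => ?_
  match B with
  | [b] => rfl
  | [] => exact φ.map_zero
  | _ :: _ :: _ => exact φ.map_zero

theorem headSum_units_smul (ε : ℤˣ) (L : List (Elt A)) (F : Elt A → List (Elt A) → N) :
    ε • headSum L F = headSum L fun a L' => ε • F a L' := by
  cases L with
  | nil => exact smul_zero _
  | cons a L' => rfl

theorem lastSum_units_smul (ε : ℤˣ) (L : List (Elt A)) (F : List (Elt A) → Elt A → N) :
    ε • lastSum L F = lastSum L fun L₁ b => ε • F L₁ b := by
  rw [lastSum, splitSum_units_smul]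
  refine splitSum_congr fun L₁ B _ => ?_
  match B with
  | [b] => rfl
  | [] => exact smul_zero _
  | _ :: _ :: _ => exact smul_zero _

theorem lastSum_neg (L : List (Elt A)) (F : List (Elt A) → Elt A → N) :
    lastSum L (fun L₁ b => -F L₁ b) = -lastSum L F := by
  have := lastSum_units_smul (-1) L F
  simpa only [Units.neg_smul, one_smul] using this.symm

theorem headSum_zero (L : List (Elt A)) : headSum L (fun _ _ => (0 : N)) = 0 := by
  cases L <;> rfl

theorem lastSum_zero (L : List (Elt A)) : lastSum L (fun _ _ => (0 : N)) = 0 := by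
  refine splitSum_eq_zero fun L₁ B _ => ?_
  match B with
  | [b] => rfl
  | [] => rfl
  | _ :: _ :: _ => rfl

theorem headSum_eq_zero {L : List (Elt A)} {F : Elt A → List (Elt A) → N}
    (h : ∀ a L', a :: L' = L → F a L' = 0) : headSum L F = 0 :=
  (headSum_congr h).trans (headSum_zero L)

theorem lastSum_eq_zero {L : List (Elt A)} {F : List (Elt A) → Elt A → N}
    (h : ∀ L₁ b, L₁ ++ [b] = L → F L₁ b = 0) : lastSum L F = 0 :=
  (lastSum_congr h).trans (lastSum_zero L)

theorem splitSum_headSum_right (L : List (Elt A)) (F : List (Elt A) → Elt A → List (Elt A) → N) :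
    (splitSum L fun L₁ K => headSum K fun b K₂ => F L₁ b K₂) =
      splitSum L fun K₁ K₂ => lastSum K₁ fun L₁ b => F L₁ b K₂ := by
  unfold lastSum
  rw [splitSum_splitSum L fun L₁ B K₂ => oneSum B fun b => F L₁ b K₂]
  refine splitSum_congr fun L₁ K _ => ?_
  cases K with
  | nil => rw [splitSum_nil]; rfl
  | cons b K =>
    rw [splitSum_cons, splitSum_eq_nil]
    · exact (zero_add _).symm
    · intro B K₂ hB
      match B, hB with
      | _ :: _, _ => rfl

theorem splitSum_headSum_left (L : List (Elt A)) (F : Elt A → List (Elt A) → List (Elt A) → N) :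
    (splitSum L fun K₁ K₂ => headSum K₁ fun a L₁ => F a L₁ K₂) =
      headSum L fun a L' => splitSum L' fun L₁ K₂ => F a L₁ K₂ := by
  cases L with
  | nil => rw [splitSum_nil]; rfl
  | cons a L' => rw [splitSum_cons]; exact zero_add _

theorem splitSum_lastSum_right (L : List (Elt A)) (F : List (Elt A) → List (Elt A) → Elt A → N) :
    (splitSum L fun L₁ K₂ => lastSum K₂ fun L₂ b => F L₁ L₂ b) =
      lastSum L fun L' b => splitSum L' fun L₁ L₂ => F L₁ L₂ b := by
  unfold lastSum
  rw [← splitSum_splitSum L fun L₁ L₂ B => oneSum B fun b => F L₁ L₂ b]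
  refine splitSum_congr fun L' B _ => ?_
  match B with
  | [b] => rfl
  | [] => exact splitSum_zero _
  | _ :: _ :: _ => exact splitSum_zero _

/-- Insertion into a function of at most two entries. -/
theorem ins_short (f : Cochain A) {G : List (Elt A) → N} (hG : ∀ L, 3 ≤ L.length → G L = 0)
    (L : List (Elt A)) : ins f G L = G [f.ent L] +
      (headSum L fun a L' => ((f.deg - 1) * (a.deg - 1)).negOnePow • G [a, f.ent L']) +
      lastSum L fun L' b => G [f.ent L', b] := by
  have e : ∀ L : List (Elt A), (splitSum L fun L₂ L₃ => G (f.ent L₂ :: L₃)) =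
      G [f.ent L] + lastSum L fun L' b => G [f.ent L', b] := by
    intro L
    have : (splitSum L fun L₂ L₃ => G (f.ent L₂ :: L₃)) =
        splitSum L (fun L₂ L₃ => match L₃ with
          | [] => G [f.ent L₂]
          | _ :: _ => 0) + lastSum L fun L' b => G [f.ent L', b] := by
      rw [lastSum, ← splitSum_add]
      refine splitSum_congr fun L₂ L₃ _ => ?_
      match L₃ with
      | [] => exact (add_zero _).symm
      | [b] => exact (zero_add _).symm
      | _ :: _ :: _ => exact (hG _ (by simp)).trans (add_zero _).symm
    rw [this, splitSum_eq_self]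
    intro L₁ L₂ h
    match L₂, h with
    | _ :: _, _ => rfl
  cases L with
  | nil =>
    simp only [ins, splitSum_nil, headSum, lastSum, sdeg_nil, mul_zero, Int.negOnePow_zero,
      one_smul, add_zero, List.nil_append]
    exact (add_zero _).symm
  | cons a L =>
    rw [ins, splitSum_cons]
    simp only [sdeg_nil, mul_zero, Int.negOnePow_zero, one_smul, List.nil_append]
    rw [e, splitSum_eq_nil, splitSum_eq_self, add_right_comm]
    · simp only [sdeg_cons, sdeg_nil, add_zero]; rfl
    · intro L₁ L₂ h
      rw [hG _ (by have := List.length_pos_iff.2 h; simp; omega), smul_zero]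
    · intro L₁ L₂ h
      refine splitSum_eq_zero fun _ _ _ => ?_
      rw [hG _ (by have := List.length_pos_iff.2 h; simp; omega), smul_zero]

/-! ### The differential with values in a bimodule -/

theorem pslot_lact (a : Elt A) (s : Perversity n) (t : ℤ) :
    PSlot M.toPerverseComplex a.perv.toFun s fun p i x => M.lact a.perv p s a.deg i t a.val x where
  out p i x hx := by
    rw [M.lact_shape fun h => hx (le_of_eq_of_le (add_comm _ _) h.1)]; rfl
  add p i x y := map_add _ _ _
  smul p i c x := map_smul _ _ _
  nat p₁ p₂ i x h₁ h₂ := by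
    have := M.lact_map_map (le_refl a.perv) h₁ (le_of_eq_of_le (add_comm _ _) h₂) a.deg i t a.val x
    rwa [A.map_self] at this

theorem pslot_ract (b : Elt A) (s : Perversity n) (t : ℤ) :
    PSlot M.toPerverseComplex b.perv.toFun s fun p i x => M.ract p b.perv s i b.deg t x b.val where
  out p i x hx := by rw [M.ract_shape fun h => hx h.1]; rfl
  add p i x y := by simp
  smul p i c x := by simp
  nat p₁ p₂ i x h₁ h₂ := by
    have := M.ract_map_map h₁ (le_refl b.perv) h₂ i b.deg t x b.val
    rwa [A.map_self] at this

theorem slot_lact {p : Perversity n} {i : ℤ} (x : M.X p i) (s : Perversity n) (t : ℤ) :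
    Slot p.toFun s fun a => M.lact a.perv p s a.deg i t a.val x where
  out a ha := by rw [M.lact_shape fun h => ha h.1]; rfl
  add p i a b := by simp
  smul p i c a := by simp
  nat p₁ p₂ j a h₁ h₂ := by
    have := M.lact_map_map h₁ (le_refl p) h₂ j i t a x
    rwa [M.map_self] at this

/-- The values of `f`, acted upon by `a`. -/
noncomputable abbrev lactVal (w : Fin (n + 1) → ℕ) (q : ℤ) (g : Raw A M) (s : Perversity n)
    (t : ℤ) (a : Elt A) (L : List (Elt A)) : M.X s t :=
  pval w q g (fun p i x => M.lact a.perv p s a.deg i t a.val x) L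

noncomputable abbrev ractVal (w : Fin (n + 1) → ℕ) (q : ℤ) (g : Raw A M) (s : Perversity n)
    (t : ℤ) (L : List (Elt A)) (b : Elt A) : M.X s t :=
  pval w q g (fun p i x => M.ract p b.perv s i b.deg t x b.val) L

/-- The Hochschild differential, for families graded by `w` and `q`. -/
noncomputable def gD (w : Fin (n + 1) → ℕ) (q : ℤ) (g : Raw A M) : Raw A M := fun L s t =>
  M.d s (t - 1) t (g L s (t - 1)) + q.negOnePow • ins (mC A) (fun K => g K s t) L +
    (headSum L fun a L' => ((a.deg + 1) * q + 1).negOnePow • lactVal w q g s t a L') +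
    lastSum L fun L' b => (sdeg L' + q).negOnePow • ractVal w q g s t L' b

theorem ins_mC {v : Fin (n + 1) → ℕ} {s : Perversity n} {G : List (Elt A) → N}
    (h : IsMul v s G) (hv : Monotone v) (L : List (Elt A)) : ins (mC A) G L =
      (splitSum L fun L₁ K => headSum K fun a L' => (sdeg L₁).negOnePow • G (L₁ ++ a.d :: L')) +
      splitSum L fun L₁ K => headSum K fun a K' => headSum K' fun b L' =>
        (sdeg L₁ + a.deg).negOnePow • G (L₁ ++ a.mul b :: L') := by
  rw [ins, ← splitSum_add]
  refine splitSum_congr fun L₁ L' _ => ?_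
  simp only [mC, show (2 : ℤ) - 1 = 1 from rfl, one_mul]
  have hs := fun L₃ => h.slot L₁ L₃
  have hm := fun L₃ : List (Elt A) => ((pervSum_mono L₁).add (pervSum_mono L₃)).add hv
  match L' with
  | [] =>
    rw [splitSum_nil]
    exact (congrArg _ (hs []).mC_nil).trans ((smul_zero _).trans (add_zero _).symm)
  | [a] =>
    rw [splitSum_cons, splitSum_nil]
    refine (congrArg₂ (· + ·) ((congrArg _ (hs _).mC_nil).trans (smul_zero _))
      (congrArg _ ((hs _).mC_one a))).trans ?_
    simp only [headSum, zero_add, add_zero]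
  | a :: b :: L₃ =>
    rw [splitSum_cons, splitSum_cons, splitSum_eq_nil]
    · refine (congrArg₂ (· + ·) ((congrArg _ (hs _).mC_nil).trans (smul_zero _))
        (congrArg₂ (· + ·) (congrArg _ ((hs _).mC_one a))
          (congrArg _ ((hs _).mC_two (hm _) a b)))).trans ?_
      simp only [headSum, zero_add, smul_smul, ← Int.negOnePow_add]
    · intro K₁ K₂ hK
      exact (congrArg _ ((hs _).mC_three (by have := List.length_pos_iff.2 hK; simp; omega))).trans
        (smul_zero _)

theorem hochD_eq_gD {p : Perversity n} {q : ℤ} {f : Raw A M}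
    (hf : Fam M.toPerverseComplex p.toFun q f) (L : List (Elt A)) (s : Perversity n) (t : ℤ) :
    hochD p q f L s t = gD p.toFun q f L s t := by
  have e1 : splitSum L (dTerm q f s t) + splitSum L (mulTerm q f s t) =
      q.negOnePow • ins (mC A) (fun K => f K s t) L := by
    rw [ins_mC (hf.mul s t) p.toFun_mono, smul_add]
    simp only [splitSum_units_smul, headSum_units_smul, smul_smul, ← Int.negOnePow_add]
    congr 1
    · refine splitSum_congr fun L₁ K _ => ?_
      match K with
      | [] => rfl
      | a :: K => rw [dTerm, add_comm]; rfl
    · refine splitSum_congr fun L₁ K _ => ?_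
      match K with
      | [] => rfl
      | [a] => rfl
      | a :: b :: K =>
        rw [mulTerm, ← Units.neg_smul, ← Int.negOnePow_succ]
        exact sgn_smul_congr (by push_cast; grind) rfl
  have e2 : leftTerm p q f s t L =
      headSum L fun a L' => ((a.deg + 1) * q + 1).negOnePow • lactVal p.toFun q f s t a L' := by
    match L with
    | [] => rfl
    | a :: L => rw [leftTerm, ← Units.neg_smul, ← Int.negOnePow_succ]; rfl
  have e3 : splitSum L (rightTerm p q f s t) =
      lastSum L fun L' b => (sdeg L' + q).negOnePow • ractVal p.toFun q f s t L' b := by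
    refine splitSum_congr fun L₁ B _ => ?_
    match B with
    | [] => rfl
    | [b] => rfl
    | _ :: _ :: _ => rfl
  rw [gD, ← e1, ← e2, ← e3]
  change M.d s (t - 1) t (f L s (t - 1)) + splitSum L (dTerm q f s t)
      + leftTerm p q f s t L + splitSum L (rightTerm p q f s t) + splitSum L (mulTerm q f s t) = _
  abel

/-- For `M = A`, the differential is `m ∘ f - (-1)^{|f| - 1} f ∘ m`. -/
theorem gD_regular (f : Cochain A) (L : List (Elt A)) (s : Perversity n) (t : ℤ) :
    gD (M := A.regular) f.w f.deg f.val L s t = f.D.val L s t := by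
  rw [f.D_val, ins_short f fun L h => mVal_eq_zero h s t]
  unfold gD
  have e1 : mVal [f.ent L] s t = A.d s (t - 1) t (f.val L s (t - 1)) := by
    rw [← f.ev_ent]; exact Elt.d_ev _ _ _
  rw [e1]
  have e2 : (headSum L fun a L' =>
      ((a.deg + 1) * f.deg + 1).negOnePow • lactVal (M := A.regular) f.w f.deg f.val s t a L') =
      headSum L fun a L' => ((f.deg - 1) * (a.deg - 1)).negOnePow • mVal [a, f.ent L'] s t :=
    headSum_congr fun a L' _ => by
      rw [mVal, smul_smul, ← Int.negOnePow_add]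
      exact sgn_smul_congr (by push_cast; grind) rfl
  have e3 : (lastSum L fun L' b =>
      (sdeg L' + f.deg).negOnePow • ractVal (M := A.regular) f.w f.deg f.val s t L' b) =
      lastSum L fun L' b => mVal [f.ent L', b] s t := rfl
  rw [e2, e3]
  have key (a b c d : A.X s t) : a + b + c + d = a + c + d + b := by abel
  exact key _ _ _ _

/-! ### The action on cochains with values in a bimodule -/

theorem addLE_ceil_ceil {u v : Fin (n + 1) → ℕ} {s : Perversity n} (hu : Monotone u)
    (hv : Monotone v) (h : u + v ≤ s.toFun) : AddLE (ceil u) (ceil v) s :=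
  le_of_eq_of_le (add_comm _ _) <| ceil_add_le hv (ceil u).toFun_mono <|
    le_of_eq_of_le (add_comm _ _) (ceil_add_le hu hv h)

theorem addLE_ceil_left {p : Perversity n} {v : Fin (n + 1) → ℕ} {s : Perversity n}
    (hv : Monotone v) (h : p.toFun + v ≤ s.toFun) : AddLE p (ceil v) s :=
  le_of_eq_of_le (add_comm _ _) (ceil_add_le hv p.toFun_mono (le_of_eq_of_le (add_comm _ _) h))

theorem addLE_ceil {p q : Perversity n} {s : Perversity n} (h : p.toFun + q.toFun ≤ s.toFun) :
    AddLE p q (ceil (p.toFun + q.toFun)) := le_ceil h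

theorem le_of_add_le_left {u v : Fin (n + 1) → ℕ} {s : Perversity n} (h : u + v ≤ s.toFun) :
    u ≤ s.toFun := le_trans (le_add_of_nonneg_right fun _ => Nat.zero_le _) h

theorem ins_splitSum (c : Cochain A) (F : List (Elt A) → List (Elt A) → N) (L : List (Elt A)) :
    ins c (fun X => splitSum X F) L = splitSum L fun L₁ L₂ => ins c (fun X => F X L₂) L₁ +
      ((c.deg - 1) * sdeg L₁).negOnePow • ins c (fun X => F L₁ X) L₂ := by
  simp only [ins, splitSum_append_cons, splitSum_add, smul_add, splitSum_units_smul, smul_smul,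
    ← Int.negOnePow_add]
  simp only [splitSum_first, splitSum_nest]
  rw [add_comm]
  congr 1
  refine splitSum_congr fun _ _ _ => splitSum_congr fun _ _ _ => splitSum_congr fun _ _ _ =>
    sgn_smul_congr ?_ rfl
  simp only [sdeg_append]; push_cast; ring

theorem ins_sign (c : Cochain A) (k : ℤ) (G : List (Elt A) → N) (L : List (Elt A)) :
    ins c (fun X => (k * sdeg X).negOnePow • G X) L =
      (k * (sdeg L + c.deg - 1)).negOnePow • ins c G L := by
  simp only [ins, splitSum_units_smul, smul_smul, ← Int.negOnePow_add]
  refine splitSum_congr fun _ _ h => splitSum_congr fun _ _ h' => sgn_smul_congr ?_ rfl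
  rw [sdeg_ent, h', h]; push_cast; ring

theorem ins_units_smul (c : Cochain A) (ε : ℤˣ) (G : List (Elt A) → N) (L : List (Elt A)) :
    ins c (fun X => ε • G X) L = ε • ins c G L := by
  simp only [ins, splitSum_units_smul, smul_comm ε]

variable {M : Bimodule A} {w : Fin (n + 1) → ℕ} {j : ℤ} {g : Raw A M}

/-- The product `f · g`. -/
noncomputable def actV (f : Cochain A) (w : Fin (n + 1) → ℕ) (j : ℤ) (g : Raw A M) : Raw A M :=
  fun L s t => splitSum L fun L₁ L₂ =>
    (j * sdeg L₁).negOnePow • lactVal w j g s t (f.ent L₁) L₂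

theorem addLE_ent (f : Cochain A) (hw : Monotone w) {s : Perversity n} (L₁ L₂ : List (Elt A))
    (h : pervSum (L₁ ++ L₂) + (f.w + w) ≤ s.toFun) :
    AddLE (f.ent L₁).perv (ceil (pervSum L₂ + w)) s :=
  addLE_ceil_ceil ((pervSum_mono _).add f.mono) ((pervSum_mono _).add hw)
    (le_of_eq_of_le (by rw [pervSum_append]; abel) h)

theorem Fam.actV (hg : Fam M.toPerverseComplex w j g) (hw : Monotone w) (f : Cochain A) :
    Fam M.toPerverseComplex (f.w + w) (f.deg + j) (actV f w j g) where
  shape L s t h := splitSum_eq_zero fun L₁ L₂ e => by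
    rw [lactVal, pval, M.lact_shape fun h' => h ?_]
    · exact smul_zero _
    · rw [← h'.2, ← e, sdeg_append, f.ent_deg]; abel
  mul s t := by
    have hf := fun L₂ : List (Elt A) =>
      slot_lact (M := M) (g L₂ (ceil (pervSum L₂ + w)) (sdeg L₂ + j)) s t
    have out : ∀ L₁ L₂ : List (Elt A), ¬ (pervSum L₁ + pervSum L₂ + (f.w + w) ≤ s.toFun) →
        lactVal w j g s t (f.ent L₁) L₂ = 0 := by
      intro L₁ L₂ h
      by_cases h₁ : pervSum L₁ + f.w ≤ (f.ent L₁).perv.toFun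
      · refine (pslot_lact (f.ent L₁) s t).ent_eq_zero hg fun h₂ => h ?_
        refine le_trans (le_of_eq_of_le ?_ (add_le_add_right h₁ (pervSum L₂ + w)))  h₂
        abel
      · have := (f.fam.mul _ (sdeg L₁ + f.deg)).out L₁ h₁
        rw [lactVal, pval]
        change M.lact _ _ _ _ _ _ (f.val L₁ (ceil (pervSum L₁ + f.w)) (sdeg L₁ + f.deg)) _ = 0
        refine (congrArg (fun y => M.lact _ _ _ _ _ _ y _) this).trans ?_
        rw [map_zero, LinearMap.zero_apply]
    refine IsMul.splitSum (fun K => ?_) fun K => ?_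
    · refine IsMul.fun_sign (φ := fun d => j * d) ?_
      refine (IsMul.weaken (w := f.w) (u := pervSum K + w) ((hf K).isMul_cochain
        (ceil _).toFun_mono f) f.mono ((pervSum_mono _).add hw) ?_).congr (by abel) fun _ => rfl
      exact fun L hL => out _ _ fun h' => hL (le_of_eq_of_le (by abel) h')
    · refine IsMul.fun_units_smul ?_ _
      refine (IsMul.weaken (w := w) (u := pervSum K + f.w)
        ((pslot_lact (f.ent K) s t).isMul_ent hg (ceil _).toFun_mono hw) hw
        ((pervSum_mono _).add f.mono) ?_).congr (by abel) fun _ => rfl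
      exact fun L hL => out _ _ fun h' => hL (le_of_eq_of_le (by abel) h')
  nat L s s' t h h' := by
    simp only [PerverseHochschild.actV, map_splitSum]
    refine splitSum_congr fun L₁ L₂ e => ?_
    rw [Units.smul_def, map_zsmul]
    refine congrArg _ (M.map_lact (addLE_ent f hw L₁ L₂ ?_) h' _ _ _ _ _)
    rw [e]; exact h

section

variable {v : Fin (n + 1) → ℕ} {s : Perversity n} {H : Elt A → N}

theorem Slot.D_ent (h : Slot v s H) (hv : Monotone v) (f : Cochain A) (L : List (Elt A)) :
    H (f.D.ent L) = H (f.ent L).d +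
      (headSum L fun a L' => ((f.deg - 1) * (a.deg - 1) + a.deg).negOnePow •
        H (a.mul (f.ent L'))) +
      (lastSum L fun L' b => (sdeg L' + f.deg).negOnePow • H ((f.ent L').mul b)) +
      f.deg.negOnePow • ins (mC A) (fun L => H (f.ent L)) L := by
  refine (h.comb_ent _ _ _ L).trans ?_
  rw [h.circ_ent hv, h.circ_ent hv, ins_short _ fun L hL => h.mC_three hL]
  simp only [h.mC_one, h.mC_two hv, smul_smul, ← Int.negOnePow_add]
  rfl

end

theorem lactVal_lact (hw : Monotone w)
    {s c : Perversity n} {t t' : ℤ} (a b : Elt A) (L : List (Elt A))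
    (h : b.perv.toFun + (pervSum L + w) ≤ c.toFun) (h' : a.perv.toFun + c.toFun ≤ s.toFun)
    (ht' : b.deg + (sdeg L + j) = t') (ht : a.deg + t' = t) :
    M.lact a.perv c s a.deg t' t a.val (lactVal w j g c t' b L) =
      lactVal w j g s t (a.mul b) L := by
  have h1 : a.perv.toFun + b.perv.toFun + (pervSum L + w) ≤ s.toFun :=
    le_trans (le_of_eq_of_le (add_assoc _ _ _) (add_le_add_right h _)) h'
  refine (M.mul_lact (addLE_ceil (le_of_add_le_left h1)) (addLE_ceil_ceil
    (a.perv.toFun_mono.add b.perv.toFun_mono) ((pervSum_mono _).add hw) h1)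
    (addLE_ceil_left ((pervSum_mono _).add hw) h) h' rfl ?_ ht' a.val b.val _).symm
  rw [← ht, ← ht', add_assoc]

theorem lactVal_ract (hw : Monotone w)
    {s c c' : Perversity n} {t t' t'' : ℤ} (a b : Elt A) (L : List (Elt A))
    (h : pervSum L + w + b.perv.toFun ≤ c.toFun) (h' : a.perv.toFun + c.toFun ≤ s.toFun)
    (hc : a.perv.toFun + (pervSum L + w) ≤ c'.toFun) (hc' : c'.toFun + b.perv.toFun ≤ s.toFun)
    (ht' : sdeg L + j + b.deg = t') (ht : a.deg + t' = t) (ht'' : a.deg + (sdeg L + j) = t'') :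
    M.ract c' b.perv s t'' b.deg t (lactVal w j g c' t'' a L) b.val =
      M.lact a.perv c s a.deg t' t a.val (ractVal w j g c t' L b) := by
  refine M.lact_ract (addLE_ceil_left ((pervSum_mono _).add hw) hc) hc'
    (ceil_add_le ((pervSum_mono _).add hw) b.perv.toFun_mono h) h' ht'' ?_ ht' a.val _ b.val
  omega

/-- The Leibniz rule. -/
theorem gD_actV (hg : Fam M.toPerverseComplex w j g) (hw : Monotone w) (f : Cochain A)
    {L : List (Elt A)} {s : Perversity n} {t : ℤ} (hs : pervSum L + (f.w + w) ≤ s.toFun)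
    (ht : sdeg L + (f.deg + j) + 1 = t) :
    gD (f.w + w) (f.deg + j) (actV f w j g) L s t = actV f.D w j g L s t +
      f.deg.negOnePow • actV f w (j + 1) (gD w j g) L s t := by
  have hX := hg.actV hw f
  have hfw : Monotone (f.w + w) := f.mono.add hw
  have range : ∀ {L₁ L₂}, L₁ ++ L₂ = L → pervSum L₁ + f.w + (pervSum L₂ + w) ≤ s.toFun :=
    fun e => le_of_eq_of_le (by rw [← e, pervSum_append]; abel) hs
  -- the four parts of the differential of the product
  have e1 : M.d s (t - 1) t (actV f w j g L s (t - 1)) = splitSum L fun L₁ L₂ =>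
      (j * sdeg L₁).negOnePow • lactVal w j g s t (f.ent L₁).d L₂ +
      (j * sdeg L₁ + (sdeg L₁ + f.deg)).negOnePow • M.lact (f.ent L₁).perv (ceil (pervSum L₂ + w))
        s (f.ent L₁).deg (sdeg L₂ + (j + 1)) t (f.ent L₁).val
        (M.d _ (sdeg L₂ + j) (sdeg L₂ + (j + 1)) (g L₂ _ _)) := by
    rw [actV, map_splitSum]
    refine splitSum_congr fun L₁ L₂ e => ?_
    rw [Units.smul_def, map_zsmul, lactVal, pval, M.d_lact (addLE_ent f hw L₁ L₂ (e ▸ hs))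
      (j' := sdeg L₂ + (j + 1)) (i' := (f.ent L₁).deg + 1) _ rfl (by omega) (by omega),
      smul_add, Int.negOnePow_add, mul_smul]
    · rfl
    · rw [← ht, ← e, f.ent_deg, sdeg_append]; omega
  have e2 : ins (mC A) (fun K => actV f w j g K s t) L = splitSum L fun L₁ L₂ =>
      (j * (sdeg L₁ + 1)).negOnePow • ins (mC A) (fun X => lactVal w j g s t (f.ent X) L₂) L₁ +
      (sdeg L₁ + j * sdeg L₁).negOnePow • ins (mC A) (lactVal w j g s t (f.ent L₁)) L₂ := by
    simp only [actV]
    rw [ins_splitSum]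
    refine splitSum_congr fun L₁ L₂ e => ?_
    rw [ins_sign, ins_units_smul, smul_smul, ← Int.negOnePow_add]
    congr 1
    · exact sgn_smul_congr (by simp only [mC]; push_cast; grind) rfl
    · exact sgn_smul_congr (by simp only [mC]; push_cast; grind) rfl
  have e3 : ∀ a L', a :: L' = L → lactVal (f.w + w) (f.deg + j) (actV f w j g) s t a L' =
      splitSum L' fun L₁ L₂ => (j * sdeg L₁).negOnePow •
        lactVal w j g s t (a.mul (f.ent L₁)) L₂ := by
    intro a L' e
    have h0 : pervSum L' + (f.w + w) + a.perv.toFun ≤ s.toFun :=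
      le_of_eq_of_le (by rw [← e, pervSum_cons]; abel) hs
    rw [lactVal, pval, actV, map_splitSum]
    refine splitSum_congr fun L₁ L₂ e' => ?_
    rw [Units.smul_def, map_zsmul]
    refine congrArg _ (lactVal_lact hw a (f.ent L₁) L₂ ?_ ?_ ?_ ?_)
    · refine ceil_add_le ((pervSum_mono _).add f.mono) ((pervSum_mono _).add hw) ?_
      refine le_of_eq_of_le ?_ (le_ceil (le_of_add_le_left h0))
      rw [← e', pervSum_append]; abel
    · exact addLE_ceil_left ((pervSum_mono _).add hfw) (le_of_eq_of_le (add_comm _ _) h0)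
    · rw [f.ent_deg, ← e', sdeg_append]; abel
    · rw [← ht, ← e, sdeg_cons]; ring
  have e4 : ∀ L' b, L' ++ [b] = L → (sdeg L' + (f.deg + j)).negOnePow •
      ractVal (f.w + w) (f.deg + j) (actV f w j g) s t L' b =
      splitSum L' fun L₁ L₂ => (sdeg L₁ + sdeg L₂ + (f.deg + j) + j * sdeg L₁).negOnePow •
        M.lact (f.ent L₁).perv (ceil (pervSum (L₂ ++ [b]) + w)) s (f.ent L₁).deg
          (sdeg (L₂ ++ [b]) + (j + 1)) t (f.ent L₁).val (ractVal w j g _ _ L₂ b) := by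
    intro L' b e
    have h0 : pervSum L' + (f.w + w) + b.perv.toFun ≤ s.toFun :=
      le_of_eq_of_le (by rw [← e, pervSum_mid, pervSum_nil]; abel) hs
    rw [ractVal, pval, actV, ← LinearMap.flip_apply, map_splitSum, splitSum_units_smul]
    refine splitSum_congr fun L₁ L₂ e' => ?_
    have h1 : pervSum L₁ + f.w + (pervSum (L₂ ++ [b]) + w) ≤ s.toFun :=
      le_of_eq_of_le (by rw [← e', pervSum_mid, pervSum_append, pervSum_nil]; abel) h0
    have h2 : pervSum (L₂ ++ [b]) + w ≤ s.toFun :=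
      le_of_add_le_left (le_of_eq_of_le (add_comm _ _) h1)
    rw [Units.smul_def ((j * sdeg L₁).negOnePow), map_zsmul, ← Units.smul_def, smul_smul,
      ← Int.negOnePow_add]
    rw [sgn_eq (y := sdeg L₁ + sdeg L₂ + (f.deg + j) + j * sdeg L₁)
      (by rw [← e', sdeg_append])]
    refine congrArg _ (lactVal_ract hw (f.ent L₁) b L₂ ?_ ?_ ?_ ?_ ?_ ?_ ?_)
    · refine le_of_eq_of_le ?_ (le_ceil h2)
      rw [pervSum_mid, pervSum_nil]; abel
    · exact addLE_ceil_ceil ((pervSum_mono _).add f.mono) ((pervSum_mono _).add hw) h1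
    · refine ceil_add_le ((pervSum_mono _).add f.mono) ((pervSum_mono _).add hw) ?_
      refine le_of_eq_of_le ?_ (le_ceil (le_of_add_le_left h0))
      rw [← e', pervSum_append]; abel
    · exact ceil_add_le ((pervSum_mono _).add hfw) b.perv.toFun_mono h0
    · rw [sdeg_mid, sdeg_nil]; ring
    · rw [← ht, ← e, ← e', f.ent_deg]; simp only [sdeg_append]; ring
    · rw [f.ent_deg, ← e', sdeg_append]; abel
  -- the four parts of the product with the differential of `g`
  have e5 : ∀ L₁ L₂, L₁ ++ L₂ = L → lactVal w (j + 1) (gD w j g) s t (f.ent L₁) L₂ =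
      M.lact (f.ent L₁).perv (ceil (pervSum L₂ + w))
        s (f.ent L₁).deg (sdeg L₂ + (j + 1)) t (f.ent L₁).val
        (M.d _ (sdeg L₂ + j) (sdeg L₂ + (j + 1)) (g L₂ _ _)) +
      j.negOnePow • ins (mC A) (lactVal w j g s t (f.ent L₁)) L₂ +
      (headSum L₂ fun b L' => ((b.deg + 1) * j + 1).negOnePow •
        lactVal w j g s t ((f.ent L₁).mul b) L') +
      lastSum L₂ fun L' b => (sdeg L' + j).negOnePow •
        M.lact (f.ent L₁).perv (ceil (pervSum (L' ++ [b]) + w)) s (f.ent L₁).deg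
          (sdeg (L' ++ [b]) + (j + 1)) t (f.ent L₁).val (ractVal w j g _ _ L' b) := by
    intro L₁ L₂ e
    have h1 := range e
    have h2 : pervSum L₂ + w ≤ s.toFun := le_of_add_le_left (le_of_eq_of_le (add_comm _ _) h1)
    have h3 : AddLE (f.ent L₁).perv (ceil (pervSum L₂ + w)) s := addLE_ent f hw L₁ L₂ (e ▸ hs)
    have h4 : (f.ent L₁).deg + (sdeg L₂ + (j + 1)) = t := by
      rw [f.ent_deg, ← ht, ← e, sdeg_append]; ring
    rw [lactVal, pval, gD, map_add, map_add, map_add, map_headSum, map_lastSum]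
    congr 1
    · congr 1
      · congr 1
        · rw [show sdeg L₂ + (j + 1) - 1 = sdeg L₂ + j by ring]
        · rw [Units.smul_def, map_zsmul]
          refine congrArg _ ((pslot_lact (f.ent L₁) s t).ins_ent hg hw (mC A) ?_ ?_ ?_).symm
          · exact le_of_eq_of_le (by simp [mC]) (le_ceil h2)
          · exact le_of_eq_of_le (add_comm _ _) h3
          · simp only [mC]; ring
      · refine headSum_congr fun b L' e' => ?_
        rw [Units.smul_def, map_zsmul]
        refine congrArg _ (lactVal_lact hw (f.ent L₁) b L' ?_ h3 ?_ h4)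
        · exact le_of_eq_of_le (by rw [← e', pervSum_cons]; abel) (le_ceil h2)
        · rw [← e', sdeg_cons]; ring
    · refine lastSum_congr fun L' b e' => ?_
      subst e'
      rw [Units.smul_def, map_zsmul]
      rfl
  have key : ∀ (f' : Cochain A) (j' : ℤ) (G : List (Elt A) → List (Elt A) → M.X s t),
      (∀ L₁ L₂, L₁ ++ L₂ = L → lactVal w j g s t (f'.ent L₁) L₂ = G L₁ L₂) →
      actV f' w j g L s t = splitSum L fun L₁ L₂ => (j * sdeg L₁).negOnePow • G L₁ L₂ :=
    fun f' j' G h => splitSum_congr fun L₁ L₂ e => by rw [h L₁ L₂ e]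
  have e6 : actV f.D w j g L s t = _ := key f.D j _ fun L₁ L₂ e =>
    (slot_lact (M := M) (g L₂ (ceil (pervSum L₂ + w)) (sdeg L₂ + j)) s t).D_ent
      (ceil _).toFun_mono f L₁
  rw [e6, gD, e1, e2, headSum_congr fun a L' e => by rw [e3 a L' e],
    lastSum_congr fun L' b e => by rw [e4 L' b e]]
  simp only [splitSum_units_smul, smul_add, headSum_units_smul, lastSum_units_smul, smul_smul,
    ← Int.negOnePow_add, splitSum_add]
  rw [← splitSum_headSum_left L fun a L₁ L₂ => _, ← splitSum_lastSum_right L fun L₁ L₂ b => _]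
  have e7 : actV f w (j + 1) (gD w j g) L s t = splitSum L fun L₁ L₂ =>
      ((j + 1) * sdeg L₁).negOnePow • _ :=
    splitSum_congr fun L₁ L₂ e => by rw [e5 L₁ L₂ e]
  rw [e7]
  simp only [splitSum_units_smul, smul_add, headSum_units_smul, lastSum_units_smul, smul_smul,
    ← Int.negOnePow_add, splitSum_add]
  rw [splitSum_headSum_right]
  have fin {a b c d x y a' b' c' d' x' y' z z' : M.X s t} (ha : a = a') (hb : b = b') (hc : c = c')
      (hd : d = d') (hx : x = x') (hy : y = y') (hz : z = -z') :
      a + b + (c + d) + x + y = a' + x' + z + c' + (b' + d' + z' + y') := by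
    rw [ha, hb, hc, hd, hx, hy, hz]; abel
  refine fin rfl ?_ ?_ ?_ ?_ ?_ ?_
  · exact splitSum_congr fun _ _ _ => sgn_smul_congr (by push_cast; grind) rfl
  · exact splitSum_congr fun _ _ _ => sgn_smul_congr (by push_cast; grind) rfl
  · exact splitSum_congr fun _ _ _ => sgn_smul_congr (by push_cast; grind) rfl
  · refine splitSum_congr fun _ _ _ => headSum_congr fun _ _ h => sgn_smul_congr ?_ rfl
    rw [← h, sdeg_cons]; push_cast; grind
  · refine splitSum_congr fun _ _ _ => lastSum_congr fun _ _ h => sgn_smul_congr ?_ rfl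
    push_cast; grind
  · rw [← splitSum_neg]
    refine splitSum_congr fun _ _ _ => ?_
    rw [← lastSum_neg]
    refine lastSum_congr fun _ _ h => ?_
    rw [← Units.neg_smul, ← Int.negOnePow_succ]
    refine sgn_smul_congr ?_ rfl
    rw [← h, sdeg_mid, sdeg_nil]; push_cast; grind

/-! ### The Gerstenhaber structure on cochains -/

/-- The cup product. -/
noncomputable def Cochain.cup (f g : Cochain A) : Cochain A where
  w := f.w + g.w
  mono := f.mono.add g.mono
  deg := f.deg + g.deg
  val := actV (M := A.regular) f g.w g.deg g.val
  fam := Fam.actV (M := A.regular) g.fam g.mono f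

theorem Cochain.cup_val (f g : Cochain A) (L : List (Elt A)) (s : Perversity n) (t : ℤ) :
    (f.cup g).val L s t = splitSum L fun L₁ L₂ =>
      (g.deg * sdeg L₁).negOnePow • (f.ent L₁).pmul (g.ent L₂) s t := rfl

/-- `m{c, g} = ± c ∪ g`. -/
theorem Cochain.brace_mC (c g : Cochain A) (L : List (Elt A)) (s : Perversity n) (t : ℤ) :
    ((mC A).brace c g).val L s t =
      (1 + g.deg * (c.deg - 1)).negOnePow • (c.cup g).val L s t := by
  rw [Cochain.cup_val, splitSum_units_smul]
  change star (insR g (mark fun K => mVal K s t)) c L = _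
  rw [star, splitSum_eq_nil]
  · refine splitSum_congr fun L₂ L₃ _ => ?_
    rw [insR, splitSum_eq_nil, splitSum_eq_self]
    · simp only [mark, List.nil_append, mVal, smul_smul, ← Int.negOnePow_add, Cochain.ent_deg,
        sdeg_nil]
      exact sgn_smul_congr (by push_cast; grind) rfl
    · intro _ K h
      rw [mark, mVal_eq_zero, smul_zero]
      have := List.length_pos_iff.2 h; simp; omega
    · intro K _ h
      refine splitSum_eq_zero fun _ _ _ => ?_
      rw [mark, mVal_eq_zero, smul_zero]
      have := List.length_pos_iff.2 h; simp; omega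
  · intro K _ h
    refine splitSum_eq_zero fun _ _ _ => ?_
    rw [insR, splitSum_eq_zero, smul_zero]
    refine fun _ _ _ => splitSum_eq_zero fun _ _ _ => ?_
    rw [mark, mVal_eq_zero, smul_zero]
    have := List.length_pos_iff.2 h; simp; omega

theorem star_insR_mVal (c g : Cochain A) (L : List (Elt A)) (s : Perversity n) (t : ℤ) :
    star (insR g (mark fun K => mVal K s t)) c L =
      (1 + g.deg * (c.deg - 1)).negOnePow • (c.cup g).val L s t := c.brace_mC g L s t

theorem star_insL_mVal (c f : Cochain A) (L : List (Elt A)) (s : Perversity n) (t : ℤ) :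
    star (insL f (mark fun K => mVal K s t)) c L = f.deg.negOnePow • (f.cup c).val L s t := by
  rw [star_insR_comm, star_insR_mVal, smul_smul, ← Int.negOnePow_add]
  exact sgn_smul_congr (by push_cast; grind) rfl

theorem ins_add (f : Cochain A) (G G' : List (Elt A) → N) (L : List (Elt A)) :
    ins f (fun K => G K + G' K) L = ins f G L + ins f G' L := by
  simp only [ins, smul_add, splitSum_add]

theorem ins_comb {w : Fin (n + 1) → ℕ} {s : Perversity n} {G : List (Elt A) → N}
    (h : IsMul w s G) {f g : Cochain A} (hw : g.w = f.w) (hd : g.deg = f.deg) (ε : ℤˣ)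
    (L : List (Elt A)) : ins (f.comb g hw hd ε) G L = ins f G L + ε • ins g G L :=
  star_comb h.mark hw hd ε L

/-- The pre-Lie identity. -/
theorem ins_ins {w : Fin (n + 1) → ℕ} {s : Perversity n} {G : List (Elt A) → N}
    (h : IsMul w s G) (hw : Monotone w) (g c : Cochain A) (L : List (Elt A)) :
    ins c (ins g G) L = ins (g.circ c) G L +
      ((g.deg - 1) * (c.deg - 1)).negOnePow • star (insR c (mark G)) g L +
      star (insR g (mark G)) c L := by
  have := ins_star h.mark hw c g L
  rw [star_insR_comm, smul_add, smul_smul, ← Int.negOnePow_add,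
    Int.negOnePow_even ((g.deg - 1) * (c.deg - 1) + (c.deg - 1) * (g.deg - 1))
      ⟨(g.deg - 1) * (c.deg - 1), by ring⟩, one_smul, ← add_assoc] at this
  exact this

theorem Cochain.circ_val (f g : Cochain A) (L : List (Elt A)) (s : Perversity n) (t : ℤ) :
    (f.circ g).val L s t = ins g (fun K => f.val K s t) L := rfl

theorem ins_mC_ins {w : Fin (n + 1) → ℕ} {s : Perversity n} {G : List (Elt A) → N}
    (h : IsMul w s G) (hw : Monotone w) (c : Cochain A) (L : List (Elt A)) :
    ins (mC A) (ins c G) L = c.deg.negOnePow • ins c.D G L +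
      (c.deg - 1).negOnePow • ins c (ins (mC A) G) L := by
  have h1 := ins_star h.mark hw (mC A) c L
  have h2 : star (mark (ins (mC A) G)) c L = star (sub (mC A) (mark G)) c L +
      (star (insR (mC A) (mark G)) c L + star (insL (mC A) (mark G)) c L) := by
    rw [← add_assoc, ← star_add, ← star_add]
    exact star_congr c L fun K a K' => mark_ins _ _ _ _ _
  rw [star_sub h.mark hw] at h2
  rw [← sub_eq_iff_eq_add'.2 h2] at h1
  have h3 : ins c.D G L = ins ((mC A).circ c) G L + c.deg.negOnePow • ins (c.circ (mC A)) G L :=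
    ins_comb h _ _ _ L
  refine h1.trans ?_
  rw [h3]
  simp only [star_mark, smul_add, smul_sub, smul_smul, ← Int.negOnePow_add]
  rw [Int.negOnePow_even _ ⟨c.deg, rfl⟩, one_smul,
    sgn_eq (x := (c.deg - 1) * ((mC A).deg - 1)) (y := c.deg - 1) (by simp [mC])]
  rw [Int.negOnePow_sub c.deg 1, Int.negOnePow_one, mul_neg_one, Units.neg_smul, Units.neg_smul]
  abel

/-- The differential of `f ∘ c`. -/
theorem Cochain.D_circ (f c : Cochain A) (L : List (Elt A)) (s : Perversity n) (t : ℤ) :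
    (f.circ c).D.val L s t = (f.D.circ c).val L s t +
      (f.deg - 1).negOnePow • (f.circ c.D).val L s t +
      (f.deg - 1).negOnePow • (f.cup c).val L s t +
      (f.deg * (c.deg - 1)).negOnePow • (c.cup f).val L s t := by
  have h1 := ins_star (mVal_isMul (A := A) s t).mark (fun _ _ _ => le_rfl) c f L
  rw [star_insR_mVal, star_insL_mVal] at h1
  have h2 := ins_mC_ins (f.fam.mul s t) f.mono c L
  have h3 : (f.D.circ c).val L s t = ins c (ins f fun K => mVal K s t) L +
      f.deg.negOnePow • ins c (ins (mC A) fun K => f.val K s t) L := by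
    rw [Cochain.circ_val, ← ins_units_smul, ← ins_add]; rfl
  have h4 : ins c (ins f fun K => mVal K s t) L = _ := h1
  rw [Cochain.D_val, h3, h4]
  change star (mark fun K => mVal K s t) (f.circ c) L +
    (f.deg + c.deg - 1).negOnePow • ins (mC A) (ins c fun K => f.val K s t) L = _
  rw [h2, Cochain.circ_val]
  simp only [negOnePow_eq_sgn, smul_add, smul_smul]
  push_cast
  generalize (f.deg : ZMod 2) = a
  generalize (c.deg : ZMod 2) = b
  rcases zmod_two_cases a with rfl | rfl <;> rcases zmod_two_cases b with rfl | rfl <;>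
    simp +decide [sgn] <;> abel

theorem Cochain.brk_val (f g : Cochain A) (L : List (Elt A)) (s : Perversity n) (t : ℤ) :
    (f.brk g).val L s t = (f.circ g).val L s t +
      (1 + (f.deg - 1) * (g.deg - 1)).negOnePow • (g.circ f).val L s t := rfl

theorem ins_of_val_eq_zero {w : Fin (n + 1) → ℕ} {s : Perversity n} {G : List (Elt A) → N}
    (h : IsMul w s G) {f : Cochain A} (e : ∀ L s t, f.val L s t = 0) (L : List (Elt A)) :
    ins f G L = 0 := by
  refine splitSum_eq_zero fun L₁ L' _ => splitSum_eq_zero fun L₂ L₃ _ => ?_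
  have : f.ent L₂ = ⟨_, _, 0⟩ := congrArg (Elt.mk _ _) (e L₂ _ _)
  rw [this, (h.slot L₁ L₃).map_zero, smul_zero]

/-- The differential of `[f, g]`, for a cocycle `g`. -/
theorem Cochain.D_brk (f : Cochain A) {g : Cochain A} (hg : Closed g) (L : List (Elt A))
    (s : Perversity n) (t : ℤ) : (f.brk g).D.val L s t = (f.D.brk g).val L s t := by
  have hD := closed_iff.1 hg
  have h1 : (f.brk g).D.val L s t = (f.circ g).D.val L s t +
      (1 + (f.deg - 1) * (g.deg - 1)).negOnePow • (g.circ f).D.val L s t := by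
    have e1 : ins (f.brk g) (fun K => mVal K s t) L = ins (f.circ g) (fun K => mVal K s t) L +
        (1 + (f.deg - 1) * (g.deg - 1)).negOnePow • ins (g.circ f) (fun K => mVal K s t) L :=
      ins_comb (mVal_isMul s t) _ _ _ L
    simp only [Cochain.D_val, Cochain.brk_val]
    rw [e1, ins_add, ins_units_smul]
    change _ + (f.deg + g.deg - 1).negOnePow • _ = _ + (f.deg + g.deg - 1).negOnePow • _ +
      _ • (_ + (g.deg + f.deg - 1).negOnePow • _)
    rw [add_comm g.deg f.deg, smul_add, smul_add, smul_comm (f.deg + g.deg - 1).negOnePow]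
    abel
  rw [h1, Cochain.D_circ, Cochain.D_circ, Cochain.brk_val]
  have e1 : (f.circ g.D).val L s t = 0 := ins_of_val_eq_zero (f.fam.mul s t) hD L
  have e2 : (g.D.circ f).val L s t = 0 := by
    rw [Cochain.circ_val]; simp only [hD]
    exact splitSum_eq_zero fun L₁ L' _ => splitSum_eq_zero fun L₂ L₃ _ => smul_zero _
  have e3 : f.D.deg = f.deg + 1 := by
    change 2 + f.deg - 1 = f.deg + 1; ring
  rw [e1, e2, e3]
  simp only [negOnePow_eq_sgn, smul_add, smul_smul, smul_zero, add_zero, zero_add]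
  push_cast
  generalize (f.deg : ZMod 2) = a
  generalize (g.deg : ZMod 2) = b
  rcases zmod_two_cases a with rfl | rfl <;> rcases zmod_two_cases b with rfl | rfl <;>
    simp +decide [sgn] <;> abel

theorem Cochain.brk_skew (f g : Cochain A) (L : List (Elt A)) (s : Perversity n) (t : ℤ) :
    (f.brk g).val L s t =
      (1 + (f.deg - 1) * (g.deg - 1)).negOnePow • (g.brk f).val L s t := by
  rw [Cochain.brk_val, Cochain.brk_val, smul_add, smul_smul, ← Int.negOnePow_add,
    Int.negOnePow_even (1 + (f.deg - 1) * (g.deg - 1) + (1 + (g.deg - 1) * (f.deg - 1)))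
      ⟨1 + (f.deg - 1) * (g.deg - 1), by ring⟩, one_smul, add_comm]

theorem Cochain.brk_brk (f g h : Cochain A) (L : List (Elt A)) (s : Perversity n) (t : ℤ) :
    ((f.brk g).brk h).val L s t =
      ins h (ins g fun K => f.val K s t) L +
      (1 + (f.deg - 1) * (g.deg - 1)).negOnePow • ins h (ins f fun K => g.val K s t) L +
      (1 + (f.deg + g.deg) * (h.deg - 1)).negOnePow • (ins (f.circ g) (fun K => h.val K s t) L +
      (1 + (f.deg - 1) * (g.deg - 1)).negOnePow • ins (g.circ f) (fun K => h.val K s t) L) := by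
  rw [Cochain.brk_val]
  have e1 : (h.circ (f.brk g)).val L s t = _ := ins_comb (h.fam.mul s t) _ _ _ L
  have e2 : ((f.brk g).circ h).val L s t = ins h (ins g fun K => f.val K s t) L +
      (1 + (f.deg - 1) * (g.deg - 1)).negOnePow • ins h (ins f fun K => g.val K s t) L := by
    rw [Cochain.circ_val, ← ins_units_smul, ← ins_add]; rfl
  rw [e1, e2]
  congr 1
  refine sgn_smul_congr ?_ rfl
  change (((1 + (f.deg + g.deg - 1 - 1) * (h.deg - 1) : ℤ)) : ZMod 2) = _
  push_cast; grind

theorem Cochain.brk_jacobi (f g h : Cochain A) (L : List (Elt A)) (s : Perversity n) (t : ℤ) :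
    ((f.brk g).brk h).val L s t = (f.brk (g.brk h)).val L s t +
      (1 + (f.deg - 1) * (g.deg - 1)).negOnePow • (g.brk (f.brk h)).val L s t := by
  rw [f.brk_skew, g.brk_skew (f.brk h)]
  simp only [Cochain.brk_brk]
  simp only [ins_ins (f.fam.mul s t) f.mono, ins_ins (g.fam.mul s t) g.mono,
    ins_ins (h.fam.mul s t) h.mono]
  change _ = (1 + (f.deg - 1) * (g.deg + h.deg - 1 - 1)).negOnePow • _ +
    _ • ((1 + (g.deg - 1) * (f.deg + h.deg - 1 - 1)).negOnePow • _)
  simp only [negOnePow_eq_sgn, smul_add, smul_smul]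
  push_cast
  generalize (f.deg : ZMod 2) = a
  generalize (g.deg : ZMod 2) = b
  generalize (h.deg : ZMod 2) = c
  rcases zmod_two_cases a with rfl | rfl <;> rcases zmod_two_cases b with rfl | rfl <;>
    rcases zmod_two_cases c with rfl | rfl <;> simp +decide [sgn] <;> abel

theorem insRR_eq_insR {v : Fin (n + 1) → ℕ} {s : Perversity n} {Γ : Marked A N}
    (h : Γ.IsMul v s) (hv : Monotone v) (f g : Cochain A) (K : List (Elt A)) (a : Elt A)
    (K' : List (Elt A)) : insRR f g Γ K a K' = insR (f.circ g) Γ K a K' := by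
  refine splitSum_congr fun K₁ K'' _ => splitSum_congr fun K₂ K₃ _ => ?_
  rw [((h.right K a).slot K₁ K₃).circ_ent (((pervSum_mono _).add (pervSum_mono _)).add
    (((pervSum_mono _).add a.perv.toFun_mono).add hv))]
  refine sgn_smul_congr ?_ rfl
  change (((f.deg + g.deg) * _ : ℤ) : ZMod 2) = (((f.deg + g.deg - 1 - 1) * _ : ℤ) : ZMod 2)
  push_cast; grind

/-- The differential of `f{c, g}`, for cocycles `f`, `c` and `g`. -/
theorem Closed.D_brace {f c g : Cochain A} (hf : Closed f) (hc : Closed c) (hg : Closed g)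
    (L : List (Elt A)) (s : Perversity n) (t : ℤ) :
    (f.deg + g.deg * (c.deg - 1)).negOnePow • (f.brace c g).D.val L s t =
      (f.circ (c.cup g)).val L s t - ((f.circ c).cup g).val L s t -
      ((f.deg - 1) * c.deg).negOnePow • (c.cup (f.circ g)).val L s t := by
  have hm := (mVal_isMul (A := A) s t)
  have h0 : Monotone (0 : Fin (n + 1) → ℕ) := fun _ _ _ => le_rfl
  have hΓ := hm.mark
  have hΓf := (f.fam.mul s t).mark
  have h1 : ins (mC A) (star (insR g (mark fun K => f.val K s t)) c) L = _ :=
    hc.ins_star (hΓf.insR f.mono g) (g.mono.add f.mono) L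
  have h2 : ∀ K a K', dMark (insR g (mark fun K => f.val K s t)) K a K' =
      (f.deg + g.deg).negOnePow • (subR f g (mark fun L => mVal L s t) K a K' +
        insR (f.circ g) (mark fun L => mVal L s t) K a K' +
        ((f.deg - 1) * (g.deg - 1)).negOnePow •
          sub f (insR g (mark fun L => mVal L s t)) K a K') -
      (g.deg - 1).negOnePow • subR (mC A) g (mark fun L => f.val L s t) K a K' := by
    intro K a K'
    have := hf.dMark_insR_mark hg (slot_ev s t) h0 K a K'
    simp only [Cochain.ev_ent] at this
    rw [← insRR_eq_insR hΓ h0]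
    exact this
  rw [star_congr c L h2, star_sub_fun, star_units_smul, star_add, star_add, star_units_smul,
    star_units_smul, star_subR hΓ h0, star_sub (hΓ.insR h0 g) (g.mono.add h0), star_insR_mVal,
    star_insR_mVal, star_subR hΓf f.mono] at h1
  have h3 : star (mark fun L => f.val L s t) ((mC A).brace c g) L =
      (1 + g.deg * (c.deg - 1)).negOnePow • (f.circ (c.cup g)).val L s t :=
    star_ent_smul hΓf (f := (mC A).brace c g) (g := c.cup g) (by
      change c.w + (g.w + 0) = c.w + g.w; rw [add_zero])
      (by change 2 + c.deg + g.deg - 2 = c.deg + g.deg; ring) _ (c.brace_mC g) L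
  rw [h3] at h1
  rw [Cochain.D_val]
  change _ • (_ + (f.deg + c.deg + g.deg - 2).negOnePow •
    ins (mC A) (star (insR g (mark fun K => f.val K s t)) c) L) = _
  rw [h1, star_mark]
  change _ • (_ + _ • _ • (_ • (_ + (1 + (f.deg + g.deg - 1) * (c.deg - 1)).negOnePow • _ +
    _ • (1 + g.deg * (f.deg + c.deg - 1 - 1)).negOnePow • _) - _)) = _
  simp only [negOnePow_eq_sgn, smul_add, smul_sub, smul_smul]
  push_cast
  generalize (f.deg : ZMod 2) = a
  generalize (g.deg : ZMod 2) = b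
  generalize (c.deg : ZMod 2) = d
  rcases zmod_two_cases a with rfl | rfl <;> rcases zmod_two_cases b with rfl | rfl <;>
    rcases zmod_two_cases d with rfl | rfl <;> simp +decide [sgn] <;> abel

theorem Cochain.cup_circ (c g f : Cochain A) (L : List (Elt A)) (s : Perversity n) (t : ℤ) :
    ((c.cup g).circ f).val L s t =
      ((f.deg - 1) * g.deg).negOnePow • ((c.circ f).cup g).val L s t +
      (c.cup (g.circ f)).val L s t := by
  simp only [Cochain.circ_val, Cochain.cup_val]
  rw [ins_splitSum, splitSum_units_smul, ← splitSum_add]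
  refine splitSum_congr fun L₁ L₂ _ => ?_
  rw [ins_sign, ins_units_smul, (slot_pmul_left (g.ent L₂) s t).circ_ent (toFun_mono _),
    (slot_pmul_right (c.ent L₁) s t).circ_ent (toFun_mono _)]
  simp only [smul_smul, ← Int.negOnePow_add]
  congr 1
  · exact sgn_smul_congr (by push_cast; grind) rfl
  · refine sgn_smul_congr ?_ rfl
    change _ = (((g.deg + f.deg - 1) * _ : ℤ) : ZMod 2)
    push_cast; grind

theorem Cochain.cup_add_left (f f' g : Cochain A) (hw : f'.w = f.w) (hd : f'.deg = f.deg)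
    (ε : ℤˣ) (L : List (Elt A)) (s : Perversity n) (t : ℤ) :
    ((f.comb f' hw hd ε).cup g).val L s t = (f.cup g).val L s t + ε • (f'.cup g).val L s t := by
  simp only [Cochain.cup_val, splitSum_units_smul, ← splitSum_add]
  refine splitSum_congr fun L₁ L₂ _ => ?_
  rw [(slot_pmul_left (g.ent L₂) s t).comb_ent hw hd, smul_add, smul_comm ε]

theorem Cochain.cup_add_right (f g g' : Cochain A) (hw : g'.w = g.w) (hd : g'.deg = g.deg)
    (ε : ℤˣ) (L : List (Elt A)) (s : Perversity n) (t : ℤ) :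
    (f.cup (g.comb g' hw hd ε)).val L s t = (f.cup g).val L s t + ε • (f.cup g').val L s t := by
  simp only [Cochain.cup_val, splitSum_units_smul, ← splitSum_add]
  refine splitSum_congr fun L₁ L₂ _ => ?_
  rw [(slot_pmul_right (f.ent L₁) s t).comb_ent hw hd, smul_add, smul_comm ε, hd]; rfl

/-- `[f, -]` is a derivation of the cup product, up to homotopy. -/
theorem Closed.brk_cup {f c g : Cochain A} (hf : Closed f) (hc : Closed c) (hg : Closed g)
    (L : List (Elt A)) (s : Perversity n) (t : ℤ) :
    (f.brk (c.cup g)).val L s t = ((f.brk c).cup g).val L s t +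
      ((f.deg - 1) * c.deg).negOnePow • (c.cup (f.brk g)).val L s t +
      (f.deg + g.deg * (c.deg - 1)).negOnePow • (f.brace c g).D.val L s t := by
  have h1 : ((f.brk c).cup g).val L s t = _ := Cochain.cup_add_left _ _ g _ _ _ L s t
  have h2 : (c.cup (f.brk g)).val L s t = _ := Cochain.cup_add_right c _ _ _ _ _ L s t
  rw [hf.D_brace hc hg, Cochain.brk_val, Cochain.cup_circ, h1, h2]
  change _ + (1 + (f.deg - 1) * (c.deg + g.deg - 1)).negOnePow • _ = _
  simp only [negOnePow_eq_sgn, smul_add, smul_smul]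
  push_cast
  generalize (f.deg : ZMod 2) = a
  generalize (g.deg : ZMod 2) = b
  generalize (c.deg : ZMod 2) = d
  rcases zmod_two_cases a with rfl | rfl <;> rcases zmod_two_cases b with rfl | rfl <;>
    rcases zmod_two_cases d with rfl | rfl <;> simp +decide [sgn] <;> abel

/-! ### Associativity and unit -/

section

variable {v w : Fin (n + 1) → ℕ} {s : Perversity n} {H : Elt A → N} {j : ℤ} {g : Raw A M}

theorem Slot.mul_eq (h : Slot v s H) {a b : Elt A} {c : Perversity n} {t : ℤ}
    (hc : a.perv.toFun + b.perv.toFun ≤ c.toFun) (hs : c.toFun + v ≤ s.toFun)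
    (ht : a.deg + b.deg = t) : H (a.mul b) = H ⟨c, t, a.pmul b c t⟩ := by
  subst ht
  rw [← a.map_pmul b _ (addLE_ceil hc) (ceil_le hc), h.nat _ _ _ _ (ceil_le hc) hs]
  rfl

theorem Slot.cup_ent (h : Slot v s H) (hv : Monotone v) (f g : Cochain A) {K : List (Elt A)}
    (hK : pervSum K + (f.w + g.w) + v ≤ s.toFun) : H ((f.cup g).ent K) =
      splitSum K fun K₁ K₂ => (g.deg * sdeg K₁).negOnePow • H ((f.ent K₁).mul (g.ent K₂)) := by
  have h₁ : pervSum K + (f.w + g.w) ≤ s.toFun := le_of_add_le_left hK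
  have h₂ := le_ceil h₁
  have h₃ : (ceil (pervSum K + (f.w + g.w))).toFun + v ≤ s.toFun :=
    ceil_add_le ((pervSum_mono K).add (f.cup g).mono) hv hK
  change H ⟨ceil (pervSum K + (f.w + g.w)), sdeg K + (f.deg + g.deg), (f.cup g).val K _ _⟩ = _
  rw [Cochain.cup_val, h.map_splitSum]
  refine splitSum_congr fun K₁ K₂ e => ?_
  rw [h.map_units_smul, h.mul_eq _ h₃]
  · rw [f.ent_deg, g.ent_deg, ← e, sdeg_append]; abel
  · refine addLE_ceil_ceil ((pervSum_mono _).add f.mono) ((pervSum_mono _).add g.mono)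
      (le_of_eq_of_le ?_ h₂)
    rw [← e, pervSum_append]; abel

/-- Associativity of the action. -/
theorem actV_actV (hw : Monotone w) (f f' : Cochain A) {L : List (Elt A)} {t : ℤ}
    (hs : pervSum L + (f.w + f'.w + w) ≤ s.toFun) (ht : sdeg L + (f.deg + f'.deg + j) = t) :
    actV f (f'.w + w) (f'.deg + j) (actV f' w j g) L s t = actV (f.cup f') w j g L s t := by
  have e1 : actV (f.cup f') w j g L s t = splitSum L fun X K₂ => splitSum X fun L₁ K₁ =>
      (j * sdeg X + f'.deg * sdeg L₁).negOnePow •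
        lactVal w j g s t ((f.ent L₁).mul (f'.ent K₁)) K₂ := by
    refine splitSum_congr fun X K₂ e => ?_
    rw [lactVal, pval, (slot_lact (M := M) (g K₂ _ _) s t).cup_ent (toFun_mono _) f f',
      splitSum_units_smul]
    · simp only [smul_smul, ← Int.negOnePow_add]; rfl
    · exact le_of_eq_of_le (add_comm _ _) (ceil_add_le
        (w := pervSum K₂ + w) (v := pervSum X + (f.w + f'.w)) ((pervSum_mono K₂).add hw)
        ((pervSum_mono X).add (f.cup f').mono)
        (le_of_eq_of_le (by rw [← e, pervSum_append]; abel) hs))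
  rw [e1, splitSum_nest]
  refine splitSum_congr fun L₁ L₂ e => ?_
  have h₀ : pervSum L₁ + f.w + (pervSum L₂ + (f'.w + w)) ≤ s.toFun :=
    le_of_eq_of_le (by rw [← e, pervSum_append]; abel) hs
  rw [lactVal, pval, actV, map_splitSum, splitSum_units_smul]
  refine splitSum_congr fun K₁ K₂ e' => ?_
  rw [Units.smul_def ((j * sdeg K₁).negOnePow), map_zsmul, ← Units.smul_def, smul_smul,
    ← Int.negOnePow_add]
  refine sgn_smul_congr ?_ (lactVal_lact hw _ _ _ ?_ ?_ ?_ ?_)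
  · rw [sdeg_append]; push_cast; ring
  · refine ceil_add_le ((pervSum_mono _).add f'.mono) ((pervSum_mono _).add hw)
      (le_of_eq_of_le ?_ (le_ceil (le_of_add_le_left (le_of_eq_of_le (add_comm _ _) h₀))))
    rw [← e', pervSum_append]; abel
  · exact addLE_ceil_ceil ((pervSum_mono _).add f.mono) ((pervSum_mono _).add (f'.mono.add hw)) h₀
  · rw [f'.ent_deg, ← e', sdeg_append]; abel
  · rw [f.ent_deg, ← ht, ← e, sdeg_append]; abel

theorem oneRaw_eq_zero {L : List (Elt A)} (h : L ≠ []) : oneRaw A L = fun _ _ => 0 := by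
  match L, h with
  | _ :: _, _ => rfl

theorem one_isMul (s : Perversity n) (t : ℤ) : IsMul 0 s fun L : List (Elt A) =>
    (oneRaw A L s t : A.X s t) where
  out L hL := by
    by_cases h : L = []
    · subst h
      exact absurd (fun _ => Nat.zero_le _) hL
    · rw [oneRaw_eq_zero h]
  slot L L' := Slot.zero.congr rfl fun x => by rw [oneRaw_eq_zero (by simp)]

/-- The unit cochain. -/
noncomputable def oneC (A : PDGA R n) : Cochain A where
  w := 0
  mono := fun _ _ _ => le_rfl
  deg := 0
  val := oneRaw A
  fam :=
    { shape := fun L s t h => by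
        match L with
        | [] =>
          simp only [oneRaw]
          rw [A.cast_of_ne s (by simpa [sdeg_nil] using h)]
          rfl
        | _ :: _ => rfl
      mul := one_isMul
      nat := fun L s s' t _ h' => by
        match L with
        | [] =>
          refine (A.map_cast s s' 0 t _).trans (congrArg (A.cast s' 0 t) ?_)
          exact A.map_map (fun _ => Nat.zero_le _) h' _ _
        | _ :: _ => exact map_zero _ }

theorem Slot.one_ent_nil (h : Slot v s H) (hs : v ≤ s.toFun) :
    H ((oneC A).ent []) = H ⟨0, 0, A.one⟩ := by
  refine (h.ent_eq (oneC A).fam (c := 0) (t := 0) ?_ ?_ ?_).trans ?_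
  · exact fun _ => le_rfl
  · exact le_of_eq_of_le (zero_add v) hs
  · rfl
  · change H ⟨0, 0, A.cast 0 0 0 (A.map 0 0 0 A.one)⟩ = _
    rw [A.cast_self, A.map_self]

theorem Slot.one_ent (h : Slot v s H) {L : List (Elt A)} (hL : L ≠ []) :
    H ((oneC A).ent L) = 0 := by
  have : (oneC A).ent L = ⟨_, _, 0⟩ :=
    congrArg (Elt.mk _ _) (congrFun (congrFun (oneRaw_eq_zero hL) _) _)
  rw [this, h.map_zero]

theorem actV_one (hg : Fam M.toPerverseComplex w j g) {L : List (Elt A)} {t : ℤ}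
    (hs : pervSum L + w ≤ s.toFun) (ht : sdeg L + j = t) :
    actV (oneC A) w j g L s t = g L s t := by
  have hl := slot_lact (M := M) (g L (ceil (pervSum L + w)) (sdeg L + j)) s t
  rw [actV, splitSum_eq_nil]
  · rw [sdeg_nil, mul_zero, Int.negOnePow_zero, one_smul, lactVal, pval,
      hl.one_ent_nil (ceil_le hs)]
    subst ht
    exact (M.one_lact (ceil_le hs) _ _).trans (hg.nat _ _ _ _ (le_ceil hs) (ceil_le hs))
  · intro L₁ L₂ h
    exact (congrArg _ ((slot_lact _ s t).one_ent h)).trans (smul_zero _)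

theorem actV_one_right (f : Cochain A) {L : List (Elt A)} {t : ℤ}
    (hs : pervSum L + f.w ≤ s.toFun) (ht : sdeg L + f.deg = t) :
    (f.cup (oneC A)).val L s t = f.val L s t := by
  have hl := slot_pmul_right (f.ent L) s t
  rw [Cochain.cup_val, splitSum_eq_self]
  · rw [hl.one_ent_nil (ceil_le hs), ← Cochain.ev_ent]
    subst ht
    change (0 * sdeg L).negOnePow • A.mul _ _ _ _ _ _ _ _ = _
    rw [zero_mul, Int.negOnePow_zero, one_smul]
    exact (A.mul_one (ceil_le hs) _ _).trans (A.cast_self _ _ _).symm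
  · intro L₁ L₂ h
    rw [(slot_pmul_right (f.ent L₁) s t).one_ent h, smul_zero]

theorem d_one (A : PDGA R n) (j : ℤ) : A.d 0 0 j A.one = 0 := by
  by_cases hj : 0 + 1 = j
  · subst hj
    have h : AddLE (0 : Perversity n) 0 0 := fun _ => le_rfl
    have := A.d_mul h (add_zero (0 : ℤ)) rfl rfl rfl A.one A.one
    rw [A.one_mul le_rfl, A.map_self, A.mul_one le_rfl, A.map_self, Int.negOnePow_zero, one_smul,
      A.one_mul le_rfl, A.map_self] at this
    simpa using this
  · rw [A.d_shape _ hj]; rfl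

theorem closed_one : Closed (oneC A) := by
  refine closed_iff.2 fun L s t => ?_
  have e1 : ins (mC A) (fun K => (oneC A).val K s t) L = 0 :=
    splitSum_eq_zero fun _ _ _ => splitSum_eq_zero fun _ _ _ => by
      change _ • oneRaw A _ s t = 0
      rw [oneRaw_eq_zero (by simp)]; exact smul_zero _
  rw [Cochain.D_val, e1, smul_zero, add_zero, ins_short _ fun L h => mVal_eq_zero h s t]
  match L with
  | [] =>
    rw [lastSum, splitSum_nil]
    change ((oneC A).ent []).d.ev s t + 0 + 0 = 0
    rw [(slot_d_ev s t).one_ent_nil fun _ => Nat.zero_le _]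
    simp only [Elt.ev, Elt.d, d_one, add_zero]
    exact (congrArg (A.cast s (0 + 1) t) (A.map 0 s (0 + 1)).map_zero).trans
      (A.cast s (0 + 1) t).map_zero
  | [a] =>
    rw [lastSum, splitSum_cons, splitSum_nil]
    change ((oneC A).ent [a]).d.ev s t + ((0 - 1) * (a.deg - 1)).negOnePow •
      (a.deg.negOnePow • a.pmul ((oneC A).ent []) s t) +
      (((oneC A).ent []).deg.negOnePow • ((oneC A).ent []).pmul a s t + 0) = 0
    rw [(slot_d_ev s t).one_ent (by simp)]
    by_cases ha : a.perv ≤ s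
    · rw [(slot_pmul_left a s t).one_ent_nil ha, (slot_pmul_right a s t).one_ent_nil ha]
      by_cases ht : a.deg = t
      · subst ht
        have h1 : a.pmul ⟨0, 0, A.one⟩ s a.deg = a.ev s a.deg := by
          rw [Elt.ev, A.cast_self]; exact A.mul_one ha _ _
        have h2 : Elt.pmul ⟨0, 0, A.one⟩ a s a.deg = a.ev s a.deg := by
          rw [Elt.ev, A.cast_self]; exact A.one_mul ha _ _
        rw [h1, h2, smul_smul, ← Int.negOnePow_add,
          sgn_eq (x := (0 - 1) * (a.deg - 1) + a.deg) (y := 1) (by push_cast; grind)]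
        simp [Cochain.ent_deg, sdeg_nil, oneC]
      · simp only [Elt.pmul]
        rw [A.mul_shape fun h => ht (by simpa using h.2),
          A.mul_shape fun h => ht (by simpa using h.2)]
        simp
    · rw [(slot_pmul_left a s t).out _ fun h => ha (le_of_add_le_left
        (le_of_eq_of_le (add_comm _ _) h)),
        (slot_pmul_right a s t).out _ fun h => ha (le_of_add_le_left
        (le_of_eq_of_le (add_comm _ _) h))]
      simp
  | a :: b :: L =>
    rw [lastSum_eq_zero]
    · change ((oneC A).ent _).d.ev s t + _ • (a.deg.negOnePow • a.pmul ((oneC A).ent _) s t) + 0 = 0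
      rw [(slot_d_ev s t).one_ent (by simp), (slot_pmul_right a s t).one_ent (by simp)]
      simp
    · intro L₁ c h
      have : L₁ ≠ [] := by rintro rfl; simp at h
      change _ • Elt.pmul _ c s t = 0
      rw [(slot_pmul_left c s t).one_ent this, smul_zero]

end

/-! ### Change of the perverse degree -/

section

variable {v w : Fin (n + 1) → ℕ} {s r : Perversity n} {q j : ℤ} {f g : Raw A M}

theorem restr_of_le (f : Raw A M) {L : List (Elt A)} (h : pervSum L + r.toFun ≤ s.toFun) (t : ℤ) :
    restr r f L s t = f L s t := if_pos h

theorem restr_of_not_le (f : Raw A M) {L : List (Elt A)} (h : ¬ (pervSum L + r.toFun ≤ s.toFun))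
    (t : ℤ) : restr r f L s t = 0 := if_neg h

theorem add_le_of_le {u : Fin (n + 1) → ℕ} (h : w ≤ r.toFun) (h' : u + r.toFun ≤ s.toFun) :
    u + w ≤ s.toFun := le_trans (add_le_add_right h u) h'

theorem Fam.restr (hf : Fam M.toPerverseComplex w q f) (h : w ≤ r.toFun) :
    Fam M.toPerverseComplex r.toFun q (restr r f) where
  shape L s t ht := by
    simp only [PerverseHochschild.restr]
    split
    · exact hf.shape L s t ht
    · rfl
  mul s t :=
    { out := fun L hL => restr_of_not_le f hL t
      slot := fun L L' =>
        { out := fun x hx => restr_of_not_le f (fun h' => hx (le_of_eq_of_le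
            (by rw [pervSum_mid]; abel) h')) t
          add := fun p i a b => by
            by_cases h' : pervSum L + pervSum L' + p.toFun + r.toFun ≤ s.toFun
            · have e (x : A.X p i) : pervSum (L ++ ⟨p, i, x⟩ :: L') + r.toFun ≤ s.toFun := by
                rw [pervSum_mid]; exact h'
              rw [restr_of_le f (e _), restr_of_le f (e _), restr_of_le f (e _)]
              exact ((hf.mul s t).slot L L').add p i a b
            · have e (x : A.X p i) : ¬ pervSum (L ++ ⟨p, i, x⟩ :: L') + r.toFun ≤ s.toFun := by
                rw [pervSum_mid]; exact h'
              rw [restr_of_not_le f (e _), restr_of_not_le f (e _), restr_of_not_le f (e _),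
                add_zero]
          smul := fun p i c a => by
            by_cases h' : pervSum L + pervSum L' + p.toFun + r.toFun ≤ s.toFun
            · have e (x : A.X p i) : pervSum (L ++ ⟨p, i, x⟩ :: L') + r.toFun ≤ s.toFun := by
                rw [pervSum_mid]; exact h'
              rw [restr_of_le f (e _), restr_of_le f (e _)]
              exact ((hf.mul s t).slot L L').smul p i c a
            · have e (x : A.X p i) : ¬ pervSum (L ++ ⟨p, i, x⟩ :: L') + r.toFun ≤ s.toFun := by
                rw [pervSum_mid]; exact h'
              rw [restr_of_not_le f (e _), restr_of_not_le f (e _), smul_zero]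
          nat := fun p₁ p₂ i a h₁ h₂ => by
            have h₃ : pervSum L + pervSum L' + p₂.toFun + r.toFun ≤ s.toFun :=
              le_of_eq_of_le (by abel) h₂
            have h₄ : pervSum L + pervSum L' + p₁.toFun + r.toFun ≤ s.toFun :=
              le_trans (add_le_add_left (add_le_add_right (show p₁.toFun ≤ p₂.toFun from h₁) _) _)
                h₃
            rw [restr_of_le f (by rw [pervSum_mid]; exact h₃),
              restr_of_le f (by rw [pervSum_mid]; exact h₄)]
            exact ((hf.mul s t).slot L L').nat p₁ p₂ i a h₁ (le_of_eq_of_le (by abel)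
              (add_le_of_le h h₃)) } }
  nat L s s' t h₁ h₂ := by
    rw [restr_of_le f h₁, restr_of_le f (le_trans h₁ h₂)]
    exact hf.nat L s s' t (add_le_of_le h h₁) h₂

theorem Normalized.restr (hf : ∀ s t, Normalized fun L => f L s t) (s : Perversity n) (t : ℤ) :
    Normalized fun L => restr r f L s t := by
  intro L L' p
  simp only [PerverseHochschild.restr]
  split
  · exact hf s t L L' p
  · rfl

theorem PSlot.restr {H : ∀ p i, M.X p i → N} (h : PSlot M.toPerverseComplex v s H)
    (hv : Monotone v) (hf : Fam M.toPerverseComplex w q f) (hr : w ≤ r.toFun) {L : List (Elt A)}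
    (hL : pervSum L + r.toFun + v ≤ s.toFun) :
    pval r.toFun q (PerverseHochschild.restr r f) H L = pval w q f H L := by
  have h₁ := le_ceil (le_of_add_le_left hL)
  have h₂ := ceil_add_le ((pervSum_mono L).add r.toFun_mono) hv hL
  rw [h.ent_eq (hf.restr hr) h₁ h₂ rfl, h.ent_eq hf (add_le_of_le hr h₁) h₂ rfl, restr_of_le f h₁]

theorem gD_restr (hf : Fam M.toPerverseComplex w q f) (hr : w ≤ r.toFun)
    {L : List (Elt A)} (hL : pervSum L + r.toFun ≤ s.toFun) (t : ℤ) :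
    gD r.toFun q (restr r f) L s t = gD w q f L s t := by
  unfold gD
  rw [restr_of_le f hL]
  congr 1
  · congr 1
    · congr 2
      refine splitSum_congr fun L₁ L' h₁ => splitSum_congr fun L₂ L₃ h₂ => congrArg _ ?_
      refine restr_of_le f (pervSum_ent_le (f := mC A) L₁ L₂ L₃ r.toFun_mono ?_) t
      rw [h₂, h₁]
      exact le_of_eq_of_le (by simp [mC]) hL
    · refine headSum_congr fun a L' e => congrArg _ ?_
      refine (pslot_lact a s t).restr a.perv.toFun_mono hf hr (le_of_eq_of_le ?_ hL)
      rw [← e, pervSum_cons]; abel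
  · refine lastSum_congr fun L' b e => congrArg _ ?_
    refine (pslot_ract b s t).restr b.perv.toFun_mono hf hr (le_of_eq_of_le ?_ hL)
    rw [← e, pervSum_mid, pervSum_nil]; abel

theorem gD_out (hf : Fam M.toPerverseComplex w q f) (hw : Monotone w) {L : List (Elt A)}
    (hL : ¬ (pervSum L + w ≤ s.toFun)) (t : ℤ) : gD w q f L s t = 0 := by
  unfold gD
  rw [(hf.mul s (t - 1)).out L hL, ((hf.mul s t).ins hw (mC A)).out L fun h => hL
    (le_of_eq_of_le (by simp [mC]) h), headSum_eq_zero, lastSum_eq_zero]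
  · simp
  · intro L' b e
    refine (congrArg _ ((pslot_ract b s t).ent_eq_zero hf fun h => hL (le_of_eq_of_le ?_ h))).trans
      (smul_zero _)
    rw [← e, pervSum_mid, pervSum_nil]; abel
  · intro a L' e
    refine (congrArg _ ((pslot_lact a s t).ent_eq_zero hf fun h => hL (le_of_eq_of_le ?_ h))).trans
      (smul_zero _)
    rw [← e, pervSum_cons]; abel

theorem gD_shape (hf : Fam M.toPerverseComplex w q f) (hw : Monotone w) {L : List (Elt A)} {t : ℤ}
    (ht : sdeg L + q + 1 ≠ t) : gD w q f L s t = 0 := by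
  unfold gD
  rw [hf.shape L s (t - 1) (by omega), (hf.ins hw (mC A)).shape L s t
    (by simp only [mC]; omega), headSum_eq_zero, lastSum_eq_zero]
  · simp
  · intro L' b e
    rw [ractVal, pval, M.ract_shape fun h => ht ?_]
    · simp
    · rw [← h.2, ← e, sdeg_mid, sdeg_nil]; ring
  · intro a L' e
    rw [lactVal, pval, M.lact_shape fun h => ht ?_]
    · simp
    · rw [← h.2, ← e, sdeg_cons]; ring

end

section

variable {v w : Fin (n + 1) → ℕ} {s r : Perversity n} {q j : ℤ} {g : Raw A M}

/-- The structure morphism from perverse degree `≤ r` to perverse degree `r`. -/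
noncomputable def Cochain.restr (f : Cochain A) (r : Perversity n) (h : f.w ≤ r.toFun) :
    Cochain A where
  w := r.toFun
  mono := r.toFun_mono
  deg := f.deg
  val := PerverseHochschild.restr (M := A.regular) r f.val
  fam := Fam.restr (M := A.regular) f.fam h

theorem Slot.restr_ent {H : Elt A → N} (h : Slot v s H) (hv : Monotone v) (f : Cochain A)
    (hr : f.w ≤ r.toFun) {L : List (Elt A)} (hL : pervSum L + r.toFun + v ≤ s.toFun) :
    H ((f.restr r hr).ent L) = H (f.ent L) :=
  PSlot.restr (M := A.regular) h.pslot hv f.fam hr hL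

theorem ins_restr {G : List (Elt A) → N} (hG : IsMul v s G) (hv : Monotone v) (f : Cochain A)
    (hr : f.w ≤ r.toFun) {L : List (Elt A)} (hL : pervSum L + (r.toFun + v) ≤ s.toFun) :
    ins (f.restr r hr) G L = ins f G L := by
  refine splitSum_congr fun L₁ L' e₁ => splitSum_congr fun L₂ L₃ e₂ => congrArg _ ?_
  refine (hG.slot L₁ L₃).restr_ent (((pervSum_mono _).add (pervSum_mono _)).add hv) f hr ?_
  refine le_of_eq_of_le ?_ hL
  rw [← e₁, ← e₂]; simp only [pervSum_append]; abel

theorem Cochain.restr_circ (f g : Cochain A) (hr : f.w ≤ r.toFun) {L : List (Elt A)} (t : ℤ)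
    (hL : pervSum L + (g.w + r.toFun) ≤ s.toFun) :
    ((f.restr r hr).circ g).val L s t = (f.circ g).val L s t := by
  rw [Cochain.circ_val, Cochain.circ_val]
  refine splitSum_congr fun L₁ L' e₁ => splitSum_congr fun L₂ L₃ e₂ => congrArg _ ?_
  refine restr_of_le (M := A.regular) f.val (pervSum_ent_le L₁ L₂ L₃ r.toFun_mono ?_) t
  rw [e₂, e₁]; exact hL

theorem Cochain.circ_restr (f g : Cochain A) (hr : g.w ≤ r.toFun) {L : List (Elt A)} (t : ℤ)
    (hL : pervSum L + (r.toFun + f.w) ≤ s.toFun) :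
    (f.circ (g.restr r hr)).val L s t = (f.circ g).val L s t :=
  ins_restr (f.fam.mul s t) f.mono g hr hL

theorem Cochain.restr_brk (f g : Cochain A) (hr : f.w ≤ r.toFun) {L : List (Elt A)} (t : ℤ)
    (hL : pervSum L + (r.toFun + g.w) ≤ s.toFun) :
    ((f.restr r hr).brk g).val L s t = (f.brk g).val L s t := by
  rw [Cochain.brk_val, Cochain.brk_val, f.restr_circ g hr t (by rwa [add_comm g.w]),
    g.circ_restr f hr t hL]
  rfl

theorem Cochain.brk_restr (f g : Cochain A) (hr : g.w ≤ r.toFun) {L : List (Elt A)} (t : ℤ)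
    (hL : pervSum L + (f.w + r.toFun) ≤ s.toFun) :
    (f.brk (g.restr r hr)).val L s t = (f.brk g).val L s t := by
  rw [Cochain.brk_val, Cochain.brk_val, g.restr_circ f hr t hL,
    f.circ_restr g hr t (by rwa [add_comm _ f.w])]
  rfl

theorem actV_restr (hg : Fam M.toPerverseComplex w j g) (hr : w ≤ r.toFun)
    (f : Cochain A) {L : List (Elt A)} (t : ℤ) (hL : pervSum L + (f.w + r.toFun) ≤ s.toFun) :
    actV f r.toFun j (restr r g) L s t = actV f w j g L s t := by
  refine splitSum_congr fun L₁ L₂ e => congrArg _ ?_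
  refine (pslot_lact (f.ent L₁) s t).restr (toFun_mono _) hg hr ?_
  refine le_of_eq_of_le (add_comm _ _) (ceil_add_le ((pervSum_mono _).add f.mono)
    ((pervSum_mono _).add r.toFun_mono) (le_of_eq_of_le ?_ hL))
  rw [← e, pervSum_append]; abel

theorem restr_actV (hw : Monotone w) (f : Cochain A) (hr : f.w ≤ r.toFun)
    {L : List (Elt A)} (t : ℤ) (hL : pervSum L + (r.toFun + w) ≤ s.toFun) :
    actV (f.restr r hr) w j g L s t = actV f w j g L s t := by
  refine splitSum_congr fun L₁ L₂ e => congrArg _ ?_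
  refine (slot_lact (M := M) _ s t).restr_ent (toFun_mono _) f hr ?_
  refine le_of_eq_of_le (add_comm _ _) (ceil_add_le ((pervSum_mono _).add hw)
    ((pervSum_mono _).add r.toFun_mono) (le_of_eq_of_le ?_ hL))
  rw [← e, pervSum_append]; abel

theorem actV_congr {f f' : Cochain A} (hw : f.w = f'.w) (hd : f.deg = f'.deg)
    (e : ∀ L s t, f.val L s t = f'.val L s t) (L : List (Elt A)) (t : ℤ) :
    actV f w j g L s t = actV f' w j g L s t :=
  splitSum_congr fun L₁ _ _ => congrArg _ ((slot_lact (M := M) _ s t).ent_congr hw hd e L₁)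

theorem actV_zero (f : Cochain A) (hg : ∀ L s t, g L s t = 0) (L : List (Elt A)) (t : ℤ) :
    actV f w j g L s t = 0 :=
  splitSum_eq_zero fun L₁ L₂ _ => by rw [lactVal, pval, hg, map_zero, smul_zero]

theorem zero_actV {f : Cochain A} (hf : ∀ L s t, f.val L s t = 0) (L : List (Elt A)) (t : ℤ) :
    actV f w j g L s t = 0 :=
  splitSum_eq_zero fun L₁ L₂ _ => by
    have : f.ent L₁ = ⟨_, _, 0⟩ := congrArg (Elt.mk _ _) (hf L₁ _ _)
    rw [this]
    exact (congrArg _ ((slot_lact (M := M) _ s t).map_zero _ _)).trans (smul_zero _)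

end

/-! ### Normalization -/

/-- The values of `f` vanish on the unit. -/
def Cochain.Norm (f : Cochain A) : Prop := ∀ s t, Normalized fun L => f.val L s t

/-- `Γ` vanishes when an entry different from the marked one is the unit. -/
structure Marked.Normalized (Γ : Marked A N) : Prop where
  left : ∀ K K₂ p a K', Γ (K ++ ⟨p, 0, A.map 0 p 0 A.one⟩ :: K₂) a K' = 0
  right : ∀ K a K' K₂ p, Γ K a (K' ++ ⟨p, 0, A.map 0 p 0 A.one⟩ :: K₂) = 0

section

variable {v w : Fin (n + 1) → ℕ} {s r : Perversity n} {q j : ℤ} {g : Raw A M}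

theorem Slot.norm_ent {H : Elt A → N} (h : Slot v s H) {f : Cochain A} (hf : f.Norm) :
    PerverseHochschild.Normalized fun L => H (f.ent L) := fun L L' p => by
  have : f.ent (L ++ ⟨p, 0, A.map 0 p 0 A.one⟩ :: L') = ⟨_, _, 0⟩ :=
    congrArg (Elt.mk _ _) (hf _ _ L L' p)
  simp only [this, h.map_zero]

theorem Normalized.mark {G : List (Elt A) → N} (hG : PerverseHochschild.Normalized G) :
    Marked.Normalized (mark G) where
  left K K₂ p a K' := by
    rw [PerverseHochschild.mark, List.append_assoc, List.cons_append]; exact hG _ _ _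
  right K a K' K₂ p := by
    rw [PerverseHochschild.mark, ← List.cons_append, ← List.append_assoc]; exact hG _ _ _

theorem Marked.Normalized.star {Γ : Marked A N} (hΓ : Γ.Normalized) (h : Γ.IsMul v s)
    {c : Cochain A} (hc : c.Norm) : PerverseHochschild.Normalized (star Γ c) := by
  intro L L' p
  simp only [PerverseHochschild.star, splitSum_append_cons]
  rw [splitSum_eq_zero, splitSum_eq_zero, add_zero]
  · exact fun L₁ L₂ _ => splitSum_eq_zero fun _ _ _ => by rw [hΓ.left, smul_zero]
  · intro L₁ L₂ _
    rw [splitSum_eq_zero, splitSum_eq_zero, add_zero]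
    · exact fun K₁ K₂ _ => 
      (congrArg _ ((h.mid L₁ K₂).norm_ent hc L₂ K₁ p)).trans (smul_zero _)
    · exact fun K₁ K₂ _ => by rw [hΓ.right, smul_zero]

theorem Normalized.ins {G : List (Elt A) → N} (hG : PerverseHochschild.Normalized G)
    (h : PerverseHochschild.IsMul v s G) {c : Cochain A} (hc : c.Norm) :
    PerverseHochschild.Normalized (ins c G) := hG.mark.star h.mark hc

theorem Marked.Normalized.insR {Γ : Marked A N} (hΓ : Γ.Normalized) (h : Γ.IsMul v s)
    {c : Cochain A} (hc : c.Norm) : Marked.Normalized (insR c Γ) where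
  left K K₂ p a K' :=
    splitSum_eq_zero fun _ _ _ => splitSum_eq_zero fun _ _ _ => by rw [hΓ.left, smul_zero]
  right K a K' K₂ p := by
    rw [insR_eq_ins]
    have := Normalized.ins (G := Γ K a) (fun L L' p => hΓ.right K a L L' p) (h.right K a) hc
    rw [this, smul_zero]

theorem Cochain.Norm.circ {f g : Cochain A} (hf : f.Norm) (hg : g.Norm) : (f.circ g).Norm :=
  fun s t => (hf s t).ins (f.fam.mul s t) hg

theorem Cochain.Norm.brace {f c g : Cochain A} (hf : f.Norm) (hc : c.Norm) (hg : g.Norm) :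
    (f.brace c g).Norm := fun s t =>
  ((hf s t).mark.insR (f.fam.mul s t).mark hg).star ((f.fam.mul s t).mark.insR f.mono g) hc

theorem Cochain.Norm.brk {f g : Cochain A} (hf : f.Norm) (hg : g.Norm) : (f.brk g).Norm := by
  intro s t L L' p
  have h1 := hf.circ hg s t L L' p
  have h2 := hg.circ hf s t L L' p
  simp only at h1 h2
  simp only [Cochain.brk_val, h1, h2, smul_zero, add_zero]

theorem Normalized.actV {f : Cochain A} (hf : f.Norm)
    (hg : ∀ s t, PerverseHochschild.Normalized fun L => g L s t) (s : Perversity n) (t : ℤ) :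
    PerverseHochschild.Normalized fun L => actV f w j g L s t := by
  intro L L' p
  simp only [PerverseHochschild.actV, splitSum_append_cons]
  rw [splitSum_eq_zero, splitSum_eq_zero, add_zero]
  · intro L₁ L₂ _
    exact (congrArg _ ((slot_lact (M := M) _ s t).norm_ent hf L L₁ p)).trans (smul_zero _)
  · intro L₁ L₂ _
    have := hg (ceil (pervSum (L₂ ++ ⟨p, 0, A.map 0 p 0 A.one⟩ :: L') + w))
      (sdeg (L₂ ++ ⟨p, 0, A.map 0 p 0 A.one⟩ :: L') + j) L₂ L' p
    simp only at this
    rw [lactVal, pval, this, map_zero, smul_zero]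

theorem oneC_norm : (oneC A).Norm := fun s t L L' p => by
  change oneRaw A _ s t = 0
  rw [oneRaw_eq_zero (by simp)]

end

/-! ### Cocycles and coboundaries -/

theorem mem_cocycles {p : Perversity n} {q : ℤ} {f : Raw A M} :
    f ∈ cocycles A M p q ↔ f ∈ HC A M p q ∧ ∀ L s t, gD p.toFun q f L s t = 0 := by
  rw [cocycles, Submodule.mem_inf, LinearMap.mem_ker]
  refine and_congr_right fun h => ?_
  have hf := (mem_HC.1 h).1
  constructor
  · intro e L s t
    rw [← hochD_eq_gD hf, e]; rfl
  · intro e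
    funext L s t
    rw [hochD_eq_gD hf, e]; rfl

/-- A cochain with values in `A`, as a bundled family. -/
noncomputable def Cochain.ofHC {p : Perversity n} {q : ℤ} {f : Raw A A.regular}
    (hf : f ∈ HC A A.regular p q) : Cochain A where
  w := p.toFun
  mono := p.toFun_mono
  deg := q
  val := f
  fam := (mem_HC.1 hf).1

theorem Cochain.ofHC_norm {p : Perversity n} {q : ℤ} {f : Raw A A.regular}
    (hf : f ∈ HC A A.regular p q) : (Cochain.ofHC hf).Norm := (mem_HC.1 hf).2

theorem closed_ofHC {p : Perversity n} {q : ℤ} {f : Raw A A.regular}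
    (hf : f ∈ cocycles A A.regular p q) : Closed (Cochain.ofHC hf.1) :=
  closed_iff.2 fun L s t => by
    rw [← gD_regular]; exact (mem_cocycles.1 hf).2 L s t

theorem Closed.gD {f : Cochain A} (hf : Closed f) (L : List (Elt A)) (s : Perversity n) (t : ℤ) :
    gD (M := A.regular) f.w f.deg f.val L s t = 0 := by
  rw [gD_regular]; exact closed_iff.1 hf L s t

section

variable {w : Fin (n + 1) → ℕ} {r : Perversity n} {q : ℤ} {X Y : Raw A M}

theorem restr_mem_HC (hX : Fam M.toPerverseComplex w q X) (hr : w ≤ r.toFun)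
    (hN : ∀ s t, Normalized fun L => X L s t) : restr r X ∈ HC A M r q :=
  mem_HC.2 ⟨hX.restr hr, Normalized.restr hN⟩

theorem restr_mem_cocycles (hX : Fam M.toPerverseComplex w q X) (hr : w ≤ r.toFun)
    (hN : ∀ s t, Normalized fun L => X L s t)
    (h : ∀ L (s : Perversity n) t, pervSum L + r.toFun ≤ s.toFun → sdeg L + q + 1 = t →
      gD w q X L s t = 0) : restr r X ∈ cocycles A M r q := by
  refine mem_cocycles.2 ⟨restr_mem_HC hX hr hN, fun L s t => ?_⟩
  by_cases hL : pervSum L + r.toFun ≤ s.toFun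
  · by_cases ht : sdeg L + q + 1 = t
    · rw [gD_restr hX hr hL, h L s t hL ht]
    · exact gD_shape (hX.restr hr) r.toFun_mono ht
  · exact gD_out (hX.restr hr) r.toFun_mono hL t

theorem ext_HC {p : Perversity n} {f g : Raw A M} (hf : f ∈ HC A M p q) (hg : g ∈ HC A M p q)
    (h : ∀ L (s : Perversity n) t, pervSum L + p.toFun ≤ s.toFun → sdeg L + q = t →
      f L s t = g L s t) : f = g := by
  funext L s t
  by_cases hL : pervSum L + p.toFun ≤ s.toFun ∧ sdeg L + q = t
  · exact h L s t hL.1 hL.2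
  · rw [hf.1 L s t hL, hg.1 L s t hL]

theorem mem_coboundaries {p : Perversity n} {f : Raw A M} (hf : f ∈ HC A M p (q + 1))
    (hY : Fam M.toPerverseComplex w q Y) (hr : w ≤ p.toFun)
    (hN : ∀ s t, Normalized fun L => Y L s t) (ε : ℤˣ)
    (h : ∀ L (s : Perversity n) t, pervSum L + p.toFun ≤ s.toFun → sdeg L + q + 1 = t →
      f L s t = ε • gD w q Y L s t) : f ∈ coboundaries A M p (q + 1) := by
  have hY' := restr_mem_HC hY hr hN
  have e : f = ε • hochD p q (restr p Y) := by
    funext L s t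
    change _ = ε • hochD p q (restr p Y) L s t
    rw [hochD_eq_gD (hY.restr hr)]
    by_cases hL : pervSum L + p.toFun ≤ s.toFun
    · by_cases ht : sdeg L + q + 1 = t
      · rw [gD_restr hY hr hL, h L s t hL ht]
      · rw [gD_shape (hY.restr hr) p.toFun_mono ht, hf.1 L s t fun h' => ht (by rw [← h'.2]; ring),
          smul_zero]
    · rw [gD_out (hY.restr hr) p.toFun_mono hL, hf.1 L s t fun h' => hL h'.1, smul_zero]
  rw [e]
  have hm : hochD p q (restr p Y) ∈ coboundaries A M p (q + 1) := by
    have : q + 1 - 1 = q := by ring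
    rw [coboundaries, this]
    exact Submodule.mem_map_of_mem hY'
  rcases Int.units_eq_one_or ε with rfl | rfl
  · rwa [one_smul]
  · rw [Units.neg_smul, one_smul]; exact neg_mem hm

theorem HH.mk_eq_iff {p : Perversity n} {f g : Raw A M} (hf : f ∈ cocycles A M p q)
    (hg : g ∈ cocycles A M p q) : HH.mk f hf = HH.mk g hg ↔ f - g ∈ coboundaries A M p q := by
  rw [HH.mk, HH.mk, Submodule.Quotient.eq]; rfl

theorem HH.mk_eq_of_homotopy {p : Perversity n} {f g : Raw A M}
    (hf : f ∈ cocycles A M p (q + 1)) (hg : g ∈ cocycles A M p (q + 1))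
    (hY : Fam M.toPerverseComplex w q Y) (hr : w ≤ p.toFun)
    (hN : ∀ s t, Normalized fun L => Y L s t) (ε : ℤˣ)
    (h : ∀ L (s : Perversity n) t, pervSum L + p.toFun ≤ s.toFun → sdeg L + q + 1 = t →
      f L s t = g L s t + ε • gD w q Y L s t) : HH.mk f hf = HH.mk g hg :=
  (HH.mk_eq_iff hf hg).2 <| mem_coboundaries (Submodule.sub_mem _ hf.1 hg.1) hY hr hN ε
    fun L s t hL ht => by
      change f L s t - g L s t = _
      rw [h L s t hL ht]; abel

theorem HH.mk_congr {p : Perversity n} {f g : Raw A M} (hf : f ∈ cocycles A M p q)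
    (hg : g ∈ cocycles A M p q)
    (h : ∀ L (s : Perversity n) t, pervSum L + p.toFun ≤ s.toFun → sdeg L + q = t →
      f L s t = g L s t) : HH.mk f hf = HH.mk g hg := by
  obtain rfl := ext_HC hf.1 hg.1 h
  rfl

end

/-! ### Maps on cohomology -/

section

variable {M₁ M₂ M₃ : Bimodule A} {p₁ p₂ p₃ : Perversity n} {i₁ i₂ i₃ : ℤ}

theorem HH.exists_rep (x : HH A M p₁ i₁) : ∃ (f : Raw A M) (hf : f ∈ cocycles A M p₁ i₁),
    x = HH.mk f hf := by
  obtain ⟨⟨f, hf⟩, rfl⟩ := Submodule.Quotient.mk_surjective _ x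
  exact ⟨f, hf, rfl⟩

/-- The map on cohomology induced by `F`. -/
theorem HH.exists_lift (F : Raw A M₁ → Raw A M₂)
    (hZ : ∀ f ∈ cocycles A M₁ p₁ i₁, F f ∈ cocycles A M₂ p₂ i₂)
    (hB : ∀ f ∈ cocycles A M₁ p₁ i₁, f ∈ coboundaries A M₁ p₁ i₁ → F f ∈ coboundaries A M₂ p₂ i₂)
    (hadd : ∀ f ∈ cocycles A M₁ p₁ i₁, ∀ g ∈ cocycles A M₁ p₁ i₁, F (f + g) = F f + F g)
    (hsmul : ∀ (c : R), ∀ f ∈ cocycles A M₁ p₁ i₁, F (c • f) = c • F f) :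
    ∃ φ : HH A M₁ p₁ i₁ →ₗ[R] HH A M₂ p₂ i₂, ∀ (f : Raw A M₁) (hf : f ∈ cocycles A M₁ p₁ i₁),
      φ (HH.mk f hf) = HH.mk (F f) (hZ f hf) := by
  refine ⟨Submodule.liftQ _
    { toFun := fun f => HH.mk (F f.1) (hZ f.1 f.2)
      map_add' := fun f g => ?_
      map_smul' := fun c f => ?_ } ?_, fun f hf => rfl⟩
  · exact congrArg (Submodule.Quotient.mk (p := (coboundaries A M₂ p₂ i₂).submoduleOf
      (cocycles A M₂ p₂ i₂))) (Subtype.ext (hadd f.1 f.2 g.1 g.2))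
  · exact congrArg (Submodule.Quotient.mk (p := (coboundaries A M₂ p₂ i₂).submoduleOf
      (cocycles A M₂ p₂ i₂))) (Subtype.ext (hsmul c f.1 f.2))
  · intro f hf
    rw [LinearMap.mem_ker]
    exact (Submodule.Quotient.mk_eq_zero _).2 (hB f.1 f.2 hf)

/-- The bilinear map on cohomology induced by `F`. -/
theorem HH.exists_lift₂ (F : Raw A M₁ → Raw A M₂ → Raw A M₃)
    (hZ : ∀ f ∈ cocycles A M₁ p₁ i₁, ∀ g ∈ cocycles A M₂ p₂ i₂, F f g ∈ cocycles A M₃ p₃ i₃)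
    (hB₁ : ∀ f ∈ cocycles A M₁ p₁ i₁, f ∈ coboundaries A M₁ p₁ i₁ →
      ∀ g ∈ cocycles A M₂ p₂ i₂, F f g ∈ coboundaries A M₃ p₃ i₃)
    (hB₂ : ∀ f ∈ cocycles A M₁ p₁ i₁, ∀ g ∈ cocycles A M₂ p₂ i₂,
      g ∈ coboundaries A M₂ p₂ i₂ → F f g ∈ coboundaries A M₃ p₃ i₃)
    (hadd₁ : ∀ f ∈ cocycles A M₁ p₁ i₁, ∀ f' ∈ cocycles A M₁ p₁ i₁,
      ∀ g ∈ cocycles A M₂ p₂ i₂, F (f + f') g = F f g + F f' g)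
    (hsmul₁ : ∀ (c : R), ∀ f ∈ cocycles A M₁ p₁ i₁, ∀ g ∈ cocycles A M₂ p₂ i₂,
      F (c • f) g = c • F f g)
    (hadd₂ : ∀ f ∈ cocycles A M₁ p₁ i₁, ∀ g ∈ cocycles A M₂ p₂ i₂,
      ∀ g' ∈ cocycles A M₂ p₂ i₂, F f (g + g') = F f g + F f g')
    (hsmul₂ : ∀ (c : R), ∀ f ∈ cocycles A M₁ p₁ i₁, ∀ g ∈ cocycles A M₂ p₂ i₂,
      F f (c • g) = c • F f g) :
    ∃ φ : HH A M₁ p₁ i₁ →ₗ[R] HH A M₂ p₂ i₂ →ₗ[R] HH A M₃ p₃ i₃,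
      ∀ (f : Raw A M₁) (g : Raw A M₂) (hf : f ∈ cocycles A M₁ p₁ i₁)
        (hg : g ∈ cocycles A M₂ p₂ i₂),
        φ (HH.mk f hf) (HH.mk g hg) = HH.mk (F f g) (hZ f hf g hg) := by
  choose ψ hψ using fun f : cocycles A M₁ p₁ i₁ => HH.exists_lift (F f.1) (hZ f.1 f.2)
    (hB₂ f.1 f.2) (hadd₂ f.1 f.2) (fun c => hsmul₂ c f.1 f.2)
  refine ⟨Submodule.liftQ _
    { toFun := ψ
      map_add' := fun f f' => ?_
      map_smul' := fun c f => ?_ } ?_, fun f g hf hg => hψ ⟨f, hf⟩ g hg⟩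
  · refine LinearMap.ext fun x => ?_
    obtain ⟨g, hg, rfl⟩ := HH.exists_rep x
    rw [LinearMap.add_apply, hψ, hψ, hψ]
    exact congrArg (Submodule.Quotient.mk (p := (coboundaries A M₃ p₃ i₃).submoduleOf
      (cocycles A M₃ p₃ i₃))) (Subtype.ext (hadd₁ f.1 f.2 f'.1 f'.2 g hg))
  · refine LinearMap.ext fun x => ?_
    obtain ⟨g, hg, rfl⟩ := HH.exists_rep x
    rw [LinearMap.smul_apply, hψ, hψ]
    exact congrArg (Submodule.Quotient.mk (p := (coboundaries A M₃ p₃ i₃).submoduleOf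
      (cocycles A M₃ p₃ i₃))) (Subtype.ext (hsmul₁ c f.1 f.2 g hg))
  · intro f hf
    rw [LinearMap.mem_ker]
    refine LinearMap.ext fun x => ?_
    obtain ⟨g, hg, rfl⟩ := HH.exists_rep x
    change ψ f _ = 0
    rw [hψ]
    exact (Submodule.Quotient.mk_eq_zero _).2 (hB₁ f.1 f.2 hf g hg)

end

theorem restr_add (r : Perversity n) (f g : Raw A M) : restr r (f + g) = restr r f + restr r g := by
  funext L s t
  by_cases h : pervSum L + r.toFun ≤ s.toFun
  · simp only [Pi.add_apply, restr_of_le _ h]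
  · simp only [Pi.add_apply, restr_of_not_le _ h, add_zero]

theorem restr_smul (r : Perversity n) (c : R) (f : Raw A M) : restr r (c • f) = c • restr r f := by
  funext L s t
  by_cases h : pervSum L + r.toFun ≤ s.toFun
  · simp only [Pi.smul_apply, restr_of_le _ h]
  · simp only [Pi.smul_apply, restr_of_not_le _ h, smul_zero]

theorem exists_of_mem_coboundaries {p : Perversity n} {q : ℤ} {f : Raw A M}
    (hf : f ∈ coboundaries A M p (q + 1)) :
    ∃ h ∈ HC A M p q, ∀ L s t, f L s t = gD p.toFun q h L s t := by
  have : q + 1 - 1 = q := by ring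
  rw [coboundaries, this] at hf
  obtain ⟨h, hh, rfl⟩ := hf
  exact ⟨h, hh, fun L s t => hochD_eq_gD (mem_HC.1 hh).1 L s t⟩

theorem HH.exists_res {p p' : Perversity n} (h : p ≤ p') (i : ℤ) :
    ∃ φ : HH A M p i →ₗ[R] HH A M p' i, ∀ (f : Raw A M) (hf : f ∈ cocycles A M p i),
      ∃ h' : restr p' f ∈ cocycles A M p' i, φ (HH.mk f hf) = HH.mk _ h' := by
  have hZ : ∀ f ∈ cocycles A M p i, restr p' f ∈ cocycles A M p' i := fun f hf =>
    restr_mem_cocycles (mem_HC.1 hf.1).1 h (mem_HC.1 hf.1).2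
      fun L s t _ _ => (mem_cocycles.1 hf).2 L s t
  obtain ⟨φ, hφ⟩ := HH.exists_lift (restr p') hZ (fun f hf hb => by
    obtain ⟨i, rfl⟩ : ∃ j, i = j + 1 := ⟨i - 1, by ring⟩
    obtain ⟨g, hg, e⟩ := exists_of_mem_coboundaries hb
    refine mem_coboundaries (hZ f hf).1 (mem_HC.1 hg).1 h (mem_HC.1 hg).2 1 fun L s t hL ht => ?_
    rw [restr_of_le f hL, e, one_smul])
    (fun f _ g _ => restr_add p' f g) (fun c f _ => restr_smul p' c f)
  exact ⟨φ, fun f hf => ⟨hZ f hf, hφ f hf⟩⟩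

theorem actRaw_eq {p q : Perversity n} {i j : ℤ} (f : Cochain A) (hf : f.w = p.toFun)
    (hi : f.deg = i) (g : Raw A M) : actRaw p q i j f.val g = actV f q.toFun j g := by
  obtain ⟨w, mono, deg, val, fam⟩ := f
  subst hf hi
  rfl

section

variable (p q : Perversity n) (i j : ℤ) (c : R) (f f' : Raw A A.regular) (g g' : Raw A M)

theorem actRaw_add_left :
    actRaw p q i j (f + f') g = actRaw p q i j f g + actRaw p q i j f' g := by
  funext L s t
  refine Eq.trans (splitSum_congr fun L₁ L₂ _ => ?_) (splitSum_add L _ _)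
  rw [Pi.add_apply, Pi.add_apply, Pi.add_apply, ← smul_add]
  exact congrArg _ (LinearMap.map_add₂ _ _ _ _)

theorem actRaw_smul_left : actRaw p q i j (c • f) g = c • actRaw p q i j f g := by
  funext L s t
  refine Eq.trans (splitSum_congr fun L₁ L₂ _ => ?_) (splitSum_smul c L _)
  exact (congrArg _ (LinearMap.map_smul₂ _ _ _ _)).trans (smul_comm _ _ _)

theorem actRaw_add_right :
    actRaw p q i j f (g + g') = actRaw p q i j f g + actRaw p q i j f g' := by
  funext L s t
  refine Eq.trans (splitSum_congr fun L₁ L₂ _ => ?_) (splitSum_add L _ _)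
  exact (congrArg _ (map_add _ _ _)).trans (smul_add _ _ _)

theorem actRaw_smul_right : actRaw p q i j f (c • g) = c • actRaw p q i j f g := by
  funext L s t
  refine Eq.trans (splitSum_congr fun L₁ L₂ _ => ?_) (splitSum_smul c L _)
  exact (congrArg _ (map_smul _ _ _)).trans (smul_comm _ _ _)

end

theorem HH.exists_act {p q r : Perversity n} {i j k : ℤ} (h : AddLE p q r) (e : i + j = k) :
    ∃ φ : HH A A.regular p i →ₗ[R] HH A M q j →ₗ[R] HH A M r k,
      ∀ (f : Raw A A.regular) (g : Raw A M) (hf : f ∈ cocycles A A.regular p i)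
        (hg : g ∈ cocycles A M q j), ∃ h' : restr r (actRaw p q i j f g) ∈ cocycles A M r k,
        φ (HH.mk f hf) (HH.mk g hg) = HH.mk _ h' := by
  have hZ : ∀ f ∈ cocycles A A.regular p i, ∀ g ∈ cocycles A M q j,
      restr r (actRaw p q i j f g) ∈ cocycles A M r k := fun f hf g hg => by
    subst e
    rw [show actRaw p q i j f g = actV (Cochain.ofHC hf.1) q.toFun j g from rfl]
    have hX := (mem_HC.1 hg.1).1.actV q.toFun_mono (Cochain.ofHC hf.1)
    have hN := fun s t => Normalized.actV (w := q.toFun) (j := j) (Cochain.ofHC_norm hf.1)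
      (mem_HC.1 hg.1).2 s t
    refine restr_mem_cocycles hX h hN fun L s t hL ht => ?_
    refine (gD_actV (mem_HC.1 hg.1).1 q.toFun_mono (Cochain.ofHC hf.1)
      (add_le_of_le h hL) ht).trans ?_
    rw [zero_actV (closed_iff.1 (closed_ofHC hf)), actV_zero _ (mem_cocycles.1 hg).2, smul_zero,
      add_zero]
  obtain ⟨φ, hφ⟩ := HH.exists_lift₂ (fun f g => restr r (actRaw p q i j f g)) hZ
    (fun f hf hb g hg => by
      obtain ⟨i, rfl⟩ : ∃ j, i = j + 1 := ⟨i - 1, by ring⟩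
      obtain rfl : k = i + j + 1 := by omega
      obtain ⟨f', hf', e'⟩ := exists_of_mem_coboundaries hb
      refine mem_coboundaries (hZ f hf g hg).1
        ((mem_HC.1 hg.1).1.actV q.toFun_mono (Cochain.ofHC hf')) h
        (Normalized.actV (Cochain.ofHC_norm hf') (mem_HC.1 hg.1).2) 1 fun L s t hL ht => ?_
      rw [restr_of_le _ hL, one_smul]
      have := gD_actV (mem_HC.1 hg.1).1 q.toFun_mono (Cochain.ofHC hf') (add_le_of_le h hL) ht
      rw [actV_zero _ (mem_cocycles.1 hg).2, smul_zero, add_zero] at this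
      refine Eq.trans ?_ this.symm
      refine actV_congr (f := Cochain.ofHC hf.1) (f' := (Cochain.ofHC hf').D) ?_ ?_
        (fun L s t => ?_) L t
      · exact (add_zero _).symm
      · change i + 1 = 2 + i - 1; ring
      · rw [← gD_regular]; exact e' L s t)
    (fun f hf g hg hb => by
      obtain ⟨j, rfl⟩ : ∃ i, j = i + 1 := ⟨j - 1, by ring⟩
      obtain rfl : k = i + j + 1 := by omega
      obtain ⟨g', hg', e'⟩ := exists_of_mem_coboundaries hb
      refine mem_coboundaries (hZ f hf g hg).1
        ((mem_HC.1 hg').1.actV q.toFun_mono (Cochain.ofHC hf.1)) h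
        (Normalized.actV (Cochain.ofHC_norm hf.1) (mem_HC.1 hg').2) i.negOnePow
        fun L s t hL ht => ?_
      have := gD_actV (mem_HC.1 hg').1 q.toFun_mono (Cochain.ofHC hf.1) (add_le_of_le h hL) ht
      rw [zero_actV (closed_iff.1 (closed_ofHC hf)), zero_add] at this
      obtain rfl : g = gD q.toFun j g' := by funext L s t; exact e' L s t
      rw [restr_of_le _ hL]
      refine Eq.trans ?_ (congrArg _ this.symm)
      rw [smul_smul, ← Int.negOnePow_add]
      change _ = (i + i).negOnePow • _
      rw [Int.negOnePow_even _ ⟨_, rfl⟩, one_smul]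
      rfl)
    (fun f _ f' _ g _ => by rw [← restr_add, actRaw_add_left])
    (fun c f _ g _ => by rw [← restr_smul, actRaw_smul_left])
    (fun f _ g _ g' _ => by rw [← restr_add, actRaw_add_right])
    (fun c f _ g _ => by rw [← restr_smul, actRaw_smul_right])
  exact ⟨φ, fun f g hf hg => ⟨hZ f hf g hg, hφ f g hf hg⟩⟩

theorem circRaw_eq {q : Perversity n} {j : ℤ} (f g : Cochain A) (hg : g.w = q.toFun)
    (hj : g.deg = j) : circRaw q j f.val g.val = (f.circ g).val := by
  obtain ⟨w, mono, deg, val, fam⟩ := g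
  subst hg hj
  rfl

theorem bracketRaw_eq {p q : Perversity n} {i j : ℤ} (f g : Cochain A) (hf : f.w = p.toFun)
    (hi : f.deg = i) (hg : g.w = q.toFun) (hj : g.deg = j) :
    bracketRaw p q i j f.val g.val = (f.brk g).val := by
  funext L s t
  change circRaw q j f.val g.val L s t -
    (((i - 1) * (j - 1)).negOnePow • circRaw p i g.val f.val L s t) = _
  rw [circRaw_eq f g hg hj, circRaw_eq g f hf hi, Cochain.brk_val, hi, hj, add_comm 1,
    Int.negOnePow_succ, Units.neg_smul, ← sub_eq_add_neg]
  rfl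

theorem ins_congr {w : Fin (n + 1) → ℕ} {s : Perversity n} {G : List (Elt A) → N}
    (h : IsMul w s G) {f g : Cochain A} (hw : f.w = g.w) (hd : f.deg = g.deg)
    (e : ∀ L s t, f.val L s t = g.val L s t) (L : List (Elt A)) : ins f G L = ins g G L :=
  splitSum_congr fun L₁ _ _ => splitSum_congr fun L₂ L₃ _ => by
    rw [(h.slot L₁ L₃).ent_congr hw hd e, hd]

theorem Cochain.brk_congr {f f' : Cochain A} (g : Cochain A) (hw : f.w = f'.w)
    (hd : f.deg = f'.deg) (e : ∀ L s t, f.val L s t = f'.val L s t) (L : List (Elt A))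
    (s : Perversity n) (t : ℤ) : (f.brk g).val L s t = (f'.brk g).val L s t := by
  rw [Cochain.brk_val, Cochain.brk_val, Cochain.circ_val, Cochain.circ_val, Cochain.circ_val,
    Cochain.circ_val, ins_congr (g.fam.mul s t) hw hd e, hd]
  simp only [e]

theorem Cochain.zero_brk {f : Cochain A} (g : Cochain A)
    (e : ∀ L s t, f.val L s t = 0) (L : List (Elt A))
    (s : Perversity n) (t : ℤ) : (f.brk g).val L s t = 0 := by
  rw [Cochain.brk_val, Cochain.circ_val, Cochain.circ_val, ins_of_val_eq_zero (g.fam.mul s t) e,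
    smul_zero, add_zero]
  simp only [e]
  exact splitSum_eq_zero fun L₁ L' _ => splitSum_eq_zero fun L₂ L₃ _ => smul_zero _

theorem Closed.brk {f g : Cochain A} (hf : Closed f) (hg : Closed g) : Closed (f.brk g) :=
  closed_iff.2 fun L s t => by
    rw [f.D_brk hg]; exact Cochain.zero_brk (f := f.D) g (closed_iff.1 hf) L s t

theorem circRaw_add_left (q : Perversity n) (j : ℤ) (f f' g : Raw A A.regular) :
    circRaw q j (f + f') g = circRaw q j f g + circRaw q j f' g := by
  funext L s t
  simp only [circRaw, Pi.add_apply, smul_add, splitSum_add]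

theorem circRaw_smul_left (q : Perversity n) (j : ℤ) (c : R) (f g : Raw A A.regular) :
    circRaw q j (c • f) g = c • circRaw q j f g := by
  funext L s t
  simp only [circRaw, Pi.smul_apply, smul_comm _ c, splitSum_smul]

theorem circRaw_add_right {p q : Perversity n} {i j : ℤ} {f : Raw A A.regular}
    (hf : f ∈ HC A A.regular p i) (g g' : Raw A A.regular) :
    circRaw q j f (g + g') = circRaw q j f g + circRaw q j f g' := by
  funext L s t
  refine Eq.trans ?_ (splitSum_add L _ _)
  refine splitSum_congr fun L₁ L' _ => ?_
  refine Eq.trans ?_ (splitSum_add L' _ _)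
  refine splitSum_congr fun L₂ L₃ _ => ?_
  exact (congrArg _ ((((mem_HC.1 hf).1.mul s t).slot L₁ L₃).add
    (ceil (pervSum L₂ + q.toFun)) (sdeg L₂ + j) (g L₂ _ _) (g' L₂ _ _))).trans (smul_add _ _ _)

theorem circRaw_smul_right {p q : Perversity n} {i j : ℤ} {f : Raw A A.regular}
    (hf : f ∈ HC A A.regular p i) (c : R) (g : Raw A A.regular) :
    circRaw q j f (c • g) = c • circRaw q j f g := by
  funext L s t
  refine Eq.trans ?_ (splitSum_smul c L _)
  refine splitSum_congr fun L₁ L' _ => ?_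
  refine Eq.trans ?_ (splitSum_smul c L' _)
  refine splitSum_congr fun L₂ L₃ _ => ?_
  exact (congrArg _ ((((mem_HC.1 hf).1.mul s t).slot L₁ L₃).smul
    (ceil (pervSum L₂ + q.toFun)) (sdeg L₂ + j) c (g L₂ _ _))).trans (smul_comm _ _ _)

theorem HH.exists_bracket {p q r : Perversity n} {i j k : ℤ} (h : AddLE p q r)
    (e : i + j = k + 1) :
    ∃ φ : HH A A.regular p i →ₗ[R] HH A A.regular q j →ₗ[R] HH A A.regular r k,
      ∀ (f g : Raw A A.regular) (hf : f ∈ cocycles A A.regular p i)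
        (hg : g ∈ cocycles A A.regular q j),
        ∃ h' : restr r (bracketRaw p q i j f g) ∈ cocycles A A.regular r k,
        φ (HH.mk f hf) (HH.mk g hg) = HH.mk _ h' := by
  have hw : q.toFun + p.toFun ≤ r.toFun := le_of_eq_of_le (add_comm _ _) h
  have hZ : ∀ f ∈ cocycles A A.regular p i, ∀ g ∈ cocycles A A.regular q j,
      restr r (bracketRaw p q i j f g) ∈ cocycles A A.regular r k := fun f hf g hg => by
    obtain rfl : k = i + j - 1 := by omega
    rw [show bracketRaw p q i j f g = ((Cochain.ofHC hf.1).brk (Cochain.ofHC hg.1)).val from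
      bracketRaw_eq (Cochain.ofHC hf.1) (Cochain.ofHC hg.1) rfl rfl rfl rfl]
    exact restr_mem_cocycles (M := A.regular)
      ((Cochain.ofHC hf.1).brk (Cochain.ofHC hg.1)).fam hw
      ((Cochain.ofHC_norm hf.1).brk (Cochain.ofHC_norm hg.1))
      fun L s t _ _ => ((closed_ofHC hf).brk (closed_ofHC hg)).gD L s t
  obtain ⟨φ, hφ⟩ := HH.exists_lift₂ (fun f g => restr r (bracketRaw p q i j f g)) hZ
    (fun f hf hb g hg => by
      obtain ⟨i, rfl⟩ : ∃ j, i = j + 1 := ⟨i - 1, by ring⟩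
      obtain ⟨k, rfl⟩ : ∃ j, k = j + 1 := ⟨k - 1, by ring⟩
      obtain rfl : k = i + j - 1 := by omega
      obtain ⟨f', hf', e'⟩ := exists_of_mem_coboundaries hb
      refine mem_coboundaries (M := A.regular) (hZ f hf g hg).1
        ((Cochain.ofHC hf').brk (Cochain.ofHC hg.1)).fam hw
        ((Cochain.ofHC_norm hf').brk (Cochain.ofHC_norm hg.1)) 1 fun L s t hL ht => ?_
      refine Eq.trans ?_ ((one_smul _ _).trans ((gD_regular
        ((Cochain.ofHC hf').brk (Cochain.ofHC hg.1)) L s t).trans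
        ((Cochain.ofHC hf').D_brk (closed_ofHC hg) L s t))).symm
      rw [restr_of_le _ hL, show bracketRaw p q (i + 1) j f g =
        ((Cochain.ofHC hf.1).brk (Cochain.ofHC hg.1)).val from
        bracketRaw_eq (Cochain.ofHC hf.1) (Cochain.ofHC hg.1) rfl rfl rfl rfl]
      refine Cochain.brk_congr (f := Cochain.ofHC hf.1) (f' := (Cochain.ofHC hf').D)
        (Cochain.ofHC hg.1) ?_ ?_ (fun L s t => ?_) L s t
      · exact (add_zero _).symm
      · change i + 1 = 2 + i - 1; ring
      · rw [← gD_regular]; exact e' L s t)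
    (fun f hf g hg hb => by
      obtain ⟨j, rfl⟩ : ∃ i, j = i + 1 := ⟨j - 1, by ring⟩
      obtain ⟨k, rfl⟩ : ∃ j, k = j + 1 := ⟨k - 1, by ring⟩
      obtain rfl : k = j + i - 1 := by omega
      obtain ⟨g', hg', e'⟩ := exists_of_mem_coboundaries hb
      refine mem_coboundaries (M := A.regular) (hZ f hf g hg).1
        ((Cochain.ofHC hg').brk (Cochain.ofHC hf.1)).fam h
        ((Cochain.ofHC_norm hg').brk (Cochain.ofHC_norm hf.1))
        (1 + (i - 1) * (j + 1 - 1)).negOnePow fun L s t hL ht => ?_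
      refine Eq.trans ?_ (congrArg _ ((gD_regular
        ((Cochain.ofHC hg').brk (Cochain.ofHC hf.1)) L s t).trans
        ((Cochain.ofHC hg').D_brk (closed_ofHC hf) L s t))).symm
      rw [restr_of_le _ hL, show bracketRaw p q i (j + 1) f g =
        ((Cochain.ofHC hf.1).brk (Cochain.ofHC hg.1)).val from
        bracketRaw_eq (Cochain.ofHC hf.1) (Cochain.ofHC hg.1) rfl rfl rfl rfl]
      refine (Cochain.brk_skew _ _ L s t).trans (congrArg _ ?_)
      refine Cochain.brk_congr (f := Cochain.ofHC hg.1) (f' := (Cochain.ofHC hg').D)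
        (Cochain.ofHC hf.1) ?_ ?_ (fun L s t => ?_) L s t
      · exact (add_zero _).symm
      · change j + 1 = 2 + j - 1; ring
      · rw [← gD_regular]; exact e' L s t)
    (fun f hf f' hf' g hg => by
      rw [← restr_add]
      refine congrArg _ ?_
      rw [bracketRaw, bracketRaw, bracketRaw, circRaw_add_left, circRaw_add_right hg.1, smul_add]
      abel)
    (fun c f hf g hg => by
      rw [← restr_smul]
      refine congrArg _ ?_
      rw [bracketRaw, bracketRaw, circRaw_smul_left, circRaw_smul_right hg.1, smul_sub,
        smul_comm c])
    (fun f hf g hg g' hg' => by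
      rw [← restr_add]
      refine congrArg _ ?_
      rw [bracketRaw, bracketRaw, bracketRaw, circRaw_add_left, circRaw_add_right hf.1, smul_add]
      abel)
    (fun c f hf g hg => by
      rw [← restr_smul]
      refine congrArg _ ?_
      rw [bracketRaw, bracketRaw, circRaw_smul_left, circRaw_smul_right hf.1, smul_sub,
        smul_comm c])
  exact ⟨φ, fun f g hf hg => ⟨hZ f hf g hg, hφ f g hf hg⟩⟩

theorem one_mem_cocycles (A : PDGA R n) : oneRaw A ∈ cocycles A A.regular 0 0 :=
  mem_cocycles.2 ⟨mem_HC.2 ⟨(oneC A).fam, oneC_norm⟩, fun L s t => closed_one.gD L s t⟩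

/-! ### Combinations of classes -/

section

variable {p : Perversity n} {q : ℤ} {f g : Raw A M}

theorem HH.mk_add (hf : f ∈ cocycles A M p q) (hg : g ∈ cocycles A M p q) :
    HH.mk f hf + HH.mk g hg = HH.mk (f + g) (Submodule.add_mem _ hf hg) := rfl

theorem units_smul_mem {V : Type*} [AddCommGroup V] [Module R V] (S : Submodule R V) (ε : ℤˣ)
    {x : V} (hx : x ∈ S) : ε • x ∈ S := by
  rcases Int.units_eq_one_or ε with rfl | rfl
  · rwa [one_smul]
  · rw [Units.neg_smul, one_smul]; exact neg_mem hx

theorem HH.mk_units_smul (ε : ℤˣ) (hf : f ∈ cocycles A M p q) :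
    ε • HH.mk f hf = HH.mk (ε • f) (units_smul_mem _ ε hf) := by
  rcases Int.units_eq_one_or ε with rfl | rfl
  · simp only [one_smul]
  · simp only [Units.neg_smul, one_smul]; rfl

end

/-! ### Representatives of classes -/

section

variable {p r : Perversity n} {q : ℤ} {X Y : Raw A M} {x y : HH A M p q}

/-- The class `x` is represented by the restriction of `X`. -/
def IsRep (X : Raw A M) (x : HH A M p q) : Prop :=
  ∃ h : restr p X ∈ cocycles A M p q, x = HH.mk _ h

theorem restr_congr (h : ∀ L (s : Perversity n) t, pervSum L + r.toFun ≤ s.toFun →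
    X L s t = Y L s t) : restr r X = restr r Y := by
  funext L s t
  by_cases hL : pervSum L + r.toFun ≤ s.toFun
  · rw [restr_of_le _ hL, restr_of_le _ hL, h L s t hL]
  · rw [restr_of_not_le _ hL, restr_of_not_le _ hL]

theorem IsRep.of_eq (h : X ∈ cocycles A M p q) (e : X = restr p Y) : IsRep Y (HH.mk X h) := by
  subst e
  exact ⟨h, rfl⟩

theorem restr_self (h : X ∈ HC A M p q) : restr p X = X := by
  funext L s t
  by_cases hL : pervSum L + p.toFun ≤ s.toFun
  · rw [restr_of_le X hL]
  · rw [restr_of_not_le X hL, h.1 L s t fun h' => hL h'.1]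

theorem IsRep.exists (x : HH A M p q) : ∃ X ∈ cocycles A M p q, IsRep X x := by
  obtain ⟨X, hX, rfl⟩ := HH.exists_rep x
  exact ⟨X, hX, IsRep.of_eq hX (restr_self hX.1).symm⟩

theorem IsRep.add (hx : IsRep X x) (hy : IsRep Y y) : IsRep (X + Y) (x + y) := by
  obtain ⟨h1, rfl⟩ := hx
  obtain ⟨h2, rfl⟩ := hy
  rw [HH.mk_add]
  exact IsRep.of_eq _ (restr_add p X Y).symm

theorem IsRep.units_smul (ε : ℤˣ) (hx : IsRep X x) : IsRep (ε • X) (ε • x) := by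
  obtain ⟨h1, rfl⟩ := hx
  rw [HH.mk_units_smul]
  refine IsRep.of_eq _ ?_
  funext L s t
  by_cases hL : pervSum L + p.toFun ≤ s.toFun
  · rw [restr_of_le _ hL]; exact congrArg _ (restr_of_le _ hL t)
  · rw [restr_of_not_le _ hL]
    change ε • restr p X L s t = 0
    rw [restr_of_not_le _ hL, smul_zero]

theorem IsRep.congr (hx : IsRep X x) (hy : IsRep Y y)
    (h : ∀ L (s : Perversity n) t, pervSum L + p.toFun ≤ s.toFun → sdeg L + q = t →
      X L s t = Y L s t) : x = y := by
  obtain ⟨h1, rfl⟩ := hx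
  obtain ⟨h2, rfl⟩ := hy
  refine HH.mk_congr h1 h2 fun L s t hL ht => ?_
  rw [restr_of_le _ hL, restr_of_le _ hL, h L s t hL ht]

theorem IsRep.homotopy {w : Fin (n + 1) → ℕ} {j : ℤ} {Z : Raw A M} (hx : IsRep X x)
    (hy : IsRep Y y) (hZ : Fam M.toPerverseComplex w j Z) (hr : w ≤ p.toFun)
    (hN : ∀ s t, Normalized fun L => Z L s t) (e : j + 1 = q) (ε : ℤˣ)
    (h : ∀ L (s : Perversity n) t, pervSum L + p.toFun ≤ s.toFun → sdeg L + j + 1 = t →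
      X L s t = Y L s t + ε • gD w j Z L s t) : x = y := by
  subst e
  obtain ⟨h1, rfl⟩ := hx
  obtain ⟨h2, rfl⟩ := hy
  refine HH.mk_eq_of_homotopy h1 h2 hZ hr hN ε fun L s t hL ht => ?_
  rw [restr_of_le _ hL, restr_of_le _ hL, h L s t hL ht]

theorem restr_restr {p' : Perversity n} (h : p ≤ p') (X : Raw A M) :
    restr p' (restr p X) = restr p' X := by
  funext L s t
  by_cases hL : pervSum L + p'.toFun ≤ s.toFun
  · rw [restr_of_le _ hL, restr_of_le _ hL, restr_of_le _ (add_le_of_le h hL)]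
  · rw [restr_of_not_le _ hL, restr_of_not_le _ hL]

end

/-- The class `x` is represented by the restriction of `f`. -/
structure Cochain.Rep (f : Cochain A) {p : Perversity n} {q : ℤ} (x : HH A A.regular p q) :
    Prop where
  deg : f.deg = q
  le : f.w ≤ p.toFun
  rep : IsRep (M := A.regular) f.val x

section

variable {p q r : Perversity n} {i j k : ℤ} {x : HH A A.regular p i} {y : HH A A.regular q j}
  {f g : Cochain A} (H : InducedOperations A)

theorem Cochain.Rep.exists (x : HH A A.regular p i) :
    ∃ f : Cochain A, f.Rep x ∧ Closed f ∧ f.Norm := by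
  obtain ⟨X, hX, h⟩ := IsRep.exists x
  exact ⟨Cochain.ofHC hX.1, ⟨rfl, le_rfl, h⟩, closed_ofHC hX, Cochain.ofHC_norm hX.1⟩

theorem restr_actRaw_restr {w : Fin (n + 1) → ℕ} {g : Raw A M}
    (hg : Fam M.toPerverseComplex w j g) (hw : Monotone w) (hf : f.w ≤ p.toFun)
    (hq : w ≤ q.toFun) (h : AddLE p q r) :
    restr r (actRaw p q f.deg j (restr (M := A.regular) p f.val) (restr q g)) =
      restr r (actV f w j g) := by
  refine restr_congr fun L s t hL => ?_
  have hL' : pervSum L + (p.toFun + q.toFun) ≤ s.toFun := add_le_of_le h hL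
  refine Eq.trans (congrFun (congrFun (congrFun
    (actRaw_eq (f.restr p hf) rfl rfl (restr q g)) L) s) t) ?_
  rw [actV_restr hg hq (f.restr p hf) t hL', restr_actV hw f hf t
    ((add_le_add_right (add_le_add_right hq _) _).trans hL')]

theorem Cochain.Rep.res (hf : f.Rep x) (h : p ≤ r) : f.Rep (H.res h i x) := by
  obtain ⟨h1, h2, h3, rfl⟩ := hf
  obtain ⟨h', e⟩ := H.res_mk h i _ h3
  rw [e]
  exact ⟨h1, h2.trans h, IsRep.of_eq h' (restr_restr h _)⟩

theorem Cochain.Rep.cup (hf : f.Rep x) (hg : g.Rep y) (h : AddLE p q r) (e : i + j = k) :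
    (f.cup g).Rep (H.cup h e x y) := by
  obtain ⟨rfl, h2, h3, rfl⟩ := hf
  obtain ⟨rfl, h2', h3', rfl⟩ := hg
  obtain ⟨h', e'⟩ := H.cup_mk h e _ _ h3 h3'
  rw [e']
  exact ⟨e, (add_le_add h2 h2').trans h, IsRep.of_eq h'
    (restr_actRaw_restr (M := A.regular) g.fam g.mono h2 h2' h)⟩

theorem Cochain.Rep.act {y : HH A A.dual q j} {w : Fin (n + 1) → ℕ} {g : Raw A A.dual}
    (hf : f.Rep x) (hg : IsRep g y) (hF : Fam A.dual.toPerverseComplex w j g) (hw : Monotone w)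
    (hq : w ≤ q.toFun) (h : AddLE p q r) (e : i + j = k) :
    IsRep (actV f w j g) (H.act h e x y) := by
  obtain ⟨rfl, h2, h3, rfl⟩ := hf
  obtain ⟨h3', rfl⟩ := hg
  obtain ⟨h', e'⟩ := H.act_mk h e _ _ h3 h3'
  rw [e']
  exact IsRep.of_eq h' (restr_actRaw_restr hF hw h2 hq h)

theorem Cochain.Rep.bracket (hf : f.Rep x) (hg : g.Rep y) (h : AddLE p q r)
    (e : i + j = k + 1) : (f.brk g).Rep (H.bracket h e x y) := by
  obtain ⟨rfl, h2, h3, rfl⟩ := hf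
  obtain ⟨rfl, h2', h3', rfl⟩ := hg
  obtain ⟨h', e'⟩ := H.bracket_mk h e _ _ h3 h3'
  rw [e']
  have hw : (f.brk g).w ≤ r.toFun := (add_le_add h2' h2).trans (le_of_eq_of_le (add_comm _ _) h)
  refine ⟨?_, hw, IsRep.of_eq h' (restr_congr fun L s t hL => ?_)⟩
  · change f.deg + g.deg - 1 = k; omega
  have hL' : pervSum L + (p.toFun + q.toFun) ≤ s.toFun := add_le_of_le h hL
  refine Eq.trans (congrFun (congrFun (congrFun
    (bracketRaw_eq (f.restr p h2) (g.restr q h2') rfl rfl rfl rfl) L) s) t) ?_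
  exact ((f.restr p h2).brk_restr g h2' t hL').trans (f.restr_brk g h2 t
    ((add_le_add_right (add_le_add_right h2' _) _).trans hL'))

theorem Cochain.Rep.one : (oneC A).Rep H.one := by
  obtain ⟨h, e⟩ := H.one_eq
  rw [e]
  exact ⟨rfl, le_rfl, IsRep.of_eq h (restr_self h.1).symm⟩

theorem Cochain.Rep.eq {x' : HH A A.regular p i} (hf : f.Rep x) (hf' : f.Rep x') : x = x' :=
  hf.rep.congr hf'.rep fun _ _ _ _ _ => rfl

end

theorem isPerverseGerstenhaber (H : InducedOperations A) :
    IsPerverseGerstenhaber H.res H.one H.cup H.bracket where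
  res_self p i x := by
    obtain ⟨f, hf, -, -⟩ := Cochain.Rep.exists x
    exact (hf.res H _).eq hf
  res_res h h' i x := by
    obtain ⟨f, hf, -, -⟩ := Cochain.Rep.exists x
    exact ((hf.res H h).res H h').eq (hf.res H _)
  res_cup h h' hr e x y := by
    obtain ⟨f, hf, -, -⟩ := Cochain.Rep.exists x
    obtain ⟨g, hg, -, -⟩ := Cochain.Rep.exists y
    exact ((hf.cup H hg h e).res H hr).eq (hf.cup H hg h' e)
  cup_res hp hq h h' e x y := by
    obtain ⟨f, hf, -, -⟩ := Cochain.Rep.exists x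
    obtain ⟨g, hg, -, -⟩ := Cochain.Rep.exists y
    exact ((hf.res H hp).cup H (hg.res H hq) h' e).eq (hf.cup H hg h e)
  res_bracket h h' hr e x y := by
    obtain ⟨f, hf, -, -⟩ := Cochain.Rep.exists x
    obtain ⟨g, hg, -, -⟩ := Cochain.Rep.exists y
    exact ((hf.bracket H hg h e).res H hr).eq (hf.bracket H hg h' e)
  bracket_res hp hq h h' e x y := by
    obtain ⟨f, hf, -, -⟩ := Cochain.Rep.exists x
    obtain ⟨g, hg, -, -⟩ := Cochain.Rep.exists y
    exact ((hf.res H hp).bracket H (hg.res H hq) h' e).eq (hf.bracket H hg h e)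
  one_cup {p q i} h h' x := by
    obtain ⟨f, hf, -, -⟩ := Cochain.Rep.exists x
    refine ((Cochain.Rep.one H).cup H hf h (zero_add i)).rep.congr (hf.res H h').rep
      fun L s t hL ht => ?_
    exact actV_one (M := A.regular) f.fam ((add_le_add_right (hf.le.trans h') _).trans hL)
      (by rw [hf.deg]; exact ht)
  cup_one {p q i} h h' x := by
    obtain ⟨f, hf, -, -⟩ := Cochain.Rep.exists x
    refine (hf.cup H (Cochain.Rep.one H) h (add_zero i)).rep.congr (hf.res H h').rep
      fun L s t hL ht => ?_
    exact PerverseHochschild.actV_one_right f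
      ((add_le_add_right (hf.le.trans h') _).trans hL) (by rw [hf.deg]; exact ht)
  cup_assoc h₁ h₂ h₃ h₄ e₁ e₂ e₃ e₄ x y z := by
    obtain ⟨f, hf, -, -⟩ := Cochain.Rep.exists x
    obtain ⟨g, hg, -, -⟩ := Cochain.Rep.exists y
    obtain ⟨h, hh, -, -⟩ := Cochain.Rep.exists z
    have h1 := (hf.cup H hg h₁ e₁).cup H hh h₂ e₂
    refine h1.rep.congr (hf.cup H (hg.cup H hh h₃ e₃) h₄ e₄).rep fun L s t hL ht => ?_
    exact (actV_actV (M := A.regular) h.mono f g ((add_le_add_right h1.le _).trans hL)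
      (by have := h1.deg; change f.deg + g.deg + h.deg = _ at this; omega)).symm
  cup_comm {p q r i j k} h h' e e' x y := by
    obtain ⟨f, hf, cf, nf⟩ := Cochain.Rep.exists x
    obtain ⟨g, hg, cg, ng⟩ := Cochain.Rep.exists y
    have h1 := hf.cup H hg h e
    refine h1.rep.homotopy ((hg.cup H hf h' e').rep.units_smul _)
      (f.circ g).fam (le_of_eq_of_le (add_comm _ _) h1.le) (nf.circ ng)
      (by have := hf.deg; have := hg.deg; change f.deg + g.deg - 1 + 1 = k; omega)
      (i - 1).negOnePow fun L s t hL ht => ?_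
    have h0 : (f.cup g).val L s t = (i * j).negOnePow • (g.cup f).val L s t +
        (i - 1).negOnePow • (f.circ g).D.val L s t := by
      have e1 : (f.D.circ g).val L s t = 0 := by
        rw [Cochain.circ_val]
        simp only [closed_iff.1 cf]
        exact splitSum_eq_zero fun _ _ _ => splitSum_eq_zero fun _ _ _ => smul_zero _
      have e2 : (f.circ g.D).val L s t = 0 :=
        ins_of_val_eq_zero (f.fam.mul s t) (closed_iff.1 cg) L
      rw [f.D_circ g, e1, e2, hf.deg, hg.deg]
      simp only [negOnePow_eq_sgn, smul_add, smul_smul, smul_zero, zero_add]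
      push_cast
      generalize (i : ZMod 2) = a
      generalize (j : ZMod 2) = b
      rcases zmod_two_cases a with rfl | rfl <;> rcases zmod_two_cases b with rfl | rfl <;>
        simp +decide [sgn]
    exact h0.trans (congrArg _ (congrArg _ (gD_regular (f.circ g) L s t).symm))
  bracket_skew {p q r i j k} h h' e e' x y := by
    obtain ⟨f, hf, cf, nf⟩ := Cochain.Rep.exists x
    obtain ⟨g, hg, cg, ng⟩ := Cochain.Rep.exists y
    rw [← Units.neg_smul, ← Int.negOnePow_succ]
    refine (hf.bracket H hg h e).rep.congr ((hg.bracket H hf h' e').rep.units_smul _)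
      fun L s t hL ht => ?_
    refine (f.brk_skew g L s t).trans ?_
    rw [hf.deg, hg.deg, add_comm 1]; rfl
  jacobi {p q r s v w u i j k l m m' t} h₁ h₂ h₃ h₄ h₅ h₆ e₁ e₂ e₃ e₄ e₅ e₆ x y z := by
    obtain ⟨f, hf, -, -⟩ := Cochain.Rep.exists x
    obtain ⟨g, hg, -, -⟩ := Cochain.Rep.exists y
    obtain ⟨h, hh, -, -⟩ := Cochain.Rep.exists z
    rw [sub_eq_add_neg, ← Units.neg_smul, ← Int.negOnePow_succ]
    refine ((hf.bracket H hg h₁ e₁).bracket H hh h₂ e₂).rep.congr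
      ((hf.bracket H (hg.bracket H hh h₃ e₃) h₄ e₄).rep.add
        ((hg.bracket H (hf.bracket H hh h₅ e₅) h₆ e₆).rep.units_smul _)) fun L s t hL ht => ?_
    refine (f.brk_jacobi g h L s t).trans ?_
    rw [hf.deg, hg.deg, add_comm 1]; rfl
  leibniz {p q r s v w u i j k l m m' t} h₁ h₂ h₃ h₄ h₅ h₆ e₁ e₂ e₃ e₄ e₅ e₆ x y z := by
    obtain ⟨f, hf, cf, nf⟩ := Cochain.Rep.exists x
    obtain ⟨g, hg, cg, ng⟩ := Cochain.Rep.exists y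
    obtain ⟨h, hh, ch, nh⟩ := Cochain.Rep.exists z
    have h1 := hf.bracket H (hg.cup H hh h₃ e₃) h₄ e₄
    have hw : (f.brace g h).w ≤ s.toFun := le_of_eq_of_le (by
      change g.w + (h.w + f.w) = g.w + h.w + f.w; abel) h1.le
    refine h1.rep.homotopy (((hf.bracket H hg h₁ e₁).cup H hh h₂ e₂).rep.add
      ((hg.cup H (hf.bracket H hh h₅ e₅) h₆ e₆).rep.units_smul _))
      (f.brace g h).fam hw (nf.brace ng nh)
      (by
        have := hf.deg; have := hg.deg; have := hh.deg
        change f.deg + g.deg + h.deg - 2 + 1 = t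
        omega)
      (f.deg + h.deg * (g.deg - 1)).negOnePow fun L s t hL ht => ?_
    refine (cf.brk_cup cg ch L s t).trans ?_
    refine Eq.trans ?_ (congrArg _ (congrArg _ (gD_regular (f.brace g h) L s t).symm))
    rw [← hf.deg, ← hg.deg]
    rfl

/-! ### Cyclic sums -/

/-- Functions of `a₀[a₁|…|aₖ]`. -/
abbrev Form (A : PDGA R n) (N : Type*) := Elt A → List (Elt A) → N

/-- The sum over the cyclic rotations of `a₀ a₁ … aₖ` and the decompositions `M Kl a₀ Kr` of these
into a list `M` and a list with marked entry `a₀`. -/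
noncomputable def cyc (Θ : List (Elt A) → Marked A N) : Form A N := fun a L =>
  splitSum L fun Kr L' => splitSum L' fun M Kl =>
    (sdeg Kl * (a.deg - 1 + sdeg Kr + sdeg M)).negOnePow • Θ M Kl a Kr

/-- `F (f[…] [M])`. -/
noncomputable def fil (f : Cochain A) (F : Form A N) (M : List (Elt A)) : Marked A N :=
  mark fun X => F (f.ent X) M

/-- Insertion of `f` around the first entry. -/
noncomputable def lieHead (f : Cochain A) (F : Form A N) : Form A N := cyc (fil f F)

/-- Insertion of `f` away from the first entry. -/
noncomputable def lieTail (f : Cochain A) (F : Form A N) : Form A N := fun a L =>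
  splitSum L fun L₁ L' => splitSum L' fun L₂ L₃ =>
    ((f.deg - 1) * (a.deg - 1 + sdeg L₁)).negOnePow • F a (L₁ ++ f.ent L₂ :: L₃)

/-- The Lie derivative along `f`. -/
noncomputable def lie (f : Cochain A) (F : Form A N) : Form A N := fun a L =>
  lieHead f F a L + lieTail f F a L

/-- Insertion into the unmarked list. -/
noncomputable def insM (f : Cochain A) (Θ : List (Elt A) → Marked A N) (M : List (Elt A)) :
    Marked A N := fun K a K' =>
  splitSum M fun M₁ M' => splitSum M' fun M₂ M₃ =>
    ((f.deg - 1) * (sdeg K + (a.deg - 1) + sdeg K' + sdeg M₁)).negOnePow •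
      Θ (M₁ ++ f.ent M₂ :: M₃) K a K'

theorem cyc_congr {Θ Θ' : List (Elt A) → Marked A N} (h : ∀ M K a K', Θ M K a K' = Θ' M K a K')
    (a : Elt A) (L : List (Elt A)) : cyc Θ a L = cyc Θ' a L := by
  obtain rfl : Θ = Θ' := by funext M K a K'; exact h M K a K'
  rfl

theorem cyc_add (Θ Θ' : List (Elt A) → Marked A N) (a : Elt A) (L : List (Elt A)) :
    cyc (fun M K a K' => Θ M K a K' + Θ' M K a K') a L = cyc Θ a L + cyc Θ' a L := by
  simp only [cyc, smul_add, splitSum_add]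

theorem cyc_units_smul (ε : ℤˣ) (Θ : List (Elt A) → Marked A N) (a : Elt A) (L : List (Elt A)) :
    cyc (fun M K a K' => ε • Θ M K a K') a L = ε • cyc Θ a L := by
  simp only [cyc, splitSum_units_smul, smul_comm ε]

theorem splitSum_first₃ (K : List (Elt A))
    (F : List (Elt A) → List (Elt A) → List (Elt A) → List (Elt A) → List (Elt A) →
      List (Elt A) → List (Elt A) → N) :
    (splitSum K fun K₁ K₂ => splitSum K₂ fun L₁ L' => splitSum L' fun L₂ L₃ =>
        splitSum K₁ fun B₁ B₂ => F K₁ B₁ B₂ L₁ L' L₂ L₃) =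
      splitSum K fun B₁ K₁ => splitSum K₁ fun B₂ K₂ => splitSum K₂ fun L₁ L' =>
        splitSum L' fun L₂ L₃ => F (B₁ ++ B₂) B₁ B₂ L₁ L' L₂ L₃ := by
  refine Eq.trans (splitSum_congr fun K₁ K₂ _ => splitSum_congr fun L₁ L' _ =>
    splitSum_comm _ _ _) ?_
  exact splitSum_first K fun K₁ B₁ B₂ L₁ L' => splitSum L' fun L₂ L₃ => F K₁ B₁ B₂ L₁ L' L₂ L₃

theorem lieHead_cyc (f : Cochain A) (Θ : List (Elt A) → Marked A N) (a : Elt A)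
    (L : List (Elt A)) : lieHead f (cyc Θ) a L = cyc (fun M => sub f (Θ M)) a L := by
  simp only [lieHead, cyc, fil, mark, sub, splitSum_units_smul, smul_smul, ← Int.negOnePow_add,
    splitSum_nest]
  rw [splitSum_first₃ L fun K₁ B₁ B₂ M Kl C₁ C₂ =>
    (sdeg Kl * (a.deg - 1 + sdeg K₁ + sdeg M) + (f.deg - 1) * sdeg C₁).negOnePow •
      Θ M C₁ (f.ent (C₂ ++ a :: B₁)) B₂]
  refine splitSum_congr fun _ _ _ => splitSum_congr fun _ _ _ => splitSum_congr fun _ _ _ =>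
    splitSum_congr fun _ _ h => sgn_smul_congr ?_ rfl
  rw [← h]
  simp only [sdeg_append, sdeg_cons, Cochain.ent_deg]; push_cast; grind

theorem lieTail_cyc (f : Cochain A) (Θ : List (Elt A) → Marked A N) (a : Elt A)
    (L : List (Elt A)) : lieTail f (cyc Θ) a L =
      cyc (fun M => insR f (Θ M)) a L + cyc (insM f Θ) a L + cyc (fun M => insL f (Θ M)) a L := by
  simp only [lieTail, cyc, insR, insL, insM, ins, splitSum_append_cons, smul_add, splitSum_add,
    splitSum_units_smul, smul_smul, ← Int.negOnePow_add]
  have key {a b c a' b' c' : N} (h₁ : a = a') (h₂ : b = b') (h₃ : c = c') :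
      a + b + c = c' + b' + a' := by rw [h₁, h₂, h₃]; abel
  simp only [splitSum_first, splitSum_nest]
  refine key ?_ ?_ ?_ <;>
  · refine splitSum_congr fun _ _ _ => splitSum_congr fun _ _ h₂ => splitSum_congr fun _ _ h₃ =>
      splitSum_congr fun _ _ h₄ => sgn_smul_congr ?_ rfl
    subst h₄ h₃ h₂
    simp only [sdeg_append, sdeg_cons, Cochain.ent_deg]; push_cast; grind

theorem cyc_insR_fil (f g : Cochain A) (Θ : List (Elt A) → Marked A N) (a : Elt A)
    (L : List (Elt A)) : cyc (fun M => insR g (fil f (cyc Θ) M)) a L =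
      cyc (fun M => subR f g (Θ M)) a L := by
  simp only [cyc, fil, mark, subR, insR, splitSum_units_smul, smul_smul, ← Int.negOnePow_add,
    splitSum_first, splitSum_first₃, splitSum_nest]
  refine splitSum_congr fun _ _ _ => splitSum_congr fun _ _ _ => splitSum_congr fun _ _ _ =>
    splitSum_congr fun _ _ _ => splitSum_congr fun _ _ _ => splitSum_congr fun _ _ h =>
      sgn_smul_congr ?_ rfl
  subst h
  simp only [sdeg_append, sdeg_cons, Cochain.ent_deg]; push_cast; grind

theorem insM_insR (f g : Cochain A) (Θ : List (Elt A) → Marked A N) (M K : List (Elt A))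
    (a : Elt A) (K' : List (Elt A)) : insM f (fun M => insR g (Θ M)) M K a K' =
      ((f.deg - 1) * (g.deg - 1)).negOnePow • insR g (insM f Θ M) K a K' := by
  simp only [insM, insR, splitSum_units_smul, smul_smul, ← Int.negOnePow_add]
  rw [splitSum_comm_left]
  refine splitSum_congr fun _ _ _ => splitSum_congr fun _ _ h => splitSum_congr fun _ _ h₁ =>
    splitSum_congr fun _ _ h₂ => sgn_smul_congr ?_ rfl
  subst h₂ h₁ h
  rename_i h
  subst h
  simp only [sdeg_append, sdeg_cons, Cochain.ent_deg]; push_cast; grind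

theorem insM_fil (f h : Cochain A) (F : Form A N) (M K : List (Elt A))
    (a : Elt A) (K' : List (Elt A)) : insM f (fil h F) M K a K' =
      ((f.deg - 1) * (h.deg - 1)).negOnePow • fil h (lieTail f F) M K a K' := by
  simp only [insM, fil, mark, lieTail, splitSum_units_smul, smul_smul, ← Int.negOnePow_add]
  refine splitSum_congr fun _ _ _ => splitSum_congr fun _ _ _ => sgn_smul_congr ?_ rfl
  simp only [sdeg_append, sdeg_cons, Cochain.ent_deg]; push_cast; grind

/-! ### The differential and the product form a cocycle -/

theorem Elt.mul_d_ev (a b : Elt A) {s : Perversity n} {t : ℤ}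
    (h : a.perv.toFun + b.perv.toFun ≤ s.toFun) (ht : a.deg + b.deg + 1 = t) :
    (a.mul b).d.ev s t = a.d.pmul b s t + a.deg.negOnePow • a.pmul b.d s t := by
  subst ht
  rw [(slot_d_ev s _).mul_eq (c := s) h (by simp) rfl]
  refine (Elt.ev_mk _ _ _ _).trans ?_
  exact (A.map_self _ _ _).trans (A.d_mul h rfl rfl rfl rfl a.val b.val)

theorem Elt.mul_pmul (a b c : Elt A) {s : Perversity n} {t : ℤ}
    (h : a.perv.toFun + b.perv.toFun + c.perv.toFun ≤ s.toFun) (ht : a.deg + b.deg + c.deg = t) :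
    (a.mul b).pmul c s t = a.pmul (b.mul c) s t :=
  have h' : b.perv.toFun + c.perv.toFun + a.perv.toFun ≤ s.toFun :=
    le_of_eq_of_le (by abel) h
  A.mul_assoc (addLE_ceil (le_of_add_le_left h))
    (ceil_add_le (a.perv.toFun_mono.add b.perv.toFun_mono) c.perv.toFun_mono h)
    (addLE_ceil (le_of_add_le_left h')) (le_of_eq_of_le (add_comm _ _) (ceil_add_le
      (b.perv.toFun_mono.add c.perv.toFun_mono) a.perv.toFun_mono h')) rfl ht rfl a.val b.val c.val

theorem Elt.d_d_ev (a : Elt A) (s : Perversity n) (t : ℤ) : a.d.d.ev s t = 0 := by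
  rw [Elt.d_ev, Elt.d_ev, A.d_d]

theorem ins_mC_mVal (L : List (Elt A)) (s : Perversity n) (t : ℤ) :
    ins (mC A) (fun K => mVal K s t) L = 0 := by
  by_cases hs : pervSum L ≤ s.toFun
  swap
  · exact (((mC A).circ (mC A)).fam.mul s t).out L (by simpa [Cochain.circ, mC] using hs)
  by_cases ht : sdeg L + 3 = t
  swap
  · exact ((mC A).circ (mC A)).fam.shape L s t (by simpa [Cochain.circ, mC] using ht)
  rw [ins_short _ fun L h => mVal_eq_zero h s t]
  have h1 := slot_d_ev (A := A) s t
  have hl := fun b : Elt A => (slot_pmul_left b s t)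
  have hr := fun a : Elt A => (slot_pmul_right a s t)
  match L, hs, ht with
  | [], hs, ht =>
    rw [lastSum, splitSum_nil]
    change ((mC A).ent []).d.ev s t + 0 + 0 = 0
    rw [h1.mC_nil]; simp
  | [a], hs, ht =>
    rw [lastSum, splitSum_cons, splitSum_nil]
    change ((mC A).ent [a]).d.ev s t + _ • _ • a.pmul ((mC A).ent []) s t +
      (_ • ((mC A).ent []).pmul a s t + 0) = 0
    rw [h1.mC_one, (hl a).mC_nil, (hr a).mC_nil, a.d_d_ev]; simp
  | [a, b], hs, ht =>
    rw [lastSum, splitSum_cons, splitSum_cons, splitSum_nil]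
    change ((mC A).ent [a, b]).d.ev s t + (1 * (a.deg - 1)).negOnePow • a.deg.negOnePow •
      a.pmul ((mC A).ent [b]) s t + (0 + ((sdeg [a] + 2).negOnePow •
        ((mC A).ent [a]).pmul b s t + 0)) = 0
    simp only [pervSum_cons, pervSum_nil, add_zero, sdeg_cons, sdeg_nil] at hs ht
    rw [h1.mC_two (fun _ _ _ => le_rfl), (hl b).mC_one, (hr a).mC_one,
      Elt.mul_d_ev a b hs (by omega), sdeg_cons, sdeg_nil]
    simp only [negOnePow_eq_sgn, smul_add, smul_smul]; push_cast
    generalize (a.deg : ZMod 2) = x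
    rcases zmod_two_cases x with rfl | rfl <;> simp +decide [sgn]
  | [a, b, c], hs, ht =>
    rw [lastSum, splitSum_cons, splitSum_cons, splitSum_cons, splitSum_nil]
    change ((mC A).ent [a, b, c]).d.ev s t + (1 * (a.deg - 1)).negOnePow • a.deg.negOnePow •
      a.pmul ((mC A).ent [b, c]) s t + (0 + (0 + ((sdeg [a, b] + 2).negOnePow •
        ((mC A).ent [a, b]).pmul c s t + 0))) = 0
    simp only [pervSum_cons, pervSum_nil, add_zero, sdeg_cons, sdeg_nil] at hs ht
    rw [h1.mC_three (by simp), (hl c).mC_two (toFun_mono _), (hr a).mC_two (toFun_mono _),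
      Elt.mul_pmul a b c (by rw [add_assoc]; exact hs) (by omega), sdeg_cons, sdeg_cons, sdeg_nil]
    simp only [negOnePow_eq_sgn, smul_smul]; push_cast
    generalize (a.deg : ZMod 2) = x
    generalize (b.deg : ZMod 2) = y
    rcases zmod_two_cases x with rfl | rfl <;> rcases zmod_two_cases y with rfl | rfl <;>
      simp +decide [sgn]
  | a :: b :: c :: e :: L, hs, ht =>
    rw [lastSum_eq_zero]
    · change ((mC A).ent _).d.ev s t + _ • _ • a.pmul ((mC A).ent _) s t + _ = _
      rw [h1.mC_three (by simp), (hr a).mC_three (by simp)]; simp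
    · intro L' x hx
      change _ • ((mC A).ent L').pmul x s t = 0
      rw [(hl x).mC_three, smul_zero]
      have := congrArg List.length hx
      simp at this; omega
/-- Multilinear natural functions of `a₀[a₁|…|aₖ]`. -/
structure IsForm (w : Fin (n + 1) → ℕ) (s : Perversity n) (F : Form A N) : Prop where
  slot : ∀ L, Slot (pervSum L + w) s fun a => F a L
  mul : ∀ a, IsMul (a.perv.toFun + w) s (F a)

/-- The operator `cyc` applied to `F (f[…]) [M]` with `g` inserted to the right of the mark. -/
noncomputable def cartan (f g : Cochain A) (F : Form A N) : Form A N :=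
  cyc fun M => insR g (fil f F M)

/-- The contraction with `g`. -/
noncomputable def iota (g : Cochain A) (F : Form A N) : Form A N := cartan (mC A) g F

/-- The function of `M` supported on the empty list. -/
def atNil (Γ : Marked A N) : List (Elt A) → Marked A N
  | [] => Γ
  | _ :: _ => fun _ _ _ => 0

/-- The unit, as an entry. -/
def oneE (A : PDGA R n) : Elt A := ⟨0, 0, A.one⟩

/-- Connes' boundary. -/
noncomputable def bop (F : Form A N) : Form A N := cyc (atNil (mark (F (oneE A))))

/-- The homotopy in Cartan's formula for the Lie derivative. -/
noncomputable def sop (f : Cochain A) (F : Form A N) : Form A N :=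
  cyc (atNil (insR f (mark (F (oneE A)))))

theorem lie_mC_cyc (Θ : List (Elt A) → Marked A N) (a : Elt A) (L : List (Elt A)) :
    lie (mC A) (cyc Θ) a L = cyc (fun M => dMark (Θ M)) a L + cyc (insM (mC A) Θ) a L := by
  rw [lie, lieHead_cyc, lieTail_cyc]
  unfold dMark
  rw [cyc_add, cyc_add]
  abel

theorem cyc_atNil (Γ : Marked A N) (a : Elt A) (L : List (Elt A)) : cyc (atNil Γ) a L =
    splitSum L fun Kr Kl => (sdeg Kl * (a.deg - 1 + sdeg Kr)).negOnePow • Γ Kl a Kr := by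
  refine splitSum_congr fun Kr L' _ => ?_
  rw [splitSum_eq_nil]
  · rw [sdeg_nil, add_zero]; rfl
  · intro L₁ L₂ h
    match L₁, h with
    | _ :: _, _ => exact smul_zero _

theorem cartan_add (f g : Cochain A) (F F' : Form A N) (a : Elt A) (L : List (Elt A)) :
    cartan f g (fun a L => F a L + F' a L) a L = cartan f g F a L + cartan f g F' a L := by
  unfold cartan
  rw [← cyc_add]
  exact cyc_congr (fun M K a K' => insR_add g (fil f F M) (fil f F' M) K a K') a L

theorem cartan_units_smul (f g : Cochain A) (ε : ℤˣ) (F : Form A N) (a : Elt A)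
    (L : List (Elt A)) :
    cartan f g (fun a L => ε • F a L) a L = ε • cartan f g F a L := by
  unfold cartan
  rw [← cyc_units_smul]
  exact cyc_congr (fun M K a K' => insR_units_smul g ε (fil f F M) K a K') a L

theorem cartan_congr (f g : Cochain A) {F F' : Form A N} (h : ∀ a L, F a L = F' a L) (a : Elt A)
    (L : List (Elt A)) : cartan f g F a L = cartan f g F' a L := by
  obtain rfl : F = F' := by funext a L; exact h a L
  rfl

theorem insM_insR_fil (h f g : Cochain A) (F : Form A N) (M K : List (Elt A)) (a : Elt A)
    (K' : List (Elt A)) : insM h (fun M => insR g (fil f F M)) M K a K' =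
      ((h.deg - 1) * (f.deg + g.deg)).negOnePow • insR g (fil f (lieTail h F) M) K a K' := by
  rw [insM_insR]
  have : insM h (fil f F) M = fun K a K' =>
      ((h.deg - 1) * (f.deg - 1)).negOnePow • fil f (lieTail h F) M K a K' := by
    funext K a K'; exact insM_fil h f F M K a K'
  rw [this, insR_units_smul, smul_smul, ← Int.negOnePow_add]
  exact sgn_smul_congr (by push_cast; grind) rfl

theorem cyc_insM_cartan (h f g : Cochain A) (F : Form A N) (a : Elt A) (L : List (Elt A)) :
    cyc (insM h fun M => insR g (fil f F M)) a L =
      ((h.deg - 1) * (f.deg + g.deg)).negOnePow • cartan f g (lieTail h F) a L := by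
  rw [cartan, ← cyc_units_smul]
  exact cyc_congr (insM_insR_fil h f g F) a L

section

variable {w : Fin (n + 1) → ℕ} {s : Perversity n} {F : Form A N}

theorem IsForm.isMul_fil (hF : IsForm w s F) (hw : Monotone w) (f : Cochain A)
    (M : List (Elt A)) : (fil f F M).IsMul (f.w + (pervSum M + w)) s :=
  ((hF.slot M).isMul_cochain ((pervSum_mono M).add hw) f).mark

theorem cyc_insRR (hF : IsForm w s F) (hw : Monotone w) (f g : Cochain A) (a : Elt A)
    (L : List (Elt A)) : cyc (fun M => insRR f g (fil (mC A) F M)) a L = iota (f.circ g) F a L :=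
  cyc_congr (fun M K a K' => insRR_eq_insR (hF.isMul_fil hw (mC A) M)
    ((mC A).mono.add ((pervSum_mono M).add hw)) f g K a K') a L

/-- The differential of `cartan f g F`, for cocycles `f`, `g` and a closed form `F`. -/
theorem lie_mC_cartan (hF : IsForm w s F) (hw : Monotone w)
    (hc : ∀ a L, lie (mC A) F a L = 0) {f g : Cochain A} (hf : Closed f) (hg : Closed g)
    (a : Elt A) (L : List (Elt A)) : lie (mC A) (cartan f g F) a L =
      (f.deg + g.deg).negOnePow • (iota (f.circ g) F a L +
        ((f.deg - 1) * (g.deg - 1)).negOnePow • lieHead f (iota g F) a L) -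
      (g.deg - 1).negOnePow • iota g (lieHead f F) a L := by
  have e1 : cyc (fun M => subR f g (fil (mC A) F M)) a L = cartan f g (lieHead (mC A) F) a L :=
    (cyc_insR_fil f g (fil (mC A) F) a L).symm
  have e2 : cyc (fun M => subR (mC A) g (fil f F M)) a L = iota g (lieHead f F) a L :=
    (cyc_insR_fil (mC A) g (fil f F) a L).symm
  have e3 : cyc (fun M => sub f (insR g (fil (mC A) F M))) a L = lieHead f (iota g F) a L :=
    (lieHead_cyc f _ a L).symm
  have e4 : cartan f g (lieTail (mC A) F) a L = -cartan f g (lieHead (mC A) F) a L := by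
    have := cartan_units_smul f g (-1) (lieHead (mC A) F) a L
    rw [Units.neg_smul, one_smul] at this
    rw [← this]
    refine cartan_congr f g (fun a L => ?_) a L
    rw [Units.neg_smul, one_smul, eq_neg_iff_add_eq_zero, add_comm]
    exact hc a L
  have e5 : cyc (fun M => dMark (insR g (fil f F M))) a L = (f.deg + g.deg).negOnePow •
      (cyc (fun M => subR f g (fil (mC A) F M)) a L +
        cyc (fun M => insRR f g (fil (mC A) F M)) a L + ((f.deg - 1) * (g.deg - 1)).negOnePow •
        cyc (fun M => sub f (insR g (fil (mC A) F M))) a L) -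
      (g.deg - 1).negOnePow • cyc (fun M => subR (mC A) g (fil f F M)) a L := by
    rw [← cyc_add, ← cyc_units_smul, ← cyc_add, ← cyc_units_smul, sub_eq_add_neg,
      ← Units.neg_smul, ← cyc_units_smul, ← cyc_add]
    refine cyc_congr (fun M K a K' => ?_) a L
    rw [Units.neg_smul, ← sub_eq_add_neg]
    exact hf.dMark_insR_mark hg (hF.slot M) ((pervSum_mono M).add hw) K a K'
  rw [cartan, lie_mC_cyc, cyc_insM_cartan, e5, e1, e2, e3, e4, cyc_insRR hF hw]
  have : (((mC A).deg - 1) * (f.deg + g.deg)).negOnePow = (f.deg + g.deg).negOnePow := by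
    rw [show (mC A).deg - 1 = 1 from rfl, one_mul]
  rw [this]
  simp only [smul_add, smul_neg]
  abel

theorem insL_insR_fil_mC (hF : IsForm w s F) (f g : Cochain A) (M K : List (Elt A)) (a : Elt A)
    (K' : List (Elt A)) : insL f (insR g (fil (mC A) F M)) K a K' = 0 := by
  rw [insL, ins]
  refine splitSum_eq_zero fun K₁ K₂ _ => splitSum_eq_zero fun L₁ L₂ _ => ?_
  have : insR g (fil (mC A) F M) (K₁ ++ f.ent L₁ :: L₂) a K' = 0 := by
    refine splitSum_eq_zero fun B₁ B₂ _ => splitSum_eq_zero fun C₁ C₂ _ => ?_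
    refine (congrArg _ ((hF.slot M).mC_three ?_)).trans (smul_zero _)
    simp; omega
  rw [this, smul_zero]

theorem insRinsR_fil_mC (hF : IsForm w s F) (f g : Cochain A) (M K : List (Elt A)) (a : Elt A)
    (K' : List (Elt A)) : insRinsR f g (fil (mC A) F M) K a K' = 0 := by
  refine splitSum_eq_zero fun K₁ L _ => splitSum_eq_zero fun K₂ K₃ _ => ?_
  have : ins g (fun X => fil (mC A) F M K a (K₁ ++ f.ent K₂ :: X)) K₃ = 0 := by
    refine splitSum_eq_zero fun B₁ B₂ _ => splitSum_eq_zero fun C₁ C₂ _ => ?_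
    refine (congrArg _ ((hF.slot M).mC_three ?_)).trans (smul_zero _)
    simp; omega
  rw [this, smul_zero]

theorem lieTail_iota (hF : IsForm w s F) (hw : Monotone w) (f g : Cochain A)
    (a : Elt A) (L : List (Elt A)) : lieTail f (iota g F) a L =
      iota (g.circ f) F a L + ((f.deg - 1) * g.deg).negOnePow • iota g (lieTail f F) a L := by
  rw [iota, cartan, lieTail_cyc, cyc_insM_cartan]
  have e1 : cyc (fun M => insL f (insR g (fil (mC A) F M))) a L = 0 :=
    splitSum_eq_zero fun _ _ _ => splitSum_eq_zero fun _ _ _ =>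
      (congrArg _ (insL_insR_fil_mC hF f g _ _ _ _)).trans (smul_zero _)
  have e2 : cyc (fun M => insR f (insR g (fil (mC A) F M))) a L = iota (g.circ f) F a L := by
    rw [← cyc_insRR hF hw]
    refine cyc_congr (fun M K a K' => ?_) a L
    rw [insR_insR, insRinsR_fil_mC hF, insRinsR_fil_mC hF, smul_zero, add_zero, add_zero]
  rw [e1, e2, add_zero]
  congr 1
  exact sgn_smul_congr (by simp only [mC]; push_cast; grind) rfl

theorem lie_mC_iota (hF : IsForm w s F) (hw : Monotone w) {g : Cochain A} (hg : Closed g)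
    (a : Elt A) (L : List (Elt A)) : lie (mC A) (iota g F) a L =
      g.deg.negOnePow • iota g (lie (mC A) F) a L := by
  have e1 : cyc (fun M => dMark (insR g (fil (mC A) F M))) a L =
      g.deg.negOnePow • iota g (lieHead (mC A) F) a L := by
    have : iota g (lieHead (mC A) F) a L = cyc (fun M => subR (mC A) g (fil (mC A) F M)) a L :=
      cyc_insR_fil (mC A) g (fil (mC A) F) a L
    rw [this, ← cyc_units_smul]
    refine cyc_congr (fun M K a K' => ?_) a L
    rw [hg.dMark_insR (hF.isMul_fil hw (mC A) M) ((mC A).mono.add ((pervSum_mono M).add hw))]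
    have e0 : dMark (fil (mC A) F M) = fun K a K' => 0 := by
      rw [fil, dMark_mark]
      funext K a K'
      refine ((hF.slot M).circ_ent ((pervSum_mono M).add hw) (mC A) (mC A) _).symm.trans ?_
      have : ∀ K, ((mC A).circ (mC A)).val K = 0 := fun K => by
        funext s t; exact ins_mC_mVal K s t
      simp only [Cochain.ent, ent, this]
      exact (hF.slot M).map_zero _ _
    have e2 : insR g (fun K a K' => (0 : N)) K a K' = 0 :=
      splitSum_eq_zero fun _ _ _ => splitSum_eq_zero fun _ _ _ => smul_zero _
    rw [e0, e2, zero_sub, smul_neg, ← Units.neg_smul, ← Int.negOnePow_succ, sub_add_cancel]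
  rw [iota, cartan, lie_mC_cyc, cyc_insM_cartan, e1]
  have e2 := cartan_add (mC A) g (lieHead (mC A) F) (lieTail (mC A) F) a L
  have e3 : (((mC A).deg - 1) * ((mC A).deg + g.deg)).negOnePow = g.deg.negOnePow :=
    sgn_eq (by simp only [mC]; push_cast; grind)
  rw [e3]
  exact (smul_add _ _ _).symm.trans (congrArg _ e2.symm)

/-! ### Connes' boundary -/

theorem dMark_atNil (Γ : Marked A N) (M K : List (Elt A)) (a : Elt A) (K' : List (Elt A)) :
    dMark (atNil Γ M) K a K' = atNil (dMark Γ) M K a K' := by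
  match M with
  | [] => rfl
  | _ :: _ =>
    simp [atNil, dMark, sub, insR, insL, ins, splitSum_zero]

theorem subR_atNil (f g : Cochain A) (Γ : Marked A N) (M K : List (Elt A)) (a : Elt A)
    (K' : List (Elt A)) : subR f g (atNil Γ M) K a K' = atNil (subR f g Γ) M K a K' := by
  match M with
  | [] => rfl
  | _ :: _ =>
    simp [atNil, subR, mark, insR, splitSum_zero]

theorem insM_atNil (f : Cochain A) (Γ : Marked A N) (M K : List (Elt A)) (a : Elt A)
    (K' : List (Elt A)) : insM f (atNil Γ) M K a K' = 0 := by
  refine splitSum_eq_zero fun M₁ _ _ => splitSum_eq_zero fun _ _ _ => ?_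
  match M₁ with
  | [] => exact smul_zero _
  | _ :: _ => exact smul_zero _

theorem lie_mC_atNil (Γ : Marked A N) (a : Elt A) (L : List (Elt A)) :
    lie (mC A) (cyc (atNil Γ)) a L = cyc (atNil (dMark Γ)) a L := by
  have : cyc (insM (mC A) (atNil Γ)) a L = 0 := splitSum_eq_zero fun _ _ _ =>
    splitSum_eq_zero fun _ _ _ => (congrArg _ (insM_atNil _ _ _ _ _ _)).trans (smul_zero _)
  rw [lie_mC_cyc, this, add_zero]
  exact cyc_congr (dMark_atNil Γ) a L

theorem iota_bop (f : Cochain A) (F : Form A N) (a : Elt A) (L : List (Elt A)) :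
    iota f (bop F) a L = cyc (atNil (subR (mC A) f (mark (F (oneE A))))) a L :=
  (cyc_insR_fil (mC A) f _ a L).trans (cyc_congr (subR_atNil _ _ _) a L)

end

/-! ### Cyclic sums of functions of few entries -/

theorem splitSum_eq_last {L : List (Elt A)} {F : List (Elt A) → List (Elt A) → N}
    (h : ∀ L₁ L₂, 2 ≤ L₂.length → F L₁ L₂ = 0) :
    splitSum L F = F L [] + lastSum L fun L₁ b => F L₁ [b] := by
  have : splitSum L F = splitSum L (fun L₁ L₂ => match L₂ with
      | [] => F L₁ []
      | _ :: _ => 0) + lastSum L fun L₁ b => F L₁ [b] := by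
    rw [lastSum, ← splitSum_add]
    refine splitSum_congr fun L₁ L₂ _ => ?_
    match L₂ with
    | [] => exact (add_zero _).symm
    | [b] => exact (zero_add _).symm
    | _ :: _ :: _ => exact (h _ _ (by simp)).trans (add_zero _).symm
  rw [this, splitSum_eq_self]
  intro L₁ L₂ h
  match L₂, h with
  | _ :: _, _ => rfl

theorem splitSum_eq_head {L : List (Elt A)} {F : List (Elt A) → List (Elt A) → N}
    (h : ∀ L₁ L₂, 2 ≤ L₁.length → F L₁ L₂ = 0) :
    splitSum L F = F [] L + headSum L fun b L' => F [b] L' := by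
  match L with
  | [] => rw [splitSum_nil]; exact (add_zero _).symm
  | b :: L =>
    rw [splitSum_cons, splitSum_eq_nil]
    · rfl
    · intro L₁ L₂ h'
      match L₁, h' with
      | _ :: _, _ => exact h _ _ (by simp)

section

variable {v w : Fin (n + 1) → ℕ} {s : Perversity n} {F : Form A N} {H : Elt A → N}

theorem lieHead_mC (hF : IsForm w s F) (hw : Monotone w) (a : Elt A) (L : List (Elt A)) :
    lieHead (mC A) F a L = F a.d L +
      (headSum L fun b M => a.deg.negOnePow • F (a.mul b) M) +
      lastSum L fun M b =>
        ((b.deg - 1) * (a.deg - 1 + sdeg M) + b.deg).negOnePow • F (b.mul a) M := by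
  have hm (M : List (Elt A)) : Monotone (pervSum M + w) := (pervSum_mono M).add hw
  rw [lieHead, cyc, splitSum_eq_head]
  · rw [splitSum_eq_last]
    · have e1 : (headSum L fun b L' => splitSum L' fun M Kl =>
          (sdeg Kl * (a.deg - 1 + sdeg [b] + sdeg M)).negOnePow • fil (mC A) F M Kl a [b]) =
          headSum L fun b M => a.deg.negOnePow • F (a.mul b) M := by
        refine headSum_congr fun b L' _ => ?_
        rw [splitSum_eq_self]
        · rw [sdeg_nil, zero_mul, Int.negOnePow_zero, one_smul]
          exact (hF.slot L').mC_two (hm L') a b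
        · intro M Kl h
          refine (congrArg _ ((hF.slot M).mC_three ?_)).trans (smul_zero _)
          have := List.length_pos_of_ne_nil h
          simp; omega
      rw [e1, sdeg_nil, zero_mul, Int.negOnePow_zero, one_smul]
      have e2 : fil (mC A) F L [] a [] = F a.d L := (hF.slot L).mC_one a
      rw [e2, add_right_comm]
      congr 1
      refine lastSum_congr fun M b _ => ?_
      have e3 : fil (mC A) F M [b] a [] = b.deg.negOnePow • F (b.mul a) M :=
        (hF.slot M).mC_two (hm M) b a
      rw [e3, smul_smul, ← Int.negOnePow_add]
      simp only [sdeg_cons, sdeg_nil, add_zero]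
    · intro M Kl h
      refine (congrArg _ ((hF.slot M).mC_three ?_)).trans (smul_zero _)
      simp; omega
  · intro Kr L' h
    refine splitSum_eq_zero fun M Kl _ => ?_
    refine (congrArg _ ((hF.slot M).mC_three ?_)).trans (smul_zero _)
    simp; omega

theorem Slot.out_mul (h : Slot v s H) (hv : Monotone v) {a b : Elt A}
    (hs : ¬ (a.perv.toFun + b.perv.toFun + v ≤ s.toFun)) : H (a.mul b) = 0 := by
  by_cases h' : H (a.mul b) = 0
  · exact h'
  · refine (smul_eq_zero_iff_eq _).1 ((h.mC_two hv a b).symm.trans ?_)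
    refine h.ent_eq_zero (mC A).fam fun h' => hs (le_of_eq_of_le ?_ h')
    simp [pervSum_cons, pervSum_nil, mC]

theorem Slot.one_mul (h : Slot v s H) (hv : Monotone v) (b : Elt A) :
    H ((oneE A).mul b) = H b := by
  by_cases hb : b.perv.toFun + v ≤ s.toFun
  · rw [h.mul_eq (c := b.perv) (t := b.deg) (le_of_eq (zero_add _)) hb (zero_add _)]
    refine congrArg (fun x => H ⟨b.perv, b.deg, x⟩) ?_
    exact (A.one_mul le_rfl _ _).trans (A.map_self _ _ _)
  · rw [h.out b hb, h.out_mul hv fun h' => hb (le_of_eq_of_le ?_ h')]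
    exact congrArg (· + v) (zero_add _).symm

theorem Slot.mul_one (h : Slot v s H) (hv : Monotone v) (b : Elt A) :
    H (b.mul (oneE A)) = H b := by
  by_cases hb : b.perv.toFun + v ≤ s.toFun
  · rw [h.mul_eq (c := b.perv) (t := b.deg) (le_of_eq (add_zero _)) hb (add_zero _)]
    refine congrArg (fun x => H ⟨b.perv, b.deg, x⟩) ?_
    exact (A.mul_one le_rfl _ _).trans (A.map_self _ _ _)
  · rw [h.out b hb, h.out_mul hv fun h' => hb (le_of_eq_of_le ?_ h')]
    exact congrArg (· + v) (add_zero _).symm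

/-- The difference of the two ways to see the list `X` as an element of `A ⊗ T(sA)`. -/
noncomputable def headLast (F : Form A N) (X : List (Elt A)) : N :=
  headSum X F - lastSum X fun K b => ((b.deg - 1) * sdeg K).negOnePow • F b K

theorem ins_mC_one (hF : IsForm w s F) (hw : Monotone w) (X : List (Elt A)) :
    ins (mC A) (F (oneE A)) X = headLast F X - lie (mC A) F (oneE A) X := by
  have hm (M : List (Elt A)) : Monotone (pervSum M + w) := (pervSum_mono M).add hw
  have e1 : lieTail (mC A) F (oneE A) X = -ins (mC A) (F (oneE A)) X := by
    rw [← one_smul ℤˣ (ins _ _ _), ← Units.neg_smul, ins, splitSum_units_smul]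
    refine splitSum_congr fun _ _ _ => ?_
    rw [splitSum_units_smul]
    refine splitSum_congr fun L₁ _ _ => ?_
    rw [smul_smul, ← Int.negOnePow_one, ← Int.negOnePow_add]
    exact sgn_smul_congr (by simp only [mC, oneE]; push_cast; grind) rfl
  have e2 : lieHead (mC A) F (oneE A) X = headLast F X := by
    rw [lieHead_mC hF hw, headLast, sub_eq_add_neg (headSum X F), ← lastSum_neg]
    have h0 : F (oneE A).d X = 0 := by
      have : (oneE A).d = ⟨0, 0 + 1, 0⟩ := congrArg (Elt.mk _ _) (d_one A _)
      rw [this, (hF.slot X).map_zero]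
    rw [h0, zero_add]
    congr 1
    · refine headSum_congr fun b M _ => ?_
      rw [(hF.slot M).one_mul (hm M)]
      exact one_smul _ _
    · refine lastSum_congr fun M b _ => ?_
      rw [(hF.slot M).mul_one (hm M), ← Units.neg_smul, ← Int.negOnePow_succ]
      exact sgn_smul_congr (by simp only [oneE]; push_cast; grind) rfl
  rw [lie, e1, e2]; abel

/-- The contraction only involves the product with the first entry. -/
theorem iota_eq (hF : IsForm w s F) (hw : Monotone w) (g : Cochain A) (a : Elt A)
    (L : List (Elt A)) : iota g F a L = splitSum L fun K M =>
      ((g.deg - 1) * (a.deg - 1) + a.deg).negOnePow • F (a.mul (g.ent K)) M := by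
  have hm (M : List (Elt A)) : Monotone (pervSum M + w) := (pervSum_mono M).add hw
  have e1 : iota g F a L = splitSum L fun Kr M => insR g (fil (mC A) F M) [] a Kr := by
    rw [iota, cartan, cyc]
    refine splitSum_congr fun Kr L' _ => ?_
    rw [splitSum_eq_self]
    · rw [sdeg_nil, zero_mul, Int.negOnePow_zero, one_smul]
    · intro M Kl h
      have : insR g (fil (mC A) F M) Kl a Kr = 0 := by
        refine splitSum_eq_zero fun B₁ B₂ _ => splitSum_eq_zero fun C₁ C₂ _ => ?_
        refine (congrArg _ ((hF.slot M).mC_three ?_)).trans (smul_zero _)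
        have := List.length_pos_of_ne_nil h
        simp; omega
      rw [this, smul_zero]
  rw [e1]
  refine splitSum_congr fun Kr M _ => ?_
  rw [insR, splitSum_eq_nil, splitSum_eq_self]
  · have : fil (mC A) F M [] a ([] ++ g.ent Kr :: []) = _ :=
      (hF.slot M).mC_two (hm M) a (g.ent Kr)
    rw [this, smul_smul, ← Int.negOnePow_add]
    simp only [sdeg_nil, zero_add, add_zero]
  · intro K₂ K₃ h
    refine (congrArg _ ((hF.slot M).mC_three ?_)).trans (smul_zero _)
    have := List.length_pos_of_ne_nil h
    simp; omega
  · intro K₁ K'' h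
    refine splitSum_eq_zero fun C₁ C₂ _ => ?_
    refine (congrArg _ ((hF.slot M).mC_three ?_)).trans (smul_zero _)
    have := List.length_pos_of_ne_nil h
    simp; omega

theorem iota_one (hF : IsForm w s F) (hw : Monotone w) (f : Cochain A) (X : List (Elt A)) :
    iota f F (oneE A) X = (f.deg - 1).negOnePow • splitSum X fun K M => F (f.ent K) M := by
  rw [iota_eq hF hw, splitSum_units_smul]
  refine splitSum_congr fun K M _ => ?_
  rw [(hF.slot M).one_mul ((pervSum_mono M).add hw)]
  exact sgn_smul_congr (by simp only [oneE]; push_cast; grind) rfl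

end

/-! ### The differential of the homotopy for the Lie derivative -/

/-- The value `x`, if the list is empty. -/
def nilSum (K : List (Elt A)) (x : N) : N :=
  match K with
  | [] => x
  | _ :: _ => 0

theorem headSum_mid (K : List (Elt A)) (a : Elt A) (K' : List (Elt A))
    (F : Elt A → List (Elt A) → N) : headSum (K ++ a :: K') F =
      nilSum K (F a K') + headSum K fun b K₁ => F b (K₁ ++ a :: K') := by
  match K with
  | [] => exact (add_zero _).symm
  | _ :: _ => exact (zero_add _).symm

theorem lastSum_mid (K : List (Elt A)) (a : Elt A) (K' : List (Elt A))
    (F : List (Elt A) → Elt A → N) : lastSum (K ++ a :: K') F =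
      nilSum K' (F K a) + lastSum K' fun K₁ b => F (K ++ a :: K₁) b := by
  rw [lastSum, splitSum_append_cons, splitSum_eq_self]
  · congr 1
    match K' with
    | [] => rfl
    | _ :: _ => rfl
  · intro L₁ L₂ h
    match L₂, h with
    | [_], _ => rfl
    | _ :: _ :: _, _ => rfl

theorem splitSum_nilSum_left (L : List (Elt A)) (x : List (Elt A) → List (Elt A) → N) :
    (splitSum L fun K K' => nilSum K (x K K')) = x [] L := by
  refine splitSum_eq_nil fun K K' h => ?_
  match K, h with
  | _ :: _, _ => rfl

theorem splitSum_nilSum_right (L : List (Elt A)) (x : List (Elt A) → List (Elt A) → N) :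
    (splitSum L fun K K' => nilSum K' (x K K')) = x L [] := by
  refine splitSum_eq_self fun K K' h => ?_
  match K', h with
  | _ :: _, _ => rfl

theorem nilSum_units_smul (ε : ℤˣ) (K : List (Elt A)) (x : N) :
    ε • nilSum K x = nilSum K (ε • x) := by
  match K with
  | [] => rfl
  | _ :: _ => exact smul_zero _

theorem splitSum_headSum_right' (L : List (Elt A))
    (F : List (Elt A) → List (Elt A) → Elt A → List (Elt A) → N) :
    (splitSum L fun L₁ K => headSum K fun b K₂ => F L₁ K b K₂) =
      splitSum L fun K₁ K₂ => lastSum K₁ fun L₁ b => F L₁ (b :: K₂) b K₂ := by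
  rw [← splitSum_headSum_right L fun L₁ b K₂ => F L₁ (b :: K₂) b K₂]
  exact splitSum_congr fun L₁ K _ => headSum_congr fun b K₂ h => by rw [h]

theorem cyc_atNil_headLast (F : Form A N) (a : Elt A) (L : List (Elt A)) :
    cyc (atNil (mark (headLast F))) a L = 0 := by
  rw [cyc_atNil]
  simp only [mark, headLast, headSum_mid, lastSum_mid, sub_eq_add_neg, neg_add, smul_add,
    smul_neg, splitSum_add, splitSum_neg, nilSum_units_smul, headSum_units_smul,
    lastSum_units_smul, splitSum_nilSum_left, splitSum_nilSum_right, smul_smul,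
    ← Int.negOnePow_add, splitSum_headSum_right']
  have key {a b a' b' : N} (h₁ : a = a') (h₂ : b = b') : a + b + (-a' + -b') = 0 := by
    rw [h₁, h₂]; abel
  refine key (sgn_smul_congr ?_ rfl) ?_
  · rw [sdeg_nil]; push_cast; grind
  · refine splitSum_congr fun _ _ _ => lastSum_congr fun _ _ h => sgn_smul_congr ?_ rfl
    subst h
    simp only [sdeg_append, sdeg_cons, sdeg_nil]; push_cast; grind

theorem cyc_insR_headLast (f : Cochain A) (F : Form A N) (a : Elt A) (L : List (Elt A)) :
    cyc (atNil (insR f (mark (headLast F)))) a L = lieTail f F a L -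
      splitSum L fun L₁ L' => splitSum L' fun L₂ L₃ =>
        ((sdeg L₂ + sdeg L₃) * (a.deg - 1 + sdeg L₁)).negOnePow • F (f.ent L₂) (L₃ ++ a :: L₁) := by
  rw [cyc_atNil]
  have h0 (K₁ K₃ : List (Elt A)) (b : Elt A) (x : N) : nilSum (K₁ ++ b :: K₃) x = 0 := by
    match K₁ with
    | [] => rfl
    | _ :: _ => rfl
  simp only [mark, insR, splitSum_units_smul, smul_smul, ← Int.negOnePow_add, splitSum_nest]
  simp only [headLast, headSum_mid, lastSum_mid, h0, zero_add, sub_eq_add_neg, neg_add, smul_add,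
    smul_neg, splitSum_add, splitSum_neg, nilSum_units_smul, headSum_units_smul,
    lastSum_units_smul, smul_smul, ← Int.negOnePow_add, splitSum_nilSum_left,
    splitSum_nilSum_right, splitSum_headSum_right']
  have key {a b c c' d d' : N} (h₁ : a = c) (h₂ : b = d) (h₃ : c' = d') :
      a + c' + (-b + -d') = c + -d := by rw [h₁, h₂, h₃]; abel
  refine key ?_ ?_ ?_
  · refine splitSum_congr fun _ _ _ => splitSum_congr fun _ _ _ => sgn_smul_congr ?_ rfl
    simp only [sdeg_nil]; push_cast; grind
  · refine splitSum_congr fun _ _ _ => splitSum_congr fun _ _ _ => sgn_smul_congr ?_ rfl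
    simp only [sdeg_append, sdeg_cons, sdeg_nil, Cochain.ent_deg]; push_cast; grind
  · refine splitSum_congr fun _ _ _ => splitSum_congr fun _ _ _ => splitSum_congr fun _ _ _ =>
      lastSum_congr fun _ _ h => ?_
    subst h
    refine sgn_smul_congr ?_ rfl
    simp only [sdeg_append, sdeg_cons, sdeg_nil, Cochain.ent_deg]; push_cast; grind

theorem lie_mC_bop {w : Fin (n + 1) → ℕ} {s : Perversity n} {F : Form A N} (hF : IsForm w s F)
    (hw : Monotone w) (a : Elt A) (L : List (Elt A)) :
    lie (mC A) (bop F) a L = -bop (lie (mC A) F) a L := by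
  rw [bop, lie_mC_atNil, dMark_mark]
  have : mark (ins (mC A) (F (oneE A))) = fun K a K' => mark (headLast F) K a K' +
      (-1 : ℤˣ) • mark (lie (mC A) F (oneE A)) K a K' := by
    funext K a K'
    rw [Units.neg_smul, one_smul, ← sub_eq_add_neg]
    exact ins_mC_one hF hw _
  have h2 := cyc_atNil_headLast F a L
  rw [cyc_atNil] at h2 ⊢
  simp only [this, smul_add, splitSum_add]
  rw [h2, zero_add, bop, cyc_atNil]
  simp only [Units.neg_smul, one_smul, smul_neg, splitSum_neg]

theorem bop_iota {w : Fin (n + 1) → ℕ} {s : Perversity n} {F : Form A N} (hF : IsForm w s F)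
    (hw : Monotone w) (f : Cochain A) (a : Elt A) (L : List (Elt A)) :
    bop (iota f F) a L = (f.deg - 1).negOnePow • (lieHead f F a L +
      splitSum L fun L₁ L' => splitSum L' fun L₂ L₃ =>
        ((sdeg L₂ + sdeg L₃) * (a.deg - 1 + sdeg L₁)).negOnePow •
          F (f.ent L₂) (L₃ ++ a :: L₁)) := by
  rw [bop, cyc_atNil]
  simp only [mark, iota_one hF hw, splitSum_append_cons, smul_add, splitSum_add,
    splitSum_units_smul, smul_smul, ← Int.negOnePow_add, lieHead, cyc, fil]
  simp only [splitSum_nest]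
  rw [add_comm]
  congr 1
  · refine splitSum_congr fun _ _ _ => splitSum_congr fun _ _ _ => sgn_smul_congr ?_ rfl
    simp only [sdeg_append]; push_cast; grind
  · refine splitSum_congr fun _ _ _ => splitSum_congr fun _ _ h => sgn_smul_congr ?_ rfl
    subst h
    simp only [sdeg_append]; push_cast; grind

/-- Cartan's formula for a cocycle `f` and a closed form `F`. -/
theorem lie_mC_sop {w : Fin (n + 1) → ℕ} {s : Perversity n} {F : Form A N} (hF : IsForm w s F)
    (hw : Monotone w) (hc : ∀ a L, lie (mC A) F a L = 0) {f : Cochain A} (hf : Closed f)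
    (a : Elt A) (L : List (Elt A)) : lie (mC A) (sop f F) a L = (f.deg - 1).negOnePow •
      (lie f F a L - (f.deg - 1).negOnePow • bop (iota f F) a L - iota f (bop F) a L) := by
  have hm : (mark (F (oneE A))).IsMul w s :=
    ((hF.mul (oneE A)).congr (zero_add _) fun _ => rfl).mark
  have e1 : dMark (mark (F (oneE A))) = mark (headLast F) := by
    rw [dMark_mark]
    funext K a K'
    refine (ins_mC_one hF hw _).trans ?_
    rw [hc, sub_zero]; rfl
  rw [sop, lie_mC_atNil, iota_bop, bop_iota hF hw, cyc_atNil, cyc_atNil]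
  have e2 := cyc_insR_headLast f F a L
  rw [cyc_atNil] at e2
  simp only [hf.dMark_insR hm hw, e1, smul_sub, splitSum_sub, smul_smul, ← Int.negOnePow_add]
  have e3 : ∀ (x : ℤ) (y : N), (x + (f.deg - 1)).negOnePow • y =
    (f.deg - 1).negOnePow • x.negOnePow • y := fun x y => by
      rw [smul_smul, ← Int.negOnePow_add, add_comm]
  simp only [e3, ← splitSum_units_smul]
  rw [e2, lie, sgn_eq (x := f.deg - 1 + (f.deg - 1 + (f.deg - 1))) (y := f.deg - 1)
    (by push_cast; grind)]
  simp only [smul_sub, smul_add]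
  abel

theorem bop_bop {F : Form A N} (hF : ∀ a, Normalized (F a)) (a : Elt A) (L : List (Elt A)) :
    bop (bop F) a L = 0 := by
  rw [bop, cyc_atNil]
  refine splitSum_eq_zero fun Kr Kl _ => ?_
  have : bop F (oneE A) (Kl ++ a :: Kr) = 0 := by
    rw [bop, cyc_atNil]
    refine splitSum_eq_zero fun K K' _ => (congrArg _ ?_).trans (smul_zero _)
    have := hF (oneE A) K' K 0
    rwa [A.map_self] at this
  rw [mark, this, smul_zero]

/-! ### Multilinearity of the operators on forms -/

section

variable {v w : Fin (n + 1) → ℕ} {s : Perversity n} {F : Form A N} {H : Elt A → N}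

theorem IsForm.congr (hF : IsForm w s F) {w' : Fin (n + 1) → ℕ} (e : w = w') {F' : Form A N}
    (e' : ∀ a L, F' a L = F a L) : IsForm w' s F' := by
  obtain rfl : F' = F := by funext a L; exact e' a L
  exact e ▸ hF

theorem IsForm.units_smul (hF : IsForm w s F) (ε : ℤˣ) : IsForm w s fun a L => ε • F a L where
  slot L := by
    obtain ⟨i, rfl⟩ : ∃ i : ℤ, i.negOnePow = ε := by
      rcases Int.units_eq_one_or ε with rfl | rfl
      · exact ⟨0, rfl⟩
      · exact ⟨1, rfl⟩
    exact (hF.slot L).fun_sign fun _ => i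
  mul a := by
    obtain ⟨i, rfl⟩ : ∃ i : ℤ, i.negOnePow = ε := by
      rcases Int.units_eq_one_or ε with rfl | rfl
      · exact ⟨0, rfl⟩
      · exact ⟨1, rfl⟩
    exact (hF.mul a).fun_sign fun _ => i

theorem IsForm.fun_add {F' : Form A N} (hF : IsForm w s F) (hF' : IsForm w s F') :
    IsForm w s fun a L => F a L + F' a L where
  slot L := (hF.slot L).fun_add (hF'.slot L)
  mul a := (hF.mul a).fun_add (hF'.mul a)

/-- Multilinear natural functions of a list and a list with a marked entry. -/
structure IsCyc (w : Fin (n + 1) → ℕ) (s : Perversity n) (Θ : List (Elt A) → Marked A N) :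
    Prop where
  marked : ∀ M, (Θ M).IsMul (pervSum M + w) s
  mul : ∀ K a K', IsMul (pervSum K + a.perv.toFun + pervSum K' + w) s fun M => Θ M K a K'

theorem IsCyc.cyc {Θ : List (Elt A) → Marked A N} (h : IsCyc w s Θ) : IsForm w s (cyc Θ) where
  slot L := by
    refine Slot.fun_splitSum _ fun Kr L' h₁ => Slot.fun_splitSum _ fun M Kl h₂ => ?_
    refine (((h.marked M).mid Kl Kr).fun_sign
      fun d => sdeg Kl * (d - 1 + sdeg Kr + sdeg M)).congr ?_ fun _ => rfl
    rw [← h₁, ← h₂]; simp only [pervSum_append]; abel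
  mul a := by
    refine IsMul.splitSum (fun L' => ?_) fun Kr => ?_
    · refine IsMul.fun_splitSum L' fun M Kl h₂ => ?_
      refine (((h.marked M).right Kl a).fun_sign
        fun d => sdeg Kl * (a.deg - 1 + d + sdeg M)).congr ?_ fun _ => rfl
      rw [← h₂]; simp only [pervSum_append]; abel
    · refine IsMul.splitSum (fun Kl => ?_) fun M => ?_
      · exact ((h.mul Kl a Kr).fun_sign
          fun d => sdeg Kl * (a.deg - 1 + sdeg Kr + d)).congr (by abel) fun _ => rfl
      · exact (((h.marked M).left a Kr).fun_sign
          fun d => d * (a.deg - 1 + sdeg Kr + sdeg M)).congr (by abel) fun _ => rfl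

theorem IsForm.mul_ent (hF : IsForm w s F) (hw : Monotone w) (f : Cochain A) (K : List (Elt A)) :
    IsMul (f.w + pervSum K + w) s fun M => F (f.ent K) M := by
  refine (IsMul.weaken (w := w) (u := pervSum K + f.w) ?_ hw ((pervSum_mono K).add f.mono)
    fun L hL => ?_).congr (by abel) fun _ => rfl
  · exact (hF.mul (f.ent K)).congr (by rw [Cochain.ent_perv]; abel) fun _ => rfl
  · exact (hF.slot L).ent_eq_zero f.fam fun h' => hL (le_of_eq_of_le (by abel) h')

theorem IsForm.isCyc_fil (hF : IsForm w s F) (hw : Monotone w) (f : Cochain A) :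
    IsCyc (f.w + w) s (fil f F) where
  marked M := by
    have := hF.isMul_fil hw f M
    rwa [show f.w + (pervSum M + w) = pervSum M + (f.w + w) by abel] at this
  mul K a K' := (hF.mul_ent hw f (K ++ a :: K')).congr (by rw [pervSum_mid]; abel) fun _ => rfl

theorem IsCyc.insR {Θ : List (Elt A) → Marked A N} (h : IsCyc w s Θ) (hw : Monotone w)
    (g : Cochain A) : IsCyc (g.w + w) s fun M => insR g (Θ M) where
  marked M := by
    have := (h.marked M).insR ((pervSum_mono M).add hw) g
    rwa [show g.w + (pervSum M + w) = pervSum M + (g.w + w) by abel] at this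
  mul K a K' := by
    refine IsMul.fun_splitSum K' fun K₁ K'' h₁ => IsMul.fun_splitSum K'' fun K₂ K₃ h₂ =>
      IsMul.fun_sign (G := fun M => Θ M K a (K₁ ++ g.ent K₂ :: K₃)) ?_
        fun _ => (g.deg - 1) * (sdeg K + (a.deg - 1) + sdeg K₁)
    refine (IsMul.weaken (w := pervSum K + a.perv.toFun + pervSum K₁ + pervSum K₃ + w)
      (u := pervSum K₂ + g.w) ?_ ?_ ((pervSum_mono K₂).add g.mono) ?_).congr ?_ fun _ => rfl
    · exact (h.mul K a _).congr (by rw [pervSum_mid, Cochain.ent_perv]; abel) fun _ => rfl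
    · exact ((((pervSum_mono _).add a.perv.toFun_mono).add (pervSum_mono _)).add
        (pervSum_mono _)).add hw
    · refine fun L hL => (((h.marked L).right K a).slot K₁ K₃).ent_eq_zero g.fam
        fun h' => hL (le_of_eq_of_le ?_ h')
      abel
    · rw [← h₁, ← h₂]; simp only [pervSum_append]; abel

theorem Marked.IsMul.isCyc_atNil {Γ : Marked A N} (h : Γ.IsMul w s) : IsCyc w s (atNil Γ) where
  marked M := by
    match M with
    | [] => rw [pervSum_nil, zero_add]; exact h
    | _ :: _ => exact ⟨fun _ _ => IsMul.zero, fun _ _ => Slot.zero, fun _ _ => IsMul.zero⟩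
  mul K a K' :=
    { out := fun M hM => by
        match M with
        | [] => exact h.out fun h' => hM (by rwa [pervSum_nil, zero_add])
        | _ :: _ => rfl
      slot := fun L L' => Slot.zero.congr rfl fun x => by
        match L with
        | [] => rfl
        | _ :: _ => rfl }

theorem IsForm.mark_one (hF : IsForm w s F) : (mark (F (oneE A))).IsMul w s :=
  ((hF.mul (oneE A)).congr (zero_add _) fun _ => rfl).mark

theorem IsForm.cartan (hF : IsForm w s F) (hw : Monotone w) (f g : Cochain A) :
    IsForm (g.w + (f.w + w)) s (cartan f g F) :=
  ((hF.isCyc_fil hw f).insR (f.mono.add hw) g).cyc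

theorem IsForm.iota (hF : IsForm w s F) (hw : Monotone w) (g : Cochain A) :
    IsForm (g.w + w) s (iota g F) :=
  (hF.cartan hw (mC A) g).congr (congrArg (g.w + ·) (zero_add w)) fun _ _ => rfl

theorem IsForm.bop (hF : IsForm w s F) : IsForm w s (bop F) := hF.mark_one.isCyc_atNil.cyc

theorem IsForm.sop (hF : IsForm w s F) (hw : Monotone w) (f : Cochain A) :
    IsForm (f.w + w) s (sop f F) := (hF.mark_one.insR hw f).isCyc_atNil.cyc

/-! ### Degrees -/

/-- The form `F` has degree `q`. -/
def HasDeg (q : ℤ) (F : Form A N) : Prop := ∀ a L, a.deg + sdeg L + q ≠ 0 → F a L = 0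

variable {q : ℤ}

theorem HasDeg.units_smul (hq : HasDeg q F) (ε : ℤˣ) : HasDeg q fun a L => ε • F a L :=
  fun a L h => (congrArg _ (hq a L h)).trans (smul_zero _)

theorem HasDeg.fun_add {F' : Form A N} (hq : HasDeg q F) (hq' : HasDeg q F') :
    HasDeg q fun a L => F a L + F' a L :=
  fun a L h => (congrArg₂ _ (hq a L h) (hq' a L h)).trans (add_zero 0)

theorem HasDeg.cartan (hq : HasDeg q F) (f g : Cochain A) :
    HasDeg (f.deg + g.deg + q - 2) (cartan f g F) := fun a L h => by
  rw [PerverseHochschild.cartan, cyc]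
  refine splitSum_eq_zero fun Kr L' h₁ => splitSum_eq_zero fun M Kl h₂ => ?_
  · have : PerverseHochschild.insR g (fil f F M) Kl a Kr = 0 := by
      refine splitSum_eq_zero fun B₁ B₂ h₃ => splitSum_eq_zero fun C₁ C₂ h₄ =>
        (congrArg _ (hq _ _ fun h' => h ?_)).trans (smul_zero _)
      rw [← h', ← h₁, ← h₂, ← h₃, ← h₄]
      simp only [sdeg_append, sdeg_cons, Cochain.ent_deg]; ring
    rw [this, smul_zero]

theorem HasDeg.iota (hq : HasDeg q F) (g : Cochain A) : HasDeg (g.deg + q) (iota g F) := by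
  have := hq.cartan (mC A) g
  rwa [show (mC A).deg + g.deg + q - 2 = g.deg + q by simp only [mC]; ring] at this

theorem HasDeg.sop (hq : HasDeg q F) (f : Cochain A) :
    HasDeg (f.deg + q - 2) (sop f F) := fun a L h => by
  rw [PerverseHochschild.sop, cyc_atNil]
  refine splitSum_eq_zero fun Kr Kl h₁ => ?_
  have : PerverseHochschild.insR f (mark (F (oneE A))) Kl a Kr = 0 := by
    refine splitSum_eq_zero fun B₁ B₂ h₃ => splitSum_eq_zero fun C₁ C₂ h₄ =>
      (congrArg _ (hq _ _ fun h' => h ?_)).trans (smul_zero _)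
    rw [← h', ← h₁, ← h₃, ← h₄]
    simp only [sdeg_append, sdeg_cons, Cochain.ent_deg, oneE]; ring
  rw [this, smul_zero]

theorem HasDeg.bop (hq : HasDeg q F) : HasDeg (q - 1) (bop F) := fun a L h => by
  rw [PerverseHochschild.bop, cyc_atNil]
  refine splitSum_eq_zero fun Kr Kl h₁ => (congrArg _ (hq _ _ fun h' => h ?_)).trans (smul_zero _)
  rw [← h', ← h₁]
  simp only [sdeg_append, sdeg_cons, oneE]; ring

/-! ### Normalization -/

theorem normalized_cyc {Θ : List (Elt A) → Marked A N} (h : ∀ M, (Θ M).Normalized)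
    (h' : ∀ K a K', Normalized fun M => Θ M K a K') (a : Elt A) : Normalized (cyc Θ a) := by
  intro L L' p
  rw [cyc, splitSum_append_cons]
  refine (congrArg₂ (· + ·) (splitSum_eq_zero fun Kr K _ => ?_)
    (splitSum_eq_zero fun K Kl₀ _ => splitSum_eq_zero fun M Kl _ => ?_)).trans (add_zero 0)
  · rw [splitSum_append_cons]
    refine (congrArg₂ (· + ·) (splitSum_eq_zero fun M Kl _ => ?_)
      (splitSum_eq_zero fun M Kl _ => ?_)).trans (add_zero 0)
    · rw [(h M).left, smul_zero]
    · exact (congrArg _ (h' Kl a Kr _ _ p)).trans (smul_zero _)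
  · rw [(h M).right, smul_zero]

theorem normalized_atNil {Γ : Marked A N} (h : Γ.Normalized) (a : Elt A) :
    Normalized (cyc (atNil Γ) a) := by
  refine normalized_cyc (fun M => ?_) (fun K a K' L L' p => ?_) a
  · match M with
    | [] => exact h
    | _ :: _ => exact ⟨fun _ _ _ _ _ => rfl, fun _ _ _ _ _ => rfl⟩
  · match L with
    | [] => rfl
    | _ :: _ => rfl

theorem normalized_bop (hN : ∀ a, Normalized (F a)) (a : Elt A) : Normalized (bop F a) :=
  normalized_atNil (hN _).mark a

theorem normalized_sop (hF : IsForm w s F) (hN : ∀ a, Normalized (F a)) {f : Cochain A}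
    (hf : f.Norm) (a : Elt A) : Normalized (sop f F a) :=
  normalized_atNil ((hN _).mark.insR hF.mark_one hf) a

theorem normalized_cartan (hF : IsForm w s F) (hw : Monotone w) (hN : ∀ a, Normalized (F a))
    {f g : Cochain A} (hf : f.Norm) (hg : g.Norm) (a : Elt A) : Normalized (cartan f g F a) := by
  refine normalized_cyc (fun M => ?_) (fun K a K' L L' p => ?_) a
  · exact ((hF.slot M).norm_ent hf).mark.insR (hF.isMul_fil hw f M) hg
  · exact splitSum_eq_zero fun _ _ _ => splitSum_eq_zero fun _ _ _ =>
      (congrArg _ (hN _ L L' p)).trans (smul_zero _)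

theorem Slot.mul_right (h : Slot v s H) (hv : Monotone v) (a : Elt A) :
    Slot (a.perv.toFun + v) s fun x => H (a.mul x) := by
  have := (((h.isMul_cochain hv (mC A)).slot [a] []).fun_sign fun _ => a.deg)
  refine this.congr (by simp [pervSum_cons, pervSum_nil, mC]) fun x => ?_
  refine Eq.trans ?_ (congrArg _ (h.mC_two hv a x)).symm
  rw [negOnePow_smul_smul]

theorem normalized_iota (hF : IsForm w s F) (hw : Monotone w) (hN : ∀ a, Normalized (F a))
    {g : Cochain A} (hg : g.Norm) (a : Elt A) : Normalized (iota g F a) := by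
  intro L L' p
  rw [iota_eq hF hw, splitSum_append_cons]
  refine (congrArg₂ (· + ·) (splitSum_eq_zero fun K M _ => ?_)
    (splitSum_eq_zero fun K M _ => ?_)).trans (add_zero 0)
  · rw [hN, smul_zero]
  · exact (congrArg _ (((hF.slot M).mul_right ((pervSum_mono M).add hw) a).norm_ent hg L K p)).trans
      (smul_zero _)

end

/-! ### The contraction with a bracket -/

section

variable {v w : Fin (n + 1) → ℕ} {s : Perversity n} {F : Form A N} {H : Elt A → N} {q : ℤ}

theorem iota_brk (hF : IsForm w s F) (hw : Monotone w) (f g : Cochain A) (a : Elt A)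
    (L : List (Elt A)) : iota (f.brk g) F a L = iota (f.circ g) F a L -
      ((f.deg - 1) * (g.deg - 1)).negOnePow • iota (g.circ f) F a L := by
  simp only [iota_eq hF hw, splitSum_units_smul, ← splitSum_sub]
  refine splitSum_congr fun K M _ => ?_
  have e : F (a.mul ((f.brk g).ent K)) M = F (a.mul ((f.circ g).ent K)) M +
      (1 + (f.deg - 1) * (g.deg - 1)).negOnePow • F (a.mul ((g.circ f).ent K)) M :=
    ((hF.slot M).mul_right ((pervSum_mono M).add hw) a).comb_ent _ _ _ K
  rw [e, smul_add]
  refine Eq.trans ?_ (sub_eq_add_neg _ _).symm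
  rw [← Units.neg_smul, ← Int.negOnePow_succ]
  refine congrArg _ ?_
  rw [smul_smul, ← Int.negOnePow_add, smul_smul, ← Int.negOnePow_add]
  exact sgn_smul_congr
    (by simp only [Cochain.brk, Cochain.comb, Cochain.circ]; push_cast; grind) rfl

theorem cartan_comb (f g : Cochain A) (x y : ℤ) (F F₁ F₂ F₃ : Form A N)
    (h : ∀ a L, F a L = x.negOnePow • F₁ a L + y.negOnePow • F₂ a L + F₃ a L) (a : Elt A)
    (L : List (Elt A)) : cartan f g F a L = x.negOnePow • cartan f g F₁ a L +
      y.negOnePow • cartan f g F₂ a L + cartan f g F₃ a L := by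
  rw [cartan_congr f g h, cartan_add, cartan_add, cartan_units_smul, cartan_units_smul]

theorem lieHead_add (f : Cochain A) (F F' : Form A N) (a : Elt A) (L : List (Elt A)) :
    lieHead f (fun a L => F a L + F' a L) a L = lieHead f F a L + lieHead f F' a L := by
  rw [lieHead, lieHead, lieHead, ← cyc_add]; rfl

theorem lieTail_add (f : Cochain A) (F F' : Form A N) (a : Elt A) (L : List (Elt A)) :
    lieTail f (fun a L => F a L + F' a L) a L = lieTail f F a L + lieTail f F' a L := by
  simp only [lieTail, smul_add, splitSum_add]

theorem lie_add (f : Cochain A) (F F' : Form A N) (a : Elt A) (L : List (Elt A)) :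
    lie f (fun a L => F a L + F' a L) a L = lie f F a L + lie f F' a L := by
  simp only [lie, lieHead_add, lieTail_add]; abel

theorem lie_units_smul (f : Cochain A) (ε : ℤˣ) (F : Form A N) (a : Elt A) (L : List (Elt A)) :
    lie f (fun a L => ε • F a L) a L = ε • lie f F a L := by
  have : lieHead f (fun a L => ε • F a L) a L = ε • lieHead f F a L := by
    rw [lieHead, lieHead, ← cyc_units_smul]; rfl
  rw [lie, this, lie, smul_add]
  simp only [lieTail, splitSum_units_smul, smul_comm ε]

/-- The primitive in the formula for the contraction with a bracket. -/
noncomputable def brkPrim (f g : Cochain A) (F : Form A N) : Form A N := fun a L =>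
  (f.deg + g.deg).negOnePow • cartan f g F a L +
    ((f.deg - 1) * (g.deg - 1) + f.deg).negOnePow • sop f (iota g F) a L +
    g.deg.negOnePow • iota g (sop f F) a L

theorem iota_brk_eq (hF : IsForm w s F) (hw : Monotone w)
    (hc : ∀ a L, lie (mC A) F a L = 0) {f g : Cochain A} (hf : Closed f) (hg : Closed g)
    (a : Elt A) (L : List (Elt A)) : iota (f.brk g) F a L =
      ((f.deg - 1) * g.deg + 1).negOnePow • bop (iota f (iota g F)) a L +
      ((f.deg - 1) * (g.deg - 1) + 1).negOnePow • iota f (bop (iota g F)) a L +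
      iota g (bop (iota f F)) a L + (f.deg - 1).negOnePow • iota g (iota f (bop F)) a L +
      lie (mC A) (brkPrim f g F) a L := by
  have hgF := hF.iota hw g
  have hgw := g.mono.add hw
  have hc' : ∀ a L, lie (mC A) (iota g F) a L = 0 := fun a L => by
    rw [lie_mC_iota hF hw hg]
    have : iota g (lie (mC A) F) a L = 0 := by
      have h0 : lie (mC A) F = fun a L => 0 := by funext a L; exact hc a L
      rw [h0]
      have := cartan_add (mC A) g (fun _ _ => (0 : N)) (fun _ _ => 0) a L
      simp only [add_zero, left_eq_add] at this
      exact this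
    rw [this, smul_zero]
  have e1 := lie_mC_cartan hF hw hc hf hg a L
  have e2 := lieTail_iota hF hw f g a L
  have e3 := iota_brk hF hw f g a L
  have e4 := lie_mC_sop hgF hgw hc' hf a L
  have e5 : ∀ a L, lie f F a L = (f.deg - 1).negOnePow • lie (mC A) (sop f F) a L +
      (f.deg - 1).negOnePow • bop (iota f F) a L + iota f (bop F) a L := fun a L => by
    rw [lie_mC_sop hF hw hc hf, negOnePow_smul_smul]
    abel
  have e6 : iota g (lie f F) a L = (f.deg - 1).negOnePow • iota g (lie (mC A) (sop f F)) a L +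
      (f.deg - 1).negOnePow • iota g (bop (iota f F)) a L + iota g (iota f (bop F)) a L :=
    cartan_comb (mC A) g _ _ _ _ _ _ e5 a L
  have e7 : iota g (lie f F) a L = iota g (lieHead f F) a L + iota g (lieTail f F) a L :=
    cartan_add _ _ _ _ _ _
  have e8 := lie_mC_iota (hF.sop hw f) (f.mono.add hw) hg a L
  have e9 : lie (mC A) (brkPrim f g F) a L =
      (f.deg + g.deg).negOnePow • lie (mC A) (cartan f g F) a L +
    ((f.deg - 1) * (g.deg - 1) + f.deg).negOnePow • lie (mC A) (sop f (iota g F)) a L +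
    g.deg.negOnePow • lie (mC A) (iota g (sop f F)) a L := by
    unfold brkPrim
    rw [lie_add, lie_add, lie_units_smul, lie_units_smul, lie_units_smul]
  have e10 : lie f (iota g F) a L = lieHead f (iota g F) a L + lieTail f (iota g F) a L := rfl
  rw [e9, e1, e4, e8, e3, e10, e2]
  rw [← sub_eq_iff_eq_add'] at e7
  rw [← e7, e6]
  simp only [negOnePow_eq_sgn, smul_add, smul_sub, smul_smul]; push_cast
  generalize (f.deg : ZMod 2) = x
  generalize (g.deg : ZMod 2) = y
  rcases zmod_two_cases x with rfl | rfl <;> rcases zmod_two_cases y with rfl | rfl <;>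
    simp +decide [sgn] <;> abel

theorem IsForm.brkPrim (hF : IsForm w s F) (hw : Monotone w) (f g : Cochain A) :
    IsForm (f.w + g.w + w) s (brkPrim f g F) :=
  ((((hF.cartan hw f g).units_smul _).congr (by abel) fun _ _ => rfl).fun_add
    (((hF.iota hw g).sop (g.mono.add hw) f).units_smul _ |>.congr (by abel) fun _ _ => rfl)).fun_add
    (((hF.sop hw f).iota (f.mono.add hw) g).units_smul _ |>.congr (by abel) fun _ _ => rfl)

theorem HasDeg.brkPrim (hq : HasDeg q F) (f g : Cochain A) :
    HasDeg (f.deg + g.deg + q - 2) (brkPrim f g F) := by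
  refine ((((hq.cartan f g).units_smul _)).fun_add ?_).fun_add ?_
  · have := ((hq.iota g).sop f).units_smul ((f.deg - 1) * (g.deg - 1) + f.deg).negOnePow
    rwa [show f.deg + (g.deg + q) - 2 = f.deg + g.deg + q - 2 by ring] at this
  · have := ((hq.sop f).iota g).units_smul g.deg.negOnePow
    rwa [show g.deg + (f.deg + q - 2) = f.deg + g.deg + q - 2 by ring] at this

theorem normalized_brkPrim (hF : IsForm w s F) (hw : Monotone w) (hN : ∀ a, Normalized (F a))
    {f g : Cochain A} (hf : f.Norm) (hg : g.Norm) (a : Elt A) :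
    Normalized (brkPrim f g F a) := fun L L' p => by
  rw [brkPrim, normalized_cartan hF hw hN hf hg a L L' p,
    normalized_sop (hF.iota hw g) (normalized_iota hF hw hN hg) hf a L L' p,
    normalized_iota (hF.sop hw f) (f.mono.add hw) (normalized_sop hF hN hf) hg a L L' p]
  simp

theorem lieTail_eq_ins (f : Cochain A) (F : Form A N) (a : Elt A) (L : List (Elt A)) :
    lieTail f F a L = ((f.deg - 1) * (a.deg - 1)).negOnePow • ins f (F a) L := by
  simp only [lieTail, ins, splitSum_units_smul, smul_smul, ← Int.negOnePow_add, mul_add]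

theorem IsForm.lie_out (hF : IsForm w s F) (hw : Monotone w) (f : Cochain A) {a : Elt A}
    {L : List (Elt A)} (h : ¬ (a.perv.toFun + pervSum L + (f.w + w) ≤ s.toFun)) :
    lie f F a L = 0 := by
  have e1 : lieHead f F a L = 0 := (hF.isCyc_fil hw f).cyc.slot L |>.out a fun h' =>
    h (le_of_eq_of_le (by abel) h')
  rw [lie, e1, lieTail_eq_ins, ((hF.mul a).ins (a.perv.toFun_mono.add hw) f).out L fun h' =>
    h (le_of_eq_of_le (by abel) h'), smul_zero, add_zero]

theorem HasDeg.lie (hq : HasDeg q F) (f : Cochain A) : HasDeg (f.deg + q - 1) (lie f F) :=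
  fun a L h => by
  have e1 : lieHead f F a L = 0 := by
    rw [lieHead, cyc]
    refine splitSum_eq_zero fun Kr L' h₁ => splitSum_eq_zero fun M Kl h₂ =>
      (congrArg _ (hq _ _ fun h' => h ?_)).trans (smul_zero _)
    rw [← h', ← h₁, ← h₂]
    simp only [sdeg_append, sdeg_cons, Cochain.ent_deg]; ring
  have e2 : lieTail f F a L = 0 := by
    rw [lieTail]
    refine splitSum_eq_zero fun Kr L' h₁ => splitSum_eq_zero fun M Kl h₂ =>
      (congrArg _ (hq _ _ fun h' => h ?_)).trans (smul_zero _)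
    rw [← h', ← h₁, ← h₂]
    simp only [sdeg_append, sdeg_cons, Cochain.ent_deg]; ring
  rw [PerverseHochschild.lie, e1, e2, add_zero]

end

/-! ### Cochains with values in the dual, as forms -/

/-- The value at `x` of a cochain with values in the dual. -/
def dval (c : Raw A A.dual) (L : List (Elt A)) (s : Perversity n) (t : ℤ)
    (x : A.X s.compl (-t)) : R := (show Module.Dual R (A.X s.compl (-t)) from c L s t) x

theorem dval_ext {c c' : Raw A A.dual} (h : ∀ L s t x, dval c L s t x = dval c' L s t x) :
    c = c' := by
  funext L s t
  exact LinearMap.ext (h L s t)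

/-- The form `f'(a₀[a₁|…|aₖ])`. -/
def form (c : Raw A A.dual) : Form A R := fun a L =>
  (a.deg * sdeg L).negOnePow • dval c L a.perv.compl (-a.deg) (a.ev _ _)

theorem Elt.mk_ev (a : Elt A) {p : Perversity n} {d : ℤ} (hp : a.perv = p) (hd : a.deg = d) :
    (⟨p, d, a.ev p d⟩ : Elt A) = a := by
  subst hp hd; rw [Elt.ev_self]

theorem Elt.exists_eq (a : Elt A) :
    ∃ (s : Perversity n) (t : ℤ) (x : A.X s.compl (-t)), a = ⟨s.compl, -t, x⟩ :=
  ⟨a.perv.compl, -a.deg, a.ev _ _,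
    (a.mk_ev (Perversity.compl_compl _).symm (neg_neg _).symm).symm⟩

theorem form_mk (c : Raw A A.dual) (L : List (Elt A)) (s : Perversity n) (t : ℤ)
    (x : A.X s.compl (-t)) : form c ⟨s.compl, -t, x⟩ L =
      (-t * sdeg L).negOnePow • dval c L s t x := by
  have : ∀ (s' : Perversity n) (t' : ℤ), s' = s → t' = t →
      dval c L s' t' ((⟨s.compl, -t, x⟩ : Elt A).ev s'.compl (-t')) = dval c L s t x := by
    rintro _ _ rfl rfl
    rw [Elt.ev_mk, A.map_self]
  exact congrArg _ (this _ _ (Perversity.compl_compl _) (neg_neg _))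

theorem form_injective {c c' : Raw A A.dual} (h : ∀ a L, form c a L = form c' a L) : c = c' := by
  refine dval_ext fun L s t x => ?_
  have := h ⟨s.compl, -t, x⟩ L
  rw [form_mk, form_mk] at this
  exact smul_left_cancel _ this

theorem form_add (c c' : Raw A A.dual) (a : Elt A) (L : List (Elt A)) :
    form (c + c') a L = form c a L + form c' a L := by
  rw [form, form, form, ← smul_add]; rfl

theorem form_units_smul (ε : ℤˣ) (c : Raw A A.dual) (a : Elt A) (L : List (Elt A)) :
    form (ε • c) a L = ε • form c a L := by
  rw [form, form, smul_comm ε]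
  refine congrArg _ ?_
  rcases Int.units_eq_one_or ε with rfl | rfl
  · simp only [one_smul]
  · simp only [Units.neg_smul, one_smul]; rfl

theorem form_zero (a : Elt A) (L : List (Elt A)) : form (0 : Raw A A.dual) a L = 0 :=
  smul_zero _

section

variable {v w : Fin (n + 1) → ℕ} {q : ℤ} {c : Raw A A.dual}

theorem not_le_compl {s : Perversity n} (h : ¬ (s.compl.toFun + v ≤ (top n).toFun)) :
    ¬ (v ≤ s.toFun) := fun h' => h <| le_compl_iff.1 <| by rwa [Perversity.compl_compl]

theorem Slot.of_compl {N : Type*} [AddCommGroup N] [Module R N] {s : Perversity n}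
    {H : Elt A → N} (h : Slot v s H) : Slot (s.compl.toFun + v) (top n) H where
  out x hx := h.out x (not_le_compl fun h' => hx (le_of_eq_of_le (by abel) h'))
  add := h.add
  smul := h.smul
  nat p₁ p₂ i a h₁ h₂ := h.nat p₁ p₂ i a h₁ <| by
    rw [← s.compl_compl]
    exact le_compl_iff.2 (le_of_eq_of_le (by abel) h₂)

theorem form_out (hc : Fam A.dual.toPerverseComplex w q c) {a : Elt A} {L : List (Elt A)}
    (h : ¬ (a.perv.toFun + (pervSum L + w) ≤ (top n).toFun)) : form c a L = 0 := by
  obtain ⟨s, t, x, rfl⟩ := a.exists_eq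
  have : c L s t = 0 := (hc.mul s t).out L (not_le_compl h)
  rw [form_mk, dval, this]
  exact smul_zero _

theorem Fam.isForm (hc : Fam A.dual.toPerverseComplex w q c) : IsForm w (top n) (form c) where
  slot L :=
    { out := fun a h => form_out hc h
      add := fun p i a b => by
        simp only [form, (slot_ev _ _).add, ← smul_add]
        exact congrArg _ (map_add _ _ _)
      smul := fun p i r a => by
        simp only [form, (slot_ev _ _).smul, smul_comm r]
        exact congrArg _ (map_smul _ _ _)
      nat := fun p₁ p₂ i a h₁ h₂ => by
        obtain ⟨s₁, rfl⟩ : ∃ s₁, p₁ = s₁.compl := ⟨p₁.compl, (Perversity.compl_compl _).symm⟩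
        obtain ⟨s₂, rfl⟩ : ∃ s₂, p₂ = s₂.compl := ⟨p₂.compl, (Perversity.compl_compl _).symm⟩
        obtain ⟨t, rfl⟩ : ∃ t, i = -t := ⟨-i, (neg_neg _).symm⟩
        rw [form_mk, form_mk]
        have h := hc.nat L s₂ s₁ t (by
          rw [← s₂.compl_compl]; exact le_compl_iff.2 h₂) (compl_le_compl_iff.1 h₁)
        rw [dval, dval, ← h]
        rfl }
  mul a := by
    obtain ⟨s, t, x, rfl⟩ := a.exists_eq
    refine ⟨fun L h => form_out hc fun h' => h (le_of_eq_of_le (by abel) h'), fun L L' => ?_⟩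
    have h := ((((hc.mul s t).slot L L').comp_lin
      (LinearMap.applyₗ (R := R) (M := A.X s.compl (-t)) (M₂ := R) x)).fun_sign
        fun d => -t * (sdeg L + sdeg L' + (d - 1))).of_compl
    refine h.congr (by abel) fun b => ?_
    rw [form_mk, sdeg_mid]
    rfl

theorem Fam.hasDeg (hc : Fam A.dual.toPerverseComplex w q c) : HasDeg q (form c) := by
  intro a L h
  obtain ⟨s, t, x, rfl⟩ := a.exists_eq
  have : c L s t = 0 := hc.shape L s t fun h' => h (by simp only; omega)
  rw [form_mk, dval, this]
  exact smul_zero _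

theorem normalized_form (h : ∀ s t, Normalized fun L => c L s t) (a : Elt A) :
    Normalized (form c a) := by
  intro L L' p
  obtain ⟨s, t, x, rfl⟩ := a.exists_eq
  have : c (L ++ ⟨p, 0, A.map 0 p 0 A.one⟩ :: L') s t = 0 := h s t L L' p
  rw [form_mk, dval, this]
  exact smul_zero _

theorem normalized_of_form (h : ∀ a, Normalized (form c a)) (s : Perversity n) (t : ℤ) :
    Normalized fun L => c L s t := by
  intro L L' p
  refine LinearMap.ext fun x => ?_
  have := h ⟨s.compl, -t, x⟩ L L' p
  rw [form_mk] at this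
  exact (smul_eq_zero_iff_eq _).1 this

/-- The cochain with a given form. -/
theorem IsForm.exists_fam {F : Form A R} (hF : IsForm w (top n) F) (hq : HasDeg q F) :
    ∃ c : Raw A A.dual, Fam A.dual.toPerverseComplex w q c ∧ ∀ a L, form c a L = F a L := by
  let c : Raw A A.dual := fun L s t =>
    show Module.Dual R (A.X s.compl (-t)) from
      (-t * sdeg L).negOnePow • (hF.slot L).lin s.compl (-t)
  have hc : ∀ L s t x, dval c L s t x = (-t * sdeg L).negOnePow • F ⟨s.compl, -t, x⟩ L :=
    fun _ _ _ _ => rfl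
  refine ⟨c, ⟨fun L s t h => ?_, fun s t => ⟨fun L h => ?_, fun L L' => ?_⟩,
    fun L s s' t h h' => ?_⟩, fun a L => ?_⟩
  · refine LinearMap.ext fun x => (hc L s t x).trans ?_
    rw [hq _ _ fun h' => h (by simp only at h'; omega), smul_zero]
    rfl
  · refine LinearMap.ext fun x => (hc L s t x).trans ?_
    rw [(hF.slot L).out _ fun h' => h (by rw [← s.compl_compl]; exact le_compl_iff.2 h'), smul_zero]
    rfl
  · have h (x : A.X s.compl (-t)) := ((hF.mul ⟨s.compl, -t, x⟩).slot L L').fun_sign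
      fun d => -t * (sdeg L + sdeg L' + (d - 1))
    have e (x : A.X s.compl (-t)) (b : Elt A) : dval c (L ++ b :: L') s t x =
        (-t * (sdeg L + sdeg L' + (b.deg - 1))).negOnePow • F ⟨s.compl, -t, x⟩ (L ++ b :: L') := by
      rw [hc, sdeg_mid]
    exact
      { out := fun b hb => LinearMap.ext fun x => (e x b).trans <| (h x).out b fun h' => hb <| by
          rw [← s.compl_compl]; exact le_compl_iff.2 (le_of_eq_of_le (by simp only; abel) h')
        add := fun p i a b => LinearMap.ext fun x =>
          (e x _).trans (((h x).add p i a b).trans (congrArg₂ _ (e x _).symm (e x _).symm))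
        smul := fun p i r a => LinearMap.ext fun x =>
          (e x _).trans (((h x).smul p i r a).trans (congrArg _ (e x _).symm))
        nat := fun p₁ p₂ i a h₁ h₂ => LinearMap.ext fun x =>
          (e x _).trans (((h x).nat p₁ p₂ i a h₁ (le_of_eq_of_le (by simp only; abel)
            (le_compl_iff.1 (le_of_le_of_eq h₂
              (congrArg Perversity.toFun s.compl_compl.symm))))).trans (e x _).symm) }
  · refine LinearMap.ext fun x => (hc L s t _).trans ((congrArg _ ?_).trans (hc L s' t x).symm)
    exact (hF.slot L).nat _ _ _ x (compl_le_compl_iff.2 h')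
      (le_compl_iff.1 (by rwa [Perversity.compl_compl]))
  · obtain ⟨s, t, x, rfl⟩ := a.exists_eq
    rw [form_mk, hc, negOnePow_smul_smul]

end

/-! ### The operations on cochains with values in the dual -/

section

variable {v w : Fin (n + 1) → ℕ} {q : ℤ} {c : Raw A A.dual} {s : Perversity n} {t : ℤ}
  {L : List (Elt A)}

theorem form_mul (hc : Fam A.dual.toPerverseComplex w q c) {a b : Elt A} {r : Perversity n} {j : ℤ}
    (M : List (Elt A)) (h : a.perv.toFun + b.perv.toFun ≤ r.compl.toFun)
    (hr : pervSum M + w ≤ r.toFun) (hj : a.deg + b.deg = -j) :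
    form c (a.mul b) M = (-j * sdeg M).negOnePow • dval c M r j (a.pmul b r.compl (-j)) := by
  rw [← form_mk]
  exact (hc.isForm.slot M).mul_eq h (le_compl_iff.1 (by rwa [Perversity.compl_compl])) hj

theorem zmod_two_sq (x : ZMod 2) : x * x = x := by revert x; decide

/-- Evaluation at `x`. -/
def dapp (x : A.X s.compl (-t)) : A.dual.X s t →ₗ[R] R :=
  LinearMap.applyₗ (R := R) (M := A.X s.compl (-t)) (M₂ := R) x

theorem map_units_smul' {N N' : Type*} [AddCommGroup N] [Module R N] [AddCommGroup N'] [Module R N']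
    (φ : N →ₗ[R] N') (ε : ℤˣ) (x : N) : φ (ε • x) = ε • φ x := by
  rw [Units.smul_def, map_zsmul]; rfl

theorem lactVal_dual (hc : Fam A.dual.toPerverseComplex w q c) (hw : Monotone w)
    (x : A.X s.compl (-t)) (b : Elt A) (M : List (Elt A))
    (hs : b.perv.toFun + (pervSum M + w) ≤ s.toFun) (ht : b.deg + (sdeg M + q) = t) :
    dapp x (lactVal w q c s t b M) =
      (b.deg + (sdeg M + q) * sdeg M).negOnePow • form c ((⟨s.compl, -t, x⟩ : Elt A).mul b) M := by
  have hr : pervSum M + w ≤ (ceil (pervSum M + w)).toFun :=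
    le_ceil (le_of_add_le_left (le_of_eq_of_le (add_comm _ _) hs))
  have h1 : AddLE b.perv (ceil (pervSum M + w)) s := addLE_ceil_left ((pervSum_mono M).add hw) hs
  rw [form_mul hc M (a := ⟨s.compl, -t, x⟩) (b := b) (addLE_compl_left.2 h1) hr
    (j := sdeg M + q) (by simp only; omega), smul_smul, ← Int.negOnePow_add]
  rw [sgn_eq (x := b.deg + (sdeg M + q) * sdeg M + -(sdeg M + q) * sdeg M) (y := b.deg)
    (by push_cast; grind)]
  rfl

theorem ractVal_dual (hc : Fam A.dual.toPerverseComplex w q c) (hw : Monotone w)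
    (x : A.X s.compl (-t)) (b : Elt A) (M : List (Elt A))
    (hs : pervSum M + w + b.perv.toFun ≤ s.toFun) (ht : sdeg M + q + b.deg = t) :
    dapp x (ractVal w q c s t M b) =
      ((sdeg M + q) * sdeg M).negOnePow • form c (b.mul ⟨s.compl, -t, x⟩) M := by
  have hr : pervSum M + w ≤ (ceil (pervSum M + w)).toFun := le_ceil (le_of_add_le_left hs)
  have h1 : AddLE (ceil (pervSum M + w)) b.perv s :=
    ceil_add_le ((pervSum_mono M).add hw) b.perv.toFun_mono hs
  rw [form_mul hc M (a := b) (b := ⟨s.compl, -t, x⟩) (addLE_compl_right.2 h1) hr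
    (j := sdeg M + q) (by simp only; omega), smul_smul, ← Int.negOnePow_add]
  rw [sgn_eq (x := (sdeg M + q) * sdeg M + -(sdeg M + q) * sdeg M) (y := 0)
    (by push_cast; grind), Int.negOnePow_zero, one_smul]
  rfl

theorem form_actV (hc : Fam A.dual.toPerverseComplex w q c) (hw : Monotone w) (g : Cochain A)
    (a : Elt A) (L : List (Elt A)) :
    form (actV g w q c) a L = (g.deg * (q + 1) + 1).negOnePow • iota g (form c) a L := by
  by_cases h : a.perv.toFun + (pervSum L + (g.w + w)) ≤ (top n).toFun
  swap
  · rw [form_out (hc.actV hw g) h, ((hc.isForm.iota hw g).slot L).out a h, smul_zero]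
  by_cases h' : a.deg + sdeg L + (g.deg + q) = 0
  swap
  · rw [(hc.actV hw g).hasDeg a L h', hc.hasDeg.iota g a L h', smul_zero]
  obtain ⟨s, t, x, rfl⟩ := a.exists_eq
  have hs : pervSum L + (g.w + w) ≤ s.toFun := by
    rw [← s.compl_compl]; exact le_compl_iff.2 h
  simp only at h'
  rw [form_mk, iota_eq hc.isForm hw]
  change _ • dapp x (actV g w q c L s t) = _
  rw [actV, map_splitSum, splitSum_units_smul, splitSum_units_smul]
  refine splitSum_congr fun L₁ L₂ e => ?_
  rw [map_units_smul', lactVal_dual hc hw x]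
  · simp only [smul_smul, ← Int.negOnePow_add]
    refine sgn_smul_congr ?_ rfl
    obtain rfl : t = sdeg L + (g.deg + q) := by omega
    rw [← e]
    simp only [sdeg_append, Cochain.ent_deg]; push_cast
    grind [zmod_two_sq (sdeg L₁ : ZMod 2), zmod_two_sq (sdeg L₂ : ZMod 2),
      zmod_two_sq (g.deg : ZMod 2), zmod_two_sq (q : ZMod 2)]
  · rw [Cochain.ent_perv]
    refine ceil_add_le ((pervSum_mono _).add g.mono) ((pervSum_mono _).add hw) ?_
    rw [← e, pervSum_append] at hs
    exact le_of_eq_of_le (by abel) hs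
  · rw [Cochain.ent_deg]; rw [← e, sdeg_append] at h'; omega

theorem form_gD_mk (hc : Fam A.dual.toPerverseComplex w q c) (hw : Monotone w)
    {x : A.X s.compl (-t)} (hs : pervSum L + w ≤ s.toFun) (ht : sdeg L + q + 1 = t) :
    form (gD w q c) ⟨s.compl, -t, x⟩ L =
      (q + 1).negOnePow • lie (mC A) (form c) ⟨s.compl, -t, x⟩ L := by
  have hF := hc.isForm
  rw [form_mk]
  change _ • dapp x (gD w q c L s t) = _
  rw [gD, map_add, map_add, map_add, map_headSum, map_lastSum, map_units_smul', map_ins]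
  simp only [map_units_smul']
  have e1 : dapp x (A.dual.d s (t - 1) t (c L s (t - 1))) =
      (t + (t + 1) * sdeg L).negOnePow • form c (⟨s.compl, -t, x⟩ : Elt A).d L := by
    have e : ∀ d, d = -(t - 1) → form c ⟨s.compl, d, A.d s.compl (-t) d x⟩ L =
        (-(t - 1) * sdeg L).negOnePow • dval c L s (t - 1) (A.d s.compl (-t) (-(t - 1)) x) := by
      rintro _ rfl; exact form_mk _ _ _ _ _
    refine Eq.trans ?_ (congrArg _ (e _ (by ring)).symm)
    rw [smul_smul, ← Int.negOnePow_add, sgn_eq (x := t + (t + 1) * sdeg L + -(t - 1) * sdeg L)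
      (y := t - 1 + 1) (by push_cast; grind), Int.negOnePow_succ, Units.neg_smul]
    refine congrArg Neg.neg ?_
    rcases Int.units_eq_one_or (t - 1).negOnePow with h | h
    · rw [h]; simp only [one_smul]; rfl
    · rw [h]; simp only [Units.neg_smul, one_smul]; rfl
  have e2 : ins (mC A) (fun K => dapp x (c K s t)) L =
      (t * (sdeg L + 1) + (t + 1)).negOnePow • lieTail (mC A) (form c) ⟨s.compl, -t, x⟩ L := by
    rw [lieTail_eq_ins, smul_smul, ← Int.negOnePow_add, ins, ins, splitSum_units_smul]
    refine splitSum_congr fun L₁ L' h₁ => ?_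
    rw [splitSum_units_smul]
    refine splitSum_congr fun L₂ L₃ h₂ => ?_
    rw [form_mk, smul_smul, smul_smul, ← Int.negOnePow_add, ← Int.negOnePow_add]
    refine sgn_smul_congr ?_ rfl
    rw [sdeg_ent, h₂, h₁]
    simp only [mC]; push_cast; grind
  have e3 :
      (headSum L fun b M => ((b.deg + 1) * q + 1).negOnePow • dapp x (lactVal w q c s t b M)) =
      headSum L fun b M => ((b.deg + 1) * q + 1 + (b.deg + (sdeg M + q) * sdeg M)).negOnePow •
        form c ((⟨s.compl, -t, x⟩ : Elt A).mul b) M := by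
    refine headSum_congr fun b M e => ?_
    rw [lactVal_dual hc hw x, smul_smul, ← Int.negOnePow_add]
    · rw [← e, pervSum_cons] at hs; rwa [← add_assoc]
    · rw [← e, sdeg_cons] at ht; omega
  have e4 : (lastSum L fun M b => (sdeg M + q).negOnePow • dapp x (ractVal w q c s t M b)) =
      lastSum L fun M b => (sdeg M + q + (sdeg M + q) * sdeg M).negOnePow •
        form c (b.mul ⟨s.compl, -t, x⟩) M := by
    refine lastSum_congr fun M b e => ?_
    rw [ractVal_dual hc hw x, smul_smul, ← Int.negOnePow_add]
    · rw [← e, pervSum_mid, pervSum_nil] at hs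
      exact le_of_eq_of_le (by abel) hs
    · rw [← e, sdeg_mid, sdeg_nil] at ht; omega
  rw [e1, e2, e3, e4, lie, lieHead_mC hF hw]
  simp only [smul_add, headSum_units_smul, lastSum_units_smul, smul_smul, ← Int.negOnePow_add]
  have key {a b c d a' b' c' d' : R} (h₁ : a = a') (h₂ : b = b') (h₃ : c = c') (h₄ : d = d') :
      a + b + c + d = a' + c' + d' + b' := by rw [h₁, h₂, h₃, h₄]; ring
  refine key (sgn_smul_congr ?_ rfl) (sgn_smul_congr ?_ rfl) (headSum_congr fun b M e =>
    sgn_smul_congr ?_ rfl) (lastSum_congr fun M b e => sgn_smul_congr ?_ rfl)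
  · subst ht; push_cast; grind [zmod_two_sq (sdeg L : ZMod 2), zmod_two_sq (q : ZMod 2)]
  · subst ht; push_cast; grind [zmod_two_sq (sdeg L : ZMod 2), zmod_two_sq (q : ZMod 2)]
  · subst ht e; simp only [sdeg_cons]; push_cast
    grind [zmod_two_sq (sdeg M : ZMod 2), zmod_two_sq (b.deg : ZMod 2), zmod_two_sq (q : ZMod 2)]
  · subst ht e; simp only [sdeg_mid, sdeg_nil]; push_cast
    grind [zmod_two_sq (sdeg M : ZMod 2), zmod_two_sq (b.deg : ZMod 2), zmod_two_sq (q : ZMod 2)]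

theorem form_gD (hc : Fam A.dual.toPerverseComplex w q c) (hw : Monotone w) (a : Elt A)
    (L : List (Elt A)) :
    form (gD w q c) a L = (q + 1).negOnePow • lie (mC A) (form c) a L := by
  by_cases h : a.perv.toFun + (pervSum L + w) ≤ (top n).toFun
  swap
  · rw [hc.isForm.lie_out hw (mC A) fun h' => h (le_of_eq_of_le (by simp [mC]; abel) h'), smul_zero]
    obtain ⟨s, t, x, rfl⟩ := a.exists_eq
    rw [form_mk, dval, gD_out hc hw (not_le_compl h)]
    exact smul_zero _
  by_cases h' : a.deg + sdeg L + (q + 1) = 0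
  swap
  · have := hc.hasDeg.lie (mC A) a L fun h'' => h' (by rw [← h'']; simp only [mC]; ring)
    rw [this, smul_zero]
    obtain ⟨s, t, x, rfl⟩ := a.exists_eq
    rw [form_mk, dval, gD_shape hc hw fun h'' => h' (by simp only; omega)]
    exact smul_zero _
  obtain ⟨s, t, x, rfl⟩ := a.exists_eq
  exact form_gD_mk hc hw (by rw [← s.compl_compl]; exact le_compl_iff.2 h)
    (by simp only at h'; omega)

end

/-! ### The dual of Connes' boundary -/

section

variable {v w : Fin (n + 1) → ℕ} {s : Perversity n} {t q : ℤ} {c h : Raw A A.dual}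
  {F F' : Form A N}

theorem top_compl (n : ℕ) : (top n).compl = 0 := by
  refine Perversity.ext (funext fun i => ?_)
  exact Nat.sub_self _

theorem bop_congr (h : ∀ a L, F a L = F' a L) (a : Elt A) (L : List (Elt A)) :
    bop F a L = bop F' a L := by
  have : F = F' := funext fun a => funext fun L => h a L
  rw [this]

theorem bop_add (F F' : Form A N) (a : Elt A) (L : List (Elt A)) :
    bop (fun a L => F a L + F' a L) a L = bop F a L + bop F' a L := by
  simp only [bop, cyc_atNil, mark, smul_add, splitSum_add]

theorem bop_units_smul (ε : ℤˣ) (F : Form A N) (a : Elt A) (L : List (Elt A)) :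
    bop (fun a L => ε • F a L) a L = ε • bop F a L := by
  simp only [bop, cyc_atNil, mark, splitSum_units_smul, smul_comm ε]

theorem bop_smul (r : R) (F : Form A N) (a : Elt A) (L : List (Elt A)) :
    bop (fun a L => r • F a L) a L = r • bop F a L := by
  simp only [bop, cyc_atNil, mark]
  exact (splitSum_congr fun _ _ _ => smul_comm _ _ _).trans (splitSum_smul r L _)

theorem form_smul (r : R) (c : Raw A A.dual) (a : Elt A) (L : List (Elt A)) :
    form (r • c) a L = r • form c a L := by
  rw [form, form, smul_comm r]; rfl

theorem form_oneE (c : Raw A A.dual) (K : List (Elt A)) :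
    form c (oneE A) K = (show Module.Dual R (A.X (top n).compl (-0)) from c K (top n) 0)
      (A.cast _ 0 (-0) (A.map 0 _ 0 A.one)) := by
  have h := form_mk c K (top n) 0 ((oneE A).ev (top n).compl (-0))
  rw [Elt.mk_ev (oneE A) (top_compl n).symm (by simp [oneE])] at h
  rw [h, sgn_eq (x := -0 * sdeg K) (y := 0) (by simp), Int.negOnePow_zero, one_smul]
  rfl

theorem isConnesDual_iff : IsConnesDual q c h ↔
    ∀ a L, form h a L = (q + 1).negOnePow • bop (form c) a L := by
  have e (a : Elt A) (L : List (Elt A)) : (q + 1).negOnePow • bop (form c) a L =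
      -(q.negOnePow • splitSum L fun L₁ L₂ => (sdeg (a :: L₁) * sdeg L₂).negOnePow •
        form c (oneE A) (L₂ ++ a :: L₁)) := by
    rw [Int.negOnePow_succ, Units.neg_smul, bop, cyc_atNil]
    refine congrArg _ (congrArg _ (splitSum_congr fun L₁ L₂ _ => ?_))
    rw [sdeg_cons, mul_comm]; rfl
  constructor
  · intro H a L
    obtain ⟨s, t, x, rfl⟩ := a.exists_eq
    rw [e, form_mk]
    refine (H L s t x).trans (congrArg _ (congrArg _ (splitSum_congr fun L₁ L₂ _ => ?_)))
    rw [form_oneE]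
  · intro H L s t x
    have := H ⟨s.compl, -t, x⟩ L
    rw [e, form_mk] at this
    refine this.trans (congrArg _ (congrArg _ (splitSum_congr fun L₁ L₂ _ => ?_)))
    rw [form_oneE]

open Classical in
/-- The dual of Connes' boundary on cochains of degree `q`. -/
noncomputable def connesV (q : ℤ) (c : Raw A A.dual) : Raw A A.dual :=
  if h : ∃ h, IsConnesDual q c h then h.choose else 0

theorem connesV_eq (hh : IsConnesDual q c h) : connesV q c = h := by
  have H : ∃ h, IsConnesDual q c h := ⟨h, hh⟩
  rw [connesV, dif_pos H]
  exact form_injective fun a L =>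
    (isConnesDual_iff.1 H.choose_spec a L).trans (isConnesDual_iff.1 hh a L).symm

theorem Fam.exists_connes (hc : Fam A.dual.toPerverseComplex w q c) :
    ∃ h, Fam A.dual.toPerverseComplex w (q - 1) h ∧ IsConnesDual q c h := by
  obtain ⟨h, h1, h2⟩ := (hc.isForm.bop.units_smul (q + 1).negOnePow).exists_fam
    (hc.hasDeg.bop.units_smul _)
  exact ⟨h, h1, isConnesDual_iff.2 h2⟩

theorem Fam.isConnesDual (hc : Fam A.dual.toPerverseComplex w q c) :
    IsConnesDual q c (connesV q c) := by
  obtain ⟨h, -, h2⟩ := hc.exists_connes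
  rwa [connesV_eq h2]

theorem Fam.connesV (hc : Fam A.dual.toPerverseComplex w q c) :
    Fam A.dual.toPerverseComplex w (q - 1) (connesV q c) := by
  obtain ⟨h, h1, h2⟩ := hc.exists_connes
  rwa [connesV_eq h2]

theorem form_connesV (hc : Fam A.dual.toPerverseComplex w q c) (a : Elt A) (L : List (Elt A)) :
    form (connesV q c) a L = (q + 1).negOnePow • bop (form c) a L :=
  isConnesDual_iff.1 hc.isConnesDual a L

theorem normalized_connesV (hc : Fam A.dual.toPerverseComplex w q c)
    (hN : ∀ s t, Normalized fun L => c L s t) (s : Perversity n) (t : ℤ) :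
    Normalized fun L => connesV q c L s t := by
  refine normalized_of_form (fun a L L' p => ?_) s t
  rw [form_connesV hc, normalized_bop (fun a => normalized_form hN a), smul_zero]

theorem gD_connesV (hc : Fam A.dual.toPerverseComplex w q c) (hw : Monotone w) :
    connesV (q + 1) (gD w q c) = (-1 : ℤˣ) • gD w (q - 1) (connesV q c) := by
  refine connesV_eq (isConnesDual_iff.2 fun a L => ?_)
  rw [form_units_smul, form_gD hc.connesV hw]
  have e1 : form (PerverseHochschild.connesV q c) =
      fun a L => (q + 1).negOnePow • bop (form c) a L :=
    funext fun a => funext fun L => form_connesV hc a L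
  have e2 : form (gD w q c) = fun a L => (q + 1).negOnePow • lie (mC A) (form c) a L :=
    funext fun a => funext fun L => form_gD hc hw a L
  rw [e1, e2, lie_units_smul, lie_mC_bop hc.isForm hw, bop_units_smul, smul_neg, smul_neg,
    Units.neg_smul, one_smul, neg_neg, smul_smul, smul_smul, ← Int.negOnePow_add,
    ← Int.negOnePow_add]
  exact sgn_smul_congr (by push_cast; grind) rfl

theorem connesV_zero (q : ℤ) : connesV q (0 : Raw A A.dual) = 0 :=
  connesV_eq <| isConnesDual_iff.2 fun a L => by
    have : form (0 : Raw A A.dual) = fun a L => (0 : R) • form (0 : Raw A A.dual) a L := by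
      funext a L; rw [form_zero, smul_zero]
    rw [form_zero, this, bop_smul, zero_smul, smul_zero]

theorem restr_connesV {r : Perversity n} (hc : Fam A.dual.toPerverseComplex w q c)
    (hr : w ≤ r.toFun) : restr r (connesV q c) = connesV q (restr r c) := by
  have hc' := hc.restr hr
  have out (c' : Raw A A.dual) (a : Elt A) (L : List (Elt A))
      (h : ¬ (a.perv.toFun + (pervSum L + r.toFun) ≤ (top n).toFun)) :
      form (restr r c') a L = 0 := by
    obtain ⟨s, t, x, rfl⟩ := a.exists_eq
    rw [form_mk, dval, restr_of_not_le _ (not_le_compl h)]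
    exact smul_zero _
  have inn (c' : Raw A A.dual) (a : Elt A) (L : List (Elt A))
      (h : a.perv.toFun + (pervSum L + r.toFun) ≤ (top n).toFun) :
      form (restr r c') a L = form c' a L := by
    obtain ⟨s, t, x, rfl⟩ := a.exists_eq
    rw [form_mk, form_mk, dval, restr_of_le _ (by rw [← s.compl_compl]; exact le_compl_iff.2 h)]
    rfl
  refine (connesV_eq (isConnesDual_iff.2 fun a L => ?_)).symm
  by_cases h : a.perv.toFun + (pervSum L + r.toFun) ≤ (top n).toFun
  · rw [inn _ _ _ h, form_connesV hc, bop, cyc_atNil, bop, cyc_atNil]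
    refine congrArg _ (splitSum_congr fun K K' e => congrArg _ ?_)
    refine (inn _ _ _ ?_).symm
    rw [← e, pervSum_append] at h
    rw [pervSum_append, pervSum_cons]
    exact le_of_eq_of_le (by change 0 + _ = _; rw [zero_add]; abel) h
  · rw [out _ _ _ h, hc'.isForm.bop.slot L |>.out a h, smul_zero]

end

section

variable {p : Perversity n} {q : ℤ} {c c' : Raw A A.dual}

theorem connesV_add (hc : c ∈ HC A A.dual p q) (hc' : c' ∈ HC A A.dual p q) :
    connesV q (c + c') = connesV q c + connesV q c' :=
  connesV_eq <| isConnesDual_iff.2 fun a L => by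
    rw [form_add, form_connesV (mem_HC.1 hc).1, form_connesV (mem_HC.1 hc').1, ← smul_add,
      ← bop_add, bop_congr (form_add c c')]

theorem connesV_smul (r : R) (hc : c ∈ HC A A.dual p q) :
    connesV q (r • c) = r • connesV q c :=
  connesV_eq <| isConnesDual_iff.2 fun a L => by
    rw [form_smul, form_connesV (mem_HC.1 hc).1, smul_comm r, ← bop_smul,
      bop_congr (form_smul r c)]

theorem connesV_mem_HC (hc : c ∈ HC A A.dual p q) : connesV q c ∈ HC A A.dual p (q - 1) :=
  mem_HC.2 ⟨(mem_HC.1 hc).1.connesV, normalized_connesV (mem_HC.1 hc).1 (mem_HC.1 hc).2⟩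

theorem connesV_mem_cocycles (hc : c ∈ cocycles A A.dual p q) :
    connesV q c ∈ cocycles A A.dual p (q - 1) :=
  mem_cocycles.2 ⟨connesV_mem_HC hc.1, fun L s t => by
    have : gD p.toFun q c = 0 := funext fun L => funext fun s => funext fun t =>
      (mem_cocycles.1 hc).2 L s t
    have h := gD_connesV (mem_HC.1 hc.1).1 p.toFun_mono
    rw [this, connesV_zero] at h
    exact (smul_eq_zero_iff_eq (-1 : ℤˣ)).1 (congrFun (congrFun (congrFun h L) s) t).symm⟩

theorem HH.exists_connes (p : Perversity n) {i j : ℤ} (e : j + 1 = i) :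
    ∃ φ : HH A A.dual p i →ₗ[R] HH A A.dual p j,
      ∀ (f : Raw A A.dual) (hf : f ∈ cocycles A A.dual p i),
        ∃ (h : Raw A A.dual) (hh : h ∈ cocycles A A.dual p j), IsConnesDual i f h ∧
          φ (HH.mk f hf) = HH.mk h hh := by
  subst e
  have hZ : ∀ f ∈ cocycles A A.dual p (j + 1), connesV (j + 1) f ∈ cocycles A A.dual p j :=
    fun f hf => by simpa using connesV_mem_cocycles hf
  obtain ⟨φ, hφ⟩ := HH.exists_lift (connesV (j + 1)) hZ (fun f hf hb => by
      obtain ⟨j, rfl⟩ : ∃ i, j = i + 1 := ⟨j - 1, by ring⟩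
      obtain ⟨h, hh, e⟩ := exists_of_mem_coboundaries hb
      have hF := (mem_HC.1 hh).1
      refine mem_coboundaries (Y := connesV (j + 1) h) (hZ f hf).1
        (by simpa using hF.connesV) le_rfl
        (normalized_connesV hF (mem_HC.1 hh).2) (-1) fun L s t _ _ => ?_
      have : f = gD p.toFun (j + 1) h := funext fun L => funext fun s => funext fun t => e L s t
      have h2 := gD_connesV hF p.toFun_mono
      rw [add_sub_cancel_right] at h2
      rw [this, h2]
      rfl)
    (fun f hf g hg => connesV_add hf.1 hg.1) (fun r f hf => connesV_smul r hf.1)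
  exact ⟨φ, fun f hf => ⟨_, hZ f hf, (mem_HC.1 hf.1).1.isConnesDual, hφ f hf⟩⟩

theorem IsRep.connes (H : InducedOperations A) {w : Fin (n + 1) → ℕ} {x : HH A A.dual p q}
    (hx : IsRep c x) (hc : Fam A.dual.toPerverseComplex w q c) (hw : w ≤ p.toFun) {j : ℤ}
    (e : j + 1 = q) : IsRep (connesV q c) (H.connes p e x) := by
  obtain ⟨h, rfl⟩ := hx
  obtain ⟨h', h1, h2, h3⟩ := H.connes_mk p e _ h
  rw [h3]
  refine IsRep.of_eq h1 ?_
  rw [restr_connesV hc hw, connesV_eq h2]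

end

theorem exists_inducedOperations (A : PDGA R n) : Nonempty (InducedOperations A) := by
  choose res hres using fun {p p' : Perversity n} (h : p ≤ p') (i : ℤ) =>
    HH.exists_res (A := A) (M := A.regular) h i
  choose cup hcup using fun {p q r : Perversity n} {i j k : ℤ} (h : AddLE p q r) (e : i + j = k) =>
    HH.exists_act (A := A) (M := A.regular) h e
  choose bracket hbracket using fun {p q r : Perversity n} {i j k : ℤ} (h : AddLE p q r)
    (e : i + j = k + 1) => HH.exists_bracket (A := A) h e
  choose act hact using fun {p q r : Perversity n} {i j k : ℤ} (h : AddLE p q r) (e : i + j = k) =>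
    HH.exists_act (A := A) (M := A.dual) h e
  choose connes hconnes using fun (p : Perversity n) {i j : ℤ} (e : j + 1 = i) =>
    HH.exists_connes (A := A) p e
  exact ⟨{
    res := res
    res_mk := hres
    one := HH.mk _ (one_mem_cocycles A)
    one_eq := ⟨one_mem_cocycles A, rfl⟩
    cup := cup
    cup_mk := hcup
    bracket := bracket
    bracket_mk := hbracket
    act := act
    act_mk := hact
    connes := connes
    connes_mk := hconnes }⟩

/-! ### The bracket in terms of the dual of Connes' boundary -/

section

variable {v w : Fin (n + 1) → ℕ} {s : Perversity n} {t k : ℤ} {c h : Raw A A.dual}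
  {f g : Cochain A}

theorem iota_units_smul (f : Cochain A) (ε : ℤˣ) (F : Form A N) (a : Elt A) (L : List (Elt A)) :
    iota f (fun a L => ε • F a L) a L = ε • iota f F a L := cartan_units_smul _ _ _ _ _ _

theorem iota_units_smul_eq (f : Cochain A) (ε : ℤˣ) (F : Form A N) :
    iota f (fun a L => ε • F a L) = fun a L => ε • iota f F a L :=
  funext fun a => funext fun L => iota_units_smul f ε F a L

theorem bop_units_smul_eq (ε : ℤˣ) (F : Form A N) :
    bop (fun a L => ε • F a L) = fun a L => ε • bop F a L :=
  funext fun a => funext fun L => bop_units_smul ε F a L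

theorem form_actV_eq (hc : Fam A.dual.toPerverseComplex w k c) (hw : Monotone w) (g : Cochain A) :
    form (actV g w k c) = fun a L => (g.deg * (k + 1) + 1).negOnePow • iota g (form c) a L :=
  funext fun a => funext fun L => form_actV hc hw g a L

theorem form_connesV_eq (hc : Fam A.dual.toPerverseComplex w k c) :
    form (connesV k c) = fun a L => (k + 1).negOnePow • bop (form c) a L :=
  funext fun a => funext fun L => form_connesV hc a L

theorem connesV_connesV (hc : Fam A.dual.toPerverseComplex w k c)
    (hN : ∀ s t, Normalized fun L => c L s t) : connesV (k - 1) (connesV k c) = 0 :=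
  form_injective fun a L => by
    rw [form_connesV hc.connesV, form_connesV_eq hc, bop_units_smul,
      bop_bop (fun a => normalized_form hN a), smul_zero, smul_zero, form_zero]

theorem actV_brk (hc : Fam A.dual.toPerverseComplex w k c) (hw : Monotone w)
    (hN : ∀ s t, Normalized fun L => c L s t) (hD : ∀ L s t, gD w k c L s t = 0)
    (hf : Closed f) (hg : Closed g) (nf : f.Norm) (ng : g.Norm) :
    ∃ W, Fam A.dual.toPerverseComplex (f.w + g.w + w) (f.deg + g.deg + k - 2) W ∧
      (∀ s t, Normalized fun L => W L s t) ∧ ∃ ε : ℤˣ, actV (f.brk g) w k c =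
      f.deg.negOnePow •
        connesV (f.deg + (g.deg + k)) (actV f (g.w + w) (g.deg + k) (actV g w k c)) +
      (-1 : ℤˣ) • actV f (g.w + w) (g.deg + k - 1) (connesV (g.deg + k) (actV g w k c)) +
      (f.deg * g.deg + f.deg + g.deg + 1).negOnePow •
        actV g (f.w + w) (f.deg + k - 1) (connesV (f.deg + k) (actV f w k c)) +
      (f.deg * g.deg + g.deg).negOnePow •
        actV g (f.w + w) (f.deg + (k - 1)) (actV f w (k - 1) (connesV k c)) +
      ε • gD (f.w + g.w + w) (f.deg + g.deg + k - 2) W := by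
  have hF := hc.isForm
  have hlie : ∀ a L, lie (mC A) (form c) a L = 0 := fun a L => by
    have h1 := form_gD hc hw a L
    have h2 : gD w k c = 0 := funext fun L => funext fun s => funext fun t => hD L s t
    rw [h2, form_zero] at h1
    exact (smul_eq_zero_iff_eq _).1 h1.symm
  have hprim := (hF.brkPrim hw f g).exists_fam (hc.hasDeg.brkPrim f g)
  obtain ⟨W, hW, hWF⟩ := hprim
  have hnF : ∀ a, Normalized (form c a) := fun a => normalized_form hN a
  refine ⟨W, hW, normalized_of_form fun a => ?_,
    ((f.deg + g.deg - 1) * (k + 1) + 1 + (f.deg + g.deg + k - 1)).negOnePow,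
    form_injective fun a L => ?_⟩
  · have : form W a = brkPrim f g (form c) a := funext fun L => hWF a L
    rw [this]
    exact normalized_brkPrim hF hw hnF nf ng a
  have hwf := f.mono.add hw
  have hwg := g.mono.add hw
  have hWe : form W = brkPrim f g (form c) := funext fun a => funext fun L => hWF a L
  have b1 := form_actV hc hw (f.brk g) a L
  rw [iota_brk_eq hF hw hlie hf hg a L] at b1
  have e1 : form (connesV (f.deg + (g.deg + k))
      (actV f (g.w + w) (g.deg + k) (actV g w k c))) a L = _ :=
    form_connesV ((hc.actV hw g).actV hwg f) a L
  rw [form_actV_eq (hc.actV hw g) hwg, form_actV_eq hc hw, iota_units_smul_eq,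
    bop_units_smul_eq, bop_units_smul_eq] at e1
  have e2 : form (actV f (g.w + w) (g.deg + k - 1) (connesV (g.deg + k) (actV g w k c))) a L = _ :=
    form_actV (hc.actV hw g).connesV hwg f a L
  rw [form_connesV_eq (hc.actV hw g), form_actV_eq hc hw, bop_units_smul_eq,
    iota_units_smul_eq, iota_units_smul_eq] at e2
  have e3 : form (actV g (f.w + w) (f.deg + k - 1) (connesV (f.deg + k) (actV f w k c))) a L = _ :=
    form_actV (hc.actV hw f).connesV hwf g a L
  rw [form_connesV_eq (hc.actV hw f), form_actV_eq hc hw, bop_units_smul_eq,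
    iota_units_smul_eq, iota_units_smul_eq] at e3
  have e4 : form (actV g (f.w + w) (f.deg + (k - 1)) (actV f w (k - 1) (connesV k c))) a L = _ :=
    form_actV (hc.connesV.actV hw f) hwf g a L
  rw [form_actV_eq hc.connesV hw, form_connesV_eq hc, iota_units_smul_eq,
    iota_units_smul_eq, iota_units_smul_eq] at e4
  have e5 := form_gD hW ((f.mono.add g.mono).add hw) a L
  rw [hWe] at e5
  simp only [form_add, form_units_smul]
  rw [b1, e1, e2, e3, e4, e5, ← Int.negOnePow_one]
  simp only [smul_add, smul_smul, ← Int.negOnePow_add]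
  have key {a b c d e a' b' c' d' e' : R} (h₁ : a = a') (h₂ : b = b') (h₃ : c = c') (h₄ : d = d')
      (h₅ : e = e') : a + b + c + d + e = a' + b' + c' + d' + e' := by rw [h₁, h₂, h₃, h₄, h₅]
  have hd : (f.brk g).deg = f.deg + g.deg - 1 := rfl
  rw [hd]
  generalize f.deg = x
  generalize g.deg = y
  refine key (sgn_smul_congr ?_ rfl) (sgn_smul_congr ?_ rfl) (sgn_smul_congr ?_ rfl)
    (sgn_smul_congr ?_ rfl) (sgn_smul_congr ?_ rfl) <;> push_cast <;>
    generalize (x : ZMod 2) = x <;> generalize (y : ZMod 2) = y <;>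
    generalize (k : ZMod 2) = k <;> revert x y k <;> decide

end

theorem HH.exists_fam {p : Perversity n} {k : ℤ} (z : HH A M p k) :
    ∃ c : Raw A M, IsRep c z ∧ Fam M.toPerverseComplex p.toFun k c ∧
      (∀ s t, Normalized fun L => c L s t) ∧ ∀ L s t, gD p.toFun k c L s t = 0 := by
  obtain ⟨X, hX, h⟩ := IsRep.exists z
  exact ⟨X, h, (mem_HC.1 hX.1).1, (mem_HC.1 hX.1).2, (mem_cocycles.1 hX).2⟩

section

variable (H : InducedOperations A) {p q r : Perversity n} {i j k m t t' u u' v v' : ℤ}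

theorem IsRep.zero : IsRep (0 : Raw A M) (0 : HH A M p i) :=
  IsRep.of_eq (Submodule.zero_mem _) (restr_self (Submodule.zero_mem (HC A M p i))).symm

theorem InducedOperations.connes_connes (z : HH A A.dual p k) (e : j + 1 = k) (e' : i + 1 = j) :
    H.connes p e' (H.connes p e z) = 0 := by
  obtain ⟨c, hz, hc, hN, -⟩ := HH.exists_fam z
  have h1 := hz.connes H hc le_rfl e
  obtain rfl : j = k - 1 := by omega
  have h2 := h1.connes H hc.connesV le_rfl e'
  rw [connesV_connesV hc hN] at h2
  exact h2.congr IsRep.zero fun _ _ _ _ _ => rfl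

theorem InducedOperations.connes_act_one (h : AddLE 0 p q) (z : HH A A.dual p k) (e : j + 1 = k) :
    H.connes q e (H.act h (zero_add k) H.one z) =
      H.act h (zero_add j) H.one (H.connes p e z) := by
  have hpq : p.toFun ≤ q.toFun := (le_of_eq (zero_add p.toFun).symm).trans h
  have key : ∀ {k : ℤ} {c : Raw A A.dual} {z : HH A A.dual p k}, IsRep c z →
      Fam A.dual.toPerverseComplex p.toFun k c →
      IsRep c (H.act h (zero_add k) H.one z) := by
    intro k c z hz hc
    obtain ⟨h1, h2⟩ := (Cochain.Rep.one H).act H hz hc p.toFun_mono le_rfl h (zero_add k)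
    rw [h2]
    refine IsRep.of_eq h1 (restr_congr fun L s t hL => ?_)
    have hL' : pervSum L + p.toFun ≤ s.toFun := (add_le_add_right hpq _).trans hL
    by_cases ht : sdeg L + k = t
    · exact actV_one hc hL' ht
    · rw [hc.shape L s t ht, (hc.actV p.toFun_mono (oneC A)).shape L s t fun h' => ht ?_]
      rw [← h']; change _ = _ + (0 + k); ring
  obtain ⟨c, hz, hc, hN, -⟩ := HH.exists_fam z
  obtain rfl : j = k - 1 := by omega
  exact ((key hz hc).connes H hc hpq e).congr (key (hz.connes H hc le_rfl e) hc.connesV)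
    fun _ _ _ _ _ => rfl

theorem InducedOperations.act_bracket (h : AddLE p q r) (h' : AddLE q p r) (hp : AddLE p 0 p)
    (hq : AddLE q 0 q) (hr : AddLE r 0 r) (e₁ : i + j = m + 1) (e₂ : m + k = t) (e₃ : j + k = u)
    (e₄ : i + u = t') (e₄' : t + 1 = t') (e₅ : i + k = v) (e₆ : u' + 1 = u) (e₇ : i + u' = t)
    (e₈ : v' + 1 = v) (e₉ : j + v' = t) {l : ℤ} (e₀ : l + 1 = k)
    (x : HH A A.regular p i) (y : HH A A.regular q j)
    (z : HH A A.dual 0 k) (hz : H.connes 0 e₀ z = 0) :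
    H.act hr e₂ (H.bracket h e₁ x y) z =
      i.negOnePow • H.connes r e₄' (H.act h e₄ x (H.act hq e₃ y z)) +
      (-1 : ℤˣ) • H.act h e₇ x (H.connes q e₆ (H.act hq e₃ y z)) +
      (i * j + i + j + 1).negOnePow • H.act h' e₉ y (H.connes p e₈ (H.act hp e₅ x z)) := by
  obtain ⟨f, hf, cf, nf⟩ := Cochain.Rep.exists x
  obtain ⟨g, hg, cg, ng⟩ := Cochain.Rep.exists y
  obtain ⟨c, hzc, hc, hN, hD⟩ := HH.exists_fam z
  have hw := (0 : Perversity n).toFun_mono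
  obtain rfl := hf.deg
  obtain rfl := hg.deg
  subst e₃ e₅
  obtain rfl : u' = g.deg + k - 1 := by omega
  obtain rfl : v' = f.deg + k - 1 := by omega
  obtain rfl : l = k - 1 := by omega
  have hwf := f.mono.add hw
  have hwg := g.mono.add hw
  have hle₁ : f.w + (0 : Perversity n).toFun ≤ p.toFun := hf.le
  have hle₂ : g.w + (0 : Perversity n).toFun ≤ q.toFun := hg.le
  have ry := hg.act H hzc hc hw le_rfl hq rfl
  have rx := hf.act H hzc hc hw le_rfl hp rfl
  have r0 := (hf.bracket H hg h e₁).act H hzc hc hw le_rfl hr e₂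
  have hxy := hf.act H ry (hc.actV hw g) hwg hle₂ h e₄
  have r1 := hxy.connes H (((hc.actV hw g).actV hwg f).congr rfl e₄)
    ((add_le_add hf.le hle₂).trans h) e₄'
  have r2 := hf.act H (ry.connes H (hc.actV hw g) hle₂ e₆) (hc.actV hw g).connesV hwg hle₂ h e₇
  have r3 := hg.act H (rx.connes H (hc.actV hw f) hle₁ e₈) (hc.actV hw f).connesV hwf hle₁ h' e₉
  have r4 := hg.act H (hf.act H (hzc.connes H hc le_rfl e₀) hc.connesV hw le_rfl hp rfl)
    (hc.connesV.actV hw f) hwf hle₁ h' (k := t) (by omega)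
  rw [hz, map_zero, map_zero] at r4
  obtain ⟨W, hW, nW, ε, e⟩ := actV_brk hc hw hN hD cf cg nf ng
  have hWr : f.w + g.w + (0 : Perversity n).toFun ≤ r.toFun := (add_le_add hf.le hg.le).trans h
  have := r0.homotopy (((r1.units_smul f.deg.negOnePow).add (r2.units_smul (-1))).add
    (r3.units_smul (f.deg * g.deg + f.deg + g.deg + 1).negOnePow) |>.add
    (r4.units_smul (f.deg * g.deg + g.deg).negOnePow)) hW hWr nW (by omega) ε fun L s d _ _ => by
      rw [e, ← e₄]; rfl
  rw [this, smul_zero, add_zero]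

end

/-! ### The Batalin–Vilkovisky structure -/

section

variable {H : InducedOperations A} {e : ℤ} {𝔇 : DerivedDuality A e}
  {φ : ∀ (p : Perversity n) (i : ℤ), HH A A.regular p i ≃ₗ[R] HH A A.dual p (i + e)}

theorem addLE_zero_right {p q : Perversity n} (h : p ≤ q) : AddLE p 0 q := by
  have : p.toFun + (0 : Perversity n).toFun = p.toFun := add_zero _
  exact le_of_eq_of_le this h

theorem addLE_zero_left {p q : Perversity n} (h : p ≤ q) : AddLE 0 p q := by
  have : (0 : Perversity n).toFun + p.toFun = p.toFun := zero_add _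
  exact le_of_eq_of_le this h

theorem Perversity.AddLE.symm {p q r : Perversity n} (h : AddLE p q r) : AddLE q p r :=
  le_of_eq_of_le (add_comm _ _) h

theorem IsAssociated.apply_eq (hφ : IsAssociated H 𝔇 φ) {p : Perversity n} {i : ℤ}
    (h : AddLE p 0 p) (e₁ : i + (0 + e) = i + e) (x : HH A A.regular p i) :
    φ p i x = H.act h e₁ x (φ 0 0 H.one) := by
  rw [← hφ.1 h (add_zero i), (isPerverseGerstenhaber H).cup_one h le_rfl,
    (isPerverseGerstenhaber H).res_self]

theorem bv_signs {V : Type*} [AddCommGroup V] (i j : ℤ) (X Y Z : V) :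
    i.negOnePow • (i.negOnePow • X + (-1 : ℤˣ) • Y + (i * j + i + j + 1).negOnePow • Z) =
      X - ((i - 1) * j).negOnePow • Z - i.negOnePow • Y := by
  simp only [negOnePow_eq_sgn, Units.neg_smul, one_smul]
  push_cast
  generalize (i : ZMod 2) = a
  generalize (j : ZMod 2) = b
  rcases zmod_two_cases a with rfl | rfl <;> rcases zmod_two_cases b with rfl | rfl <;>
    simp +decide [sgn] <;> abel

theorem apply_delta (p : Perversity n) (i : ℤ) (x : HH A A.regular p i) :
    φ p (i - 1) (delta H φ p i x) = H.connes p (by omega) (φ p i x) :=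
  (φ p (i - 1)).apply_symm_apply _

theorem IsAssociated.isPerverseBV (hφ : IsAssociated H 𝔇 φ) (h1 : delta H φ 0 0 H.one = 0) :
    IsPerverseBV H.res H.one H.cup H.bracket (delta H φ) where
  toIsPerverseGerstenhaber := isPerverseGerstenhaber H
  res_delta {p p'} h i x := by
    have hG := isPerverseGerstenhaber H
    have h' := addLE_zero_left h
    have hres (j : ℤ) (y : HH A A.regular p j) :
        φ p' j (H.res h j y) = H.act h' (zero_add _) H.one (φ p j y) := by
      rw [← hG.one_cup h' h, hφ.1 h' (zero_add j)]
    refine (φ p' (i - 1)).injective ?_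
    rw [hres, apply_delta, apply_delta, hres, H.connes_act_one]
  delta_delta p i x := by
    refine (φ p (i - 1 - 1)).injective ?_
    rw [apply_delta, apply_delta, H.connes_connes, map_zero]
  bracket_eq {p q r i j k} h e₁ e₀ e₂ e₃ x y := by
    have hG := isPerverseGerstenhaber H
    have h0 (s : Perversity n) : AddLE s 0 s := addLE_zero_right le_rfl
    have hz : H.connes 0 (j := 0 - 1 + e) (by omega) (φ 0 0 H.one) = 0 := by
      rw [← apply_delta, h1, map_zero]
    have hb := H.act_bracket (t := k - 1 + e) h h.symm (h0 p) (h0 q) (h0 r) e₀ (by omega)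
      (u := j + e) (t' := k + e) (v := i + e) (by omega) (by omega) (by omega) (by omega)
      (u' := j - 1 + e) (v' := i - 1 + e)
      (by omega) (by omega) (by omega) (by omega) _ x y _ hz
    have a1 := hφ.apply_eq (h0 r) (by omega) (H.bracket h e₀ x y)
    have a2 : φ r (k - 1) (delta H φ r k (H.cup h e₁ x y)) = _ := apply_delta r k _
    rw [hφ.1 h e₁ (by omega), hφ.apply_eq (h0 q) (by omega) y] at a2
    have a3 : φ r (k - 1) (H.cup h e₂ (delta H φ p i x) y) = _ :=
      congrArg _ (hG.cup_comm h h.symm e₂ (by omega) _ _)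
    rw [Units.smul_def, map_zsmul, ← Units.smul_def, hφ.1 h.symm (by omega) (by omega),
      apply_delta, hφ.apply_eq (h0 p) (by omega) x] at a3
    have a4 := hφ.1 h e₃ (by omega) x (delta H φ q j y)
    rw [apply_delta, hφ.apply_eq (h0 q) (by omega) y] at a4
    refine (φ r (k - 1)).injective ?_
    rw [map_sub, map_sub, Units.smul_def, Units.smul_def, map_zsmul, map_zsmul, ← Units.smul_def,
      ← Units.smul_def, a1, a2, a3, a4, hb]
    exact bv_signs i j _ _ _

end

end

section

variable {R : Type u} [CommRing R] {n : ℕ} {A : PDGA R n} {M N : Bimodule A}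

/-! ### Functoriality in the bimodule -/

section

variable {w : Fin (n + 1) → ℕ} {q e : ℤ} {f : Raw A M} (g : BimoduleHom M N e)

theorem Fam.push (hf : Fam M.toPerverseComplex w q f) :
    Fam N.toPerverseComplex w (q + e) (push g f) where
  shape L s t h := by
    change g.toFun _ _ _ _ = _
    rw [hf.shape L s (t - e) (by omega), map_zero]
  mul s t :=
    { out := fun L h => by
        change g.toFun _ _ _ _ = _
        rw [(hf.mul s (t - e)).out L h, map_zero]
      slot := fun L L' => ((hf.mul s (t - e)).slot L L').comp_lin (g.toFun s (t - e) t) }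
  nat L s s' t h h' := by
    change N.map s s' t (g.toFun _ _ _ _) = g.toFun _ _ _ _
    rw [g.natural h', hf.nat L s s' _ h h']

theorem Normalized.push (hf : ∀ s t, Normalized fun L => f L s t) (s : Perversity n) (t : ℤ) :
    Normalized fun L => push g f L s t := fun L L' p => by
  have := hf s (t - e) L L' p
  simp only at this
  change g.toFun _ _ _ _ = _
  rw [this, map_zero]

theorem push_mem_HC {p : Perversity n} (hf : f ∈ HC A M p q) : push g f ∈ HC A N p (q + e) :=
  mem_HC.2 ⟨(mem_HC.1 hf).1.push g, Normalized.push g (mem_HC.1 hf).2⟩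

theorem push_lact (p q' r : Perversity n) (i j k : ℤ) (a : A.X p i) (x : M.X q' (j - e)) :
    N.lact p q' r i j k a (g.toFun q' (j - e) j x) =
      (e * i).negOnePow • g.toFun r (k - e) k (M.lact p q' r i (j - e) (k - e) a x) := by
  by_cases h : AddLE p q' r ∧ i + j = k
  · rw [g.map_lact h.1 (by omega) (sub_add_cancel j e) (sub_add_cancel k e), negOnePow_smul_smul]
  · rw [N.lact_shape h, M.lact_shape fun h' => h ⟨h'.1, by omega⟩]
    simp

theorem push_ract (p q' r : Perversity n) (i j k : ℤ) (x : M.X p (i - e)) (b : A.X q' j) :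
    N.ract p q' r i j k (g.toFun p (i - e) i x) b =
      g.toFun r (k - e) k (M.ract p q' r (i - e) j (k - e) x b) := by
  by_cases h : AddLE p q' r ∧ i + j = k
  · rw [g.map_ract h.1 (by omega) (sub_add_cancel i e) (sub_add_cancel k e)]
  · rw [N.ract_shape h, M.ract_shape fun h' => h ⟨h'.1, by omega⟩]
    simp

theorem push_d (p : Perversity n) (i j : ℤ) (x : M.X p (i - e)) :
    N.d p i j (g.toFun p (i - e) i x) =
      e.negOnePow • g.toFun p (j - e) j (M.d p (i - e) (j - e) x) := by
  by_cases h : i + 1 = j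
  · exact g.comm_d p (sub_add_cancel i e) (by omega) h x
  · rw [N.d_shape p h, M.d_shape p (by omega)]
    simp

theorem lactVal_push (s : Perversity n) (t : ℤ) (a : Elt A) (L : List (Elt A)) :
    lactVal w (q + e) (push g f) s t a L =
      (e * a.deg).negOnePow • g.toFun s (t - e) t (lactVal w q f s (t - e) a L) := by
  rw [lactVal, pval, push, push_lact]
  have : ∀ d, d = sdeg L + q → M.lact a.perv (ceil (pervSum L + w)) s a.deg d (t - e) a.val
      (f L _ d) = lactVal w q f s (t - e) a L := by rintro _ rfl; rfl
  rw [this _ (by ring)]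

theorem ractVal_push (s : Perversity n) (t : ℤ) (L : List (Elt A)) (b : Elt A) :
    ractVal w (q + e) (push g f) s t L b =
      g.toFun s (t - e) t (ractVal w q f s (t - e) L b) := by
  rw [ractVal, pval, push, push_ract]
  have : ∀ d, d = sdeg L + q → M.ract (ceil (pervSum L + w)) b.perv s d b.deg (t - e)
      (f L _ d) b.val = ractVal w q f s (t - e) L b := by rintro _ rfl; rfl
  rw [this _ (by ring)]

theorem gD_push (L : List (Elt A)) (s : Perversity n) (t : ℤ) :
    gD w (q + e) (push g f) L s t = e.negOnePow • push g (gD w q f) L s t := by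
  have hd : ∀ d, d = t - e - 1 → g.toFun s (t - e) t (M.d s d (t - e) (f L s d)) =
      g.toFun s (t - e) t (M.d s (t - e - 1) (t - e) (f L s (t - e - 1))) := by rintro _ rfl; rfl
  rw [push, gD, gD, map_add, map_add, map_add, map_headSum, map_lastSum, map_units_smul', map_ins]
  simp only [map_units_smul', lactVal_push, ractVal_push, smul_add, headSum_units_smul,
    lastSum_units_smul, smul_smul, ← Int.negOnePow_add]
  congr 1
  · congr 1
    · congr 1
      · rw [push, push_d, hd _ (by ring)]
      · exact sgn_smul_congr (by push_cast; ring) rfl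
    · exact headSum_congr fun a L' _ => sgn_smul_congr (by push_cast; grind) rfl
  · exact lastSum_congr fun L' b _ => sgn_smul_congr (by push_cast; ring) rfl

theorem push_mem_cocycles {p : Perversity n} (hf : f ∈ cocycles A M p q) :
    push g f ∈ cocycles A N p (q + e) :=
  mem_cocycles.2 ⟨push_mem_HC g hf.1, fun L s t => by
    rw [gD_push, push, (mem_cocycles.1 hf).2, map_zero, smul_zero]⟩

theorem push_restr (r : Perversity n) : push g (restr r f) = restr r (push g f) := by
  funext L s t
  by_cases h : pervSum L + r.toFun ≤ s.toFun
  · rw [restr_of_le _ h, push, push, restr_of_le _ h]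
  · rw [restr_of_not_le _ h, push, restr_of_not_le _ h, map_zero]

theorem actRaw_push (p p' : Perversity n) (i j : ℤ) (h : Raw A A.regular) (L : List (Elt A))
    (s : Perversity n) (t : ℤ) : actRaw p p' i (j + e) h (push g f) L s t =
      (e * i).negOnePow • push g (actRaw p p' i j h f) L s t := by
  refine Eq.trans ?_ (congrArg _ (map_splitSum (g.toFun s (t - e) t) L _).symm)
  rw [splitSum_units_smul]
  refine splitSum_congr fun L₁ L₂ _ => ?_
  have := lactVal_push (w := p'.toFun) (q := j) (f := f) g s t
    ⟨ceil (pervSum L₁ + p.toFun), sdeg L₁ + i, h L₁ _ _⟩ L₂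
  refine (congrArg _ this).trans ?_
  rw [map_units_smul', smul_smul, smul_smul, ← Int.negOnePow_add, ← Int.negOnePow_add]
  exact sgn_smul_congr (by push_cast; grind) rfl

/-- The map induced on cohomology by a morphism of bimodules. -/
theorem HH.exists_push (p : Perversity n) {i j : ℤ} (hj : i + e = j) :
    ∃ φ : HH A M p i →ₗ[R] HH A N p j, ∀ (f : Raw A M) (hf : f ∈ cocycles A M p i),
      ∃ h' : push g f ∈ cocycles A N p j, φ (HH.mk f hf) = HH.mk _ h' := by
  subst hj
  obtain ⟨φ, hφ⟩ := HH.exists_lift (p₂ := p) (i₂ := i + e) (push g)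
    (fun f hf => push_mem_cocycles g hf)
    (fun f hf hb => by
      obtain ⟨i, rfl⟩ : ∃ j, i = j + 1 := ⟨i - 1, by ring⟩
      obtain ⟨h, hh, eq⟩ := exists_of_mem_coboundaries hb
      have ei : i + 1 + e = i + e + 1 := by ring
      have hZ := push_mem_HC g hf.1
      rw [ei] at hZ ⊢
      refine mem_coboundaries hZ ((mem_HC.1 hh).1.push g) le_rfl
        (Normalized.push g (mem_HC.1 hh).2) e.negOnePow fun L s t _ _ => ?_
      rw [gD_push, negOnePow_smul_smul, push,
        push, eq])
    (fun f _ f' _ => by funext L s t; exact map_add _ _ _)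
    (fun c f _ => by funext L s t; exact map_smul _ _ _)
  exact ⟨φ, fun f hf => ⟨_, hφ f hf⟩⟩

end

/-! ### Shifting the degree -/

section

variable (M) (q : ℤ)

/-- The bimodule `M` with the degrees shifted by `q`. -/
def Bimodule.shift : Bimodule A where
  X p i := M.X p (i + q)
  map p p' i := M.map p p' (i + q)
  map_shape i h := M.map_shape _ h
  map_self p i x := M.map_self _ _ x
  map_map h h' i x := M.map_map h h' _ x
  d p i j := q.negOnePow • M.d p (i + q) (j + q)
  d_shape p i j h := by rw [M.d_shape p (by omega), smul_zero]
  d_d p i j k x := by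
    simp only [LinearMap.smul_apply, map_units_smul', M.d_d, smul_zero]
  map_d h i j x := by
    simp only [LinearMap.smul_apply, map_units_smul', M.map_d h]
  lact p p' r i j k := (q * i).negOnePow • M.lact p p' r i (j + q) (k + q)
  lact_shape h := by rw [M.lact_shape fun h' => h ⟨h'.1, by omega⟩, smul_zero]
  map_lact h h' i j k a x := by
    simp only [LinearMap.smul_apply, map_units_smul', M.map_lact h h']
  lact_map_map h h' h'' i j k a x := by
    simp only [LinearMap.smul_apply, M.lact_map_map h h' h'']
  ract p p' r i j k := M.ract p p' r (i + q) j (k + q)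
  ract_shape h := M.ract_shape fun h' => h ⟨h'.1, by omega⟩
  map_ract h h' i j k x b := M.map_ract h h' _ _ _ x b
  ract_map_map h h' h'' i j k x b := M.ract_map_map h h' h'' _ _ _ x b
  mul_lact {p p' r s v w i j k l m t} h1 h2 h3 h4 e1 e2 e3 a b x := by
    simp only [LinearMap.smul_apply, map_units_smul']
    rw [M.mul_lact h1 h2 h3 h4 e1 (by omega) (by omega : j + (k + q) = m + q), smul_smul,
      ← Int.negOnePow_add]
    exact sgn_smul_congr (by rw [← e1]; push_cast; ring) rfl
  lact_ract {p p' r s v w i j k l m t} h1 h2 h3 h4 e1 e2 e3 a x b := by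
    simp only [LinearMap.smul_apply, LinearMap.map_smul_of_tower]
    rw [← M.lact_ract h1 h2 h3 h4 (by omega : i + (j + q) = l + q) (by omega) (by omega)]
  ract_mul h1 h2 h3 h4 e1 e2 e3 x a b := M.ract_mul h1 h2 h3 h4 (by omega) (by omega) e3 x a b
  one_lact h i x := by
    simp only [mul_zero, Int.negOnePow_zero, one_smul]
    exact M.one_lact h _ x
  ract_one h i x := M.ract_one h _ x
  d_lact {p p' r i j k i' j' k'} h e1 e2 e3 e4 a x := by
    simp only [LinearMap.smul_apply, map_units_smul']
    rw [M.d_lact h (by omega) e2 (by omega : j + q + 1 = j' + q) (by omega)]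
    simp only [smul_add, smul_smul, ← Int.negOnePow_add]
    congr 1
    · exact sgn_smul_congr (by rw [← e2]; push_cast; ring) rfl
    · exact sgn_smul_congr (by push_cast; ring) rfl
  d_ract {p p' r i j k i' j' k'} h e1 e2 e3 e4 x b := by
    simp only [LinearMap.smul_apply]
    rw [M.d_ract h (by omega) (by omega : i + q + 1 = i' + q) e3 (by omega)]
    rcases Int.units_eq_one_or q.negOnePow with h | h <;>
      simp [Int.negOnePow_add, h]

/-- The identity. -/
def Bimodule.id : BimoduleHom M M 0 where
  toFun p i j := M.cast p i j
  shape p i j h := M.cast_of_ne p (by omega)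
  natural _ i j x := M.map_cast _ _ _ _ _
  comm_d p {i j i' j'} h h' h'' x := by
    obtain rfl : i = j := by omega
    obtain rfl : i' = j' := by omega
    rw [M.cast_self, M.cast_self, Int.negOnePow_zero, one_smul]
  map_lact {p p' r i j k j' k'} h e1 e2 e3 a x := by
    obtain rfl : j = j' := by omega
    obtain rfl : k = k' := by omega
    rw [M.cast_self, M.cast_self, zero_mul, Int.negOnePow_zero, one_smul]
  map_ract {p p' r i j k i' k'} h e1 e2 e3 x b := by
    obtain rfl : i = i' := by omega
    obtain rfl : k = k' := by omega
    rw [M.cast_self, M.cast_self]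

variable {M q}

/-- A morphism of bimodules, as a morphism to the shift. -/
def BimoduleHom.shift {e e' : ℤ} (g : BimoduleHom M N e) (he : e' + q = e) :
    BimoduleHom M (N.shift q) e' where
  toFun p i j := g.toFun p i (j + q)
  shape p i j h := g.shape p (by omega)
  natural h i j x := g.natural h _ _ x
  comm_d p {i j i' j'} h h' h'' x := by
    have key : q.negOnePow • N.d p (j + q) (j' + q) (g.toFun p i (j + q) x) =
        e'.negOnePow • g.toFun p i' (j' + q) (M.d p i i' x) := by
      rw [g.comm_d p (by omega) h' (by omega : j + q + 1 = j' + q), smul_smul,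
        ← Int.negOnePow_add]
      exact sgn_smul_congr (by rw [← he]; push_cast; grind) rfl
    exact key
  map_lact {p p' r i j k j' k'} h e1 e2 e3 a x := by
    have key : g.toFun r k (k' + q) (M.lact p p' r i j k a x) = (e' * i).negOnePow •
        (q * i).negOnePow • N.lact p p' r i (j' + q) (k' + q) a (g.toFun p' j (j' + q) x) := by
      rw [g.map_lact h e1 (by omega : j + e = j' + q) (by omega), smul_smul, ← Int.negOnePow_add]
      exact sgn_smul_congr (by rw [← he]; push_cast; ring) rfl
    exact key
  map_ract {p p' r i j k i' k'} h e1 e2 e3 x b := g.map_ract h e1 (by omega) (by omega) x b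

variable (M q)

/-- The identity, as a morphism from the shift. -/
def Bimodule.ofShift : BimoduleHom (M.shift q) M q where
  toFun p i j := M.cast p (i + q) j
  shape p i j h := M.cast_of_ne p (by omega)
  natural h i j x := M.map_cast _ _ _ _ _
  comm_d p {i j i' j'} h h' h'' x := by
    have key (x : M.X p (i + q)) : M.d p j j' (M.cast p (i + q) j x) =
        q.negOnePow • M.cast p (i' + q) j' (q.negOnePow • M.d p (i + q) (i' + q) x) := by
      obtain rfl : j' = i' + q := by omega
      subst h
      rw [M.cast_self, M.cast_self, negOnePow_smul_smul]
    exact key x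
  map_lact {p p' r i j k j' k'} h e1 e2 e3 a x := by
    have key (x : M.X p' (j + q)) : M.cast r (k + q) k'
        ((q * i).negOnePow • M.lact p p' r i (j + q) (k + q) a x) =
        (q * i).negOnePow • M.lact p p' r i j' k' a (M.cast p' (j + q) j' x) := by
      subst e2 e3
      rw [M.cast_self, M.cast_self]
    exact key x
  map_ract {p p' r i j k i' k'} h e1 e2 e3 x b := by
    have key (x : M.X p (i + q)) : M.cast r (k + q) k' (M.ract p p' r (i + q) j (k + q) x b) =
        M.ract p p' r i' j k' (M.cast p (i + q) i' x) b := by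
      subst e2 e3
      rw [M.cast_self, M.cast_self]
    exact key x

end

/-! ### The fiber of a morphism of bimodules of degree one -/

/-- The fiber of a morphism `g : M → N` of degree one, `M ⊕ N` with the differential
`(m, x) ↦ (d m, g m + d x)`. -/
def BimoduleHom.fiber (g : BimoduleHom M N 1) : Bimodule A where
  X p i := M.X p i × N.X p i
  map p q i := (M.map p q i).prodMap (N.map p q i)
  map_shape i h := by rw [M.map_shape i h, N.map_shape i h]; rfl
  map_self p i x := Prod.ext (M.map_self p i x.1) (N.map_self p i x.2)
  map_map h h' i x := Prod.ext (M.map_map h h' i x.1) (N.map_map h h' i x.2)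
  d p i j := ((M.d p i j).comp (LinearMap.fst R _ _)).prod
    ((g.toFun p i j).comp (LinearMap.fst R _ _) + (N.d p i j).comp (LinearMap.snd R _ _))
  d_shape p i j h := by
    rw [M.d_shape p h, N.d_shape p h, g.shape p h]
    ext <;> simp
  d_d p i j k x := by
    refine Prod.ext (M.d_d p i j k x.1) ?_
    change g.toFun p j k (M.d p i j x.1) + N.d p j k (g.toFun p i j x.1 + N.d p i j x.2) = 0
    rw [map_add, N.d_d, add_zero]
    by_cases h : i + 1 = j
    · by_cases h' : j + 1 = k
      · rw [g.comm_d p h h h', Int.negOnePow_one, Units.neg_smul, one_smul, add_neg_cancel]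
      · rw [g.shape p h', N.d_shape p h']; simp
    · rw [g.shape p h, M.d_shape p h]; simp
  map_d h i j x := by
    refine Prod.ext (M.map_d h i j x.1) ?_
    change N.map _ _ j (g.toFun _ i j x.1 + N.d _ i j x.2) = _
    rw [map_add, g.natural h, N.map_d h]
    rfl
  lact p q r i j k := LinearMap.mk₂ R
    (fun a x => (M.lact p q r i j k a x.1, N.lact p q r i j k a x.2))
    (fun a b x => by ext <;> simp) (fun c a x => by ext <;> simp)
    (fun a x y => by ext <;> simp) (fun c a x => by ext <;> simp)
  lact_shape h := by
    ext a x <;> simp [M.lact_shape h, N.lact_shape h]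
  map_lact h h' i j k a x := Prod.ext (M.map_lact h h' i j k a x.1) (N.map_lact h h' i j k a x.2)
  lact_map_map h h' h'' i j k a x :=
    Prod.ext (M.lact_map_map h h' h'' i j k a x.1) (N.lact_map_map h h' h'' i j k a x.2)
  ract p q r i j k := LinearMap.mk₂ R
    (fun x b => (M.ract p q r i j k x.1 b, N.ract p q r i j k x.2 b))
    (fun x y b => by ext <;> simp) (fun c x b => by ext <;> simp)
    (fun x a b => by ext <;> simp) (fun c x b => by ext <;> simp)
  ract_shape h := by
    ext x b <;> simp [M.ract_shape h, N.ract_shape h]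
  map_ract h h' i j k x b := Prod.ext (M.map_ract h h' i j k x.1 b) (N.map_ract h h' i j k x.2 b)
  ract_map_map h h' h'' i j k x b :=
    Prod.ext (M.ract_map_map h h' h'' i j k x.1 b) (N.ract_map_map h h' h'' i j k x.2 b)
  mul_lact h1 h2 h3 h4 e1 e2 e3 a b x := Prod.ext (M.mul_lact h1 h2 h3 h4 e1 e2 e3 a b x.1)
    (N.mul_lact h1 h2 h3 h4 e1 e2 e3 a b x.2)
  lact_ract h1 h2 h3 h4 e1 e2 e3 a x b := Prod.ext (M.lact_ract h1 h2 h3 h4 e1 e2 e3 a x.1 b)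
    (N.lact_ract h1 h2 h3 h4 e1 e2 e3 a x.2 b)
  ract_mul h1 h2 h3 h4 e1 e2 e3 x a b := Prod.ext (M.ract_mul h1 h2 h3 h4 e1 e2 e3 x.1 a b)
    (N.ract_mul h1 h2 h3 h4 e1 e2 e3 x.2 a b)
  one_lact h i x := Prod.ext (M.one_lact h i x.1) (N.one_lact h i x.2)
  ract_one h i x := Prod.ext (M.ract_one h i x.1) (N.ract_one h i x.2)
  d_lact {p q r i j k i' j' k'} h e1 e2 e3 e4 a x := by
    refine Prod.ext ((M.d_lact h e1 e2 e3 e4 a x.1)) ?_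
    change g.toFun r k k' (M.lact p q r i j k a x.1) + N.d r k k' (N.lact p q r i j k a x.2) =
      N.lact p q r i' j k' (A.d p i i' a) x.2 +
        i.negOnePow • N.lact p q r i j' k' a (g.toFun q j j' x.1 + N.d q j j' x.2)
    rw [g.map_lact h e1 e3 e4, N.d_lact h e1 e2 e3 e4, one_mul, map_add, smul_add]
    abel
  d_ract {p q r i j k i' j' k'} h e1 e2 e3 e4 x b := by
    refine Prod.ext ((M.d_ract h e1 e2 e3 e4 x.1 b)) ?_
    change g.toFun r k k' (M.ract p q r i j k x.1 b) + N.d r k k' (N.ract p q r i j k x.2 b) =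
      N.ract p q r i' j k' (g.toFun p i i' x.1 + N.d p i i' x.2) b +
        i.negOnePow • N.ract p q r i j' k' x.2 (A.d q j j' b)
    rw [g.map_ract h e1 e2 e4, N.d_ract h e1 e2 e3 e4, map_add, LinearMap.add_apply]
    abel

/-- The projection from the fiber. -/
def BimoduleHom.fiberFst (g : BimoduleHom M N 1) : BimoduleHom g.fiber M 0 where
  toFun p i j := (M.id.toFun p i j).comp (LinearMap.fst R (M.X p i) (N.X p i))
  shape p i j h := by rw [M.id.shape p h]; rfl
  natural h i j x := M.id.natural h i j x.1
  comm_d p {i j i' j'} h h' h'' x := M.id.comm_d p h h' h'' x.1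
  map_lact h e1 e2 e3 a x := M.id.map_lact h e1 e2 e3 a x.1
  map_ract h e1 e2 e3 x b := M.id.map_ract h e1 e2 e3 x.1 b

/-- A perverse cochain complex all of whose cocycles are coboundaries. -/
def PerverseComplex.Acyclic (C : PerverseComplex R n) : Prop :=
  ∀ (p : Perversity n) (i j k : ℤ), j + 1 = i → i + 1 = k → ∀ x : C.X p i, C.d p i k x = 0 →
    ∃ y : C.X p j, C.d p j i y = x

theorem BimoduleHom.IsQuasiIso.inj {e : ℤ} {g : BimoduleHom M N e} (hg : g.IsQuasiIso)
    (p : Perversity n) {i i₀ i₁ j j₀ : ℤ} (hj : i + e = j) (hi : i₀ + 1 = i) (hi' : i + 1 = i₁)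
    (hj' : j₀ + 1 = j) (x : M.X p i) (hx : M.d p i i₁ x = 0) (y : N.X p j₀)
    (hy : N.d p j₀ j y = g.toFun p i j x) : ∃ z : M.X p i₀, M.d p i₀ i z = x := by
  obtain rfl : i₀ = i - 1 := by omega
  obtain rfl : j₀ = j - 1 := by omega
  subst hi'
  exact (hg p i j hj).1 x hx ⟨y, hy⟩

theorem BimoduleHom.IsQuasiIso.surj {e : ℤ} {g : BimoduleHom M N e} (hg : g.IsQuasiIso)
    (p : Perversity n) {i i₁ j j₀ j₁ : ℤ} (hj : i + e = j) (hi' : i + 1 = i₁)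
    (hj' : j₀ + 1 = j) (hj₁ : j + 1 = j₁) (y : N.X p j) (hy : N.d p j j₁ y = 0) :
    ∃ x : M.X p i, M.d p i i₁ x = 0 ∧ ∃ z : N.X p j₀, N.d p j₀ j z = g.toFun p i j x - y := by
  obtain rfl : j₀ = j - 1 := by omega
  subst hi' hj₁
  exact (hg p i j hj).2 y hy

theorem BimoduleHom.IsQuasiIso.acyclic_fiber {g : BimoduleHom M N 1} (hg : g.IsQuasiIso) :
    g.fiber.Acyclic := by
  rintro p i j k hj hk ⟨m, x⟩ h
  have h1 : M.d p i k m = 0 := congrArg Prod.fst h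
  have h2 : g.toFun p i k m + N.d p i k x = 0 := congrArg Prod.snd h
  obtain ⟨z, hz⟩ := hg.inj p hk hj hk hk m h1 (-x)
    (by rw [map_neg]; exact neg_eq_of_add_eq_zero_left h2)
  have h3 : N.d p i k (x - g.toFun p j i z) = 0 := by
    rw [map_sub, g.comm_d p hj hj hk, hz, Int.negOnePow_one, Units.neg_smul, one_smul,
      sub_neg_eq_add, add_comm, h2]
  obtain ⟨y, hy, w, hw⟩ := hg.surj p hj hj hj hk _ h3
  refine ⟨(z + y, -w), Prod.ext ?_ ?_⟩
  · change M.d p j i (z + y) = m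
    rw [map_add, hy, hz, add_zero]
  · change g.toFun p j i (z + y) + N.d p j i (-w) = x
    rw [map_add, map_neg, hw]
    abel

theorem BimoduleHom.IsQuasiIso.shift {e e' q : ℤ} {g : BimoduleHom M N e} (hg : g.IsQuasiIso)
    (he : e' + q = e) : (g.shift he).IsQuasiIso := by
  intro p i j hj
  constructor
  · rintro x hx ⟨y, hy⟩
    have key (y : N.X p (j - 1 + q))
        (hy : q.negOnePow • N.d p (j - 1 + q) (j + q) y = g.toFun p i (j + q) x) :
        ∃ z : M.X p (i - 1), M.d p (i - 1) i z = x :=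
      hg.inj p (by omega : i + e = j + q) (by omega) rfl (by omega) x hx (q.negOnePow • y)
        (by rw [map_units_smul', hy])
    exact key y hy
  · intro y hy
    have key (y : N.X p (j + q)) (hy : q.negOnePow • N.d p (j + q) (j + 1 + q) y = 0) :
        ∃ x : M.X p i, M.d p i (i + 1) x = 0 ∧ ∃ z : N.X p (j - 1 + q),
          q.negOnePow • N.d p (j - 1 + q) (j + q) z = g.toFun p i (j + q) x - y := by
      obtain ⟨x, hx, z, hz⟩ := hg.surj p (by omega : i + e = j + q) rfl
        (by omega : j - 1 + q + 1 = j + q) (by omega) y ((smul_eq_zero_iff_eq _).1 hy)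
      exact ⟨x, hx, q.negOnePow • z, by
        rw [map_units_smul', negOnePow_smul_smul, hz]⟩
    exact key y hy

theorem Bimodule.id_isQuasiIso (M : Bimodule A) : M.id.IsQuasiIso := by
  intro p i j hj
  obtain rfl : i = j := by omega
  have e (x : M.X p i) : M.id.toFun p i i x = x := M.cast_self _ _ _
  refine ⟨?_, fun y hy => ⟨y, hy, 0, by rw [e, map_zero, sub_self]⟩⟩
  rintro x hx ⟨y, hy⟩
  exact ⟨y, hy.trans (e x)⟩

theorem PerverseComplex.Acyclic.isQuasiIso (hM : M.Acyclic) (hN : N.Acyclic) {e : ℤ}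
    (g : BimoduleHom M N e) : g.IsQuasiIso := by
  intro p i j hj
  refine ⟨fun x hx _ => hM p i (i - 1) (i + 1) (by omega) rfl x hx, fun y hy => ⟨0, map_zero _, ?_⟩⟩
  rw [map_zero, zero_sub]
  exact hN p j (j - 1) (j + 1) (by omega) rfl _ (by rw [map_neg, hy, neg_zero])

theorem Bimodule.shift_acyclic (hM : M.Acyclic) (q : ℤ) : (M.shift q).Acyclic := by
  intro p i j k hj hk x hx
  have key (x : M.X p (i + q)) (hx : q.negOnePow • M.d p (i + q) (k + q) x = 0) :
      ∃ y : M.X p (j + q), q.negOnePow • M.d p (j + q) (i + q) y = x := by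
    obtain ⟨y, hy⟩ := hM p (i + q) (j + q) (k + q) (by omega) (by omega) x
      ((smul_eq_zero_iff_eq _).1 hx)
    exact ⟨q.negOnePow • y, by
      rw [map_units_smul', negOnePow_smul_smul, hy]⟩
  exact key x hx

section

variable {w : Fin (n + 1) → ℕ} {q : ℤ} (g : BimoduleHom M N 1)

/-- The cochain with values in the fiber given by its components. -/
def fiberRaw (f : Raw A M) (h : Raw A N) : Raw A g.fiber := fun L s t => (f L s t, h L s t)

/-- The second component of a cochain with values in the fiber. -/
def sndRaw (f : Raw A g.fiber) : Raw A N := fun L s t => (f L s t : M.X s t × N.X s t).2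

/-- The first component of a cochain with values in the fiber. -/
def fstRaw (f : Raw A g.fiber) : Raw A M := fun L s t => (f L s t : M.X s t × N.X s t).1

def fiberFstLin (p : Perversity n) (i : ℤ) : g.fiber.X p i →ₗ[R] M.X p i :=
  LinearMap.fst R (M.X p i) (N.X p i)

def fiberSndLin (p : Perversity n) (i : ℤ) : g.fiber.X p i →ₗ[R] N.X p i :=
  LinearMap.snd R (M.X p i) (N.X p i)

variable {g} {f : Raw A g.fiber}

theorem Fam.fst (hf : Fam g.fiber.toPerverseComplex w q f) :
    Fam M.toPerverseComplex w q (fstRaw g f) where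
  shape L s t h := congrArg Prod.fst (hf.shape L s t h)
  mul s t :=
    { out := fun L h => congrArg Prod.fst ((hf.mul s t).out L h)
      slot := fun L L' => ((hf.mul s t).slot L L').comp_lin (fiberFstLin g s t) }
  nat L s s' t h h' := congrArg Prod.fst (hf.nat L s s' t h h')

theorem Fam.snd (hf : Fam g.fiber.toPerverseComplex w q f) :
    Fam N.toPerverseComplex w q (sndRaw g f) where
  shape L s t h := congrArg Prod.snd (hf.shape L s t h)
  mul s t :=
    { out := fun L h => congrArg Prod.snd ((hf.mul s t).out L h)
      slot := fun L L' => ((hf.mul s t).slot L L').comp_lin (fiberSndLin g s t) }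
  nat L s s' t h h' := congrArg Prod.snd (hf.nat L s s' t h h')

theorem mem_HC_fst {p : Perversity n} (hf : f ∈ HC A g.fiber p q) :
    fstRaw g f ∈ HC A M p q :=
  mem_HC.2 ⟨(mem_HC.1 hf).1.fst, fun s t L L' p => congrArg Prod.fst ((mem_HC.1 hf).2 s t L L' p)⟩

theorem mem_HC_snd {p : Perversity n} (hf : f ∈ HC A g.fiber p q) :
    sndRaw g f ∈ HC A N p q :=
  mem_HC.2 ⟨(mem_HC.1 hf).1.snd, fun s t L L' p => congrArg Prod.snd ((mem_HC.1 hf).2 s t L L' p)⟩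

theorem mem_HC_fiberRaw {p : Perversity n} {f : Raw A M} {h : Raw A N} (hf : f ∈ HC A M p q)
    (hh : h ∈ HC A N p q) : fiberRaw g f h ∈ HC A g.fiber p q := by
  obtain ⟨f1, f2, f3, f4, f5, f6⟩ := hf
  obtain ⟨h1, h2, h3, h4, h5, h6⟩ := hh
  exact ⟨fun L s t x => Prod.ext (f1 L s t x) (h1 L s t x),
    fun L L' p' i a b s t => Prod.ext (f2 L L' p' i a b s t) (h2 L L' p' i a b s t),
    fun L L' p' i a b s t => Prod.ext (f3 L L' p' i a b s t) (h3 L L' p' i a b s t),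
    fun L L' p₁ p₂ i a s t x y => Prod.ext (f4 L L' p₁ p₂ i a s t x y) (h4 L L' p₁ p₂ i a s t x y),
    fun L s s' t x y => Prod.ext (f5 L s s' t x y) (h5 L s s' t x y),
    fun L L' p' s t => Prod.ext (f6 L L' p' s t) (h6 L L' p' s t)⟩

theorem fst_gD (L : List (Elt A)) (s : Perversity n) (t : ℤ) :
    fstRaw g (gD w q f) L s t = gD w q (fstRaw g f) L s t := by
  change fiberFstLin g s t (gD w q f L s t) = _
  rw [gD, map_add, map_add, map_add, map_headSum, map_lastSum, map_units_smul', map_ins]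
  simp only [map_units_smul']
  rfl

theorem snd_gD (L : List (Elt A)) (s : Perversity n) (t : ℤ) :
    sndRaw g (gD w q f) L s t = push g (fstRaw g f) L s t + gD w q (sndRaw g f) L s t := by
  change fiberSndLin g s t (gD w q f L s t) = _
  rw [gD, map_add, map_add, map_add, map_headSum, map_lastSum, map_units_smul', map_ins]
  simp only [map_units_smul']
  have : fiberSndLin g s t (g.fiber.d s (t - 1) t (f L s (t - 1))) =
      push g (fstRaw g f) L s t + N.d s (t - 1) t (sndRaw g f L s (t - 1)) := rfl
  rw [this, gD]
  simp only [add_assoc]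
  rfl

end

/-! ### Shifting the perversity -/

/-- The sum `p ⊕ q`. -/
noncomputable def Perversity.oplus (p q : Perversity n) : Perversity n := ceil (p.toFun + q.toFun)

section

variable {p p' q q' r s s' v : Perversity n}

theorem addLE_of_le (h : p ≤ q) (h' : AddLE q r s) : AddLE p r s :=
  fun i => (Nat.add_le_add_right (h i) _).trans (h' i)

theorem addLE_of_le_of_le (h : p ≤ p') (h' : q ≤ q') (h'' : AddLE p' q' r) : AddLE p q r :=
  fun i => (Nat.add_le_add (h i) (h' i)).trans (h'' i)

theorem Perversity.AddLE.trans (h : AddLE p q r) (h' : r ≤ s) : AddLE p q s := le_trans h h'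

theorem addLE_oplus (h : AddLE p q s) : AddLE p q (p.oplus q) := le_ceil h

theorem oplus_le (h : AddLE p q s) : p.oplus q ≤ s := ceil_le h

theorem oplus_mono (h : p ≤ q) (h' : AddLE q r s) : p.oplus r ≤ q.oplus r :=
  ceil_le (addLE_of_le h (addLE_oplus h'))

theorem le_of_addLE (h : AddLE p q r) : q ≤ r :=
  (le_of_eq_of_le (zero_add q.toFun).symm
    (add_le_add_left (fun _ => Nat.zero_le _ : 0 ≤ p.toFun) q.toFun)).trans h

theorem le_of_addLE' (h : AddLE p q r) : p ≤ r := le_of_addLE h.symm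

theorem addLE_oplus_oplus (h : AddLE p q r) (h' : AddLE r v s) :
    AddLE p (q.oplus v) (r.oplus v) := by
  have h1 := addLE_oplus h'
  refine AddLE.symm (ceil_add_le (q.toFun_mono.add v.toFun_mono) p.toFun_mono ?_)
  refine le_trans (le_of_eq_of_le ?_ (add_le_add_left h v.toFun)) h1
  abel

theorem addLE_oplus_oplus' (h : AddLE p q r) (h' : AddLE r v s) :
    AddLE (p.oplus v) q (r.oplus v) := (addLE_oplus_oplus h.symm h').symm

end

open Classical in
/-- The values at the perversity `s ⊕ v`, if `s + v` is at most the top perversity. -/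
noncomputable def PerverseComplex.pshiftX (C : PerverseComplex R n) (v s : Perversity n) (t : ℤ) :
    Submodule R (C.X (s.oplus v) t) :=
  if AddLE s v (top n) then ⊤ else ⊥

section

variable (C : PerverseComplex R n) {v s s' : Perversity n} {t : ℤ}

theorem PerverseComplex.pshiftX_zero (h : ¬ AddLE s v (top n)) {x : C.X (s.oplus v) t}
    (hx : x ∈ C.pshiftX v s t) : x = 0 := by
  rwa [pshiftX, if_neg h, Submodule.mem_bot] at hx

theorem PerverseComplex.pshiftX_ext {x y : C.pshiftX v s t}
    (h : AddLE s v (top n) → x.1 = y.1) : x = y := by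
  by_cases h' : AddLE s v (top n)
  · exact Subtype.ext (h h')
  · exact Subtype.ext ((C.pshiftX_zero h' x.2).trans (C.pshiftX_zero h' y.2).symm)

open Classical in
/-- The projection onto `pshiftX`. -/
noncomputable def PerverseComplex.pproj (v s : Perversity n) (t : ℤ) :
    C.X (s.oplus v) t →ₗ[R] C.pshiftX v s t where
  toFun x := ⟨if AddLE s v (top n) then x else 0, by
    by_cases h : AddLE s v (top n)
    · rw [pshiftX, if_pos h]; exact Submodule.mem_top
    · rw [if_neg h]; exact Submodule.zero_mem _⟩
  map_add' x y := by
    by_cases h : AddLE s v (top n) <;> simp [h]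
  map_smul' c x := by
    by_cases h : AddLE s v (top n) <;> simp [h]

theorem PerverseComplex.pproj_val (h : AddLE s v (top n)) (x : C.X (s.oplus v) t) :
    (C.pproj v s t x).1 = x := if_pos h

theorem addLE_top_of_le (h : s ≤ s') (h' : AddLE s' v (top n)) : AddLE s v (top n) :=
  addLE_of_le h h'

end

open Classical in
/-- The bimodule of values at the perversities `s ⊕ v`. -/
noncomputable def Bimodule.pshift (M : Bimodule A) (v : Perversity n) : Bimodule A where
  X s t := M.pshiftX v s t
  map s s' t := if s ≤ s' then
    (M.pproj v s' t ∘ₗ M.map (s.oplus v) (s'.oplus v) t) ∘ₗ (M.pshiftX v s t).subtype else 0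
  map_shape i h := if_neg h
  map_self s t x := by
    rw [if_pos le_rfl]
    exact M.pshiftX_ext fun h => (M.pproj_val h _).trans (M.map_self _ _ _)
  map_map {p q r} h h' i x := by
    rw [if_pos h, if_pos h', if_pos (h.trans h')]
    refine M.pshiftX_ext fun hr => ?_
    have hq := addLE_top_of_le h' hr
    refine (M.pproj_val hr _).trans (Eq.trans ?_ (M.pproj_val hr _).symm)
    refine (congrArg _ (M.pproj_val hq _)).trans ?_
    exact M.map_map (oplus_mono h hq) (oplus_mono h' hr) i x.1
  d s i j := (M.pproj v s j ∘ₗ M.d (s.oplus v) i j) ∘ₗ (M.pshiftX v s i).subtype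
  d_shape s i j h := by rw [M.d_shape _ h]; simp
  d_d s i j k x := by
    refine M.pshiftX_ext fun hs => ?_
    exact (M.pproj_val hs _).trans ((congrArg _ (M.pproj_val hs _)).trans (M.d_d _ i j k x.1))
  map_d {s s'} h i j x := by
    rw [if_pos h, if_pos h]
    refine M.pshiftX_ext fun hs' => ?_
    have hs := addLE_top_of_le h hs'
    refine (M.pproj_val hs' _).trans (Eq.trans ?_ (M.pproj_val hs' _).symm)
    exact (congrArg _ (M.pproj_val hs _)).trans
      ((M.map_d (oplus_mono h hs') i j x.1).trans (congrArg _ (M.pproj_val hs' _)).symm)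
  lact p q r i j k := if AddLE p q r then
    ((M.lact p (q.oplus v) (r.oplus v) i j k).compl₂ (M.pshiftX v q j).subtype).compr₂
      (M.pproj v r k) else 0
  lact_shape {p q r i j k} h := by
    by_cases h' : AddLE p q r
    · rw [if_pos h', M.lact_shape fun h'' => h ⟨h', h''.2⟩]
      ext; simp
    · rw [if_neg h']
  map_lact {p q r r'} h h' i j k a x := by
    rw [if_pos h, if_pos h', if_pos (AddLE.trans h h')]
    refine M.pshiftX_ext fun hr' => ?_
    have hr := addLE_top_of_le h' hr'
    refine (M.pproj_val hr' _).trans (Eq.trans ?_ (M.pproj_val hr' _).symm)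
    refine (congrArg _ (M.pproj_val hr _)).trans ?_
    exact M.map_lact (addLE_oplus_oplus h hr) (oplus_mono h' hr') i j k a x.1
  lact_map_map {p p' q q' r} h h' h'' i j k a x := by
    have h3 : AddLE p q r := addLE_of_le_of_le h h' h''
    rw [if_pos h'', if_pos h', if_pos h3]
    refine M.pshiftX_ext fun hr => ?_
    have hq' := addLE_top_of_le (le_of_addLE h'') hr
    refine (M.pproj_val hr _).trans (Eq.trans ?_ (M.pproj_val hr _).symm)
    refine (congrArg _ (M.pproj_val hq' _)).trans ?_
    exact M.lact_map_map h (oplus_mono h' hq') (addLE_oplus_oplus h'' hr) i j k a x.1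
  ract p q r i j k := if AddLE p q r then
    ((M.ract (p.oplus v) q (r.oplus v) i j k) ∘ₗ (M.pshiftX v p i).subtype).compr₂
      (M.pproj v r k) else 0
  ract_shape {p q r i j k} h := by
    by_cases h' : AddLE p q r
    · rw [if_pos h', M.ract_shape fun h'' => h ⟨h', h''.2⟩]
      ext; simp
    · rw [if_neg h']
  map_ract {p q r r'} h h' i j k x b := by
    rw [if_pos h, if_pos h', if_pos (AddLE.trans h h')]
    refine M.pshiftX_ext fun hr' => ?_
    have hr := addLE_top_of_le h' hr'
    refine (M.pproj_val hr' _).trans (Eq.trans ?_ (M.pproj_val hr' _).symm)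
    refine (congrArg _ (M.pproj_val hr _)).trans ?_
    exact M.map_ract (addLE_oplus_oplus' h hr) (oplus_mono h' hr') i j k x.1 b
  ract_map_map {p p' q q' r} h h' h'' i j k x b := by
    have h3 : AddLE p q r := addLE_of_le_of_le h h' h''
    rw [if_pos h'', if_pos h, if_pos h3]
    refine M.pshiftX_ext fun hr => ?_
    have hp' := addLE_top_of_le (le_of_addLE' h'') hr
    refine (M.pproj_val hr _).trans (Eq.trans ?_ (M.pproj_val hr _).symm)
    refine (congrArg (fun y => M.ract _ _ _ _ _ _ y _) (M.pproj_val hp' _)).trans ?_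
    exact M.ract_map_map (oplus_mono h hp') h' (addLE_oplus_oplus' h'' hr) i j k x.1 b
  mul_lact {p q r s v' w i j k l m t} h1 h2 h3 h4 e1 e2 e3 a b x := by
    rw [if_pos h2, if_pos h4, if_pos h3]
    refine M.pshiftX_ext fun hs => ?_
    have hw := addLE_top_of_le (le_of_addLE h4) hs
    refine (M.pproj_val hs _).trans (Eq.trans ?_ (M.pproj_val hs _).symm)
    refine Eq.trans ?_ (congrArg _ (M.pproj_val hw _)).symm
    exact M.mul_lact h1 (addLE_oplus_oplus h2 hs) (addLE_oplus_oplus h3 hw)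
      (addLE_oplus_oplus h4 hs) e1 e2 e3 a b x.1
  lact_ract {p q r s v' w i j k l m t} h1 h2 h3 h4 e1 e2 e3 a x b := by
    rw [if_pos h1, if_pos h2, if_pos h3, if_pos h4]
    refine M.pshiftX_ext fun hs => ?_
    have hw := addLE_top_of_le (le_of_addLE h4) hs
    have hv := addLE_top_of_le (le_of_addLE' h2) hs
    refine (M.pproj_val hs _).trans (Eq.trans ?_ (M.pproj_val hs _).symm)
    refine (congrArg (fun y => M.ract _ _ _ _ _ _ y _) (M.pproj_val hv _)).trans
      (Eq.trans ?_ (congrArg _ (M.pproj_val hw _)).symm)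
    exact M.lact_ract (addLE_oplus_oplus h1 hv) (addLE_oplus_oplus' h2 hs)
      (addLE_oplus_oplus' h3 hw) (addLE_oplus_oplus h4 hs) e1 e2 e3 a x.1 b
  ract_mul {p q r s v' w i j k l m t} h1 h2 h3 h4 e1 e2 e3 x a b := by
    rw [if_pos h2, if_pos h4, if_pos h1]
    refine M.pshiftX_ext fun hs => ?_
    have hv := addLE_top_of_le (le_of_addLE' h2) hs
    refine (M.pproj_val hs _).trans (Eq.trans ?_ (M.pproj_val hs _).symm)
    refine (congrArg (fun y => M.ract _ _ _ _ _ _ y _) (M.pproj_val hv _)).trans ?_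
    exact M.ract_mul (addLE_oplus_oplus' h1 hv) (addLE_oplus_oplus' h2 hs) h3
      (addLE_oplus_oplus' h4 hs) e1 e2 e3 x.1 a b
  one_lact {p q} h i x := by
    rw [if_pos (addLE_zero_left h), if_pos h]
    refine M.pshiftX_ext fun hq => ?_
    refine (M.pproj_val hq _).trans (Eq.trans ?_ (M.pproj_val hq _).symm)
    exact M.one_lact (oplus_mono h hq) i x.1
  ract_one {p q} h i x := by
    rw [if_pos (addLE_zero_right h), if_pos h]
    refine M.pshiftX_ext fun hq => ?_
    refine (M.pproj_val hq _).trans (Eq.trans ?_ (M.pproj_val hq _).symm)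
    exact M.ract_one (oplus_mono h hq) i x.1
  d_lact {p q r i j k i' j' k'} h e1 e2 e3 e4 a x := by
    rw [if_pos h, if_pos h, if_pos h]
    refine M.pshiftX_ext fun hr => ?_
    have hq := addLE_top_of_le (le_of_addLE h) hr
    refine (M.pproj_val hr _).trans ((congrArg _ (M.pproj_val hr _)).trans ?_)
    refine (M.d_lact (addLE_oplus_oplus h hr) e1 e2 e3 e4 a x.1).trans ?_
    refine congrArg₂ _ (M.pproj_val hr _).symm ?_
    have e'' : ∀ (ε : ℤˣ) (y : M.pshiftX v r k'), (ε • y).1 = ε • y.1 := fun ε y =>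
      map_units_smul' (M.pshiftX v r k').subtype ε y
    refine Eq.trans ?_ (e'' _ _).symm
    refine congrArg _ (Eq.trans ?_ (M.pproj_val hr _).symm)
    exact (congrArg _ (M.pproj_val hq _)).symm
  d_ract {p q r i j k i' j' k'} h e1 e2 e3 e4 x b := by
    rw [if_pos h, if_pos h, if_pos h]
    refine M.pshiftX_ext fun hr => ?_
    have hp := addLE_top_of_le (le_of_addLE' h) hr
    refine (M.pproj_val hr _).trans ((congrArg _ (M.pproj_val hr _)).trans ?_)
    refine (M.d_ract (addLE_oplus_oplus' h hr) e1 e2 e3 e4 x.1 b).trans ?_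
    have e'' : ∀ (ε : ℤˣ) (y : M.pshiftX v r k'), (ε • y).1 = ε • y.1 := fun ε y =>
      map_units_smul' (M.pshiftX v r k').subtype ε y
    refine congrArg₂ _ (Eq.trans ?_ (M.pproj_val hr _).symm)
      (Eq.trans ?_ (e'' _ _).symm)
    · exact (congrArg (fun y => M.ract _ _ _ _ _ _ y _) (M.pproj_val hp _)).symm
    · exact congrArg _ (M.pproj_val hr _).symm

theorem Bimodule.pshift_acyclic (hM : M.Acyclic) (v : Perversity n) : (M.pshift v).Acyclic := by
  intro s i j k hj hk x hx
  by_cases hs : AddLE s v (top n)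
  · have key (x : M.pshiftX v s i) (hx : M.pproj v s k (M.d (s.oplus v) i k x.1) = 0) :
        ∃ y : M.pshiftX v s j, M.pproj v s i (M.d (s.oplus v) j i y.1) = x := by
      have h0 : M.d (s.oplus v) i k x.1 = 0 := by
        rw [← M.pproj_val hs (M.d (s.oplus v) i k x.1), hx]; rfl
      obtain ⟨y, hy⟩ := hM _ i j k hj hk x.1 h0
      refine ⟨M.pproj v s j y, Subtype.ext ?_⟩
      rw [M.pproj_val hs, M.pproj_val hs, hy]
    exact key x hx
  · exact ⟨0, M.pshiftX_ext fun h => absurd h hs⟩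

/-! ### Cochains with values in the shift of perversities -/

section

variable {v : Perversity n} {q : ℤ} {f f' : Raw A M} {g : Raw A (M.pshift v)}

/-- The underlying value at the perversity `s ⊕ v`. -/
noncomputable def Bimodule.pincl (M : Bimodule A) (v s : Perversity n) (t : ℤ) :
    (M.pshift v).X s t →ₗ[R] M.X (s.oplus v) t := (M.pshiftX v s t).subtype

theorem pshift_ext {s : Perversity n} {t : ℤ} {x y : (M.pshift v).X s t}
    (h : AddLE s v (top n) → M.pincl v s t x = M.pincl v s t y) : x = y := M.pshiftX_ext h

theorem le_top (s : Perversity n) : s ≤ top n := fun i => s.toFun_le_top i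

theorem Perversity.AddLE.top {p q r : Perversity n} (h : AddLE p q r) : AddLE p q (top n) :=
  AddLE.trans h (le_top r)

theorem pincl_map {s s' : Perversity n} (t : ℤ) (h : s ≤ s') (h' : AddLE s' v (top n))
    (x : (M.pshift v).X s t) : M.pincl v s' t ((M.pshift v).map s s' t x) =
      M.map (s.oplus v) (s'.oplus v) t (M.pincl v s t x) := by
  have e : (M.pshift v).map s s' t =
    (M.pproj v s' t ∘ₗ M.map (s.oplus v) (s'.oplus v) t) ∘ₗ (M.pshiftX v s t).subtype := if_pos h
  rw [e]
  exact M.pproj_val h' _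

theorem pincl_d {s : Perversity n} (i j : ℤ) (h' : AddLE s v (top n))
    (x : (M.pshift v).X s i) : M.pincl v s j ((M.pshift v).d s i j x) =
      M.d (s.oplus v) i j (M.pincl v s i x) := M.pproj_val h' _

theorem pincl_lact {p q r : Perversity n} (i j k : ℤ) (h : AddLE p q r) (h' : AddLE r v (top n))
    (a : A.X p i) (x : (M.pshift v).X q j) :
    M.pincl v r k ((M.pshift v).lact p q r i j k a x) =
      M.lact p (q.oplus v) (r.oplus v) i j k a (M.pincl v q j x) := by
  have e : (M.pshift v).lact p q r i j k =
    ((M.lact p (q.oplus v) (r.oplus v) i j k).compl₂ (M.pshiftX v q j).subtype).compr₂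
      (M.pproj v r k) := if_pos h
  rw [e]
  exact M.pproj_val h' _

theorem pincl_ract {p q r : Perversity n} (i j k : ℤ) (h : AddLE p q r) (h' : AddLE r v (top n))
    (x : (M.pshift v).X p i) (b : A.X q j) :
    M.pincl v r k ((M.pshift v).ract p q r i j k x b) =
      M.ract (p.oplus v) q (r.oplus v) i j k (M.pincl v p i x) b := by
  have e : (M.pshift v).ract p q r i j k =
    ((M.ract (p.oplus v) q (r.oplus v) i j k) ∘ₗ (M.pshiftX v p i).subtype).compr₂
      (M.pproj v r k) := if_pos h
  rw [e]
  exact M.pproj_val h' _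

/-- The cochain `f` with values in `M` corresponds to the cochain `g` with values in the shift. -/
def ShiftRel (f : Raw A M) (g : Raw A (M.pshift v)) : Prop :=
  ∀ L (r s : Perversity n) t, pervSum L ≤ r.toFun → AddLE r v s →
    f L s t = M.map (r.oplus v) s t (M.pincl v r t (g L r t))

theorem pervSum_add_zero (L : List (Elt A)) : pervSum L + (0 : Perversity n).toFun = pervSum L :=
  add_zero _

theorem ceil_rel {L : List (Elt A)} {s : Perversity n} (h : pervSum L + v.toFun ≤ s.toFun) :
    pervSum L ≤ (ceil (pervSum L)).toFun ∧ AddLE (ceil (pervSum L)) v s :=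
  ⟨le_ceil (le_of_add_le_left h), ceil_add_le (pervSum_mono L) v.toFun_mono h⟩

theorem ShiftRel.lactVal (h : ShiftRel f g) {r s : Perversity n} (t : ℤ) {a : Elt A}
    {L : List (Elt A)} (hL : pervSum (a :: L) ≤ r.toFun) (hs : AddLE r v s) :
    lactVal v.toFun q f s t a L = M.map (r.oplus v) s t (M.pincl v r t
      (lactVal (0 : Perversity n).toFun q g r t a L)) := by
  have hL' : a.perv.toFun + (pervSum L + (0 : Perversity n).toFun) ≤ r.toFun := by
    rwa [pervSum_add_zero, ← pervSum_cons]
  have hv : a.perv.toFun + (pervSum L + v.toFun) ≤ s.toFun := by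
    refine le_trans ?_ hs
    rw [← add_assoc, ← pervSum_cons]
    exact add_le_add_left hL v.toFun
  have h1 : AddLE a.perv (ceil (pervSum L + (0 : Perversity n).toFun)) r :=
    addLE_ceil_left ((pervSum_mono L).add (0 : Perversity n).toFun_mono) hL'
  have h2 : AddLE a.perv (ceil (pervSum L + v.toFun)) s :=
    addLE_ceil_left ((pervSum_mono L).add v.toFun_mono) hv
  obtain ⟨h4, h3⟩ := ceil_rel (L := L) (v := v)
    (le_ceil (le_of_add_le_left (le_of_eq_of_le (add_comm _ _) hv)))
  have e := h L _ _ (sdeg L + q) h4 h3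
  refine (congrArg _ e).trans ?_
  have e2 := M.lact_map_map (le_refl a.perv) (oplus_le h3) h2 a.deg (sdeg L + q) t a.val
    (M.pincl v _ _ (g L _ _))
  rw [A.map_self] at e2
  refine e2.trans ?_
  exact ((congrArg _ (pincl_lact _ _ _ h1 hs.top _ _)).trans
    (M.map_lact (addLE_oplus_oplus h1 hs) (oplus_le hs) ..)).symm

theorem ShiftRel.ractVal (h : ShiftRel f g) {r s : Perversity n} (t : ℤ) {b : Elt A}
    {L : List (Elt A)} (hL : pervSum (L ++ [b]) ≤ r.toFun) (hs : AddLE r v s) :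
    ractVal v.toFun q f s t L b = M.map (r.oplus v) s t (M.pincl v r t
      (ractVal (0 : Perversity n).toFun q g r t L b)) := by
  rw [pervSum_mid, pervSum_nil, add_zero] at hL
  have hL' : b.perv.toFun + (pervSum L + (0 : Perversity n).toFun) ≤ r.toFun :=
    le_of_eq_of_le (add_comm b.perv.toFun (pervSum L + (0 : Perversity n).toFun)) hL
  have hv : b.perv.toFun + (pervSum L + v.toFun) ≤ s.toFun := by
    refine le_trans ?_ hs
    exact le_of_eq_of_le (by abel) (add_le_add_left hL v.toFun)
  have h1 : AddLE (ceil (pervSum L + (0 : Perversity n).toFun)) b.perv r :=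
    (addLE_ceil_left ((pervSum_mono L).add (0 : Perversity n).toFun_mono) hL').symm
  have h2 : AddLE (ceil (pervSum L + v.toFun)) b.perv s :=
    (addLE_ceil_left ((pervSum_mono L).add v.toFun_mono) hv).symm
  obtain ⟨h4, h3⟩ := ceil_rel (L := L) (v := v)
    (le_ceil (le_of_add_le_left (le_of_eq_of_le (add_comm _ _) hv)))
  have e := h L _ _ (sdeg L + q) h4 h3
  refine (congrArg (fun y => M.ract _ _ _ _ _ _ y _) e).trans ?_
  have e2 := M.ract_map_map (oplus_le h3) (le_refl b.perv) h2 (sdeg L + q) b.deg t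
    (M.pincl v _ _ (g L _ _)) b.val
  rw [A.map_self] at e2
  refine e2.trans ?_
  exact ((congrArg _ (pincl_ract _ _ _ h1 hs.top _ _)).trans
    (M.map_ract (addLE_oplus_oplus' h1 hs) (oplus_le hs) ..)).symm

theorem ShiftRel.gD (h : ShiftRel f g) :
    ShiftRel (gD v.toFun q f) (gD (0 : Perversity n).toFun q g) := by
  intro L r s t hL hs
  change _ = (M.map (r.oplus v) s t ∘ₗ M.pincl v r t) _
  rw [PerverseHochschild.gD, PerverseHochschild.gD, map_add, map_add, map_add, map_headSum,
    map_lastSum, map_units_smul', map_ins]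
  simp only [map_units_smul']
  congr 1
  · congr 1
    · congr 1
      · rw [h L r s (t - 1) hL hs, LinearMap.comp_apply, pincl_d _ _ hs.top, M.map_d (oplus_le hs)]
      · refine congrArg _ (splitSum_congr fun L₁ L' h₁ => splitSum_congr fun L₂ L₃ h₂ =>
          congrArg _ (h _ _ _ _ ?_ hs))
        have := pervSum_ent_le (f := mC A) (s := r) L₁ L₂ L₃ (0 : Perversity n).toFun_mono (by
          rw [h₂, h₁]
          exact le_of_eq_of_le (by simp [mC]; rfl) hL)
        rwa [pervSum_add_zero] at this
    · refine headSum_congr fun a L' e => congrArg _ ?_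
      subst e
      exact h.lactVal t hL hs
  · refine lastSum_congr fun L' b e => congrArg _ ?_
    subst e
    exact h.ractVal t hL hs

theorem ShiftRel.pincl (h : ShiftRel f g) {L : List (Elt A)} {r : Perversity n} (t : ℤ)
    (hL : pervSum L ≤ r.toFun) (hr : AddLE r v (top n)) :
    M.pincl v r t (g L r t) = f L (r.oplus v) t :=
  (M.map_self _ _ _).symm.trans (h L r _ t hL (addLE_oplus hr)).symm

theorem le_oplus {L : List (Elt A)} {r : Perversity n} (hL : pervSum L ≤ r.toFun)
    (hr : AddLE r v (top n)) : pervSum L + v.toFun ≤ (r.oplus v).toFun :=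
  (add_le_add_left hL v.toFun).trans (addLE_oplus hr)

theorem pervSum_set_le (L L' : List (Elt A)) {p₁ p₂ : Perversity n} (h : p₁ ≤ p₂) (i : ℤ)
    (a : A.X p₁ i) (b : A.X p₂ i) :
    pervSum (L ++ ⟨p₁, i, a⟩ :: L') ≤ pervSum (L ++ ⟨p₂, i, b⟩ :: L') := by
  rw [pervSum_append, pervSum_append, pervSum_cons, pervSum_cons]
  exact add_le_add le_rfl (add_le_add (show p₁.toFun ≤ p₂.toFun from h) le_rfl)

theorem mem_HC_of_local {p p' : Perversity n} {f : Raw A M} {g : Raw A N} (hg : g ∈ HC A N p' q)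
    (hout : ∀ (L : List (Elt A)) (s : Perversity n) t,
      ¬ pervSum L + p.toFun ≤ s.toFun → f L s t = 0)
    (nat : ∀ (L : List (Elt A)) (s s' : Perversity n) t, pervSum L + p.toFun ≤ s.toFun → s ≤ s' →
      M.map s s' t (f L s t) = f L s' t)
    (h : ∀ (L : List (Elt A)) (s : Perversity n) t, pervSum L + p.toFun ≤ s.toFun →
      ∃ (r : Perversity n) (φ : N.X r t →ₗ[R] M.X s t), (pervSum L + p'.toFun ≤ r.toFun ∨ φ = 0) ∧
        ∀ L' : List (Elt A), pervSum L' ≤ pervSum L → f L' s t = φ (g L' r t)) :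
    f ∈ HC A M p q := by
  obtain ⟨g1, g2, g3, g4, g5, g6⟩ := hg
  have hout' {L L' : List (Elt A)} {s : Perversity n} (t : ℤ) (h : pervSum L ≤ pervSum L')
      (hL : ¬ pervSum L + p.toFun ≤ s.toFun) : f L' s t = 0 :=
    hout L' s t fun h' => hL ((add_le_add_left h _).trans h')
  refine ⟨fun L s t hs => ?_, fun L L' p' i a b s t => ?_, fun L L' p' i c a s t => ?_,
    fun L L' p₁ p₂ i a s t h1 h2 => ?_, nat, fun L L' p' s t => ?_⟩
  · by_cases hL : pervSum L + p.toFun ≤ s.toFun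
    · obtain ⟨r, φ, -, e⟩ := h L s t hL
      rw [e L le_rfl, g1 L _ t fun h' => hs ⟨hL, h'.2⟩, map_zero]
    · exact hout L s t hL
  · have l (x y : A.X p' i) := pervSum_set_le L L' (le_refl p') i x y
    by_cases hL : pervSum (L ++ ⟨p', i, a + b⟩ :: L') + p.toFun ≤ s.toFun
    · obtain ⟨r, φ, -, e⟩ := h _ s t hL
      rw [e _ le_rfl, e _ (l a (a + b)), e _ (l b (a + b)), g2, map_add]
    · rw [hout _ s t hL, hout' t (l _ a) hL, hout' t (l _ b) hL, add_zero]
  · have l (x y : A.X p' i) := pervSum_set_le L L' (le_refl p') i x y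
    by_cases hL : pervSum (L ++ ⟨p', i, c • a⟩ :: L') + p.toFun ≤ s.toFun
    · obtain ⟨r, φ, -, e⟩ := h _ s t hL
      rw [e _ le_rfl, e _ (l a (c • a)), g3, map_smul]
    · rw [hout _ s t hL, hout' t (l _ a) hL, smul_zero]
  · obtain ⟨r, φ, hr, e⟩ := h _ s t h2
    rw [e _ le_rfl, e _ (pervSum_set_le L L' h1 i a _)]
    rcases hr with hr | rfl
    · rw [g4 L L' p₁ p₂ i a _ t h1 hr]
    · rfl
  · by_cases hL : pervSum (L ++ ⟨p', 0, A.map 0 p' 0 A.one⟩ :: L') + p.toFun ≤ s.toFun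
    · obtain ⟨r, φ, -, e⟩ := h _ s t hL
      rw [e _ le_rfl, g6, map_zero]
    · exact hout _ s t hL

theorem ShiftRel.mem_HC (h : ShiftRel f g) (hg : g ∈ HC A (M.pshift v) 0 q)
    (hout : ∀ L (s : Perversity n) t, ¬ pervSum L + v.toFun ≤ s.toFun → f L s t = 0) :
    f ∈ HC A M v q :=
  mem_HC_of_local hg hout (fun L s s' t h1 h2 => by
    obtain ⟨r1, r2⟩ := ceil_rel h1
    rw [h _ _ s t r1 r2, h _ _ s' t r1 (r2.trans h2), M.map_map (oplus_le r2) h2])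
    fun L s t hL => ⟨_, M.map _ s t ∘ₗ M.pincl v (ceil (pervSum L)) t, Or.inl (ceil_rel hL).1,
      fun L' h' => h L' _ s t (h'.trans (ceil_rel hL).1) (ceil_rel hL).2⟩

theorem ShiftRel.mem_HC_pshift (h : ShiftRel f g) (hf : f ∈ HC A M v q)
    (hout : ∀ L (r : Perversity n) t, ¬ pervSum L ≤ r.toFun → g L r t = 0) :
    g ∈ HC A (M.pshift v) 0 q := by
  refine mem_HC_of_local (p := 0) hf hout (fun L s s' t h1 h2 => pshift_ext fun hr => ?_)
    fun L s t hL => ?_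
  · have hr' := addLE_top_of_le h2 hr
    rw [pincl_map t h2 hr, h.pincl t h1 hr', h.pincl t (le_trans h1 h2) hr,
      hf.2.2.2.2.1 L _ _ t (le_oplus h1 hr') (oplus_mono h2 hr)]
  · by_cases hs : AddLE s v (top n)
    · exact ⟨_, M.pproj v s t, Or.inl (le_oplus hL hs), fun L' h' => pshift_ext fun _ =>
        (h.pincl t (h'.trans hL) hs).trans (M.pproj_val hs _).symm⟩
    · exact ⟨v, 0, Or.inr rfl, fun L' _ => pshift_ext fun h' => absurd h' hs⟩

theorem exists_shiftRel (hf : f ∈ cocycles A M v q) :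
    ∃ g ∈ cocycles A (M.pshift v) 0 q, ShiftRel f g := by
  classical
  obtain ⟨hf, hf0⟩ := mem_cocycles.1 hf
  let g : Raw A (M.pshift v) := fun L r t =>
    if pervSum L ≤ r.toFun then M.pproj v r t (f L (r.oplus v) t) else 0
  have h : ShiftRel f g := by
    intro L r s t hL hs
    have e : M.pincl v r t (g L r t) = f L (r.oplus v) t :=
      (congrArg _ (if_pos hL)).trans (M.pproj_val hs.top _)
    rw [e]
    exact (hf.2.2.2.2.1 L _ s t (le_oplus hL hs.top) (oplus_le hs)).symm
  have hg := h.mem_HC_pshift hf fun L r t hL => if_neg hL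
  refine ⟨g, mem_cocycles.2 ⟨hg, fun L r t => ?_⟩, h⟩
  by_cases hL : pervSum L ≤ r.toFun
  · exact pshift_ext fun hr => (h.gD.pincl t hL hr).trans ((hf0 ..).trans (map_zero _).symm)
  · exact gD_out (PerverseHochschild.mem_HC.1 hg).1 (0 : Perversity n).toFun_mono hL t

theorem exists_shiftRel_of_pshift (hg : g ∈ HC A (M.pshift v) 0 q) :
    ∃ f ∈ HC A M v q, ShiftRel f g := by
  classical
  let f : Raw A M := fun L s t => if pervSum L + v.toFun ≤ s.toFun then
    M.map ((ceil (pervSum L)).oplus v) s t (M.pincl v _ t (g L (ceil (pervSum L)) t)) else 0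
  have h : ShiftRel f g := by
    intro L r s t hL hs
    have hr : (M.pshift v).map (ceil (pervSum L)) r t (g L _ t) = g L r t :=
      hg.2.2.2.2.1 L _ r t (le_ceil hL) (ceil_le hL)
    have e := pincl_map t (ceil_le hL) hs.top (g L (ceil (pervSum L)) t)
    refine (if_pos ((add_le_add_left hL v.toFun).trans hs)).trans ?_
    rw [← hr, e, M.map_map (oplus_mono (ceil_le hL) hs.top) (oplus_le hs)]
  exact ⟨f, h.mem_HC hg fun L s t hL => if_neg hL, h⟩

theorem ShiftRel.eq (h : ShiftRel f g) (h' : ShiftRel f' g) {L : List (Elt A)} {s : Perversity n}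
    {t : ℤ} (hL : pervSum L + v.toFun ≤ s.toFun) : f L s t = f' L s t :=
  (h L _ s t (ceil_rel hL).1 (ceil_rel hL).2).trans
    (h' L _ s t (ceil_rel hL).1 (ceil_rel hL).2).symm

end

/-! ### Quasi-isomorphisms induce isomorphisms on cohomology -/

section

variable {q e e' i j : ℤ} {v : Perversity n} {f : Raw A M}

theorem push_ofShift (g : BimoduleHom M N e) (he : e' + q = e) (f : Raw A M) :
    push (N.ofShift q) (push (g.shift he) f) = push g f := by
  funext L s t
  have key : ∀ a b, a = t → b = t - e →
      N.cast s a t (g.toFun s b a (f L s b)) = g.toFun s (t - e) t (f L s (t - e)) := by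
    rintro _ _ rfl rfl
    exact N.cast_self _ _ _
  exact key (t - q + q) (t - q - e') (by ring) (by omega)

theorem push_id_shift (g : BimoduleHom M N e) (he : e' + q = e) (he' : -q + q = 0) (f : Raw A M) :
    push (N.id.shift he') (push g f) = push (g.shift he) f := by
  funext L s t
  have key : ∀ a b c, a = t + q → b = t + q - e → c = b →
      N.cast s a (t + q) (g.toFun s b a (f L s b)) = g.toFun s c (t + q) (f L s c) := by
    rintro _ _ _ rfl rfl rfl
    exact N.cast_self _ _ _
  exact key (t - -q) (t - -q - e) (t - e') (by ring) (by ring) (by omega)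

theorem push_id (f : Raw A M) : push M.id f = f := by
  funext L s t
  have key : ∀ b, b = t → M.cast s b t (f L s b) = f L s t := by
    rintro _ rfl
    exact M.cast_self _ _ _
  exact key (t - 0) (sub_zero t)

theorem gD_units_smul (hf : f ∈ HC A M v q) (ε : ℤˣ) (L : List (Elt A)) (s : Perversity n) (t : ℤ) :
    gD v.toFun q (ε • f) L s t = ε • gD v.toFun q f L s t := by
  have h := units_smul_mem _ ε hf
  rw [← hochD_eq_gD (mem_HC.1 h).1, ← hochD_eq_gD (mem_HC.1 hf).1, map_units_smul']
  rfl

theorem mem_coboundaries_of_eq (hf : f ∈ HC A M v i) (hi : q + 1 = i) {h : Raw A M}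
    (hh : h ∈ HC A M v q) (ε : ℤˣ) (e : ∀ L (s : Perversity n) t,
      pervSum L + v.toFun ≤ s.toFun → f L s t = ε • gD v.toFun q h L s t) :
    f ∈ coboundaries A M v i := by
  subst hi
  exact mem_coboundaries hf (mem_HC.1 hh).1 le_rfl (mem_HC.1 hh).2 ε fun L s t hL _ => e L s t hL

theorem exists_eq_gD_of_mem_coboundaries (hi : q + 1 = i) (hf : f ∈ coboundaries A M v i) :
    ∃ h ∈ HC A M v q, ∀ L s t, f L s t = gD v.toFun q h L s t := by
  subst hi
  exact exists_of_mem_coboundaries hf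

theorem push_gD (g : BimoduleHom M N e) (w : Fin (n + 1) → ℕ) (f : Raw A M) (L : List (Elt A))
    (s : Perversity n) (t : ℤ) :
    push g (gD w q f) L s t = e.negOnePow • gD w (q + e) (push g f) L s t := by
  rw [gD_push, negOnePow_smul_smul]

theorem BarCofibrant.mem_coboundaries_zero (hA : BarCofibrant A) (hM : M.Acyclic)
    (hf : f ∈ cocycles A M 0 0) : f ∈ coboundaries A M 0 0 := by
  let σ : BimoduleHom M (M.shift (-1)) 1 := M.id.shift (by norm_num)
  have hE : σ.fiber.Acyclic := (M.id_isQuasiIso.shift _).acyclic_fiber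
  have hs : ∀ p i, Function.Surjective (σ.fiberFst.toFun p i i) := fun p i x =>
    ⟨((x, 0) : M.X p i × (M.shift (-1)).X p i), M.cast_self _ _ _⟩
  obtain ⟨g, hg, e⟩ := hA _ _ σ.fiberFst (PerverseComplex.Acyclic.isQuasiIso hE hM _) hs f hf
  have hfst : fstRaw σ g = f := by
    funext L s t
    exact (M.cast_self s t _).symm.trans (e L s t)
  refine mem_coboundaries_of_eq (q := 0 + -1) hf.1 (by norm_num)
    (push_mem_HC (M.ofShift (-1)) (mem_HC_snd hg.1)) (-(-1 : ℤ).negOnePow) fun L s t _ => ?_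
  have h0 : push σ f = -gD (0 : Perversity n).toFun 0 (sndRaw σ g) := by
    funext L s t
    have := snd_gD (g := σ) (w := (0 : Perversity n).toFun) (q := 0) (f := g) L s t
    rw [hfst] at this
    refine eq_neg_of_add_eq_zero_left (this.symm.trans ?_)
    exact congrArg Prod.snd ((mem_cocycles.1 hg).2 L s t)
  rw [Units.neg_smul, ← push_gD]
  refine (congrFun (congrFun (congrFun (push_id f) L) s) t).symm.trans ?_
  rw [← push_ofShift M.id (by norm_num : 1 + -1 = (0 : ℤ)) f]
  change push (M.ofShift (-1)) (push σ f) L s t = _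
  rw [h0]
  exact map_neg _ _

theorem BarCofibrant.mem_coboundaries (hA : BarCofibrant A) (hM : M.Acyclic)
    (hf : f ∈ cocycles A M v i) : f ∈ coboundaries A M v i := by
  have base {M : Bimodule A} {f : Raw A M} (hM : M.Acyclic) (hf : f ∈ cocycles A M v 0) :
      f ∈ coboundaries A M v 0 := by
    obtain ⟨g, hg, h⟩ := exists_shiftRel hf
    have hb := hA.mem_coboundaries_zero (M.pshift_acyclic hM v) hg
    obtain ⟨k, hk, e⟩ := exists_eq_gD_of_mem_coboundaries (q := -1) (by norm_num) hb
    obtain ⟨l, hl, h'⟩ := exists_shiftRel_of_pshift hk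
    obtain rfl : g = gD (0 : Perversity n).toFun (-1) k := by
      funext L s t
      exact e L s t
    exact mem_coboundaries_of_eq (q := -1) hf.1 (by norm_num) hl 1
      fun L s t hL => (h.eq h'.gD hL).trans (one_smul _ _).symm
  have he : -i + i = 0 := by ring
  have h1 := push_mem_cocycles (M.id.shift he) hf
  rw [add_neg_cancel] at h1
  obtain ⟨h, hh, e⟩ := exists_eq_gD_of_mem_coboundaries (q := -1) (by norm_num)
    (base (Bimodule.shift_acyclic hM i) h1)
  refine mem_coboundaries_of_eq (q := -1 + i) hf.1 (by ring) (push_mem_HC (M.ofShift i) hh)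
    i.negOnePow fun L s t _ => ?_
  rw [← push_gD]
  refine (congrFun (congrFun (congrFun (push_id f) L) s) t).symm.trans ?_
  rw [← push_ofShift M.id he f]
  exact congrArg _ (e L s _)

variable {g : BimoduleHom M N e}

theorem fiberRaw_mem_cocycles {g : BimoduleHom M N 1} {h : Raw A N} (hf : f ∈ cocycles A M v q)
    (hh : h ∈ HC A N v q) (e : ∀ L s t, push g f L s t + gD v.toFun q h L s t = 0) :
    fiberRaw g f h ∈ cocycles A g.fiber v q :=
  mem_cocycles.2 ⟨mem_HC_fiberRaw hf.1 hh, fun L s t => Prod.ext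
    ((fst_gD L s t).trans ((mem_cocycles.1 hf).2 L s t)) ((snd_gD L s t).trans (e L s t))⟩

theorem BarCofibrant.mem_coboundaries_of_push (hA : BarCofibrant A) (hg : g.IsQuasiIso)
    (hj : i + e = j) (hf : f ∈ cocycles A M v i) (hb : push g f ∈ coboundaries A N v j) :
    f ∈ coboundaries A M v i := by
  have he : 1 + (e - 1) = e := by ring
  have he' : -(e - 1) + (e - 1) = 0 := by ring
  obtain ⟨y, hy, eq⟩ := exists_eq_gD_of_mem_coboundaries (q := i + (e - 1)) (by omega) hb
  have hy' := push_mem_HC (N.id.shift he') hy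
  rw [show i + (e - 1) + -(e - 1) = i by ring] at hy'
  have hK := (hg.shift he).acyclic_fiber
  have hz : (-(-(e - 1)).negOnePow : ℤˣ) • push (N.id.shift he') y ∈ HC A (N.shift (e - 1)) v i :=
    units_smul_mem _ _ hy'
  have hc := fiberRaw_mem_cocycles (g := g.shift he) hf hz fun L s t => by
    have h1 : gD v.toFun i (push (N.id.shift he') y) L s t =
        (-(e - 1)).negOnePow • push (g.shift he) f L s t := by
      have := gD_push (w := v.toFun) (q := i + (e - 1)) (f := y) (N.id.shift he') L s t
      rw [show i + (e - 1) + -(e - 1) = i by ring] at this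
      rw [this, ← push_id_shift g he he' f]
      exact congrArg _ (congrArg _ (eq L s _).symm)
    rw [gD_units_smul hy', h1, smul_smul, neg_mul, ← Int.negOnePow_add,
      Int.negOnePow_even _ ⟨_, rfl⟩, Units.neg_smul, one_smul, add_neg_cancel]
  obtain ⟨h, hh, e'⟩ := exists_eq_gD_of_mem_coboundaries (q := i - 1) (by ring)
    (hA.mem_coboundaries hK hc)
  refine mem_coboundaries_of_eq (q := i - 1) hf.1 (by ring) (mem_HC_fst hh) 1 fun L s t _ => ?_
  rw [one_smul, ← fst_gD]
  exact congrArg Prod.fst (e' L s t)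

theorem BarCofibrant.exists_push (hA : BarCofibrant A) (hg : g.IsQuasiIso)
    (hj : i + e = j) {y : Raw A N} (hy : y ∈ cocycles A N v j) :
    ∃ f ∈ cocycles A M v i, y - push g f ∈ coboundaries A N v j := by
  have he : 1 + (e - 1) = e := by ring
  have he' : -(e - 1) + (e - 1) = 0 := by ring
  have hy' := push_mem_cocycles (N.id.shift he') hy
  rw [show j + -(e - 1) = i + 1 by omega] at hy'
  have hK := (hg.shift he).acyclic_fiber
  have h0 : (0 : Raw A M) ∈ cocycles A M v (i + 1) := zero_mem _
  have hc := fiberRaw_mem_cocycles (g := g.shift he) h0 hy'.1 fun L s t => by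
    rw [(mem_cocycles.1 hy').2, add_zero]
    exact map_zero _
  obtain ⟨h, hh, eq⟩ := exists_eq_gD_of_mem_coboundaries (q := i) rfl (hA.mem_coboundaries hK hc)
  have hf : fstRaw (g.shift he) h ∈ cocycles A M v i :=
    mem_cocycles.2 ⟨mem_HC_fst hh, fun L s t =>
      (fst_gD L s t).symm.trans (congrArg Prod.fst (eq L s t)).symm⟩
  refine ⟨_, hf, mem_coboundaries_of_eq (q := i + (e - 1)) ?_ (by omega)
    (push_mem_HC (N.ofShift (e - 1)) (mem_HC_snd hh)) (e - 1).negOnePow fun L s t _ => ?_⟩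
  · have := push_mem_HC g hf.1
    rw [hj] at this
    exact sub_mem hy.1 this
  · rw [← push_gD]
    refine sub_eq_of_eq_add' ?_
    refine (congrFun (congrFun (congrFun (push_id y) L) s) t).symm.trans ?_
    rw [← push_ofShift N.id he' y, ← push_ofShift g he]
    refine Eq.trans ?_ (map_add _ _ _)
    refine congrArg _ ?_
    exact (congrArg Prod.snd (eq L s _)).trans (snd_gD L s _)

/-- A quasi-isomorphism of bimodules induces an isomorphism on cohomology. -/
theorem BarCofibrant.exists_pushEquiv (hA : BarCofibrant A) (hg : g.IsQuasiIso)
    (v : Perversity n) (hj : i + e = j) :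
    ∃ φ : HH A M v i ≃ₗ[R] HH A N v j, ∀ (f : Raw A M) (hf : f ∈ cocycles A M v i),
      ∃ h' : push g f ∈ cocycles A N v j, φ (HH.mk f hf) = HH.mk _ h' := by
  obtain ⟨φ, hφ⟩ := HH.exists_push g v hj
  refine ⟨LinearEquiv.ofBijective φ ⟨?_, fun y => ?_⟩, hφ⟩
  · refine (injective_iff_map_eq_zero φ).2 fun x hx => ?_
    obtain ⟨f, hf, rfl⟩ := HH.exists_rep x
    obtain ⟨h', e⟩ := hφ f hf
    have h0 := (HH.mk_eq_iff h' (zero_mem _)).1 ((e.symm.trans hx))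
    rw [sub_zero] at h0
    refine (HH.mk_eq_iff hf (zero_mem _)).2 ?_
    rw [sub_zero]
    exact hA.mem_coboundaries_of_push hg hj hf h0
  · obtain ⟨y, hy, rfl⟩ := HH.exists_rep y
    obtain ⟨f, hf, h⟩ := hA.exists_push hg hj hy
    obtain ⟨h', e⟩ := hφ f hf
    exact ⟨HH.mk f hf, e.trans ((HH.mk_eq_iff hy h').2 h).symm⟩

end

/-! ### Associated isomorphisms -/

section

variable {e i j j' k k' : ℤ} {p q r : Perversity n} {f : Raw A M} (g : BimoduleHom M N e)

theorem push_restr_actRaw (hj : j + e = j') (h : Raw A A.regular) :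
    push g (restr r (actRaw p q i j h f)) =
      (e * i).negOnePow • restr r (actRaw p q i j' h (push g f)) := by
  subst hj
  funext L s t
  rw [push_restr]
  change _ = (e * i).negOnePow • restr r _ L s t
  by_cases hL : pervSum L + r.toFun ≤ s.toFun
  · rw [restr_of_le _ hL, restr_of_le _ hL, actRaw_push, negOnePow_smul_smul]
  · rw [restr_of_not_le _ hL, restr_of_not_le _ hL, smul_zero]

variable {g}

theorem push_act (hj : j + e = j') {Φ : HH A M q j →ₗ[R] HH A N q j'}
    (hΦ : ∀ (f : Raw A M) (hf : f ∈ cocycles A M q j),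
      ∃ h' : push g f ∈ cocycles A N q j', Φ (HH.mk f hf) = HH.mk _ h')
    {Φ' : HH A M r k →ₗ[R] HH A N r k'}
    (hΦ' : ∀ (f : Raw A M) (hf : f ∈ cocycles A M r k),
      ∃ h' : push g f ∈ cocycles A N r k', Φ' (HH.mk f hf) = HH.mk _ h')
    {ψ : HH A A.regular p i →ₗ[R] HH A M q j →ₗ[R] HH A M r k}
    (hψ : ∀ (f : Raw A A.regular) (g : Raw A M) (hf : f ∈ cocycles A A.regular p i)
      (hg : g ∈ cocycles A M q j), ∃ h' : restr r (actRaw p q i j f g) ∈ cocycles A M r k,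
      ψ (HH.mk f hf) (HH.mk g hg) = HH.mk _ h')
    {ψ' : HH A A.regular p i →ₗ[R] HH A N q j' →ₗ[R] HH A N r k'}
    (hψ' : ∀ (f : Raw A A.regular) (g : Raw A N) (hf : f ∈ cocycles A A.regular p i)
      (hg : g ∈ cocycles A N q j'), ∃ h' : restr r (actRaw p q i j' f g) ∈ cocycles A N r k',
      ψ' (HH.mk f hf) (HH.mk g hg) = HH.mk _ h')
    (x : HH A A.regular p i) (y : HH A M q j) :
    Φ' (ψ x y) = (e * i).negOnePow • ψ' x (Φ y) := by
  obtain ⟨f, hf, rfl⟩ := HH.exists_rep x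
  obtain ⟨m, hm, rfl⟩ := HH.exists_rep y
  obtain ⟨h1, e1⟩ := hψ f m hf hm
  obtain ⟨h2, e2⟩ := hΦ' _ h1
  obtain ⟨h3, e3⟩ := hΦ m hm
  obtain ⟨h4, e4⟩ := hψ' f _ hf h3
  rw [e1, e2, e3, e4]
  refine Eq.trans ?_ (HH.mk_units_smul _ h4).symm
  exact HH.mk_congr _ _ fun L s t _ _ =>
    congrFun (congrFun (congrFun (push_restr_actRaw g hj f) L) s) t

end

theorem exists_units_smul_equiv {V : Type*} [AddCommGroup V] [Module R V] (ε : ℤˣ) :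
    ∃ s : V ≃ₗ[R] V, ∀ x, s x = ε • x := by
  rcases Int.units_eq_one_or ε with rfl | rfl
  · exact ⟨LinearEquiv.refl R V, fun x => (one_smul _ x).symm⟩
  · exact ⟨LinearEquiv.neg R, fun x => by simp⟩

theorem act_signs {V : Type*} [AddCommGroup V] (e i j k : ℤ) (h : i + j = k) (X : V) :
    (e * k).negOnePow • (e * i).negOnePow • X = (e * j).negOnePow • X := by
  rw [smul_smul, ← Int.negOnePow_add]
  exact sgn_smul_congr (by rw [← h]; push_cast; grind) rfl

/-- The derived isomorphism `A ← P → DA` has exactly one associated isomorphism of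
`HH(A)`-modules. -/
theorem BarCofibrant.existsUnique_isAssociated (hA : BarCofibrant A) (H : InducedOperations A)
    {e : ℤ} (𝔇 : DerivedDuality A e) :
    ∃! φ : ∀ (p : Perversity n) (i : ℤ), HH A A.regular p i ≃ₗ[R] HH A A.dual p (i + e),
      IsAssociated H 𝔇 φ := by
  choose Q hQ using fun (p : Perversity n) (i : ℤ) =>
    hA.exists_pushEquiv 𝔇.q_quasiIso p (add_zero i)
  choose C hC using fun (p : Perversity n) (i : ℤ) =>
    hA.exists_pushEquiv 𝔇.c_quasiIso p (rfl : i + e = i + e)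
  choose S hS using fun (p : Perversity n) (i : ℤ) =>
    exists_units_smul_equiv (R := R) (V := HH A A.dual p (i + e)) (e * i).negOnePow
  let φ (p : Perversity n) (i : ℤ) : HH A A.regular p i ≃ₗ[R] HH A A.dual p (i + e) :=
    ((Q p i).symm.trans (C p i)).trans (S p i)
  have hφ (p : Perversity n) (i : ℤ) (x) : φ p i x = (e * i).negOnePow • C p i ((Q p i).symm x) :=
    hS p i _
  have key (φ' : ∀ (p : Perversity n) (i : ℤ), HH A A.regular p i ≃ₗ[R] HH A A.dual p (i + e))
      (h : IsAssociated H 𝔇 φ') : φ' 0 0 H.one = C 0 0 ((Q 0 0).symm H.one) := by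
    obtain ⟨-, f, hf, hq, hc, e1, e2⟩ := h
    obtain ⟨hq', e3⟩ := hQ 0 0 f hf
    obtain ⟨hc', e4⟩ := hC 0 0 f hf
    have : (Q 0 0).symm H.one = HH.mk f hf := by
      rw [LinearEquiv.symm_apply_eq, e3, e1]
    rw [this, e4, e2]
  have hass : IsAssociated H 𝔇 φ := by
    refine ⟨fun {p q r i j k} h h₁ h₂ x y => ?_, ?_⟩
    · obtain ⟨ψ, hψ⟩ := HH.exists_act (A := A) (M := 𝔇.P) h h₁
      have a1 := push_act (g := 𝔇.q) (Φ := (Q q j).toLinearMap) (Φ' := (Q r k).toLinearMap)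
        (add_zero j) (hQ q j) (hQ r k) hψ (H.cup_mk h h₁) x ((Q q j).symm y)
      have a2 := push_act (g := 𝔇.c) (Φ := (C q j).toLinearMap) (Φ' := (C r k).toLinearMap)
        rfl (hC q j) (hC r k) hψ (H.act_mk h h₂) x ((Q q j).symm y)
      rw [zero_mul, Int.negOnePow_zero, one_smul] at a1
      have a3 : (Q r k).symm (H.cup h h₁ x y) = ψ x ((Q q j).symm y) := by
        rw [LinearEquiv.symm_apply_eq]
        refine Eq.trans ?_ a1.symm
        exact congrArg _ ((Q q j).apply_symm_apply y).symm
      rw [hφ, hφ, a3, map_units_smul']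
      exact (congrArg _ a2).trans (act_signs e i j k h₁ _)
    · obtain ⟨f, hf, e0⟩ := HH.exists_rep ((Q 0 0).symm H.one)
      obtain ⟨hq, e1⟩ := hQ 0 0 f hf
      obtain ⟨hc, e2⟩ := hC 0 0 f hf
      refine ⟨f, hf, hq, hc, ?_, ?_⟩
      · rw [← e1, ← e0, LinearEquiv.apply_symm_apply]
      · rw [hφ, ← e2, ← e0, mul_zero, Int.negOnePow_zero, one_smul]
  refine ⟨φ, hass, fun φ' h' => ?_⟩
  funext p i
  refine LinearEquiv.ext fun x => ?_
  have h0 : AddLE p 0 p := addLE_zero_right le_rfl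
  rw [h'.apply_eq h0 (by omega), hass.apply_eq h0 (by omega), key φ' h', key φ hass]

end

end PerverseHochschild

theorem theoremC {R : Type u} [CommRing R] {n : ℕ} (A : PDGA R n) :
    ∃ H : InducedOperations A,
      IsPerverseGerstenhaber H.res H.one H.cup H.bracket ∧
      ∀ (e : ℤ) (𝔇 : DerivedDuality A e),
        (BarCofibrant A → ∃! φ : ∀ (p : Perversity n) (i : ℤ),
          HH A A.regular p i ≃ₗ[R] HH A A.dual p (i + e), IsAssociated H 𝔇 φ) ∧
        ∀ φ : ∀ (p : Perversity n) (i : ℤ), HH A A.regular p i ≃ₗ[R] HH A A.dual p (i + e),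
          IsAssociated H 𝔇 φ → delta H φ 0 0 H.one = 0 →
            IsPerverseBV H.res H.one H.cup H.bracket (delta H φ) := by
  obtain ⟨H⟩ := exists_inducedOperations A
  exact ⟨H, isPerverseGerstenhaber H, fun e 𝔇 =>
    ⟨fun hA => hA.existsUnique_isAssociated H 𝔇, fun φ hφ h1 => hφ.isPerverseBV h1⟩⟩
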